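/- Fix a dimension $d\ge 1$; all $O$-constants and the two programs below depend only on $d$. Let $s_1,\dots,s_n\in\mathbb R^d$ ($n\ge 1$) be distinct sites with weights $0<w_1\le\dots\le w_n$, let $\varepsilon\in(0,1/4]$, and let $B_i=\{(i,j): i<j\}$ index the set of balls (bisectors) of site $s_i$ with the sites of larger index. A canonical cube system is a hierarchical tiling of $\mathbb R^d$ by (half-open) cubes: level $0$ consists of the unit cubes with integer vertices, level $\ell+1$ arises from level $\ell$ by bisecting every cube along all $d$ axes, and the coarser levels are obtained by merging $2^d$ cubes at a time; we fix one in which any two cubes are contained in a common canonical cube. A *cell* is a canonical cube or all of $\mathbb R^d$, from which possibly one canonical cube is removed. An *$\varepsilon$-AMWVD* ($\varepsilon$-approximate multiplicatively weighted Voronoi diagram) is a finite partition of $\mathbb R^d$ into non-empty cells, each associated with one site, such that for every point $p$, if $s_{\ell(p)}$ is the site associated with the cell containing $p$, then $$\frac{\lVert p-s_{\ell(p)}\rVert}{w_{\ell(p)}}\le(1+\varepsilon)\min_i\frac{\lVert p-s_i\rVert}{w_i}.$$ Its size is its number of cells. The model of computation is the real RAM: integer and real registers and arrays; addition, subtraction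 and comparison of integers (which serve as addresses, labels and levels); $+,-,\cdot,/,\sqrt{\ }$ and comparison of reals; and, at unit cost, the canonical-cube operations giving the side length of a level, the canonical interval of a given level containing a given real, and the level of the smallest canonical interval containing two given distinct reals. **Statement.** There are a construction program and a query program such that for all $n$, $(s_i)$, $(w_i)$, $\varepsilon$ as above, the construction program, given this input, computes an $\varepsilon$-AMWVD (a list of its cells with their labels, together with a search structure for point location) of total size $$N=O\!\left(n\,\frac{\log(1/\varepsilon)}{\varepsilon^{d-1}}\right),$$ the storage of the whole output also being $O(n\log(1/\varepsilon)/\varepsilon^{d-1})$. The construction time is $$O\!\left(\frac1n\sum_{i=1}^{n}|B_i|^d+\log\frac n\varepsilon\right)\cdot N ,$$ and for every $q\in\mathbb R^d$ the query program finds the cell of the $\varepsilon$-AMWVD that contains $q$ in $O(\log(n/\varepsilon))$ time, without changing the stored structure. -/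

import Mathlib

namespace AMWVD

noncomputable section

/-! ### The canonical cube system

Level `0` consists of the unit cubes with integer vertices, level `ℓ + 1` arises from level `ℓ` by
bisecting along every axis, and the coarser levels arise by merging `2 ^ d` cubes. The mergers
alternate between the two possible directions, so that any two cubes lie in a common larger
canonical cube. -/

/-- Origin (the same on every axis) of the level `-m` grid, whose side length is `2 ^ m`. -/
def gridShift : ℕ → ℝ
  | 0 => 0
  | m + 1 => if Odd m then gridShift m - 2 ^ m else gridShift m

/-- Origin of the level `ℓ` grid; it is `0` for all `ℓ ≥ 0`. -/
def gridOrigin (ℓ : ℤ) : ℝ := gridShift (-ℓ).toNat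

/-- Side length of the canonical cubes of level `ℓ`. -/
def gridSide (ℓ : ℤ) : ℝ := (2 : ℝ) ^ (-ℓ)

/-- Left end point of the `k`-th canonical interval of level `ℓ`. -/
def gridPoint (ℓ k : ℤ) : ℝ := gridOrigin ℓ + k * gridSide ℓ

/-- Number of the canonical interval of level `ℓ` that contains `x`. -/
def gridIndex (ℓ : ℤ) (x : ℝ) : ℤ := ⌊(x - gridOrigin ℓ) / gridSide ℓ⌋

/-- Level of the smallest canonical interval that contains both `x` and `y`, for `x ≠ y`. -/
def commonLevel (x y : ℝ) : ℤ := sSup {ℓ : ℤ | gridIndex ℓ x = gridIndex ℓ y}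

/-- A canonical cube of `ℝ ^ d`: its level and its position in the grid of that level. -/
structure Cube (d : ℕ) where
  level : ℤ
  index : Fin d → ℤ

/-- The half-open cube, so that the cubes of one level partition the space. -/
def Cube.region {d : ℕ} (Q : Cube d) : Set (EuclideanSpace ℝ (Fin d)) :=
  {p | ∀ k, gridPoint Q.level (Q.index k) ≤ p k ∧
    p k < gridPoint Q.level (Q.index k) + gridSide Q.level}

/-! ### Subdivisions and approximate multiplicatively weighted Voronoi diagrams -/

/-- A cell: a canonical cube (or all of space, `outer = none`), from which one canonical cube may
be removed. -/
structure Cell (d : ℕ) where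
  outer : Option (Cube d)
  inner : Option (Cube d)

def Cell.region {d : ℕ} (c : Cell d) : Set (EuclideanSpace ℝ (Fin d)) :=
  (c.outer.elim Set.univ Cube.region) \ (c.inner.elim ∅ Cube.region)

/-- A finite list of cells, each associated with one of `n` sites. Its size is the number of
cells. -/
structure Diagram (d n : ℕ) where
  size : ℕ
  cell : Fin size → Cell d
  label : Fin size → Fin n

/-- The cells form a subdivision of `ℝ ^ d`. -/
structure Diagram.IsSubdivision {d n : ℕ} (D : Diagram d n) : Prop where
  nonempty : ∀ j, (D.cell j).region.Nonempty
  disjoint : Pairwise fun j j' => Disjoint (D.cell j).region (D.cell j').region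
  cover : ⋃ j, (D.cell j).region = Set.univ

/-- `D` is an `ε`-approximate multiplicatively weighted Voronoi diagram of the sites `s` with
weights `w`: at every point `p` of a cell, the weighted distance to the site of that cell is at
most `1 + ε` times the minimum of all weighted distances. -/
structure Diagram.IsAMWVD {d n : ℕ} (D : Diagram d n) (ε : ℝ)
    (s : Fin n → EuclideanSpace ℝ (Fin d)) (w : Fin n → ℝ) : Prop where
  isSubdivision : D.IsSubdivision
  approx : ∀ j, ∀ p ∈ (D.cell j).region, ∀ i,
    ‖p - s (D.label j)‖ / w (D.label j) ≤ (1 + ε) * (‖p - s i‖ / w i)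

/-- The balls `B_i` of the site `i`, given as the pairs `(i, j)` with `i < j`. -/
def balls {n : ℕ} (i : Fin n) : Finset (Fin n × Fin n) :=
  Finset.univ.filter fun e => e.1 = i ∧ i < e.2

/-! ### The real RAM

Programs have integer registers and arrays (for addresses, counters, labels and levels) and real
registers and arrays. Integers can be added, subtracted and compared; reals admit the four
arithmetic operations, square roots and comparisons. Three further unit-cost operations give access
to the canonical cubes: the side length of a level, the canonical interval of a given level that
contains a given real, and the level of the smallest canonical interval that contains two given
reals. Reals cannot be converted into integers. -/

/-- Memory: `ireg r`, `rreg r` are registers; `iarr a z`, `rarr a z` is entry `z` of array `a`. -/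
structure State where
  ireg : ℕ → ℤ
  rreg : ℕ → ℝ
  iarr : ℕ → ℤ → ℤ
  rarr : ℕ → ℤ → ℝ

inductive IExp where
  | const (z : ℤ)
  | reg (r : ℕ)
  | arr (a : ℕ) (i : IExp)
  | add (x y : IExp)
  | sub (x y : IExp)

def IExp.eval (σ : State) : IExp → ℤ
  | .const z => z
  | .reg r => σ.ireg r
  | .arr a i => σ.iarr a (i.eval σ)
  | .add x y => x.eval σ + y.eval σ
  | .sub x y => x.eval σ - y.eval σ

/-- Number of operations in an expression. -/
def IExp.cost : IExp → ℕ
  | .const _ => 1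
  | .reg _ => 1
  | .arr _ i => i.cost + 1
  | .add x y => x.cost + y.cost + 1
  | .sub x y => x.cost + y.cost + 1

inductive RExp where
  | const (q : ℚ)
  | reg (r : ℕ)
  | arr (a : ℕ) (i : IExp)
  | ofInt (i : IExp)
  | add (x y : RExp)
  | sub (x y : RExp)
  | mul (x y : RExp)
  | div (x y : RExp)
  | sqrt (x : RExp)
  | side (l : IExp)
  | corner (l : IExp) (x : RExp)

def RExp.eval (σ : State) : RExp → ℝ
  | .const q => q
  | .reg r => σ.rreg r
  | .arr a i => σ.rarr a (i.eval σ)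
  | .ofInt i => i.eval σ
  | .add x y => x.eval σ + y.eval σ
  | .sub x y => x.eval σ - y.eval σ
  | .mul x y => x.eval σ * y.eval σ
  | .div x y => x.eval σ / y.eval σ
  | .sqrt x => Real.sqrt (x.eval σ)
  | .side l => gridSide (l.eval σ)
  | .corner l x => gridPoint (l.eval σ) (gridIndex (l.eval σ) (x.eval σ))

def RExp.cost : RExp → ℕ
  | .const _ => 1
  | .reg _ => 1
  | .arr _ i => i.cost + 1
  | .ofInt i => i.cost + 1
  | .add x y => x.cost + y.cost + 1
  | .sub x y => x.cost + y.cost + 1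
  | .mul x y => x.cost + y.cost + 1
  | .div x y => x.cost + y.cost + 1
  | .sqrt x => x.cost + 1
  | .side l => l.cost + 1
  | .corner l x => l.cost + x.cost + 1

inductive Test where
  | ile (x y : IExp)
  | rle (x y : RExp)
  | neg (b : Test)
  | both (b c : Test)

def Test.Holds (σ : State) : Test → Prop
  | .ile x y => x.eval σ ≤ y.eval σ
  | .rle x y => x.eval σ ≤ y.eval σ
  | .neg b => ¬ b.Holds σ
  | .both b c => b.Holds σ ∧ c.Holds σ

def Test.cost : Test → ℕ
  | .ile x y => x.cost + y.cost + 1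
  | .rle x y => x.cost + y.cost + 1
  | .neg b => b.cost + 1
  | .both b c => b.cost + c.cost + 1

inductive Cmd where
  | skip
  | iset (r : ℕ) (e : IExp)
  | rset (r : ℕ) (e : RExp)
  | istore (a : ℕ) (i : IExp) (e : IExp)
  | rstore (a : ℕ) (i : IExp) (e : RExp)
  | level (r : ℕ) (x y : RExp)
  | seq (c₁ c₂ : Cmd)
  | cond (b : Test) (c₁ c₂ : Cmd)
  | loop (b : Test) (c : Cmd)

def State.setIreg (σ : State) (r : ℕ) (v : ℤ) : State :=
  { σ with ireg := Function.update σ.ireg r v }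

def State.setRreg (σ : State) (r : ℕ) (v : ℝ) : State :=
  { σ with rreg := Function.update σ.rreg r v }

def State.setIarr (σ : State) (a : ℕ) (z : ℤ) (v : ℤ) : State :=
  { σ with iarr := Function.update σ.iarr a (Function.update (σ.iarr a) z v) }

def State.setRarr (σ : State) (a : ℕ) (z : ℤ) (v : ℝ) : State :=
  { σ with rarr := Function.update σ.rarr a (Function.update (σ.rarr a) z v) }

/-- `Exec c σ t σ'`: started in `σ`, the program `c` halts after `t` steps in `σ'`. Every operation,
memory access, test and assignment takes one step. -/
inductive Exec : Cmd → State → ℕ → State → Prop where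
  | skip (σ : State) : Exec .skip σ 1 σ
  | iset (σ : State) (r : ℕ) (e : IExp) :
      Exec (.iset r e) σ (e.cost + 1) (σ.setIreg r (e.eval σ))
  | rset (σ : State) (r : ℕ) (e : RExp) :
      Exec (.rset r e) σ (e.cost + 1) (σ.setRreg r (e.eval σ))
  | istore (σ : State) (a : ℕ) (i e : IExp) :
      Exec (.istore a i e) σ (i.cost + e.cost + 1) (σ.setIarr a (i.eval σ) (e.eval σ))
  | rstore (σ : State) (a : ℕ) (i : IExp) (e : RExp) :
      Exec (.rstore a i e) σ (i.cost + e.cost + 1) (σ.setRarr a (i.eval σ) (e.eval σ))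
  | level (σ : State) (r : ℕ) (x y : RExp) :
      Exec (.level r x y) σ (x.cost + y.cost + 1)
        (σ.setIreg r (commonLevel (x.eval σ) (y.eval σ)))
  | seq {c₁ c₂ : Cmd} {σ σ₁ σ₂ : State} {t₁ t₂ : ℕ} :
      Exec c₁ σ t₁ σ₁ → Exec c₂ σ₁ t₂ σ₂ → Exec (.seq c₁ c₂) σ (t₁ + t₂) σ₂
  | condTrue {b : Test} {c₁ c₂ : Cmd} {σ σ' : State} {t : ℕ} :
      b.Holds σ → Exec c₁ σ t σ' → Exec (.cond b c₁ c₂) σ (b.cost + t) σ'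
  | condFalse {b : Test} {c₁ c₂ : Cmd} {σ σ' : State} {t : ℕ} :
      ¬ b.Holds σ → Exec c₂ σ t σ' → Exec (.cond b c₁ c₂) σ (b.cost + t) σ'
  | loopDone {b : Test} {c : Cmd} {σ : State} :
      ¬ b.Holds σ → Exec (.loop b c) σ b.cost σ
  | loopStep {b : Test} {c : Cmd} {σ σ₁ σ₂ : State} {t₁ t₂ : ℕ} :
      b.Holds σ → Exec c σ t₁ σ₁ → Exec (.loop b c) σ₁ t₂ σ₂ →
      Exec (.loop b c) σ (b.cost + t₁ + t₂) σ₂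

/-! ### Input and output conventions -/

/-- Initial memory: `n` in integer register `0`, `ε` in real register `0`, the `k`-th coordinates of
the sites in real array `k < d`, the weights in real array `d`, and `0` everywhere else. -/
def inputState {d n : ℕ} (s : Fin n → EuclideanSpace ℝ (Fin d)) (w : Fin n → ℝ) (ε : ℝ) : State where
  ireg := fun r => if r = 0 then (n : ℤ) else 0
  rreg := fun r => if r = 0 then ε else 0
  iarr := fun _ _ => 0
  rarr := fun a z =>
    if hz : 0 ≤ z ∧ z.toNat < n then
      if ha : a < d then s ⟨z.toNat, hz.2⟩ ⟨a, ha⟩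
      else if a = d then w ⟨z.toNat, hz.2⟩ else 0
    else 0

/-- Entry `z` describes the cube `Q`, or its absence: integer array `a` holds the flag `1` or `0`,
integer array `a + 1` the level, and the `d` real arrays from `b` on hold the lower corner. -/
def StoresCube {d : ℕ} (σ : State) (a b : ℕ) (z : ℤ) : Option (Cube d) → Prop
  | none => σ.iarr a z = 0
  | some Q => σ.iarr a z = 1 ∧ σ.iarr (a + 1) z = Q.level ∧
      ∀ k : Fin d, σ.rarr (b + k) z = gridPoint Q.level (Q.index k)

/-- The memory `σ` lists the diagram `D`: the number of cells is entry `0` of integer array `5`;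
for the `j`-th cell, the label is in integer array `0`, the outer cube is described in integer
arrays `1, 2` and real arrays `d + 1, …, 2 d`, and the inner cube in integer arrays `3, 4` and real
arrays `2 d + 1, …, 3 d`. -/
def StoresDiagram {d n : ℕ} (σ : State) (D : Diagram d n) : Prop :=
  σ.iarr 5 0 = (D.size : ℤ) ∧
  ∀ j : Fin D.size,
    σ.iarr 0 (j : ℕ) = ((D.label j : ℕ) : ℤ) ∧
    StoresCube σ 1 (d + 1) (j : ℕ) (D.cell j).outer ∧
    StoresCube σ 3 (2 * d + 1) (j : ℕ) (D.cell j).inner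

/-- All array entries at addresses outside `[0, M)` are unused. -/
def StorageAtMost (σ : State) (M : ℝ) : Prop :=
  ∀ (a : ℕ) (z : ℤ), (z < 0 ∨ M ≤ (z : ℝ)) → σ.iarr a z = 0 ∧ σ.rarr a z = 0

/-- The program `query` locates `q` in the diagram `D` that is stored in the arrays of `σ`, within
`T` steps: whatever the registers hold apart from the coordinates of `q` in the real registers
`0, …, d - 1`, it halts with the number of the cell containing `q` in integer register `0`, and it
leaves all arrays unchanged. -/
def Locates {d n : ℕ} (query : Cmd) (σ : State) (D : Diagram d n)
    (q : EuclideanSpace ℝ (Fin d)) (T : ℝ) : Prop :=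
  ∀ τ : State, τ.iarr = σ.iarr → τ.rarr = σ.rarr → (∀ k : Fin d, τ.rreg k = q k) →
    ∃ (t : ℕ) (τ' : State), Exec query τ t τ' ∧ (t : ℝ) ≤ T ∧
      τ'.iarr = σ.iarr ∧ τ'.rarr = σ.rarr ∧
      ∃ j : Fin D.size, τ'.ireg 0 = ((j : ℕ) : ℤ) ∧ q ∈ (D.cell j).region

end

end AMWVD

/-! The diagram is a compressed quadtree that is refined only where no single label is good enough.
A charging argument bounds the refinements, and a binary search along the traversal order locates
points.

Thinning the sites. For a site `a` and a heavier site `c` put `phi a c = w a * ‖s a - s c‖ / w c`.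
Treating the sites from the heaviest down, `a` leaves the net at the smallest scale `phi a c` for
which `c` survives to at least twice that scale; `kap a` is the reciprocal (`0` if `a` never
leaves). At scale `t` the survivors are separated (`Alive.lt_phi`), and every site has a surviving
representative that is at least as heavy, with `phi` at most `2 * t` (`exists_alive`). A cube is
examined with the net of scale `eps * side / 1000`, so farther than one side from a site its
representative is almost as good (`wd_le_of_phi`).

Essential cubes. A cube is essential if, at some point near it, a net site that is not too far away
wins against all heavier net sites and ties with one of them. Near a cube that is not essential,
label changes involve only far sites, so a site that is best at one point is nearly best throughout
(`Best.le_of_not_ess`), and nearby net sites survive to the next coarser scale (`alive_of_not_ess`).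
Hence the best net site at the corner of a cube is good at all of its points that lie in no
essential subcube (`Best.le_of_forall_not_ess`).

Counting them. At a tie the region where the lighter site wins lies in a half space. A column of
cubes along the steepest axis of the normal therefore meets boundedly many cubes charged to one site
at one level, which gives the factor `1 / eps ^ (d - 1)` (`ncard_charged_le`). A charged site, or
the partner it ties with, leaves the net within a factor of order `1 / eps ^ 2` of the current
scale, and a partner serves one site per level (`Charged.dying`, `ncard_ess_le`). So of the order of
`n * log (1 / eps)` pairs of a site and a level are charged.

Refining. A cube becomes a cell if its bad set is empty. Otherwise the traversal jumps to the
smallest canonical cube around the bad set, or splits when there is no smaller one or when a much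
heavier site interferes. A split occurs only at a cube that is the hull of its essential subcubes
(`Stuck.isHull`), so the number of steps is linear in the number of essential cubes
(`exists_explored`). The bad set of one lighter or comparable site is the cube cut by a ball, whose
bounding box has a closed form (`isBox_badOf`); a step thus costs a constant times `n + 1`. The mean
of `|B_i| ^ d` is at least `(n - 1) / 2` (`le_sum_card_balls`), which absorbs this factor.

Locating. The traversal writes entries in the order of the cubes along it. The entries that a point
has passed form a prefix, and the last of them names its cell (`Seg`, `Explored.exists_seg`), so
bisection over the entries answers queries. What remains shows, with the triples `Runs`, that the
programs realise these mathematical objects within the stated times. -/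

namespace AMWVD
noncomputable section

/-! ### The canonical grid -/

theorem gridSide_pos (l : ℤ) : 0 < gridSide l := by unfold gridSide; positivity

theorem gridSide_succ (l : ℤ) : gridSide l = 2 * gridSide (l + 1) := by
  unfold gridSide
  rw [neg_add, zpow_add₀ (by norm_num)]
  norm_num
  ring

theorem gridSide_add (l : ℤ) (m : ℕ) : gridSide (l + m) = gridSide l / 2 ^ m := by
  unfold gridSide
  rw [neg_add, zpow_add₀ (by norm_num), zpow_neg _ (m : ℤ), zpow_natCast]
  rfl

theorem gridSide_le {l m : ℤ} (h : l ≤ m) : gridSide m ≤ gridSide l := by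
  unfold gridSide
  exact zpow_le_zpow_right₀ (by norm_num) (by omega)

/-- `1` if the level `l` grid is shifted against the level `l + 1` grid, and `0` otherwise. -/
def gridBit (l : ℤ) : ℤ := if gridOrigin l = gridOrigin (l + 1) then 0 else 1

theorem gridOrigin_succ (l : ℤ) :
    gridOrigin l = gridOrigin (l + 1) - gridBit l * gridSide (l + 1) := by
  unfold gridBit
  split_ifs with h
  · simp [h]
  · rcases le_or_gt 0 l with hl | hl
    · exfalso
      apply h
      unfold gridOrigin
      rw [show (-l).toNat = 0 by omega, show (-(l + 1)).toNat = 0 by omega]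
    · obtain ⟨m, rfl⟩ : ∃ m : ℕ, l = -(m + 1 : ℕ) := ⟨(-l).toNat - 1, by omega⟩
      unfold gridOrigin gridSide at *
      rw [show (-(-((m + 1 : ℕ) : ℤ))).toNat = m + 1 by omega,
        show (-(-((m + 1 : ℕ) : ℤ) + 1)).toNat = m by omega] at *
      rw [show (-(-((m + 1 : ℕ) : ℤ) + 1)) = (m : ℤ) by push_cast; ring, zpow_natCast]
      have hs : gridShift (m + 1) = if Odd m then gridShift m - 2 ^ m else gridShift m := rfl
      rw [hs] at h ⊢
      split_ifs at h ⊢ with h'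
      · simp
      · exact absurd rfl h

theorem gridBit_mem (l : ℤ) : gridBit l = 0 ∨ gridBit l = 1 := by
  unfold gridBit; split_ifs <;> simp

theorem gridPoint_succ (l k : ℤ) : gridPoint l k = gridPoint (l + 1) (2 * k - gridBit l) := by
  unfold gridPoint
  rw [gridOrigin_succ l, gridSide_succ l]
  push_cast
  ring

theorem gridIndex_eq_iff {l k : ℤ} {x : ℝ} :
    gridIndex l x = k ↔ gridPoint l k ≤ x ∧ x < gridPoint l k + gridSide l := by
  unfold gridIndex gridPoint
  have h := gridSide_pos l
  rw [Int.floor_eq_iff, le_div_iff₀ h, div_lt_iff₀ h]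
  constructor <;> rintro ⟨h1, h2⟩ <;> constructor <;> linarith

theorem gridPoint_le (l : ℤ) (x : ℝ) : gridPoint l (gridIndex l x) ≤ x :=
  (gridIndex_eq_iff.1 rfl).1

theorem lt_gridPoint_add (l : ℤ) (x : ℝ) : x < gridPoint l (gridIndex l x) + gridSide l :=
  (gridIndex_eq_iff.1 rfl).2

@[simp] theorem gridIndex_gridPoint (l k : ℤ) : gridIndex l (gridPoint l k) = k :=
  gridIndex_eq_iff.2 ⟨le_rfl, by linarith [gridSide_pos l]⟩

theorem gridIndex_succ (l : ℤ) (x : ℝ) :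
    gridIndex (l + 1) x = 2 * gridIndex l x - gridBit l ∨
    gridIndex (l + 1) x = 2 * gridIndex l x - gridBit l + 1 := by
  have h1 := gridPoint_le l x
  have h2 := lt_gridPoint_add l x
  rw [gridPoint_succ] at h1 h2
  rw [gridSide_succ] at h2
  have h3 : gridPoint (l + 1) (2 * gridIndex l x - gridBit l + 1)
      = gridPoint (l + 1) (2 * gridIndex l x - gridBit l) + gridSide (l + 1) := by
    unfold gridPoint; push_cast; ring
  by_cases h : x < gridPoint (l + 1) (2 * gridIndex l x - gridBit l) + gridSide (l + 1)
  · left; exact gridIndex_eq_iff.2 ⟨h1, h⟩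
  · right; rw [gridIndex_eq_iff, h3]; constructor <;> linarith

theorem gridIndex_succ_div (l : ℤ) (x : ℝ) :
    gridIndex l x = (gridIndex (l + 1) x + gridBit l) / 2 := by
  rcases gridIndex_succ l x with h | h <;> rw [h] <;> omega

/-- Nesting of the grids: passing to the next coarser level halves the shifted index, so equal
indices stay equal. -/
theorem gridIndex_eq_of_le {l m : ℤ} (hlm : l ≤ m) {x y : ℝ}
    (h : gridIndex m x = gridIndex m y) : gridIndex l x = gridIndex l y := by
  obtain ⟨k, rfl⟩ := Int.le.dest hlm
  clear hlm
  induction k with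
  | zero => simpa using h
  | succ k ih =>
    apply ih
    rw [gridIndex_succ_div _ x, gridIndex_succ_div _ y]
    push_cast at h
    rw [← add_assoc] at h
    rw [h]

theorem gridIndex_mono (l : ℤ) : Monotone (gridIndex l) := by
  intro x y h
  unfold gridIndex
  exact Int.floor_le_floor (div_le_div_of_nonneg_right (by linarith) (gridSide_pos l).le)

/-- The shifts at odd steps add up to a geometric series: at even steps the origin lies about two
thirds of a side to the left of `0`. -/
theorem gridShift_two_mul (m : ℕ) :
    gridShift (2 * m) = -(2 / 3) * (4 ^ m - 1) ∧ gridShift (2 * m + 1) = -(2 / 3) * (4 ^ m - 1) := by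
  induction m with
  | zero => simp [gridShift]
  | succ m ih =>
    have h1 : gridShift (2 * (m + 1)) = -(2 / 3) * (4 ^ (m + 1) - 1) := by
      rw [show 2 * (m + 1) = (2 * m + 1) + 1 by ring, gridShift, if_pos ⟨m, rfl⟩, ih.2,
        pow_succ 2, pow_mul]
      norm_num
      ring
    refine ⟨h1, ?_⟩
    rw [gridShift, if_neg (by simp), h1]

theorem exists_common_level (x y : ℝ) : ∃ l : ℤ, gridIndex l x = gridIndex l y := by
  obtain ⟨m, hm⟩ := pow_unbounded_of_one_lt (3 * (|x| + |y|) + 1) (by norm_num : (1 : ℝ) < 4)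
  -- Interval number `0` of level `-2m` reaches about `2 / 3 * 4 ^ m` to the left and `4 ^ m / 3` to
  -- the right of `0`; the factor `3` in the choice of `m` comes from the shorter reach.
  have key : ∀ z : ℝ, |z| ≤ |x| + |y| → gridIndex (-(2 * m : ℕ)) z = 0 := by
    intro z hz
    refine gridIndex_eq_iff.2 ?_
    unfold gridPoint gridOrigin gridSide
    rw [neg_neg, Int.toNat_natCast, (gridShift_two_mul m).1, zpow_natCast, pow_mul]
    norm_num
    have h1 := neg_abs_le z
    have h2 := le_abs_self z
    constructor <;> linarith
  refine ⟨-(2 * m : ℕ), ?_⟩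
  rw [key x (by linarith [abs_nonneg y]), key y (by linarith [abs_nonneg x])]

theorem abs_sub_lt_of_gridIndex_eq {l : ℤ} {x y : ℝ} (h : gridIndex l x = gridIndex l y) :
    |x - y| < gridSide l := by
  have h1 := gridPoint_le l x
  have h2 := lt_gridPoint_add l x
  have h3 := gridPoint_le l y
  have h4 := lt_gridPoint_add l y
  rw [h] at h1 h2
  rw [abs_lt]; constructor <;> linarith

theorem exists_gridSide_lt {δ : ℝ} (hδ : 0 < δ) : ∃ m : ℕ, gridSide m < δ := by
  obtain ⟨m, hm⟩ := exists_pow_lt_of_lt_one hδ (by norm_num : (1 / 2 : ℝ) < 1)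
  refine ⟨m, ?_⟩
  unfold gridSide
  rw [zpow_neg, zpow_natCast]
  simpa using hm

/-- This replaces the supremum by a usable criterion. The levels at which two points share an
interval are closed downwards by nesting, nonempty because some coarse interval contains both, and
bounded because intervals shorter than `|x - y|` cannot contain both. -/
theorem le_commonLevel_iff {x y : ℝ} (h : x ≠ y) (l : ℤ) :
    l ≤ commonLevel x y ↔ gridIndex l x = gridIndex l y := by
  obtain ⟨m, hm⟩ := exists_gridSide_lt (abs_pos.2 (sub_ne_zero.2 h))
  have hb : BddAbove {ℓ : ℤ | gridIndex ℓ x = gridIndex ℓ y} := by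
    refine ⟨m, fun l hl => ?_⟩
    by_contra hlt
    push Not at hlt
    exact absurd (abs_sub_lt_of_gridIndex_eq hl) (not_lt.2 (hm.le.trans' (gridSide_le hlt.le)))
  have hmem := Int.csSup_mem (exists_common_level x y) hb
  constructor
  · exact fun hl => gridIndex_eq_of_le hl hmem
  · exact fun hl => le_csSup hb hl

theorem commonLevel_spec {x y : ℝ} (h : x ≠ y) :
    gridIndex (commonLevel x y) x = gridIndex (commonLevel x y) y :=
  (le_commonLevel_iff h _).1 le_rfl

/-! ### The smallest canonical interval around a half-open interval -/

/-- Level of the smallest canonical interval that contains `[x, y)`. -/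
def hullLevel (x y : ℝ) : ℤ :=
  if y ≤ gridPoint (commonLevel x y) (gridIndex (commonLevel x y) x)
    + gridSide (commonLevel x y) / 2 then commonLevel x ((x + y) / 2) else commonLevel x y

theorem gridPoint_add_side (l k : ℤ) : gridPoint l k + gridSide l = gridPoint l (k + 1) := by
  unfold gridPoint; push_cast; ring

theorem gridPoint_strictMono (l : ℤ) : StrictMono (gridPoint l) := by
  intro a b h
  unfold gridPoint
  have := gridSide_pos l
  have h' : (a : ℝ) < b := by exact_mod_cast h
  nlinarith

/-- The end of the canonical interval of level `l` around `x`. -/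
def gridEnd (l : ℤ) (x : ℝ) : ℝ := gridPoint l (gridIndex l x) + gridSide l

theorem gridEnd_anti {l m : ℤ} (h : l ≤ m) (x : ℝ) : gridEnd m x ≤ gridEnd l x := by
  unfold gridEnd
  by_contra hlt
  push Not at hlt
  have h1 : gridIndex m (gridPoint l (gridIndex l x) + gridSide l) = gridIndex m x :=
    gridIndex_eq_iff.2 ⟨(gridPoint_le m x).trans (lt_gridPoint_add l x).le, hlt⟩
  have h2 := gridIndex_eq_of_le h h1
  rw [gridPoint_add_side, gridIndex_gridPoint] at h2
  omega

/-- The end `y` need not belong to the interval, so `commonLevel x y` is too coarse exactly when `y`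
is the middle of the common interval. In that case `y` is a grid point of every finer level, and the
midpoint of `x` and `y` detects which intervals around `x` end before `y`. -/
theorem le_hullLevel_iff {x y : ℝ} (h : x < y) (l : ℤ) : l ≤ hullLevel x y ↔ y ≤ gridEnd l x := by
  have hmid : x ≠ (x + y) / 2 := by intro h'; linarith
  have hc : ∀ l, gridIndex l x = gridIndex l y ↔ y < gridEnd l x := by
    intro l
    rw [eq_comm, gridIndex_eq_iff]
    exact ⟨fun h => h.2, fun h' => ⟨(gridPoint_le l x).trans h.le, h'⟩⟩
  set L := commonLevel x y with hL
  have hLs := (le_commonLevel_iff h.ne (L + 1)).not.1 (by omega)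
  rw [hc] at hLs
  have hL0 := (hc L).1 (commonLevel_spec h.ne)
  have hstep : gridEnd (L + 1) x = gridPoint L (gridIndex L x) + gridSide L / 2 ∨
      gridEnd (L + 1) x = gridEnd L x := by
    have e1 := gridSide_succ L
    unfold gridEnd
    rw [gridPoint_succ L]
    rcases gridIndex_succ L x with h' | h' <;> rw [h']
    · left; linarith
    · right; rw [← gridPoint_add_side]; linarith
  unfold hullLevel
  rw [← hL]
  split_ifs with hcase
  · have he : gridEnd (L + 1) x = y := by
      rcases hstep with h' | h'
      · linarith
      · linarith
    rw [le_commonLevel_iff hmid]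
    have hm : ∀ l, gridIndex l x = gridIndex l ((x + y) / 2) ↔ (x + y) / 2 < gridEnd l x := by
      intro l
      rw [eq_comm, gridIndex_eq_iff]
      exact ⟨fun h => h.2, fun h' => ⟨(gridPoint_le l x).trans (by linarith), h'⟩⟩
    rw [hm]
    constructor
    · intro hlt
      rcases le_or_gt l (L + 1) with hl | hl
      · rw [← he]; exact gridEnd_anti hl x
      · by_contra hle
        push Not at hle
        -- `y` is a grid point of level `l`, and so lies at least a side beyond the interval
        have hy : ∃ k, y = gridPoint l k := by
          obtain ⟨m, rfl⟩ := Int.le.dest hl.le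
          rw [← he]
          unfold gridEnd
          rw [gridPoint_add_side]
          generalize gridIndex (L + 1) x + 1 = k
          clear hl hle hlt
          induction m with
          | zero => exact ⟨k, by simp⟩
          | succ m ih =>
            obtain ⟨k', hk'⟩ := ih
            have := gridPoint_succ (L + 1 + m) k'
            rw [add_assoc (L + 1)] at this
            exact ⟨_, hk'.trans (by exact_mod_cast this)⟩
        obtain ⟨k, rfl⟩ := hy
        unfold gridEnd at hle hlt
        rw [gridPoint_add_side] at hle
        have h3 := (gridPoint_strictMono l).lt_iff_lt.1 hle
        -- A grid point beyond the end of the interval is at least two sides beyond its start. Then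
        -- the midpoint of `x` and `y` is already at or past the end, against `hlt`.
        have h4 : gridPoint l (gridIndex l x + 2) ≤ gridPoint l k :=
          (gridPoint_strictMono l).le_iff_le.2 (by omega)
        have h5 := gridPoint_le l x
        have h6 : gridPoint l (gridIndex l x + 2)
            = gridPoint l (gridIndex l x) + 2 * gridSide l := by
          unfold gridPoint; push_cast; ring
        linarith
    · intro hle; linarith
  · rw [hL, le_commonLevel_iff h.ne, hc]
    constructor
    · exact le_of_lt
    · intro hle
      refine lt_of_le_of_ne hle fun heq => ?_
      have hl : l ≤ L ∨ L + 1 ≤ l := by omega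
      rcases hl with hl | hl
      · linarith [gridEnd_anti hl x]
      · have := gridEnd_anti hl x
        rcases hstep with h' | h'
        · linarith
        · linarith

/-! ### Canonical cubes -/

variable {d : ℕ}

/-- Side length of a cube. -/
def Cube.side (Q : Cube d) : ℝ := gridSide Q.level

/-- Lower corner of a cube. -/
def Cube.corner (Q : Cube d) : EuclideanSpace ℝ (Fin d) :=
  WithLp.toLp 2 fun k => gridPoint Q.level (Q.index k)

/-- The cube of level `l` that contains `p`. -/
def cubeAt (l : ℤ) (p : EuclideanSpace ℝ (Fin d)) : Cube d := ⟨l, fun k => gridIndex l (p k)⟩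

theorem Cube.side_pos (Q : Cube d) : 0 < Q.side := gridSide_pos _

@[simp] theorem Cube.corner_apply (Q : Cube d) (k : Fin d) :
    Q.corner k = gridPoint Q.level (Q.index k) := rfl

@[ext] theorem Cube.ext' {P Q : Cube d} (h : P.level = Q.level) (h' : P.index = Q.index) : P = Q := by
  cases P; cases Q; simp_all

theorem Cube.mem_region {Q : Cube d} {p : EuclideanSpace ℝ (Fin d)} :
    p ∈ Q.region ↔ ∀ k, gridIndex Q.level (p k) = Q.index k := by
  simp only [Cube.region, Set.mem_ofPred_eq, gridIndex_eq_iff]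

theorem Cube.mem_region_iff_eq {Q : Cube d} {p : EuclideanSpace ℝ (Fin d)} :
    p ∈ Q.region ↔ cubeAt Q.level p = Q := by
  rw [Cube.mem_region]
  constructor
  · intro h; exact Cube.ext' rfl (funext h)
  · intro h k; exact congrFun (congrArg Cube.index h) k

theorem Cube.corner_mem (Q : Cube d) : Q.corner ∈ Q.region := by
  rw [Cube.mem_region]; intro k; simp

theorem mem_cubeAt (l : ℤ) (p : EuclideanSpace ℝ (Fin d)) : p ∈ (cubeAt l p).region :=
  Cube.mem_region.2 fun _ => rfl

/-- Inclusion of cubes. -/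
def Cube.Sub (P Q : Cube d) : Prop := Q.level ≤ P.level ∧ P.corner ∈ Q.region

theorem Cube.Sub.refl (Q : Cube d) : Q.Sub Q := ⟨le_rfl, Q.corner_mem⟩

theorem Cube.Sub.subset {P Q : Cube d} (h : P.Sub Q) : P.region ⊆ Q.region := by
  intro p hp
  rw [Cube.mem_region] at *
  intro k
  rw [← Cube.mem_region.1 h.2 k]
  exact gridIndex_eq_of_le h.1 (by simp [hp k])

theorem Cube.sub_of_mem {P Q : Cube d} (h : Q.level ≤ P.level) {p : EuclideanSpace ℝ (Fin d)}
    (hP : p ∈ P.region) (hQ : p ∈ Q.region) : P.Sub Q := by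
  refine ⟨h, ?_⟩
  rw [Cube.mem_region] at *
  intro k
  rw [← hQ k]
  exact gridIndex_eq_of_le h (by simp [hP k])

theorem Cube.Sub.trans {P Q R : Cube d} (h : P.Sub Q) (h' : Q.Sub R) : P.Sub R :=
  ⟨h'.1.trans h.1, h'.subset h.2⟩

theorem Cube.Sub.eq_of_level {P Q : Cube d} (h : P.Sub Q) (hl : P.level ≤ Q.level) : P = Q := by
  have h1 := Cube.mem_region_iff_eq.1 h.2
  rw [le_antisymm h.1 hl, Cube.mem_region_iff_eq.1 P.corner_mem] at h1
  exact h1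

theorem Cube.Sub.antisymm {P Q : Cube d} (h : P.Sub Q) (h' : Q.Sub P) : P = Q :=
  h.eq_of_level h'.1

theorem cubeAt_sub {l : ℤ} {p : EuclideanSpace ℝ (Fin d)} {Q : Cube d} (hl : Q.level ≤ l)
    (hp : p ∈ Q.region) : (cubeAt l p).Sub Q :=
  Cube.sub_of_mem hl (mem_cubeAt l p) hp

/-- The child of `Q` on the side of each axis that is given by the bits of `v`. -/
def Cube.child (Q : Cube d) (v : ℕ) : Cube d :=
  ⟨Q.level + 1, fun k => 2 * Q.index k - gridBit Q.level + if v.testBit k then 1 else 0⟩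

theorem Cube.child_sub (Q : Cube d) (v : ℕ) : (Q.child v).Sub Q := by
  refine ⟨by simp [Cube.child], Cube.mem_region.2 fun k => ?_⟩
  rw [gridIndex_succ_div]
  simp only [Cube.corner_apply, Cube.child, gridIndex_gridPoint]
  rcases gridBit_mem Q.level with h | h <;> rw [h] <;> split_ifs <;> omega

theorem Cube.child_corner (Q : Cube d) (v : ℕ) (k : Fin d) :
    (Q.child v).corner k = Q.corner k + if v.testBit k then gridSide (Q.level + 1) else 0 := by
  simp only [Cube.corner_apply, Cube.child]
  rw [gridPoint_succ Q.level]
  split_ifs with h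
  · rw [gridPoint_add_side]
  · simp

theorem Cube.exists_child {Q : Cube d} {p : EuclideanSpace ℝ (Fin d)} (hp : p ∈ Q.region) :
    ∃ v < 2 ^ d, p ∈ (Q.child v).region := by
  classical
  rw [Cube.mem_region] at hp
  set f : ℕ → Bool := fun k => if h : k < d then
    decide (gridIndex (Q.level + 1) (p ⟨k, h⟩) = 2 * Q.index ⟨k, h⟩ - gridBit Q.level + 1)
    else false with hf
  refine ⟨Nat.ofBits (fun k : Fin d => f k), Nat.ofBits_lt_two_pow _, Cube.mem_region.2 fun k => ?_⟩
  have hb : (Nat.ofBits (fun k : Fin d => f k)).testBit k = f k := by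
    rw [Nat.testBit_ofBits_lt _ _ k.2]
  simp only [Cube.child]
  rw [hb]
  have := gridIndex_succ Q.level (p k)
  rw [hp k] at this
  simp only [hf, k.2, dite_true, Fin.eta, decide_eq_true_eq]
  rcases this with h | h
  · rw [if_neg (by omega)]; omega
  · rw [if_pos h]; omega

theorem Cube.child_testBit {Q : Cube d} {u v : ℕ} {p : EuclideanSpace ℝ (Fin d)}
    (hu : p ∈ (Q.child u).region) (hv : p ∈ (Q.child v).region) (k : Fin d) :
    u.testBit k = v.testBit k := by
  have h1 := Cube.mem_region.1 hu k
  have h2 := Cube.mem_region.1 hv k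
  simp only [Cube.child] at h1 h2
  rw [h1] at h2
  split_ifs at h2 with a b b <;> first | omega | simp [a, b]

theorem Cube.Sub.exists_child {P Q : Cube d} (h : P.Sub Q) (hne : P ≠ Q) :
    ∃ v < 2 ^ d, P.Sub (Q.child v) := by
  obtain ⟨v, hv, hm⟩ := Cube.exists_child h.2
  refine ⟨v, hv, ?_, hm⟩
  simp only [Cube.child]
  rcases lt_or_eq_of_le h.1 with h' | h'
  · omega
  · exact absurd (h.eq_of_level h'.ge) hne

theorem Cube.norm_sub_corner_le (hd : 1 ≤ d) {Q : Cube d} {p : EuclideanSpace ℝ (Fin d)}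
    (hp : ∀ k, |p k - Q.corner k| ≤ Q.side) : ‖p - Q.corner‖ ≤ d * Q.side := by
  have hs := Q.side_pos
  have hd' : (1 : ℝ) ≤ d := by exact_mod_cast hd
  rw [EuclideanSpace.norm_eq]
  apply Real.sqrt_le_iff.2
  refine ⟨by positivity, ?_⟩
  calc ∑ i, ‖(p - Q.corner) i‖ ^ 2 ≤ ∑ _i : Fin d, Q.side ^ 2 := by
        apply Finset.sum_le_sum
        intro i _
        have := hp i
        rw [Real.norm_eq_abs]
        exact pow_le_pow_left₀ (abs_nonneg _) this 2
    _ = d * Q.side ^ 2 := by simp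
    _ ≤ (d * Q.side) ^ 2 := by nlinarith [sq_nonneg Q.side]

theorem Cube.norm_sub_corner_le_of_mem (hd : 1 ≤ d) {Q : Cube d} {p : EuclideanSpace ℝ (Fin d)}
    (hp : p ∈ Q.region) : ‖p - Q.corner‖ ≤ d * Q.side := by
  apply Cube.norm_sub_corner_le hd
  intro k
  have := hp k
  simp only [Cube.corner_apply, Cube.side]
  rw [abs_le]
  constructor <;> linarith [gridSide_pos Q.level]


/-! ### Weighted nets -/

/-- Weighted sites together with the reciprocals `kap` of the scales up to which the sites stay in
the net. -/
structure Net (d n : ℕ) where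
  s : Fin n → EuclideanSpace ℝ (Fin d)
  w : Fin n → ℝ
  eps : ℝ
  kap : Fin n → ℝ
  hd : 1 ≤ d
  hn : 1 ≤ n
  inj : Function.Injective s
  wpos : ∀ i, 0 < w i
  mono : Monotone w
  eps_pos : 0 < eps
  eps_le : eps ≤ 1 / 4
  kap_nonneg : ∀ i, 0 ≤ kap i
  -- The hypothesis says that `c` survives to at least twice the scale `phi a c`; then `a` must be
  -- gone at `phi a c`. Conversely, `of_kap` demands that a removal happens exactly at such a value,
  -- which makes the net both separated and covering.
  kap_of : ∀ a c, a < c → 2 * kap c * (w a * ‖s a - s c‖ / w c) ≤ 1 →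
    1 ≤ kap a * (w a * ‖s a - s c‖ / w c)
  of_kap : ∀ a, kap a = 0 ∨ ∃ c, a < c ∧ 2 * kap c * (w a * ‖s a - s c‖ / w c) ≤ 1 ∧
    kap a * (w a * ‖s a - s c‖ / w c) = 1

namespace Net

variable {d n : ℕ} (I : Net d n)

/-- Weighted distance. -/
def wd (i : Fin n) (p : EuclideanSpace ℝ (Fin d)) : ℝ := ‖p - I.s i‖ / I.w i

/-- Distance of `a` from the heavier site `c`, scaled by the ratio of the weights. -/
def phi (a c : Fin n) : ℝ := I.w a * ‖I.s a - I.s c‖ / I.w c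

/-- The site `a` belongs to the net of scale `t`. -/
def Alive (t : ℝ) (a : Fin n) : Prop := I.kap a * t < 1

variable {I}

theorem wd_nonneg (i : Fin n) (p : EuclideanSpace ℝ (Fin d)) : 0 ≤ I.wd i p :=
  div_nonneg (norm_nonneg _) (I.wpos i).le

theorem wd_eq_zero {i : Fin n} {p : EuclideanSpace ℝ (Fin d)} (h : I.wd i p = 0) : p = I.s i := by
  unfold wd at h
  rw [div_eq_zero_iff] at h
  rcases h with h | h
  · exact sub_eq_zero.1 (norm_eq_zero.1 h)
  · exact absurd h (I.wpos i).ne'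

theorem phi_nonneg (a c : Fin n) : 0 ≤ I.phi a c :=
  div_nonneg (mul_nonneg (I.wpos a).le (norm_nonneg _)) (I.wpos c).le

@[simp] theorem phi_self (a : Fin n) : I.phi a a = 0 := by simp [phi]

theorem Alive.mono {t u : ℝ} (h : t ≤ u) {a : Fin n} (ha : I.Alive u a) : I.Alive t a :=
  lt_of_le_of_lt (mul_le_mul_of_nonneg_left h (I.kap_nonneg a)) ha

theorem phi_triangle' (a b c : Fin n) :
    I.phi a c ≤ I.phi a b * (I.w b / I.w c) + I.w a / I.w b * I.phi b c := by
  have ha := I.wpos a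
  have hb := I.wpos b
  have hc := I.wpos c
  have h := norm_sub_le_norm_sub_add_norm_sub (I.s a) (I.s b) (I.s c)
  have e : I.phi a b * (I.w b / I.w c) + I.w a / I.w b * I.phi b c
      = I.w a * (‖I.s a - I.s b‖ + ‖I.s b - I.s c‖) / I.w c := by
    unfold phi; field_simp
  rw [e]
  unfold phi
  gcongr

/-- `phi` is directed from the lighter to the heavier site and is no metric, but along increasing
weights both ratios in `phi_triangle'` are at most `1`. -/
theorem phi_triangle {a b c : Fin n} (hab : a ≤ b) (hbc : b ≤ c) :
    I.phi a c ≤ I.phi a b + I.phi b c := by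
  refine (phi_triangle' a b c).trans (add_le_add ?_ ?_)
  · exact mul_le_of_le_one_right (phi_nonneg _ _) ((div_le_one (I.wpos c)).2 (I.mono hbc))
  · exact mul_le_of_le_one_left (phi_nonneg _ _) ((div_le_one (I.wpos b)).2 (I.mono hab))

/-- Separation of the net: if `t` were at least `2 * phi a c`, the survival of `c` at `t` would
force the removal of `a` by the scale `phi a c`. -/
theorem Alive.lt_phi {t : ℝ} {a c : Fin n} (hac : a < c) (ha : I.Alive t a)
    (hc : I.Alive t c) : t < 2 * I.phi a c := by
  by_contra hle
  push Not at hle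
  have h0 := phi_nonneg (I := I) a c
  have h1 := I.kap_of a c hac
  have hk := I.kap_nonneg c
  have hk' := I.kap_nonneg a
  unfold Alive at ha hc
  rw [show I.w a * ‖I.s a - I.s c‖ / I.w c = I.phi a c from rfl] at h1
  have h2 : I.kap c * (2 * I.phi a c) ≤ I.kap c * t := mul_le_mul_of_nonneg_left hle hk
  have h3 := h1 (by linarith)
  have h4 : I.kap a * (2 * I.phi a c) ≤ I.kap a * t := mul_le_mul_of_nonneg_left hle hk'
  nlinarith

/-- Covering of the net. Follow the removal witnesses from `a` upwards in weight; each of them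
survives to at least twice the scale at which its predecessor left, so the distances add up like a
geometric series. Subtracting `(kap a)⁻¹` from `2 * t` is the form in which this sum passes through
the induction. -/
theorem exists_alive_aux {t : ℝ} (m : ℕ) : ∀ a : Fin n, n - a ≤ m → ¬ I.Alive t a →
    ∃ c, a ≤ c ∧ I.Alive t c ∧ I.phi a c ≤ 2 * t - (I.kap a)⁻¹ := by
  induction m with
  | zero => intro a ha; omega
  | succ m ih =>
    intro a ha hdead
    unfold Alive at hdead
    push Not at hdead
    have hpos : 0 < I.kap a := by
      rcases (I.kap_nonneg a).lt_or_eq with h | h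
      · exact h
      · rw [← h] at hdead; simp at hdead; linarith
    have hle : (I.kap a)⁻¹ ≤ t := by
      rw [inv_le_iff_one_le_mul₀ hpos]; linarith
    rcases I.of_kap a with h | ⟨c, hac, h2, h1⟩
    · exact absurd h hpos.ne'
    · rw [show I.w a * ‖I.s a - I.s c‖ / I.w c = I.phi a c from rfl] at h1 h2
      have hphi : I.phi a c = (I.kap a)⁻¹ := eq_inv_of_mul_eq_one_right h1
      by_cases hc : I.Alive t c
      · exact ⟨c, hac.le, hc, by linarith⟩
      · obtain ⟨c', hcc', hal, hp⟩ := ih c (by have := Fin.lt_def.1 hac; omega) hc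
        refine ⟨c', hac.le.trans hcc', hal, ?_⟩
        have h3 := phi_triangle (I := I) hac.le hcc'
        have hcpos : 0 < I.kap c := by
          rcases (I.kap_nonneg c).lt_or_eq with h | h
          · exact h
          · unfold Alive at hc; rw [← h] at hc; simp at hc
        have h4 : 2 * I.phi a c ≤ (I.kap c)⁻¹ := by
          rw [← one_div, le_div_iff₀ hcpos]; linarith
        linarith

theorem exists_alive {t : ℝ} (ht : 0 < t) (a : Fin n) :
    ∃ c, a ≤ c ∧ I.Alive t c ∧ I.phi a c ≤ 2 * t := by
  by_cases h : I.Alive t a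
  · exact ⟨a, le_rfl, h, by simp; linarith⟩
  · obtain ⟨c, h1, h2, h3⟩ := exists_alive_aux (n - a) a le_rfl h
    exact ⟨c, h1, h2, h3.trans (by linarith [inv_nonneg.2 (I.kap_nonneg a)])⟩

/-- A heavier site is nearly as good as `a` away from `a`. -/
theorem wd_le_add (I : Net d n) (a c : Fin n) (p : EuclideanSpace ℝ (Fin d)) :
    I.wd c p ≤ I.wd a p * (I.w a / I.w c) + I.phi a c / I.w a := by
  have ha := I.wpos a
  have hc := I.wpos c
  have h := norm_sub_le_norm_sub_add_norm_sub p (I.s a) (I.s c)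
  have e : I.wd a p * (I.w a / I.w c) + I.phi a c / I.w a
      = (‖p - I.s a‖ + ‖I.s a - I.s c‖) / I.w c := by
    unfold wd phi; field_simp
  rw [e]
  unfold wd
  gcongr

/-- The way the net enters the approximation: relative to the distance of `p` from `a`, the loss on
replacing `a` by its representative is `phi a c`. -/
theorem wd_le_of_phi {a c : Fin n} (hac : a ≤ c) {p : EuclideanSpace ℝ (Fin d)} {θ : ℝ}
    (h : I.phi a c ≤ θ * ‖p - I.s a‖) : I.wd c p ≤ (1 + θ) * I.wd a p := by
  have ha := I.wpos a
  have h1 : I.wd a p * (I.w a / I.w c) ≤ I.wd a p :=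
    mul_le_of_le_one_right (wd_nonneg _ _) ((div_le_one (I.wpos c)).2 (I.mono hac))
  have h2 : I.phi a c / I.w a ≤ θ * I.wd a p := by
    unfold wd
    rw [← mul_div_assoc]
    gcongr
  linarith [I.wd_le_add a c p]

/-! ### Essential cubes -/

variable (I)

/-- Scale of the net for the cube `Q`. -/
def scale (Q : Cube d) : ℝ := I.eps * Q.side / 1000

/-- Dilation factor of the neighbourhood of a cube. -/
def dil (_ : Net d n) : ℝ := d + 10

/-- The neighbourhood of a cube. -/
def nbhd (Q : Cube d) : Set (EuclideanSpace ℝ (Fin d)) :=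
  Metric.closedBall Q.corner (I.dil * Q.side)

/-- `a` is at least as good as every heavier site of the net of scale `t`. -/
def Wins (t : ℝ) (a : Fin n) (p : EuclideanSpace ℝ (Fin d)) : Prop :=
  ∀ c, a < c → I.Alive t c → I.wd a p ≤ I.wd c p

/-- The bisector of the net sites `a < c` passes near `Q` and `a` is not far from `Q`. -/
def Charged (Q : Cube d) (a : Fin n) : Prop :=
  I.Alive (I.scale Q) a ∧ ‖Q.corner - I.s a‖ ≤ 200 * I.dil * Q.side / I.eps ∧
    ∃ u ∈ I.nbhd Q, I.Wins (I.scale Q) a u ∧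
      ∃ c, a < c ∧ I.Alive (I.scale Q) c ∧ I.wd c u = I.wd a u

def Ess (Q : Cube d) : Prop := ∃ a, I.Charged Q a

/-- `b` is the best site of the net of `Q` at the point `x`. -/
def Best (Q : Cube d) (b : Fin n) (x : EuclideanSpace ℝ (Fin d)) : Prop :=
  I.Alive (I.scale Q) b ∧ ∀ c, I.Alive (I.scale Q) c → I.wd b x ≤ I.wd c x

variable {I}

theorem scale_pos (Q : Cube d) : 0 < I.scale Q := by
  have := Q.side_pos
  have := I.eps_pos
  unfold scale; positivity

theorem dil_ge : (11 : ℝ) ≤ I.dil := by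
  have : (1 : ℝ) ≤ d := by exact_mod_cast I.hd
  unfold dil; linarith

theorem mem_nbhd {Q : Cube d} {p : EuclideanSpace ℝ (Fin d)} :
    p ∈ I.nbhd Q ↔ ‖p - Q.corner‖ ≤ I.dil * Q.side := by
  unfold nbhd; rw [mem_closedBall_iff_norm]

theorem mem_nbhd_of_norm_le {Q : Cube d} {p q : EuclideanSpace ℝ (Fin d)} (hp : p ∈ Q.region)
    (h : ‖q - p‖ ≤ 10 * Q.side) : q ∈ I.nbhd Q := by
  rw [mem_nbhd]
  have h1 := Cube.norm_sub_corner_le_of_mem I.hd hp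
  have h2 := norm_sub_le_norm_sub_add_norm_sub q p Q.corner
  unfold dil; linarith

theorem mem_nbhd_of_mem {Q : Cube d} {p : EuclideanSpace ℝ (Fin d)} (hp : p ∈ Q.region) :
    p ∈ I.nbhd Q :=
  mem_nbhd_of_norm_le hp (by simp; linarith [Q.side_pos])

/-! ### The net near a cube that is not essential -/

theorem continuous_wd (i : Fin n) : Continuous (I.wd i) := by
  unfold wd; fun_prop

theorem exists_best (Q : Cube d) (x : EuclideanSpace ℝ (Fin d)) : ∃ b, I.Best Q b x := by
  classical
  obtain ⟨c, _, hc, _⟩ := exists_alive (I := I) (scale_pos Q) ⟨0, I.hn⟩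
  obtain ⟨b, hb, hmin⟩ := Finset.exists_min_image
    (Finset.univ.filter fun a => I.Alive (I.scale Q) a) (fun a => I.wd a x) ⟨c, by simpa using hc⟩
  exact ⟨b, by simpa using hb, fun c hc => hmin c (by simpa using hc)⟩

/-- On the connected neighbourhood the continuous function `min_c (wd c - wd a)`, over the heavier
net sites, goes from nonnegative at `x` to nonpositive at `y`. At a zero `a` wins and ties, so `a`
would be charged unless it is far from the cube. -/
theorem far_of_cross {Q : Cube d} (hQ : ¬ I.Ess Q) {a : Fin n} (ha : I.Alive (I.scale Q) a)
    {x y : EuclideanSpace ℝ (Fin d)} (hx : x ∈ I.nbhd Q) (hy : y ∈ I.nbhd Q)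
    (hxa : I.Wins (I.scale Q) a x) {c : Fin n} (hac : a < c) (hc : I.Alive (I.scale Q) c)
    (hyc : I.wd c y ≤ I.wd a y) : 200 * I.dil * Q.side / I.eps < ‖Q.corner - I.s a‖ := by
  classical
  by_contra hle
  push Not at hle
  refine hQ ⟨a, ha, hle, ?_⟩
  set A := Finset.univ.filter fun c => a < c ∧ I.Alive (I.scale Q) c with hA
  have hAne : A.Nonempty := ⟨c, by simp [hA, hac, hc]⟩
  set f : EuclideanSpace ℝ (Fin d) → ℝ := fun p => A.inf' hAne fun c => I.wd c p - I.wd a p with hf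
  have hfc : Continuous f := by
    apply Continuous.finset_inf'_apply
    intro i _
    exact (continuous_wd i).sub (continuous_wd a)
  have hfx : 0 ≤ f x := by
    simp only [hf]
    rw [Finset.le_inf'_iff]
    intro i hi
    simp only [hA, Finset.mem_filter, Finset.mem_univ, true_and] at hi
    linarith [hxa i hi.1 hi.2]
  have hfy : f y ≤ 0 := by
    simp only [hf]
    exact (Finset.inf'_le _ (by simp [hA, hac, hc] : c ∈ A)).trans (by linarith)
  have hconv : IsPreconnected (I.nbhd Q) := (convex_closedBall _ _).isPreconnected
  obtain ⟨u, hu, hu0⟩ := hconv.intermediate_value hy hx hfc.continuousOn ⟨hfy, hfx⟩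
  refine ⟨u, hu, ?_, ?_⟩
  · intro i hi hal
    have := Finset.inf'_le (fun c => I.wd c u - I.wd a u) (by simp [hA, hi, hal] : i ∈ A)
    simp only [hf] at hu0
    linarith
  · obtain ⟨i, hi, he⟩ := Finset.exists_mem_eq_inf' hAne fun c => I.wd c u - I.wd a u
    simp only [hA, Finset.mem_filter, Finset.mem_univ, true_and] at hi
    simp only [hf] at hu0
    exact ⟨i, hi.1, hi.2, by linarith⟩

/-- Far sites keep the order of their weighted distances up to a small factor. -/
theorem wd_le_of_far {a b c : Fin n} {x y : EuclideanSpace ℝ (Fin d)} {m : ℝ}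
    (hxy : ‖x - y‖ ≤ m) (hm : 40 * m ≤ I.eps * ‖x - I.s a‖)
    (hm' : 40 * m ≤ I.eps * ‖y - I.s c‖) (h : I.wd a x ≤ I.wd c x) (hb : b = a) :
    I.wd b y ≤ (1 + I.eps / 10) * I.wd c y := by
  subst hb
  have he := I.eps_pos
  have he' := I.eps_le
  have h1 := norm_sub_le_norm_sub_add_norm_sub y x (I.s b)
  have h2 := norm_sub_le_norm_sub_add_norm_sub x y (I.s c)
  rw [norm_sub_rev y x] at h1
  have g1 : I.wd b y ≤ (1 + I.eps / 40) * I.wd b x := by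
    unfold wd
    rw [← mul_div_assoc]
    have := (I.wpos b).le
    gcongr
    linarith
  have g2 : I.wd c x ≤ (1 + I.eps / 40) * I.wd c y := by
    unfold wd
    rw [← mul_div_assoc]
    have := (I.wpos c).le
    gcongr
    linarith
  have h0 := wd_nonneg (I := I) c y
  calc I.wd b y ≤ (1 + I.eps / 40) * ((1 + I.eps / 40) * I.wd c y) := by
        refine g1.trans ?_
        gcongr
        linarith
    _ ≤ (1 + I.eps / 10) * I.wd c y := by
        rw [← mul_assoc]
        gcongr
        nlinarith

theorem norm_le_of_wd_le {a c : Fin n} (hac : a ≤ c) {x : EuclideanSpace ℝ (Fin d)}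
    (h : I.wd a x ≤ I.wd c x) : ‖x - I.s a‖ ≤ ‖x - I.s c‖ := by
  unfold wd at h
  have ha := I.wpos a
  have hc := I.wpos c
  rw [div_le_div_iff₀ ha hc] at h
  have := I.mono hac
  nlinarith [norm_nonneg (x - I.s a), norm_nonneg (x - I.s c)]

/-- Near a cube that is not essential the net has a single best site. -/
theorem Best.le_of_not_ess {Q : Cube d} (hQ : ¬ I.Ess Q) {b : Fin n}
    {x y : EuclideanSpace ℝ (Fin d)} (hb : I.Best Q b x) (hx : x ∈ I.nbhd Q) (hy : y ∈ I.nbhd Q)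
    {c : Fin n} (hc : I.Alive (I.scale Q) c) : I.wd b y ≤ (1 + I.eps / 10) * I.wd c y := by
  have he := I.eps_pos
  have he' := I.eps_le
  have hdil := dil_ge (I := I)
  have hs := Q.side_pos
  obtain ⟨c', hc'⟩ := exists_best (I := I) Q y
  have hxy : ‖x - y‖ ≤ 2 * I.dil * Q.side := by
    rw [mem_nbhd] at hx hy
    have := norm_sub_le_norm_sub_add_norm_sub x Q.corner y
    rw [norm_sub_rev Q.corner y] at this
    linarith
  have hfar : ∀ (a : Fin n) (z : EuclideanSpace ℝ (Fin d)), z ∈ I.nbhd Q →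
      200 * I.dil * Q.side / I.eps < ‖Q.corner - I.s a‖ →
      80 * (2 * I.dil * Q.side) ≤ I.eps * ‖z - I.s a‖ := by
    intro a z hz h
    rw [mem_nbhd] at hz
    rw [div_lt_iff₀ he] at h
    have := norm_sub_le_norm_sub_add_norm_sub Q.corner z (I.s a)
    rw [norm_sub_rev Q.corner z] at this
    have hpos : 0 < I.dil * Q.side := by positivity
    nlinarith
  suffices h : I.wd b y ≤ (1 + I.eps / 10) * I.wd c' y by
    refine h.trans ?_
    gcongr
    exact hc'.2 c hc
  have hpos : 0 ≤ 2 * I.dil * Q.side := by positivity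
  -- The lighter of `b` and `c'` wins at one of the two points and loses to the other site at the
  -- other, so `far_of_cross` makes it far. The heavier site is even farther away at the winning
  -- point. The factor `80` in `hfar` leaves room for carrying that bound from one point to the
  -- other.
  rcases lt_trichotomy b c' with hlt | heq | hlt
  · have h1 := far_of_cross hQ hb.1 hx hy (fun c _ hc => hb.2 c hc) hlt hc'.1 (hc'.2 b hb.1)
    have h2 := hfar b x hx h1
    have h3 := norm_le_of_wd_le hlt.le (hb.2 c' hc'.1)
    have h4 := norm_sub_le_norm_sub_add_norm_sub x y (I.s c')
    refine wd_le_of_far hxy (by linarith) ?_ (hb.2 c' hc'.1) rfl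
    nlinarith
  · subst heq
    nlinarith [wd_nonneg (I := I) b y]
  · have h1 := far_of_cross hQ hc'.1 hy hx (fun c _ hc => hc'.2 c hc) hlt hb.1 (hb.2 c' hc'.1)
    have h2 := hfar c' y hy h1
    have h3 := norm_le_of_wd_le hlt.le (hc'.2 b hb.1)
    have h4 := norm_sub_le_norm_sub_add_norm_sub y x (I.s b)
    rw [norm_sub_rev y x] at h4
    refine wd_le_of_far hxy ?_ (by linarith) (hb.2 c' hc'.1) rfl
    nlinarith

theorem Best.of_mem {Q : Cube d} {c : Fin n} (hc : I.Alive (I.scale Q) c) :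
    I.Best Q c (I.s c) :=
  ⟨hc, fun i _ => by simpa [wd] using wd_nonneg (I := I) i (I.s c)⟩

/-- At its own position a net site has weighted distance `0`, so a label that is nearly best there
must be that site. -/
theorem Best.eq_of_not_ess {Q : Cube d} (hQ : ¬ I.Ess Q) {b c : Fin n}
    {x : EuclideanSpace ℝ (Fin d)} (hb : I.Best Q b x) (hx : x ∈ I.nbhd Q)
    (hc : I.Alive (I.scale Q) c) (hcm : I.s c ∈ I.nbhd Q) : b = c := by
  have h := hb.le_of_not_ess hQ hx hcm hc
  have h0 : I.wd c (I.s c) = 0 := by simp [wd]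
  rw [h0, mul_zero] at h
  exact I.inj (wd_eq_zero (le_antisymm h (wd_nonneg _ _))).symm

/-- A net site near a cube that is not essential survives in the net of twice the scale. -/
theorem alive_of_not_ess {Q : Cube d} (hQ : ¬ I.Ess Q) {c : Fin n}
    (hc : I.Alive (I.scale Q) c) {p : EuclideanSpace ℝ (Fin d)} (hp : p ∈ Q.region)
    (hcp : ‖p - I.s c‖ ≤ 2 * Q.side) : I.Alive (2 * I.scale Q) c := by
  by_contra hdead
  have ht := scale_pos (I := I) Q
  have hs := Q.side_pos
  have he := I.eps_pos
  have he' := I.eps_le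
  obtain ⟨c', hle, hal, hphi⟩ := exists_alive (I := I) (t := 2 * I.scale Q) (by linarith) c
  have hne : c ≠ c' := by rintro rfl; exact hdead hal
  have hts : I.scale Q ≤ Q.side / 1000 := by unfold scale; nlinarith
  have hcm : I.s c ∈ I.nbhd Q := by
    apply mem_nbhd_of_norm_le hp
    rw [norm_sub_rev]; linarith
  have hδ : 0 < ‖I.s c' - I.s c‖ := norm_pos_iff.2 (sub_ne_zero.2 fun h => hne (I.inj h).symm)
  set δ := ‖I.s c' - I.s c‖ with hδd
  -- Move from `c` towards its heavier representative `c'` by `16` scales, or as far as `c'` itself.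
  -- Since `phi c c'` is at most `4` scales, `c'` beats `c` there by a factor well above `1 + eps /
  -- 10`, although `c` is the best site at its own position. The point is still close to the cube.
  set x : ℝ := min δ (16 * I.scale Q) with hx
  set v := I.s c + (x / δ) • (I.s c' - I.s c) with hv
  have hx0 : 0 < x := lt_min hδ (by linarith)
  have hxδ : x ≤ δ := min_le_left _ _
  have h1 : ‖v - I.s c‖ = x := by
    rw [hv, add_sub_cancel_left, norm_smul, Real.norm_of_nonneg (by positivity), ← hδd]
    field_simp
  have h2 : ‖v - I.s c'‖ = δ - x := by
    have : v - I.s c' = (x / δ - 1) • (I.s c' - I.s c) := by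
      rw [hv, sub_smul, one_smul]; abel
    rw [this, norm_smul, ← hδd, Real.norm_of_nonpos]
    · field_simp; ring
    · rw [sub_nonpos, div_le_one hδ]; exact hxδ
  have hvm : v ∈ I.nbhd Q := by
    apply mem_nbhd_of_norm_le hp
    have := norm_sub_le_norm_sub_add_norm_sub v (I.s c) p
    rw [norm_sub_rev (I.s c) p] at this
    have : x ≤ 16 * I.scale Q := min_le_right _ _
    linarith
  have hgood := (Best.of_mem hc).le_of_not_ess hQ hcm hvm (hal.mono (by linarith))
  unfold wd at hgood
  rw [h1, h2] at hgood
  have hwc := I.wpos c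
  have hwc' := I.wpos c'
  have hphi' : I.w c * δ ≤ 4 * I.scale Q * I.w c' := by
    unfold phi at hphi
    rw [div_le_iff₀ hwc', norm_sub_rev, ← hδd] at hphi
    linarith
  rw [← mul_div_assoc, div_le_div_iff₀ hwc hwc'] at hgood
  rcases min_cases δ (16 * I.scale Q) with ⟨h, _⟩ | ⟨h, h'⟩
  · rw [← hx] at h
    rw [h] at hgood
    have : 0 < δ * I.w c' := by positivity
    simp at hgood
    linarith
  · rw [← hx] at h
    rw [h] at hgood
    have e1 : (1 + I.eps / 10) * (δ - 16 * I.scale Q) * I.w c ≤ 2 * (δ * I.w c) := by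
      have h5 : (1 + I.eps / 10) * (δ - 16 * I.scale Q) ≤ 2 * δ := by nlinarith
      nlinarith
    have : 0 < I.scale Q * I.w c' := by positivity
    nlinarith

/-- Let `a` be the best site at `p`. If `a` is at least one side away, its representative in the net
of `Q` is nearly as good, and so is the label. Otherwise a good substitute for `a` is found in the
net of a smaller cube around `p`. Since no cube between that one and `Q` is essential, the
substitute survives in all coarser nets up to `Q`, and it must be the label. -/
theorem Best.le_of_forall_not_ess {Q : Cube d} {b : Fin n} (hb : I.Best Q b Q.corner)
    {p : EuclideanSpace ℝ (Fin d)} (hp : p ∈ Q.region)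
    (hne : ∀ P : Cube d, P.Sub Q → p ∈ P.region → ¬ I.Ess P) (j : Fin n) :
    I.wd b p ≤ (1 + I.eps) * I.wd j p := by
  classical
  have he := I.eps_pos
  have he' := I.eps_le
  have hs := Q.side_pos
  have ht := scale_pos (I := I) Q
  obtain ⟨a, -, ha⟩ := Finset.exists_min_image Finset.univ (fun a => I.wd a p)
    ⟨(⟨0, I.hn⟩ : Fin n), Finset.mem_univ _⟩
  suffices h : I.wd b p ≤ (1 + I.eps) * I.wd a p by
    refine h.trans ?_
    gcongr
    exact ha j (Finset.mem_univ j)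
  have h0 := wd_nonneg (I := I) a p
  set R := ‖p - I.s a‖ with hR
  have hcor : Q.corner ∈ I.nbhd Q := mem_nbhd_of_mem Q.corner_mem
  have hQ : ¬ I.Ess Q := hne Q (Cube.Sub.refl Q) hp
  rcases le_or_gt Q.side R with hRQ | hRQ
  · obtain ⟨c, hac, hal, hphi⟩ := exists_alive (I := I) ht a
    have h1 : I.wd c p ≤ (1 + I.eps / 500) * I.wd a p := by
      apply wd_le_of_phi hac
      rw [← hR]
      have : I.eps * Q.side ≤ I.eps * R := by gcongr
      unfold scale at hphi
      linarith
    have h2 := hb.le_of_not_ess hQ hcor (mem_nbhd_of_mem hp) hal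
    calc I.wd b p ≤ (1 + I.eps / 10) * ((1 + I.eps / 500) * I.wd a p) := by
          refine h2.trans ?_
          gcongr
      _ ≤ _ := by
          rw [← mul_assoc]
          gcongr
          nlinarith
  · let q : ℕ → Cube d := fun m => cubeAt (Q.level + m) p
    have hqs : ∀ m, (q m).side = Q.side / 2 ^ m := fun m => gridSide_add _ _
    have hqsub : ∀ m, (q m).Sub Q := fun m => cubeAt_sub (by simp) hp
    have hqe : ∀ m, ¬ I.Ess (q m) := fun m => hne _ (hqsub m) (mem_cubeAt _ _)
    have hq0 : q 0 = Q := by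
      simp only [q, Nat.cast_zero, add_zero]
      exact Cube.mem_region_iff_eq.1 hp
    have hsc : ∀ m, I.scale (q m) = 2 * I.scale (q (m + 1)) := by
      intro m; unfold scale; rw [hqs, hqs, pow_succ]; field_simp
    -- Descend until `a` itself is in the net, or until one more halving would make the side smaller
    -- than the distance of `a`. The descent ends because the scales tend to `0`.
    have hex : ∃ m, I.Alive (I.scale (q m)) a ∨ (q (m + 1)).side < R := by
      have : Filter.Tendsto (fun m : ℕ => I.kap a * (I.eps * (Q.side / 2 ^ m) / 1000)) Filter.atTop
          (nhds (I.kap a * (I.eps * (Q.side * 0) / 1000))) := by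
        have h : Filter.Tendsto (fun m : ℕ => Q.side / (2 : ℝ) ^ m) Filter.atTop
            (nhds (Q.side * 0)) := by
          have := (tendsto_pow_atTop_nhds_zero_of_lt_one (by norm_num : (0 : ℝ) ≤ 1 / 2)
            (by norm_num)).const_mul Q.side
          refine this.congr fun m => ?_
          rw [one_div, inv_pow, div_eq_mul_inv]
        exact ((h.const_mul I.eps).div_const 1000).const_mul _
      have h1 := (this.eventually (gt_mem_nhds (by simp : _ < (1 : ℝ)))).exists
      obtain ⟨m, hm⟩ := h1
      refine ⟨m, Or.inl ?_⟩
      unfold Alive scale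
      rw [hqs]; exact hm
    set M := Nat.find hex with hM
    have hRM : R ≤ (q M).side := by
      rcases Nat.eq_zero_or_pos M with h | h
      · rw [h, hq0]; exact hRQ.le
      · have := Nat.find_min hex (m := M - 1) (by omega)
        push Not at this
        rw [show M - 1 + 1 = M by omega] at this
        exact this.2
    have hMs := (q M).side_pos
    obtain ⟨c, hac, hal, hcp, hca⟩ : ∃ c, a ≤ c ∧ I.Alive (I.scale (q M)) c ∧
        ‖p - I.s c‖ ≤ 2 * (q M).side ∧ I.wd c p ≤ (1 + I.eps) * I.wd a p := by
      rcases Nat.find_spec hex with h | h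
      · exact ⟨a, le_rfl, h, by linarith, by nlinarith⟩
      · rw [← hM, hqs, pow_succ, ← div_div, ← hqs] at h
        obtain ⟨c, hac, hal, hphi⟩ := exists_alive (I := I) (scale_pos (I := I) (q M)) a
        have hphi' : I.phi a c ≤ I.eps / 250 * R := by
          unfold scale at hphi
          have := mul_le_mul_of_nonneg_left h.le he.le
          linarith
        have h1 := wd_le_of_phi hac (p := p) hphi'
        refine ⟨c, hac, hal, ?_, by nlinarith⟩
        have h2 := ha c (Finset.mem_univ c)
        have h3 := (h2.trans (I.wd_le_add a c p))
        have hwa := I.wpos a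
        have hwc := I.wpos c
        have h4 : I.w a * ‖I.s a - I.s c‖ ≤ I.eps / 250 * R * I.w c := by
          unfold phi at hphi'
          rwa [div_le_iff₀ hwc] at hphi'
        unfold wd at h1
        rw [← mul_div_assoc, div_le_div_iff₀ hwc hwa, ← hR] at h1
        -- A representative much heavier than `a` would beat `a` at `p`, where `a` is the best site
        -- of all. So the weights are comparable, and the small `phi a c` bounds the true distance
        -- of `a` and `c`.
        have h5 : I.w c ≤ 2 * I.w a := by
          have hw : R / I.w a * (I.w a / I.w c) + I.phi a c / I.w a
              ≤ R / I.w c + I.eps / 250 * R / I.w a := by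
            gcongr
            apply le_of_eq; field_simp
          have h6 : R / I.w a ≤ R / I.w c + I.eps / 250 * R / I.w a := by
            unfold wd at h3; rw [← hR] at h3; linarith
          have hRpos : 0 < R := lt_of_le_of_lt (by positivity) h
          rw [div_add_div _ _ hwc.ne' hwa.ne', div_le_div_iff₀ hwa (by positivity)] at h6
          have h7 : R * I.w a * I.w c ≤ R * I.w a * (I.w a + I.eps / 250 * I.w c) := by nlinarith
          have h8 := le_of_mul_le_mul_left h7 (by positivity)
          nlinarith
        have h6 : ‖I.s a - I.s c‖ ≤ R := by
          have : I.w a * ‖I.s a - I.s c‖ ≤ I.w a * R := by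
            refine h4.trans ?_
            have hRpos : 0 < R := lt_of_le_of_lt (by positivity) h
            have : I.eps / 250 * R * I.w c ≤ I.eps / 250 * R * (2 * I.w a) := by gcongr
            have h9 : 0 < R * I.w a := by positivity
            nlinarith
          exact le_of_mul_le_mul_left this hwa
        have := norm_sub_le_norm_sub_add_norm_sub p (I.s a) (I.s c)
        linarith
    -- Climb back to `Q`: the scale doubles at each level, and `alive_of_not_ess` keeps `c` in the
    -- net.
    have hup : ∀ k ≤ M, I.Alive (I.scale (q (M - k))) c := by
      intro k
      induction k with
      | zero => intro _; exact hal
      | succ k ih =>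
        intro hk
        have h1 := ih (by omega)
        have h2 : (q M).side ≤ (q (M - k)).side := gridSide_le (by simp [q, cubeAt])
        have h3 := alive_of_not_ess (hqe (M - k)) h1 (mem_cubeAt _ p) (by linarith)
        rwa [show M - k = (M - (k + 1)) + 1 by omega, ← hsc] at h3
    have h1 := hup M le_rfl
    rw [Nat.sub_self, hq0] at h1
    have h2 : I.s c ∈ I.nbhd Q := by
      apply mem_nbhd_of_norm_le hp
      rw [norm_sub_rev]
      have : (q M).side ≤ Q.side := gridSide_le (by simp [q, cubeAt])
      linarith
    rw [hb.eq_of_not_ess hQ hcor h1 h2]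
    exact hca

/-- Near a cube that is not essential, the label of the cube cannot be beaten by a much heavier
site. -/
theorem Best.no_heavy {Q : Cube d} (hQ : ¬ I.Ess Q) {b j : Fin n} (hb : I.Best Q b Q.corner)
    (hw : (1 + I.eps) * I.w b ≤ I.w j) {p : EuclideanSpace ℝ (Fin d)}
    (hp : ‖p - Q.corner‖ ≤ d * Q.side) : I.wd b p ≤ (1 + I.eps) * I.wd j p := by
  by_contra hlt
  push Not at hlt
  have he := I.eps_pos
  have he' := I.eps_le
  have hs := Q.side_pos
  have ht := scale_pos (I := I) Q
  have hcor : Q.corner ∈ I.nbhd Q := mem_nbhd_of_mem Q.corner_mem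
  have hbp := I.wpos b
  have hjp := I.wpos j
  -- Beyond one side from `j` the net represents `j` up to `eps / 500`, so the label cannot be bad
  -- against `j` there.
  have key : ∀ y ∈ I.nbhd Q, (1 + I.eps) * I.wd j y < I.wd b y → ‖y - I.s j‖ < Q.side := by
    intro y hy hyb
    by_contra hle
    push Not at hle
    obtain ⟨c, hjc, hal, hphi⟩ := exists_alive (I := I) ht j
    have h1 : I.wd c y ≤ (1 + I.eps / 500) * I.wd j y := by
      apply wd_le_of_phi hjc
      have : I.eps * Q.side ≤ I.eps * ‖y - I.s j‖ := by gcongr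
      unfold scale at hphi
      linarith
    have h2 := hb.le_of_not_ess hQ hcor hy hal
    have h3 : I.wd b y ≤ (1 + I.eps / 10) * ((1 + I.eps / 500) * I.wd j y) := by
      refine h2.trans ?_
      gcongr
    have h0 := wd_nonneg (I := I) j y
    have h4 : (1 + I.eps / 10) * ((1 + I.eps / 500) * I.wd j y) ≤ (1 + I.eps) * I.wd j y := by
      rw [← mul_assoc]
      gcongr
      nlinarith
    linarith
  -- For `w j ≥ (1 + eps) * w b` the quadratic form in `hbad` is convex, so if it is positive at `p`
  -- it is positive at `p + h` or at `p - h`; the parallelogram law below says this. A step of two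
  -- sides leads away from `j` by more than one side, where `key` forbids bad points.
  obtain ⟨h, hh⟩ : ∃ h : EuclideanSpace ℝ (Fin d), ‖h‖ = 2 * Q.side :=
    ⟨EuclideanSpace.single ⟨0, I.hd⟩ (2 * Q.side), by
      rw [PiLp.norm_single, Real.norm_of_nonneg (by positivity)]⟩
  have hbad : ∀ y, (1 + I.eps) * I.wd j y < I.wd b y ↔
      0 < I.w j ^ 2 * ‖y - I.s b‖ ^ 2 - ((1 + I.eps) * I.w b) ^ 2 * ‖y - I.s j‖ ^ 2 := by
    intro y
    unfold wd
    rw [← mul_div_assoc, div_lt_div_iff₀ hjp hbp, sub_pos, ← mul_pow, ← mul_pow,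
      pow_lt_pow_iff_left₀ (by positivity) (by positivity) two_ne_zero]
    constructor <;> intro h <;> linarith
  have hnear : ∀ e : EuclideanSpace ℝ (Fin d), ‖e‖ = 2 * Q.side → p + e ∈ I.nbhd Q := by
    intro e he
    rw [mem_nbhd]
    have := norm_add_le (p - Q.corner) e
    rw [show p - Q.corner + e = p + e - Q.corner by abel] at this
    unfold dil
    linarith
  have hp0 : p ∈ I.nbhd Q := by rw [mem_nbhd]; unfold dil; nlinarith
  have hpj := key p hp0 hlt
  have hno : ∀ e : EuclideanSpace ℝ (Fin d), ‖e‖ = 2 * Q.side →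
      ¬ (1 + I.eps) * I.wd j (p + e) < I.wd b (p + e) := by
    intro e he hbe
    have h1 := key _ (hnear e he) hbe
    have h2 := norm_sub_le (p + e - I.s j) (p - I.s j)
    rw [show p + e - I.s j - (p - I.s j) = e by abel, he] at h2
    linarith
  have hA := hno h hh
  have hB := hno (-h) (by rw [norm_neg, hh])
  rw [hbad] at hA hB hlt
  push Not at hA hB
  have e1 : ∀ i, ‖p + h - I.s i‖ ^ 2 + ‖p + -h - I.s i‖ ^ 2 = 2 * (‖p - I.s i‖ ^ 2 + ‖h‖ ^ 2) := by
    intro i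
    have := parallelogram_law_with_norm ℝ (p - I.s i) h
    rw [show p + h - I.s i = p - I.s i + h by abel, show p + -h - I.s i = p - I.s i - h by abel]
    nlinarith
  have e2 := e1 b
  have e3 := e1 j
  have hww : ((1 + I.eps) * I.w b) ^ 2 ≤ I.w j ^ 2 := pow_le_pow_left₀ (by positivity) hw 2
  nlinarith [sq_nonneg ‖h‖]

end Net

/-! ### Counting the essential cubes -/

theorem ncard_le_of_injOn {α β : Type*} {S : Set α} {f : α → β} {T : Finset β}
    (hm : ∀ x ∈ S, f x ∈ T) (hf : Set.InjOn f S) : S.Finite ∧ S.ncard ≤ T.card := by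
  have hfin : S.Finite := Set.Finite.of_finite_image
    (T.finite_toSet.subset (by rintro _ ⟨x, hx, rfl⟩; exact hm x hx)) hf
  refine ⟨hfin, ?_⟩
  rw [← Set.ncard_coe_finset T]
  exact Set.ncard_le_ncard_of_injOn f (by simpa using hm) hf T.finite_toSet

theorem ncard_le_of_cover {α ι : Type*} {S : Set α} {T : Finset ι} {A : ι → Set α} {m : ℕ}
    (hS : ∀ x ∈ S, ∃ i ∈ T, x ∈ A i) (hA : ∀ i ∈ T, (A i).Finite ∧ (A i).ncard ≤ m) :
    S.Finite ∧ S.ncard ≤ T.card * m := by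
  classical
  have hsub : S ⊆ ⋃ i ∈ T, A i := by
    intro x hx
    obtain ⟨i, hi, hxi⟩ := hS x hx
    exact Set.mem_biUnion hi hxi
  have hfin : (⋃ i ∈ T, A i).Finite := T.finite_toSet.biUnion fun i hi => (hA i hi).1
  refine ⟨hfin.subset hsub, (Set.ncard_le_ncard hsub hfin).trans ?_⟩
  refine (Finset.set_ncard_biUnion_le T A).trans ?_
  rw [← smul_eq_mul]
  exact Finset.sum_le_card_nsmul _ _ _ fun i hi => (hA i hi).2

namespace Net

variable {d n : ℕ} {I : Net d n}

-- Since `c` is at least as heavy, `a` beats `c` exactly where `w c ^ 2 * ‖v - s a‖ ^ 2 - w a ^ 2 *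
-- ‖v - s c‖ ^ 2` is at most `0`. This is a sublevel set of a convex quadratic with `u` on its
-- boundary, so half the gradient at `u` is the normal of a supporting half space.
open RealInnerProductSpace in
theorem Charged.exists_support {Q : Cube d} {a : Fin n} (h : I.Charged Q a) :
    ∃ u ∈ I.nbhd Q, I.Wins (I.scale Q) a u ∧ ∃ g : EuclideanSpace ℝ (Fin d), g ≠ 0 ∧
      ∀ v, I.Wins (I.scale Q) a v → ⟪g, v - u⟫ ≤ 0 := by
  obtain ⟨-, -, u, hu, hw, c, hac, hal, heq⟩ := h
  have ha := I.wpos a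
  have hc := I.wpos c
  have hwac := I.mono hac.le
  refine ⟨u, hu, hw, (I.w c ^ 2) • (u - I.s a) - (I.w a ^ 2) • (u - I.s c), ?_, ?_⟩
  · intro h0
    rw [sub_eq_zero] at h0
    have h1 := congrArg norm h0
    rw [norm_smul, norm_smul, Real.norm_of_nonneg (by positivity),
      Real.norm_of_nonneg (by positivity)] at h1
    unfold wd at heq
    rw [div_eq_div_iff hc.ne' ha.ne'] at heq
    have hne : I.s a ≠ I.s c := fun h => hac.ne (I.inj h)
    -- A zero normal contradicts the tie: for different weights `u` would be the position of both
    -- sites, and for equal weights the sites would coincide.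
    rcases hwac.lt_or_eq with hlt | he
    · have h2 : ‖u - I.s c‖ * (I.w a * (I.w c - I.w a)) = 0 := by nlinarith
      have h3 : ‖u - I.s c‖ = 0 := by
        rcases mul_eq_zero.1 h2 with h | h
        · exact h
        · have : 0 < I.w a * (I.w c - I.w a) := mul_pos ha (by linarith)
          linarith
      rw [h3, zero_mul] at heq
      have h4 : ‖u - I.s a‖ = 0 := by
        rcases mul_eq_zero.1 heq.symm with h | h
        · exact h
        · exact absurd h hc.ne'
      rw [norm_eq_zero, sub_eq_zero] at h3 h4
      exact hne (h4.symm.trans h3)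
    · rw [he] at h0
      have h2 := smul_right_injective _ (pow_ne_zero 2 hc.ne') h0
      simp only [sub_right_inj] at h2
      exact hne h2
  · intro v hv
    have h1 := hv c hac hal
    unfold wd at h1 heq
    rw [div_le_div_iff₀ ha hc] at h1
    rw [div_eq_div_iff hc.ne' ha.ne'] at heq
    have h2 : (‖v - I.s a‖ * I.w c) ^ 2 ≤ (‖v - I.s c‖ * I.w a) ^ 2 :=
      pow_le_pow_left₀ (by positivity) h1 2
    have h3 : (‖u - I.s c‖ * I.w a) ^ 2 = (‖u - I.s a‖ * I.w c) ^ 2 := by rw [heq]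
    have e1 := norm_add_sq_real (u - I.s a) (v - u)
    have e2 := norm_add_sq_real (u - I.s c) (v - u)
    rw [show u - I.s a + (v - u) = v - I.s a by abel] at e1
    rw [show u - I.s c + (v - u) = v - I.s c by abel] at e2
    rw [mul_pow, mul_pow, e1, e2] at h2
    rw [mul_pow, mul_pow] at h3
    rw [inner_sub_left, inner_smul_left, inner_smul_left]
    simp only [conj_trivial]
    have h4 : I.w a ^ 2 * ‖v - u‖ ^ 2 ≤ I.w c ^ 2 * ‖v - u‖ ^ 2 := by gcongr
    nlinarith

/-- The supporting half space at the point that makes `Q` charged is steepest along the axis `k`,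
in the direction given by `σ`. -/
def Facing (I : Net d n) (Q : Cube d) (a : Fin n) (k : Fin d) (σ : Bool) : Prop :=
  ∃ u ∈ I.nbhd Q, I.Wins (I.scale Q) a u ∧ ∃ g : Fin d → ℝ,
    (∀ l, |g l| ≤ |g k|) ∧ 0 < (if σ then g k else -g k) ∧
    ∀ v, I.Wins (I.scale Q) a v → ∑ l, g l * (v l - u l) ≤ 0

theorem Charged.exists_facing {Q : Cube d} {a : Fin n} (h : I.Charged Q a) :
    ∃ k σ, I.Facing Q a k σ := by
  obtain ⟨u, hu, hw, g, hg, hs⟩ := h.exists_support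
  obtain ⟨k, -, hk⟩ := Finset.exists_max_image Finset.univ (fun l => |g l|)
    ⟨(⟨0, I.hd⟩ : Fin d), Finset.mem_univ _⟩
  have hk0 : g k ≠ 0 := by
    intro h0
    apply hg
    ext l
    have := hk l (Finset.mem_univ l)
    rw [h0, abs_zero] at this
    exact abs_eq_zero.1 (le_antisymm this (abs_nonneg _))
  refine ⟨k, decide (0 < g k), u, hu, hw, g, fun l => hk l (Finset.mem_univ l), ?_, ?_⟩
  · by_cases h : 0 < g k
    · simp [h]
    · have : g k < 0 := lt_of_le_of_ne (not_lt.1 h) hk0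
      simp [h, this]
  · intro v hv
    have := hs v hv
    rw [PiLp.inner_apply] at this
    simpa [mul_comm] using this

/-- If `Q'` is far ahead of `Q` in a column along `k`, the vector from `u` to `u'` is almost
parallel to that axis. A normal steepest along `k` then has a definite sign on it, so one winning
point violates the half space at the other: that at `u` for `σ = true`, that at `u'` for `σ =
false`. -/
theorem Facing.index_le {Q Q' : Cube d} {a : Fin n} {k : Fin d} {σ : Bool} (h : I.Facing Q a k σ)
    (h' : I.Facing Q' a k σ) (hl : Q'.level = Q.level) (hi : ∀ l, l ≠ k → Q'.index l = Q.index l)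
    (hk : Q.index k ≤ Q'.index k) : Q'.index k ≤ Q.index k + (2 * d * (d + 10) : ℕ) := by
  obtain ⟨u, hu, hw, g, hmax, hg, hsup⟩ := h
  obtain ⟨u', hu', hw', g', hmax', hg', hsup'⟩ := h'
  have hside : Q'.side = Q.side := by unfold Cube.side; rw [hl]
  have hsc : I.scale Q' = I.scale Q := by unfold scale; rw [hside]
  rw [hsc] at hw' hsup'
  rw [mem_nbhd] at hu hu'
  rw [hside] at hu'
  have hs := Q.side_pos
  have hcor : ∀ l, Q'.corner l - Q.corner l
      = if l = k then ((Q'.index k : ℝ) - Q.index k) * Q.side else 0 := by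
    intro l
    simp only [Cube.corner_apply, hl]
    split_ifs with h
    · subst h; unfold gridPoint Cube.side; ring
    · rw [hi l h]; simp
  have hdev : ∀ l, |(u' l - u l) - (Q'.corner l - Q.corner l)| ≤ 2 * I.dil * Q.side := by
    intro l
    have h1 := (PiLp.norm_apply_le (u - Q.corner) l).trans hu
    have h2 := (PiLp.norm_apply_le (u' - Q'.corner) l).trans hu'
    rw [Real.norm_eq_abs, PiLp.sub_apply] at h1 h2
    rw [abs_le] at *
    constructor <;> linarith
  -- The corners differ along `k` only, and each coordinate of `u' - u` is within `2 * dil * side`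
  -- of that of the corners. So if the corners are far apart, the term of the axis `k` determines
  -- the sign of the sum.
  have main : ∀ G : Fin d → ℝ, (∀ l, |G l| ≤ |G k|) → 0 < |G k| →
      ((Q'.index k : ℝ) - Q.index k) * Q.side * |G k| ≤
        |G k| * (2 * I.dil * Q.side) * d ∨
      (0 < G k → 0 < ∑ l, G l * (u' l - u l)) ∧ (G k < 0 → ∑ l, G l * (u' l - u l) < 0) := by
    intro G hG hG0
    by_contra hcon
    rw [not_or] at hcon
    obtain ⟨hc1, hc2⟩ := hcon
    push Not at hc1
    apply hc2
    have hsum : |∑ l, G l * (u' l - u l) - G k * (((Q'.index k : ℝ) - Q.index k) * Q.side)|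
        ≤ |G k| * (2 * I.dil * Q.side) * d := by
      have e : ∑ l, G l * (u' l - u l) - G k * (((Q'.index k : ℝ) - Q.index k) * Q.side)
          = ∑ l, G l * ((u' l - u l) - (Q'.corner l - Q.corner l)) := by
        simp only [mul_sub, Finset.sum_sub_distrib]
        congr 1
        rw [← Finset.sum_sub_distrib]
        simp only [← mul_sub, hcor]
        simp
      rw [e]
      refine (Finset.abs_sum_le_sum_abs _ _).trans ?_
      calc ∑ l, |G l * ((u' l - u l) - (Q'.corner l - Q.corner l))|
          ≤ ∑ _l : Fin d, |G k| * (2 * I.dil * Q.side) := by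
            apply Finset.sum_le_sum
            intro l _
            rw [abs_mul]
            exact mul_le_mul (hG l) (hdev l) (abs_nonneg _) (abs_nonneg _)
        _ = _ := by simp; ring
    rw [abs_le] at hsum
    constructor
    · intro hp
      rw [abs_of_pos hp] at hc1 hsum
      nlinarith [hsum.1]
    · intro hp
      rw [abs_of_neg hp] at hc1 hsum
      nlinarith [hsum.2]
  have fin : ∀ G : Fin d → ℝ, 0 < |G k| → ((Q'.index k : ℝ) - Q.index k) * Q.side * |G k| ≤
        |G k| * (2 * I.dil * Q.side) * d → Q'.index k ≤ Q.index k + (2 * d * (d + 10) : ℕ) := by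
    intro G hG0 hle
    have h1 : (Q.side * |G k|) * ((Q'.index k : ℝ) - Q.index k)
        ≤ (Q.side * |G k|) * (2 * I.dil * d) := by linarith
    have h2 := le_of_mul_le_mul_left h1 (by positivity)
    unfold dil at h2
    have h3 : (Q'.index k : ℝ) ≤ ((Q.index k + (2 * d * (d + 10) : ℕ) : ℤ) : ℝ) := by
      push_cast; linarith
    exact_mod_cast h3
  cases σ with
  | true =>
    simp only [if_true] at hg
    have hg0 : 0 < |g k| := abs_pos.2 hg.ne'
    rcases main g hmax hg0 with h | h
    · exact fin g hg0 h
    · exact absurd (hsup u' hw') (not_le.2 (h.1 hg))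
  | false =>
    simp only [Bool.false_eq_true, if_false] at hg'
    have hg0 : 0 < |g' k| := abs_pos.2 (by linarith)
    rcases main g' hmax' hg0 with h | h
    · exact fin g' hg0 h
    · have h1 := hsup' u hw
      have h2 := h.2 (by linarith)
      have e : ∑ l, g' l * (u l - u' l) = -∑ l, g' l * (u' l - u l) := by
        rw [← Finset.sum_neg_distrib]; congr 1; ext l; ring
      rw [e] at h1
      linarith

theorem card_window_le {l : ℤ} {x ρ : ℝ} (hρ : 0 ≤ ρ) :
    ∃ T : Finset ℤ, (T.card : ℝ) ≤ 2 * ρ + 1 ∧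
      ∀ i : ℤ, |gridPoint l i - x| ≤ ρ * gridSide l → i ∈ T := by
  have hs := gridSide_pos l
  refine ⟨Finset.Icc ⌈(x - gridOrigin l) / gridSide l - ρ⌉ ⌊(x - gridOrigin l) / gridSide l + ρ⌋,
    ?_, ?_⟩
  · rw [Int.card_Icc]
    have h1 := Int.le_ceil ((x - gridOrigin l) / gridSide l - ρ)
    have h2 := Int.floor_le ((x - gridOrigin l) / gridSide l + ρ)
    rcases le_total 0 (⌊(x - gridOrigin l) / gridSide l + ρ⌋ + 1
      - ⌈(x - gridOrigin l) / gridSide l - ρ⌉) with h | h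
    · have : (((⌊(x - gridOrigin l) / gridSide l + ρ⌋ + 1
          - ⌈(x - gridOrigin l) / gridSide l - ρ⌉).toNat : ℤ) : ℝ)
          = (⌊(x - gridOrigin l) / gridSide l + ρ⌋ : ℝ) + 1
          - ⌈(x - gridOrigin l) / gridSide l - ρ⌉ := by
        rw [Int.toNat_of_nonneg h]; push_cast; ring
      rw [← Int.cast_natCast, this]
      linarith
    · rw [Int.toNat_of_nonpos h]; simp; linarith
  · intro i hi
    unfold gridPoint at hi
    rw [abs_le] at hi
    rw [Finset.mem_Icc, Int.ceil_le, Int.le_floor, sub_le_iff_le_add, div_le_iff₀ hs,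
      ← sub_le_iff_le_add, le_div_iff₀ hs]
    constructor <;> linarith

/-- The number of cubes of one level that are charged to a site. -/
theorem ncard_charged_le (I : Net d n) (a : Fin n) (l : ℤ) :
    {Q : Cube d | Q.level = l ∧ I.Charged Q a}.Finite ∧
    (({Q : Cube d | Q.level = l ∧ I.Charged Q a}.ncard : ℕ) : ℝ) ≤
      2 * d * ((2 * d * (d + 10) + 1) * (401 * I.dil / I.eps) ^ (d - 1)) := by
  classical
  have he := I.eps_pos
  have he' := I.eps_le
  have hdil := dil_ge (I := I)
  set ρ : ℝ := 200 * I.dil / I.eps with hρ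
  have hρ0 : 0 ≤ ρ := by positivity
  choose T hTc hTm using fun k : Fin d => card_window_le (l := l) (x := I.s a k) hρ0
  set M : ℕ := 2 * d * (d + 10) with hM
  set W : ℕ := ⌊2 * ρ + 1⌋₊ with hW
  have hTW : ∀ k, (T k).card ≤ W := fun k => Nat.le_floor (hTc k)
  have hone : ∀ kσ : Fin d × Bool,
      {Q : Cube d | Q.level = l ∧ I.Charged Q a ∧ I.Facing Q a kσ.1 kσ.2}.Finite ∧
      {Q : Cube d | Q.level = l ∧ I.Charged Q a ∧ I.Facing Q a kσ.1 kσ.2}.ncard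
        ≤ (M + 1) * W ^ (d - 1) := by
    rintro ⟨k, σ⟩
    -- The indices along the other axes lie in windows of `W` values around the site. Within a
    -- column the index along `k` varies by at most `M`, so its residue modulo `M + 1` determines
    -- it.
    have h := ncard_le_of_injOn
      (S := {Q : Cube d | Q.level = l ∧ I.Charged Q a ∧ I.Facing Q a k σ})
      (f := fun Q m => if m = k then Q.index m % ((M : ℤ) + 1) else Q.index m)
      (T := Fintype.piFinset fun m => if m = k then Finset.Ico (0 : ℤ) (M + 1) else T m) ?_ ?_
    · refine ⟨h.1, h.2.trans ?_⟩
      rw [Fintype.card_piFinset, ← Finset.mul_prod_erase _ _ (Finset.mem_univ k)]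
      refine Nat.mul_le_mul (by simp) ?_
      refine (Finset.prod_le_pow_card _ _ W ?_).trans ?_
      · intro m hm
        rw [if_neg (Finset.ne_of_mem_erase hm)]
        exact hTW m
      · simp [Finset.card_erase_of_mem]
    · rintro Q ⟨hQl, hQc, hQf⟩
      rw [Fintype.mem_piFinset]
      intro m
      split_ifs with hmk
      · rw [Finset.mem_Ico]
        exact ⟨Int.emod_nonneg _ (by omega), Int.emod_lt_of_pos _ (by omega)⟩
      · apply hTm
        have h1 := hQc.2.1
        have h2 := (PiLp.norm_apply_le (Q.corner - I.s a) m).trans h1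
        rw [Real.norm_eq_abs, PiLp.sub_apply, Cube.corner_apply, hQl] at h2
        rw [hρ, ← hQl]
        rw [hQl]
        have e : 200 * I.dil * Q.side / I.eps = 200 * I.dil / I.eps * gridSide l := by
          unfold Cube.side; rw [hQl]; ring
        rwa [e] at h2
    · rintro Q ⟨hQl, hQc, hQf⟩ Q' ⟨hQl', hQc', hQf'⟩ heq
      have hidx : ∀ m, m ≠ k → Q'.index m = Q.index m := by
        intro m hm
        have := congrFun heq m
        simp only [if_neg hm] at this
        exact this.symm
      have hk := congrFun heq k
      simp only [if_true] at hk
      have hll : Q'.level = Q.level := hQl'.trans hQl.symm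
      refine Cube.ext' hll.symm (funext fun m => ?_)
      by_cases hm : m = k
      · subst hm
        have hmod : (M : ℤ) + 1 ∣ Q'.index m - Q.index m := Int.ModEq.dvd hk
        have hlt : |Q'.index m - Q.index m| < M + 1 := by
          rw [abs_lt]
          rcases le_total (Q.index m) (Q'.index m) with h | h
          · have := hQf.index_le hQf' hll hidx h
            constructor <;> omega
          · have := hQf'.index_le hQf hll.symm (fun m hm => (hidx m hm).symm) h
            constructor <;> omega
        have := Int.eq_zero_of_abs_lt_dvd hmod hlt
        omega
      · exact (hidx m hm).symm
  have hall := ncard_le_of_cover (S := {Q : Cube d | Q.level = l ∧ I.Charged Q a})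
    (T := (Finset.univ : Finset (Fin d × Bool)))
    (A := fun kσ => {Q : Cube d | Q.level = l ∧ I.Charged Q a ∧ I.Facing Q a kσ.1 kσ.2})
    (fun Q hQ => by
      obtain ⟨k, σ, h⟩ := hQ.2.exists_facing
      exact ⟨(k, σ), Finset.mem_univ _, hQ.1, hQ.2, h⟩) (fun kσ _ => hone kσ)
  refine ⟨hall.1, ?_⟩
  have hWr : (W : ℝ) ≤ 401 * I.dil / I.eps := by
    refine (Nat.floor_le (by positivity)).trans ?_
    rw [hρ, ← mul_div_assoc, div_add_one he.ne']
    gcongr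
    linarith
  calc (({Q : Cube d | Q.level = l ∧ I.Charged Q a}.ncard : ℕ) : ℝ)
      ≤ ((Finset.univ : Finset (Fin d × Bool)).card * ((M + 1) * W ^ (d - 1)) : ℕ) := by
        exact_mod_cast hall.2
    _ = 2 * d * ((2 * d * (d + 10) + 1) * (W : ℝ) ^ (d - 1)) := by
        rw [Finset.card_univ, Fintype.card_prod, Fintype.card_fin, Fintype.card_bool, hM]
        push_cast
        ring
    _ ≤ _ := by gcongr

/-! ### The levels at which a site can be charged -/

/-- Scale of the net for the cubes of level `l`. -/
def scaleAt (I : Net d n) (l : ℤ) : ℝ := I.eps * gridSide l / 1000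

/-- Ratio between the scales at which a site can be charged and its scale of death. -/
def span (I : Net d n) : ℝ := 64 * (402000 * I.dil / I.eps ^ 2)

theorem one_le_span : 1 ≤ I.span := by
  have he := I.eps_pos
  have he' := I.eps_le
  have hdil := dil_ge (I := I)
  unfold span
  rw [← mul_div_assoc, one_le_div (by positivity)]
  nlinarith

/-- At the tie `w a * ‖u - s c‖ = w c * ‖u - s a‖`, so `phi a c` is at most `2 * ‖u - s a‖`, and `a`
is within a multiple of `side / eps` of the cube. One factor `eps` of `span` is this distance, the
other the ratio of side and scale; `64` is a reserve for `ncard_ess_le`. -/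
theorem Charged.phi_le {Q : Cube d} {a : Fin n} (h : I.Charged Q a) :
    ∃ c, a < c ∧ I.Alive (I.scale Q) c ∧ 64 * I.phi a c ≤ I.span * I.scale Q := by
  obtain ⟨-, hfar, u, hu, -, c, hac, hal, heq⟩ := h
  refine ⟨c, hac, hal, ?_⟩
  have he := I.eps_pos
  have he' := I.eps_le
  have hdil := dil_ge (I := I)
  have hs := Q.side_pos
  have ha := I.wpos a
  have hc := I.wpos c
  rw [mem_nbhd] at hu
  have hua : ‖u - I.s a‖ ≤ 201 * I.dil * Q.side / I.eps := by
    have h1 := norm_sub_le_norm_sub_add_norm_sub u Q.corner (I.s a)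
    have h2 : I.dil * Q.side ≤ I.dil * Q.side / I.eps := by
      rw [le_div_iff₀ he]
      have : 0 < I.dil * Q.side := by positivity
      nlinarith
    have e : 201 * I.dil * Q.side / I.eps
        = 200 * I.dil * Q.side / I.eps + I.dil * Q.side / I.eps := by ring
    linarith
  have hphi : I.phi a c ≤ 2 * ‖u - I.s a‖ := by
    unfold phi
    unfold wd at heq
    rw [div_eq_div_iff hc.ne' ha.ne'] at heq
    rw [div_le_iff₀ hc]
    have h1 := norm_sub_le_norm_sub_add_norm_sub (I.s a) u (I.s c)
    rw [norm_sub_rev (I.s a) u] at h1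
    have h2 : I.w a * ‖I.s a - I.s c‖ ≤ I.w a * (‖u - I.s a‖ + ‖u - I.s c‖) := by gcongr
    have h3 : I.w a * ‖u - I.s a‖ ≤ I.w c * ‖u - I.s a‖ := by
      gcongr; exact I.mono hac.le
    nlinarith
  have e : I.span * I.scale Q = 64 * (2 * (201 * I.dil * Q.side / I.eps)) := by
    unfold span scale; field_simp; ring
  rw [e]
  linarith

/-- The site `x` dies between the scale for level `l` and its multiple by `span`. -/
def Dying (I : Net d n) (x : Fin n × ℤ) : Prop :=
  I.Alive (I.scaleAt x.2) x.1 ∧ ¬ I.Alive (I.span * I.scaleAt x.2) x.1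

/-- If `a` lives on at `span` times the scale, separation shows that `c` does not, so `c` is the
dying site. The extra conclusions in this case are what allows `c` to be blamed by only one `a` per
level. -/
theorem Charged.dying {Q : Cube d} {a : Fin n} (h : I.Charged Q a) :
    I.Dying (a, Q.level) ∨ ∃ c, I.Dying (c, Q.level) ∧ a < c ∧
      I.Alive (I.span * I.scale Q) a ∧ 64 * I.phi a c ≤ I.span * I.scale Q ∧
      I.w c < 16 * I.w a := by
  have hal := h.1
  obtain ⟨c, hac, hc, hphi⟩ := h.phi_le
  have ht := scale_pos (I := I) Q
  have hsp := one_le_span (I := I)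
  have hpos : 0 < I.phi a c := by
    unfold phi
    have := I.wpos a
    have := I.wpos c
    have : 0 < ‖I.s a - I.s c‖ := norm_pos_iff.2 (sub_ne_zero.2 fun h => hac.ne (I.inj h))
    positivity
  by_cases hdead : I.Alive (I.span * I.scale Q) a
  · right
    refine ⟨c, ⟨hc, ?_⟩, hac, hdead, hphi, ?_⟩
    · intro hcal
      have := hdead.lt_phi hac hcal
      linarith
    · by_contra hw
      push Not at hw
      -- If `c` were at least `16` times as heavy as `a`, then going on from `c` to its
      -- representative `e` at scale `8 * phi a c` would cost only a sixteenth as seen from `a`. So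
      -- `phi a e` is at most `2 * phi a c`, and `e` lives long enough to remove `a` too early.
      obtain ⟨e, hce, hel, hpe⟩ := exists_alive (I := I) (t := 8 * I.phi a c) (by linarith) c
      have hae : a < e := hac.trans_le hce
      have h1 : I.phi a e ≤ 2 * I.phi a c := by
        have h2 := phi_triangle' (I := I) a c e
        have h3 : I.phi a c * (I.w c / I.w e) ≤ I.phi a c :=
          mul_le_of_le_one_right hpos.le ((div_le_one (I.wpos e)).2 (I.mono hce))
        have h4 : I.w a / I.w c ≤ 1 / 16 := by
          rw [div_le_div_iff₀ (I.wpos c) (by norm_num)]; linarith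
        have h5 : I.w a / I.w c * I.phi c e ≤ 1 / 16 * (2 * (8 * I.phi a c)) := by
          have := phi_nonneg (I := I) c e
          gcongr
        linarith
      have h2 : 2 * I.kap e * I.phi a e ≤ 1 := by
        unfold Alive at hel
        have := mul_le_mul_of_nonneg_left h1 (I.kap_nonneg e)
        have := mul_nonneg (I.kap_nonneg e) hpos.le
        linarith
      have h3 := I.kap_of a e hae h2
      have h4 : I.kap a * I.phi a e ≤ I.kap a * (I.span * I.scale Q) :=
        mul_le_mul_of_nonneg_left (by linarith) (I.kap_nonneg a)
      unfold Alive at hdead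
      unfold phi at h4
      linarith
  · exact Or.inl ⟨hal, hdead⟩

/-- The scale halves with each level, so two levels at which the same site is dying differ by at
most `log₂ span`; all of them lie in a window around any one of them. -/
theorem ncard_dying_le (I : Net d n) :
    {x | I.Dying x}.Finite ∧ {x | I.Dying x}.ncard ≤ n * (2 * ⌈Real.logb 2 I.span⌉₊ + 1) := by
  classical
  have hsp := one_le_span (I := I)
  set m := ⌈Real.logb 2 I.span⌉₊ with hm
  have hpow : I.span ≤ 2 ^ m := by
    have h1 : Real.logb 2 I.span ≤ m := Nat.le_ceil _
    rw [Real.logb_le_iff_le_rpow (by norm_num) (by linarith)] at h1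
    rwa [Real.rpow_natCast] at h1
  have hclose : ∀ (a : Fin n) (l l' : ℤ), I.Dying (a, l) → I.Dying (a, l') → l' ≤ l + m := by
    intro a l l' h h'
    by_contra hlt
    push Not at hlt
    have h1 := h.1
    have h2 := h'.2
    unfold Alive scaleAt at h1 h2
    simp only at h1 h2
    push Not at h2
    have h3 : gridSide l' ≤ gridSide l / 2 ^ m := by
      rw [← gridSide_add]; exact gridSide_le hlt.le
    rw [le_div_iff₀ (by positivity)] at h3
    have h4 : I.span * gridSide l' ≤ gridSide l := by
      have := gridSide_pos l'
      nlinarith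
    have h5 : I.kap a * I.eps / 1000 * (I.span * gridSide l') ≤ I.kap a * I.eps / 1000 * gridSide l := by
      have := I.kap_nonneg a
      have := I.eps_pos
      gcongr
    linarith
  have h := ncard_le_of_cover (S := {x | I.Dying x}) (T := (Finset.univ : Finset (Fin n)))
    (A := fun a => {x | x.1 = a ∧ I.Dying x}) (m := 2 * m + 1)
    (fun x hx => ⟨x.1, Finset.mem_univ _, rfl, hx⟩) ?_
  · simpa using h
  · intro a _
    rcases Set.eq_empty_or_nonempty {x | x.1 = a ∧ I.Dying x} with h | ⟨⟨a', l⟩, ha, hl⟩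
    · rw [h]; simp
    · simp only at ha
      subst ha
      have := ncard_le_of_injOn (S := {x | x.1 = a' ∧ I.Dying x}) (f := Prod.snd)
        (T := Finset.Icc (l - m) (l + m)) ?_ ?_
      · refine ⟨this.1, this.2.trans ?_⟩
        rw [Int.card_Icc]; omega
      · rintro ⟨a, l'⟩ ⟨h1, h2⟩
        simp only at h1
        subst h1
        have h3 := hclose a l l' hl h2
        have h4 := hclose a l' l h2 hl
        rw [Finset.mem_Icc]
        constructor <;> simp only <;> omega
      · rintro ⟨a, l1⟩ ⟨h1, -⟩ ⟨b, l2⟩ ⟨h2, -⟩ h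
        simp only at h1 h2 h
        subst h1 h2 h
        rfl

/-- Three factors: the dying pairs of a site and a level, a factor `2` because a charged pair is
either dying itself or mapped injectively to a dying partner, and the number of cubes charged to one
pair. -/
theorem ncard_ess_le (I : Net d n) :
    {Q : Cube d | I.Ess Q}.Finite ∧ (({Q : Cube d | I.Ess Q}.ncard : ℕ) : ℝ) ≤
      2 * (n * (2 * ⌈Real.logb 2 I.span⌉₊ + 1)) *
        (2 * d * ((2 * d * (d + 10) + 1) * (401 * I.dil / I.eps) ^ (d - 1))) := by
  classical
  obtain ⟨hDf, hDc⟩ := ncard_dying_le I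
  have hsp := one_le_span (I := I)
  set m := ⌈Real.logb 2 I.span⌉₊ with hm
  set B : ℝ := 2 * d * ((2 * d * (d + 10) + 1) * (401 * I.dil / I.eps) ^ (d - 1)) with hB
  set P : Set (Fin n × ℤ) := {x | ∃ Q : Cube d, Q.level = x.2 ∧ I.Charged Q x.1} with hP
  let R : Fin n × ℤ → Fin n → Prop := fun x c => I.Dying (c, x.2) ∧ x.1 < c ∧
      I.Alive (I.span * I.scaleAt x.2) x.1 ∧ 64 * I.phi x.1 c ≤ I.span * I.scaleAt x.2 ∧
      I.w c < 16 * I.w x.1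
  have hPR : ∀ x ∈ P, I.Dying x ∨ ∃ c, R x c := by
    rintro ⟨a, l⟩ ⟨Q, hl, hQ⟩
    simp only at hl hQ
    subst hl
    exact hQ.dying
  -- Two sites `a < a'` with the same partner `c` would both be in the net at `span` times the
  -- scale, hence separated by more than half of it. But through `c` their `phi` is at most `16 * (1
  -- / 64 + 1 / 64)` of it, because `w c < 16 * w a'`.
  have hRlt : ∀ a a' l c, a < a' → R (a, l) c → ¬ R (a', l) c := by
    rintro a a' l c hlt ⟨-, hac, hal, hp, hw⟩ ⟨-, hac', hal', hp', hw'⟩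
    simp only at *
    have h1 := hal.lt_phi hlt hal'
    have ha := I.wpos a
    have ha' := I.wpos a'
    have hc := I.wpos c
    have haa := I.mono hlt.le
    have h2 : I.phi a a' ≤ 16 * (I.phi a c + I.phi a' c) := by
      unfold phi
      rw [← add_div, ← mul_div_assoc, div_le_div_iff₀ ha' hc]
      have h3 := norm_sub_le_norm_sub_add_norm_sub (I.s a) (I.s c) (I.s a')
      rw [norm_sub_rev (I.s c)] at h3
      calc I.w a * ‖I.s a - I.s a'‖ * I.w c
          ≤ I.w a * (‖I.s a - I.s c‖ + ‖I.s a' - I.s c‖) * (16 * I.w a') := by gcongr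
        _ ≤ 16 * (I.w a * ‖I.s a - I.s c‖ + I.w a' * ‖I.s a' - I.s c‖) * I.w a' := by
            have : I.w a * ‖I.s a' - I.s c‖ ≤ I.w a' * ‖I.s a' - I.s c‖ := by gcongr
            nlinarith
    linarith
  have hRinj : ∀ a a' l c, R (a, l) c → R (a', l) c → a = a' := by
    intro a a' l c h h'
    rcases lt_trichotomy a a' with hlt | heq | hlt
    · exact absurd h' (hRlt a a' l c hlt h)
    · exact heq
    · exact absurd h (hRlt a' a l c hlt h')
  have hP2 : {x | ∃ c, R x c}.Finite ∧ {x | ∃ c, R x c}.ncard ≤ n * (2 * m + 1) := by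
    have : Nonempty (Fin n) := ⟨⟨0, I.hn⟩⟩
    choose! f hf using fun (x : Fin n × ℤ) (hx : ∃ c, R x c) => hx
    have := ncard_le_of_injOn (S := {x | ∃ c, R x c}) (f := fun x => (f x, x.2))
      (T := hDf.toFinset) ?_ ?_
    · refine ⟨this.1, this.2.trans ?_⟩
      rw [← Set.ncard_eq_toFinset_card _ hDf]; exact hDc
    · intro x hx
      simpa using (hf x hx).1
    · rintro ⟨a, l⟩ hx ⟨a', l'⟩ hx' heq
      simp only [Prod.mk.injEq] at heq
      obtain ⟨h1, rfl⟩ := heq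
      have h2 := hf _ hx
      have h3 := hf _ hx'
      rw [← h1] at h3
      rw [hRinj a a' l _ h2 h3]
  have hPsub : P ⊆ {x | I.Dying x} ∪ {x | ∃ c, R x c} := hPR
  have hPf : P.Finite := (hDf.union hP2.1).subset hPsub
  have hPc : P.ncard ≤ 2 * (n * (2 * m + 1)) :=
    ((Set.ncard_le_ncard hPsub (hDf.union hP2.1)).trans (Set.ncard_union_le _ _)).trans (by omega)
  have hcov := ncard_le_of_cover (S := {Q : Cube d | I.Ess Q}) (T := hPf.toFinset)
    (A := fun x => {Q : Cube d | Q.level = x.2 ∧ I.Charged Q x.1}) (m := ⌊B⌋₊)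
    (fun Q hQ => by
      obtain ⟨a, ha⟩ := hQ
      exact ⟨(a, Q.level), by simpa [hP] using ⟨Q, rfl, ha⟩, rfl, ha⟩)
    (fun x _ => ⟨(ncard_charged_le I x.1 x.2).1, Nat.le_floor (ncard_charged_le I x.1 x.2).2⟩)
  refine ⟨hcov.1, ?_⟩
  have hB0 : 0 ≤ B := by
    have := dil_ge (I := I)
    have := I.eps_pos
    positivity
  rw [← Set.ncard_eq_toFinset_card _ hPf] at hcov
  calc (({Q : Cube d | I.Ess Q}.ncard : ℕ) : ℝ) ≤ ((P.ncard * ⌊B⌋₊ : ℕ) : ℝ) := by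
        exact_mod_cast hcov.2
    _ ≤ ((2 * (n * (2 * m + 1)) : ℕ) : ℝ) * B := by
        push_cast
        have h1 := Nat.floor_le hB0
        have h2 : (P.ncard : ℝ) ≤ 2 * (n * (2 * m + 1)) := by exact_mod_cast hPc
        gcongr
    _ = _ := by push_cast; ring

/-- Here `log span` is a constant plus a multiple of `log (1 / eps)`; since `eps ≤ 1 / 4` makes that
logarithm at least `1`, it absorbs the additive constants. -/
theorem exists_ess_bound (d : ℕ) : ∃ C : ℝ, 0 < C ∧ ∀ (n : ℕ) (I : Net d n),
    (({Q : Cube d | I.Ess Q}.ncard : ℕ) : ℝ) ≤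
      C * (n * Real.log (1 / I.eps) / I.eps ^ (d - 1)) := by
  set K : ℝ := d + 10 with hK
  set c0 : ℝ := Real.logb 2 (64 * 402000 * K) with hc0
  have hKpos : 0 < K := by positivity
  have hc0n : 0 ≤ c0 := Real.logb_nonneg (by norm_num) (by
    have : (10 : ℝ) ≤ K := by simp [hK]
    linarith)
  refine ⟨2 * (2 * c0 + 3 + 4 / Real.log 2) *
    (2 * d * ((2 * d * (d + 10) + 1) * (401 * K) ^ (d - 1))) + 1, by positivity, ?_⟩
  intro n I
  have he := I.eps_pos
  have he' := I.eps_le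
  have hlog2 : 0 < Real.log 2 := Real.log_pos (by norm_num)
  have hL1 : 1 ≤ Real.log (1 / I.eps) := by
    rw [Real.le_log_iff_exp_le (by positivity), le_div_iff₀ he]
    have := Real.exp_one_lt_d9
    nlinarith [Real.exp_pos 1]
  have hspan : Real.logb 2 I.span = c0 + 2 / Real.log 2 * Real.log (1 / I.eps) := by
    have e : I.span = 64 * 402000 * K * (1 / I.eps) ^ 2 := by
      unfold span dil; rw [← hK]; field_simp
    rw [e, Real.logb_mul (by positivity) (by positivity), Real.logb_pow, hc0]
    congr 1
    unfold Real.logb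
    push_cast
    ring
  have hm : (2 * ⌈Real.logb 2 I.span⌉₊ + 1 : ℝ) ≤
      (2 * c0 + 3 + 4 / Real.log 2) * Real.log (1 / I.eps) := by
    have h1 := Nat.ceil_lt_add_one (Real.logb_nonneg (by norm_num : (1 : ℝ) < 2)
      (one_le_span (I := I)))
    rw [hspan] at h1 ⊢
    have h2 : 2 * c0 + 3 ≤ (2 * c0 + 3) * Real.log (1 / I.eps) :=
      le_mul_of_one_le_right (by positivity) hL1
    have e : 4 / Real.log 2 * Real.log (1 / I.eps)
        = 2 * (2 / Real.log 2 * Real.log (1 / I.eps)) := by ring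
    linarith
  have hdk : I.dil = K := rfl
  refine (ncard_ess_le I).2.trans ?_
  rw [hdk, div_pow]
  set c1 := 2 * c0 + 3 + 4 / Real.log 2 with hc1
  set L := Real.log (1 / I.eps) with hL
  have hbig : 0 ≤ (n * L / I.eps ^ (d - 1) : ℝ) := by positivity
  calc (2 * (n * (2 * ⌈Real.logb 2 I.span⌉₊ + 1)) *
        (2 * d * ((2 * d * (d + 10) + 1) * ((401 * K) ^ (d - 1) / I.eps ^ (d - 1)))) : ℝ)
      ≤ 2 * (n * (c1 * L)) *
        (2 * d * ((2 * d * (d + 10) + 1) * ((401 * K) ^ (d - 1) / I.eps ^ (d - 1)))) := by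
        gcongr
    _ = 2 * c1 * (2 * d * ((2 * d * (d + 10) + 1) * (401 * K) ^ (d - 1)))
        * (n * L / I.eps ^ (d - 1)) := by ring
    _ ≤ _ := by rw [add_mul]; linarith

end Net

/-! ### The adaptive subdivision: number of cubes -/

/-- What happens to a cube: it becomes a cell, it becomes a cell after removal of a smaller cube
that is treated next, or it is split into its children. -/
inductive Outcome (d n : ℕ) where
  | leaf (b : Fin n)
  | jump (b : Fin n) (P : Cube d)
  | split

namespace Net

variable {d n : ℕ} {I : Net d n}

/-- The part of `Q` where the label `b` is not good enough. -/
def badSet (I : Net d n) (Q : Cube d) (b : Fin n) : Set (EuclideanSpace ℝ (Fin d)) :=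
  {p | p ∈ Q.region ∧ ∃ j, (1 + I.eps) * I.wd j p < I.wd b p}

/-- A certificate that no proper part of the cube can be treated instead of the cube. -/
def Stuck (I : Net d n) (Q : Cube d) : Prop :=
  ∃ b, I.Best Q b Q.corner ∧
    ((∃ j p, (1 + I.eps) * I.w b ≤ I.w j ∧ ‖p - Q.corner‖ ≤ d * Q.side ∧
        (1 + I.eps) * I.wd j p < I.wd b p) ∨
      ((I.badSet Q b).Nonempty ∧ ∀ H : Cube d, I.badSet Q b ⊆ H.region → H.level ≤ Q.level))

/-- A jump must go to the smallest cube around the bad set, and a split must carry a certificate;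
only so can the steps be charged to essential cubes. A leaf needs no relation to the net. -/
def OutcomeSpec (I : Net d n) (Q : Cube d) : Outcome d n → Prop
  | .leaf b => ∀ p ∈ Q.region, ∀ j, I.wd b p ≤ (1 + I.eps) * I.wd j p
  | .jump b P => I.Best Q b Q.corner ∧ P.Sub Q ∧ P ≠ Q ∧ (I.badSet Q b).Nonempty ∧
      I.badSet Q b ⊆ P.region ∧ ∀ H : Cube d, I.badSet Q b ⊆ H.region → H.level ≤ P.level
  | .split => I.Stuck Q

/-- The subdivision of `Q` is complete after `N` steps. -/
inductive Explored (out : Cube d → Outcome d n) : Cube d → ℕ → Prop where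
  | leaf {Q : Cube d} {b : Fin n} (h : out Q = .leaf b) : Explored out Q 1
  | jump {Q P : Cube d} {b : Fin n} {N : ℕ} (h : out Q = .jump b P) (hP : Explored out P N) :
      Explored out Q (N + 2)
  | split {Q : Cube d} {N : ℕ → ℕ} (h : out Q = .split)
      (hN : ∀ v < 2 ^ d, Explored out (Q.child v) (N v)) :
      Explored out Q (1 + ∑ v ∈ Finset.range (2 ^ d), N v)

/-- Bad points lie in essential cubes, so a cube that contains all essential cubes in `Q` contains
the bad set of `Q`. -/
theorem Best.badSet_subset {Q : Cube d} {b : Fin n} (hb : I.Best Q b Q.corner)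
    {p : EuclideanSpace ℝ (Fin d)} (hp : p ∈ I.badSet Q b) :
    ∃ P : Cube d, P.Sub Q ∧ p ∈ P.region ∧ I.Ess P := by
  by_contra hcon
  push Not at hcon
  obtain ⟨hpQ, j, hj⟩ := hp
  exact absurd (hb.le_of_forall_not_ess hpQ hcon j) (not_le.2 hj)

/-! ### Essential cubes inside a given cube, and the length of the traversal -/

open Classical in
/-- Number of the essential cubes in `Q`. -/
def essCount (I : Net d n) (Q : Cube d) : ℕ :=
  ((ncard_ess_le I).1.toFinset.filter fun P => P.Sub Q).card

theorem essCount_pos {Q : Cube d} : 0 < I.essCount Q ↔ ∃ P : Cube d, P.Sub Q ∧ I.Ess P := by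
  classical
  unfold essCount
  rw [Finset.card_pos]
  constructor
  · rintro ⟨P, hP⟩
    simp only [Finset.mem_filter, Set.Finite.mem_toFinset] at hP
    exact ⟨P, hP.2, hP.1⟩
  · rintro ⟨P, h1, h2⟩
    exact ⟨P, by simpa using ⟨h2, h1⟩⟩

theorem essCount_mono {P Q : Cube d} (h : P.Sub Q) : I.essCount P ≤ I.essCount Q := by
  classical
  unfold essCount
  exact Finset.card_le_card (Finset.monotone_filter_right _ fun R _ hR => hR.trans h)

theorem essCount_lt {P Q R : Cube d} (h : P.Sub Q) (hR : R.Sub Q) (hess : I.Ess R)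
    (hn : ¬ R.Sub P) : I.essCount P < I.essCount Q := by
  classical
  unfold essCount
  apply Finset.card_lt_card
  rw [Finset.ssubset_iff_of_subset (Finset.monotone_filter_right _ fun R _ hR => hR.trans h)]
  exact ⟨R, by simpa using ⟨hess, hR⟩, by simp [hn]⟩

theorem _root_.AMWVD.Cube.child_disjoint {Q P : Cube d} {u v : ℕ} (hu : u < 2 ^ d) (hv : v < 2 ^ d)
    (h : P.Sub (Q.child u)) (h' : P.Sub (Q.child v)) : u = v := by
  apply Nat.eq_of_testBit_eq
  intro k
  rcases lt_or_ge k d with hk | hk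
  · exact Cube.child_testBit (h.subset P.corner_mem) (h'.subset P.corner_mem) ⟨k, hk⟩
  · rw [Nat.testBit_eq_false_of_lt (hu.trans_le (Nat.pow_le_pow_right (by norm_num) hk)),
      Nat.testBit_eq_false_of_lt (hv.trans_le (Nat.pow_le_pow_right (by norm_num) hk))]

open Classical in
theorem sum_essCount_le (Q : Cube d) : (∑ v ∈ Finset.range (2 ^ d), I.essCount (Q.child v)) +
    (if I.Ess Q then 1 else 0) ≤ I.essCount Q := by
  set E := (ncard_ess_le I).1.toFinset with hE
  have h1 : ∑ v ∈ Finset.range (2 ^ d), I.essCount (Q.child v)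
      = ((Finset.range (2 ^ d)).biUnion fun v => E.filter fun P => P.Sub (Q.child v)).card := by
    rw [Finset.card_biUnion]
    · rfl
    · intro u hu v hv huv
      simp only [Function.onFun]
      rw [Finset.disjoint_left]
      intro P hP hP'
      simp only [Finset.mem_filter] at hP hP'
      exact huv (Cube.child_disjoint (Finset.mem_range.1 hu) (Finset.mem_range.1 hv) hP.2 hP'.2)
  have hsub : ((Finset.range (2 ^ d)).biUnion fun v => E.filter fun P => P.Sub (Q.child v))
      ⊆ E.filter fun P => P.Sub Q := by
    intro P hP
    simp only [Finset.mem_biUnion, Finset.mem_filter] at hP ⊢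
    obtain ⟨v, -, hPE, hPv⟩ := hP
    exact ⟨hPE, hPv.trans (Q.child_sub v)⟩
  rw [h1]
  split_ifs with hQ
  · rw [show I.essCount Q = (E.filter fun P => P.Sub Q).card from rfl]
    rw [Nat.add_one_le_iff]
    apply Finset.card_lt_card
    rw [Finset.ssubset_iff_of_subset hsub]
    refine ⟨Q, by simpa [hE] using ⟨hQ, Cube.Sub.refl Q⟩, ?_⟩
    simp only [Finset.mem_biUnion, Finset.mem_filter, not_exists, not_and]
    intro v _ _ h
    have := h.1
    simp [Cube.child] at this
  · exact Finset.card_le_card hsub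

/-- `Q` is the smallest cube that contains all essential cubes in `Q`. -/
def IsHull (I : Net d n) (Q : Cube d) : Prop :=
  I.Ess Q ∨ ∃ u v, u < 2 ^ d ∧ v < 2 ^ d ∧ u ≠ v ∧ 0 < I.essCount (Q.child u) ∧
    0 < I.essCount (Q.child v)

/-- As long as a cube is not a hull, exactly one of its children contains essential cubes; descend
into it. The level of one essential cube `R` bounds the descent. -/
theorem exists_hull (m : ℕ) : ∀ Q R : Cube d, R.Sub Q → I.Ess R → R.level ≤ Q.level + m →
    ∃ H : Cube d, H.Sub Q ∧ I.IsHull H ∧ ∀ P : Cube d, P.Sub Q → I.Ess P → P.Sub H := by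
  induction m with
  | zero =>
    intro Q R hR hess hl
    have := hR.eq_of_level (by simpa using hl)
    subst this
    exact ⟨R, Cube.Sub.refl R, Or.inl hess, fun P hP _ => hP⟩
  | succ m ih =>
    intro Q R hR hess hl
    by_cases hQ : I.IsHull Q
    · exact ⟨Q, Cube.Sub.refl Q, hQ, fun P hP _ => hP⟩
    · unfold IsHull at hQ
      push Not at hQ
      have hne : ∀ P, I.Ess P → P ≠ Q := fun P hP h => hQ.1 (h ▸ hP)
      obtain ⟨v, hv, hRv⟩ := hR.exists_child (hne R hess)
      obtain ⟨H, hH, hHh, hHall⟩ := ih (Q.child v) R hRv hess (by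
        simp only [Cube.child]; push_cast at hl; linarith)
      refine ⟨H, hH.trans (Q.child_sub v), hHh, fun P hP hPe => hHall P ?_ hPe⟩
      obtain ⟨u, hu, hPu⟩ := hP.exists_child (hne P hPe)
      by_cases huv : u = v
      · exact huv ▸ hPu
      · exact absurd (essCount_pos.2 ⟨R, hRv, hess⟩)
          (not_lt.2 (hQ.2 u v hu hv huv (essCount_pos.2 ⟨P, hPu, hPe⟩)))

/-- A bad, much heavier site is impossible at a cube that is not essential, by `Best.no_heavy`. In
the other case the hull of the essential cubes contains the bad set, so by the certificate it is no
smaller than `Q`. -/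
theorem Stuck.isHull {Q : Cube d} (h : I.Stuck Q) : I.IsHull Q := by
  obtain ⟨b, hb, h⟩ := h
  by_contra hQ
  have hne : ¬ I.Ess Q := fun h => hQ (Or.inl h)
  rcases h with ⟨j, p, hw, hp, hbad⟩ | ⟨⟨p, hp⟩, hmin⟩
  · exact absurd (hb.no_heavy hne hw hp) (not_le.2 hbad)
  · obtain ⟨R, hR, -, hRe⟩ := hb.badSet_subset hp
    obtain ⟨H, hH, hHh, hall⟩ := exists_hull (I := I) (R.level - Q.level).toNat Q R hR hRe (by omega)
    have hlev := hmin H fun x hx => by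
      obtain ⟨P, hP, hxP, hPe⟩ := hb.badSet_subset hx
      exact (hall P hP hPe).subset hxP
    have := hH.eq_of_level hlev
    exact hQ (this ▸ hHh)

/-- Strong induction on the number `e` of essential cubes in `Q`. Without any, the bad set is empty
and one step suffices. A cube that is not a hull needs at most the two steps of a jump more than a
hull, whence the `+ 2`. At a hull, either an essential cube drops out and pays `2 * 2 ^ d + 6`, or
two children are occupied, and the credit `2 ^ d + 3` of one of them pays for the split. -/
theorem exists_explored {out : Cube d → Outcome d n} (hout : ∀ Q, I.OutcomeSpec Q (out Q)) (e : ℕ) :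
    ∀ Q : Cube d, I.essCount Q = e → ∃ N, Explored out Q N ∧ (e = 0 → N = 1) ∧
      (0 < e → N + (2 ^ d + 3) ≤ (2 * 2 ^ d + 6) * e + 2) ∧
      (I.IsHull Q → N + (2 ^ d + 3) ≤ (2 * 2 ^ d + 6) * e) := by
  induction e using Nat.strong_induction_on with
  | _ e ih =>
  have hull_pos : ∀ Q, I.IsHull Q → 0 < I.essCount Q := by
    rintro Q (h | ⟨u, v, hu, hv, huv, h, h'⟩)
    · exact essCount_pos.2 ⟨Q, Cube.Sub.refl Q, h⟩
    · exact h.trans_le (essCount_mono (Q.child_sub u))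
  -- a jump from a cube to a cube with fewer essential cubes
  have less : ∀ P : Cube d, I.essCount P < e → ∃ N, Explored out P N ∧
      N + 2 + (2 ^ d + 3) ≤ (2 * 2 ^ d + 6) * e ∧ N ≤ (2 * 2 ^ d + 6) * I.essCount P + 1 := by
    intro P hP
    obtain ⟨N, hN, h0, h1, -⟩ := ih _ hP P rfl
    refine ⟨N, hN, ?_⟩
    have h2 : (2 * 2 ^ d + 6) * (I.essCount P + 1) ≤ (2 * 2 ^ d + 6) * e := Nat.mul_le_mul_left _ hP
    rw [mul_add, mul_one] at h2
    rcases Nat.eq_zero_or_pos (I.essCount P) with h | h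
    · have := h0 h
      constructor <;> omega
    · have := h1 h
      constructor <;> omega
  have hullCase : ∀ Q : Cube d, I.essCount Q = e → I.IsHull Q →
      ∃ N, Explored out Q N ∧ N + (2 ^ d + 3) ≤ (2 * 2 ^ d + 6) * e := by
    intro Q hQe hQ
    have hpos := hull_pos Q hQ
    rw [hQe] at hpos
    have hbase : (2 * 2 ^ d + 6) * 1 ≤ (2 * 2 ^ d + 6) * e := Nat.mul_le_mul_left _ hpos
    have hspec := hout Q
    cases ho : out Q with
    | leaf b => exact ⟨1, .leaf ho, by omega⟩
    | jump b P =>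
      rw [ho] at hspec
      obtain ⟨-, hPQ, hne, -⟩ := hspec
      have hlt : I.essCount P < e := by
        rw [← hQe]
        rcases hQ with h | ⟨u, v, hu, hv, huv, h, h'⟩
        · exact essCount_lt hPQ (Cube.Sub.refl Q) h fun hs => hne (hPQ.antisymm hs)
        · obtain ⟨w, hw, hPw⟩ := hPQ.exists_child hne
          obtain ⟨x, hx, hxw, hx0⟩ : ∃ x, x < 2 ^ d ∧ x ≠ w ∧ 0 < I.essCount (Q.child x) := by
            by_cases huw : u = w
            · exact ⟨v, hv, fun h => huv (huw.trans h.symm), h'⟩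
            · exact ⟨u, hu, huw, h⟩
          obtain ⟨R, hR, hRe⟩ := essCount_pos.1 hx0
          exact essCount_lt hPQ (hR.trans (Q.child_sub x)) hRe fun hs =>
            hxw (Cube.child_disjoint hx hw hR (hs.trans hPw))
      obtain ⟨N, hN, h1, -⟩ := less P hlt
      exact ⟨N + 2, .jump ho hN, h1⟩
    | split =>
      have hsum := sum_essCount_le (I := I) Q
      rw [hQe] at hsum
      by_cases hess : I.Ess Q
      · rw [if_pos hess] at hsum
        have hlt : ∀ v < 2 ^ d, I.essCount (Q.child v) < e := by
          intro v hv
          have := Finset.single_le_sum (f := fun v => I.essCount (Q.child v))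
            (fun _ _ => Nat.zero_le _) (Finset.mem_range.2 hv)
          omega
        choose! N hN h1 h2 using fun v (hv : v < 2 ^ d) => less (Q.child v) (hlt v hv)
        refine ⟨_, .split ho hN, ?_⟩
        have h3 : ∑ v ∈ Finset.range (2 ^ d), N v
            ≤ (2 * 2 ^ d + 6) * (∑ v ∈ Finset.range (2 ^ d), I.essCount (Q.child v)) + 2 ^ d := by
          calc _ ≤ ∑ v ∈ Finset.range (2 ^ d), ((2 * 2 ^ d + 6) * I.essCount (Q.child v) + 1) :=
                Finset.sum_le_sum fun v hv => h2 v (Finset.mem_range.1 hv)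
            _ = _ := by rw [Finset.sum_add_distrib, ← Finset.mul_sum]; simp
        have h4 : (2 * 2 ^ d + 6) * ((∑ v ∈ Finset.range (2 ^ d), I.essCount (Q.child v)) + 1)
            ≤ (2 * 2 ^ d + 6) * e := Nat.mul_le_mul_left _ hsum
        rw [mul_add, mul_one] at h4
        omega
      · rw [if_neg hess, add_zero] at hsum
        obtain h | ⟨u, w, hu, hw, huw, hu0, hw0⟩ := hQ
        · exact absurd h hess
        have hpair : ∀ x y, x < 2 ^ d → y < 2 ^ d → x ≠ y →
            I.essCount (Q.child x) + I.essCount (Q.child y) ≤ e := by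
          intro x y hx hy hxy
          refine le_trans ?_ hsum
          rw [← Finset.sum_pair (f := fun v => I.essCount (Q.child v)) hxy]
          apply Finset.sum_le_sum_of_subset
          intro z hz
          simp only [Finset.mem_insert, Finset.mem_singleton] at hz
          rcases hz with rfl | rfl <;> simpa
        have hlt : ∀ v < 2 ^ d, I.essCount (Q.child v) < e := by
          intro v hv
          by_cases h : v = u
          · have := hpair v w hv hw (by rw [h]; exact huw); omega
          · have := hpair v u hv hu h; omega
        -- The unit is the slack of every child; `2 ^ d + 2` is the additional slack of the two
        -- children known to be occupied.
        have hex : ∀ v, v < 2 ^ d → ∃ N, Explored out (Q.child v) N ∧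
            N + (1 + (if v = u then 2 ^ d + 2 else 0) + (if v = w then 2 ^ d + 2 else 0))
              ≤ (2 * 2 ^ d + 6) * I.essCount (Q.child v) + 2 := by
          intro v hv
          obtain ⟨N, hN, h0, h1, -⟩ := ih _ (hlt v hv) (Q.child v) rfl
          refine ⟨N, hN, ?_⟩
          split_ifs with h h' h'
          · exact absurd (h.symm.trans h') huw
          · have := h1 (h ▸ hu0); omega
          · have := h1 (h' ▸ hw0); omega
          · rcases Nat.eq_zero_or_pos (I.essCount (Q.child v)) with h' | h'
            · have := h0 h'; omega
            · have := h1 h'; omega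
        choose! N hN h1 using hex
        refine ⟨_, .split ho hN, ?_⟩
        have h3 := Finset.sum_le_sum fun v hv => h1 v (Finset.mem_range.1 hv)
        simp only [Finset.sum_add_distrib, ← Finset.mul_sum, Finset.sum_ite_eq', Finset.mem_range,
          hu, hw, if_true, Finset.sum_const, Finset.card_range, smul_eq_mul] at h3
        have h4 := Nat.mul_le_mul_left (2 * 2 ^ d + 6) hsum
        omega
  intro Q hQe
  by_cases hQ : I.IsHull Q
  · obtain ⟨N, hN, h⟩ := hullCase Q hQe hQ
    have := hull_pos Q hQ
    exact ⟨N, hN, by omega, by omega, fun _ => h⟩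
  · have hspec := hout Q
    have hne : ¬ I.Ess Q := fun h => hQ (Or.inl h)
    cases ho : out Q with
    | leaf b =>
      refine ⟨1, .leaf ho, by omega, fun he => ?_, fun h => absurd h hQ⟩
      have hbase : (2 * 2 ^ d + 6) * 1 ≤ (2 * 2 ^ d + 6) * e := Nat.mul_le_mul_left _ he
      omega
    | jump b P =>
      rw [ho] at hspec
      obtain ⟨hb, hPQ, hPne, ⟨p, hp⟩, hsub, hmin⟩ := hspec
      obtain ⟨R, hR, -, hRe⟩ := hb.badSet_subset hp
      have he : 0 < e := hQe ▸ essCount_pos.2 ⟨R, hR, hRe⟩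
      obtain ⟨H, hH, hHh, hall⟩ :=
        exists_hull (I := I) (R.level - Q.level).toNat Q R hR hRe (by omega)
      have hbadH : I.badSet Q b ⊆ H.region := fun x hx => by
        obtain ⟨P, hP, hxP, hPe⟩ := hb.badSet_subset hx
        exact (hall P hP hPe).subset hxP
      -- The jump leads into the hull `H`, since `H` contains the bad set and `P` is the smallest
      -- such cube. Either `P` has lost an essential cube, or `P = H` and the estimate for hulls
      -- applies.
      have hPH : P.Sub H := Cube.sub_of_mem (hmin H hbadH) (hsub hp) (hbadH hp)
      have hHe : I.essCount H = e := by
        rw [← hQe]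
        refine le_antisymm (essCount_mono hH) ?_
        classical
        unfold essCount
        apply Finset.card_le_card
        intro S hS
        simp only [Finset.mem_filter, Set.Finite.mem_toFinset, Set.mem_ofPred_eq] at hS ⊢
        exact ⟨hS.1, hall S hS.2 hS.1⟩
      rcases lt_or_eq_of_le (hHe ▸ essCount_mono (I := I) hPH) with hlt | heq
      · obtain ⟨N, hN, h1, -⟩ := less P hlt
        exact ⟨N + 2, .jump ho hN, by omega, by omega, fun h => absurd h hQ⟩
      · have hPHeq : P = H := by
          by_contra hPHne
          rcases hHh with h | ⟨u, v, hu, hv, huv, h, h'⟩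
          · have := essCount_lt hPH (Cube.Sub.refl H) h fun hs => hPHne (hPH.antisymm hs)
            omega
          · obtain ⟨w, hw, hPw⟩ := hPH.exists_child hPHne
            obtain ⟨x, hx, hxw, hx0⟩ : ∃ x, x < 2 ^ d ∧ x ≠ w ∧ 0 < I.essCount (H.child x) := by
              by_cases huw : u = w
              · exact ⟨v, hv, fun h => huv (huw.trans h.symm), h'⟩
              · exact ⟨u, hu, huw, h⟩
            obtain ⟨R, hR, hRe⟩ := essCount_pos.1 hx0
            have := essCount_lt hPH (hR.trans (H.child_sub x)) hRe fun hs =>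
              hxw (Cube.child_disjoint hx hw hR (hs.trans hPw))
            omega
        subst hPHeq
        obtain ⟨N, hN, h⟩ := hullCase P heq hHh
        exact ⟨N + 2, .jump ho hN, by omega, by omega, fun h => absurd h hQ⟩
    | split =>
      rw [ho] at hspec
      exact absurd hspec.isHull hQ

end Net

/-! ### The order of the cubes along the traversal -/

variable {d : ℕ}

/-- The point `q` comes after the cube `Q`: below the smallest cube that contains both, the two
are separated by the last axis along which their children differ. -/
def Cube.After (Q : Cube d) (q : EuclideanSpace ℝ (Fin d)) : Prop :=
  ∃ L < Q.level, (∀ l, gridIndex L (q l) = gridIndex L (Q.corner l)) ∧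
    ∃ k, gridIndex (L + 1) (Q.corner k) < gridIndex (L + 1) (q k) ∧
      ∀ l, k < l → gridIndex (L + 1) (Q.corner l) = gridIndex (L + 1) (q l)

theorem Cube.After.not_mem {Q : Cube d} {q : EuclideanSpace ℝ (Fin d)} (h : Q.After q) :
    q ∉ Q.region := by
  obtain ⟨L, hL, -, k, hk, -⟩ := h
  intro hq
  have h1 := Cube.mem_region.1 hq k
  have h2 : gridIndex (L + 1) (q k) = gridIndex (L + 1) (Q.corner k) :=
    gridIndex_eq_of_le (m := Q.level) (by omega) (by simp [h1])
  omega

/-- For a point outside `Q` the separation happens at a level above `Q`, where `P` and `Q` have the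
same indices. -/
theorem Cube.Sub.after_iff {P Q : Cube d} (h : P.Sub Q) {q : EuclideanSpace ℝ (Fin d)}
    (hq : q ∉ Q.region) : P.After q ↔ Q.After q := by
  have hcor : ∀ m ≤ Q.level, ∀ k, gridIndex m (P.corner k) = gridIndex m (Q.corner k) := by
    intro m hm k
    exact gridIndex_eq_of_le hm (by rw [Cube.mem_region.1 h.2 k]; simp)
  constructor
  · rintro ⟨L, hL, hLq, k, hk, hk'⟩
    have hLQ : L < Q.level := by
      by_contra hle
      push Not at hle
      apply hq
      rw [Cube.mem_region]
      intro l
      rw [← Cube.mem_region.1 h.2 l]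
      exact gridIndex_eq_of_le hle (hLq l)
    refine ⟨L, hLQ, fun l => ?_, k, ?_, fun l hl => ?_⟩
    · rw [← hcor L hLQ.le l]; exact hLq l
    · rw [← hcor _ (by omega) k]; exact hk
    · rw [← hcor _ (by omega) l]; exact hk' l hl
  · rintro ⟨L, hL, hLq, k, hk, hk'⟩
    refine ⟨L, hL.trans_le h.1, fun l => ?_, k, ?_, fun l hl => ?_⟩
    · rw [hcor L hL.le l]; exact hLq l
    · rw [hcor _ (by omega) k]; exact hk
    · rw [hcor _ (by omega) l]; exact hk' l hl

theorem Cube.gridIndex_child (Q : Cube d) (v : ℕ) (k : Fin d) :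
    gridIndex (Q.level + 1) ((Q.child v).corner k)
      = 2 * Q.index k - gridBit Q.level + if v.testBit k then 1 else 0 := by
  simp only [Cube.corner_apply, Cube.child, gridIndex_gridPoint]

theorem Cube.child_index_of_mem {Q : Cube d} {v : ℕ} {q : EuclideanSpace ℝ (Fin d)}
    (hq : q ∈ (Q.child v).region) (k : Fin d) : gridIndex (Q.level + 1) (q k)
      = 2 * Q.index k - gridBit Q.level + if v.testBit k then 1 else 0 :=
  Cube.mem_region.1 hq k

/-- The numerical order of the children is the traversal order: the highest bit in which `u` and `v`
differ belongs to the last axis along which the children differ. -/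
theorem Cube.after_child {Q : Cube d} {u v : ℕ} (huv : u < v) (hv : v < 2 ^ d)
    {q : EuclideanSpace ℝ (Fin d)} (hq : q ∈ (Q.child v).region) : (Q.child u).After q := by
  obtain ⟨k, hk1, hk2, hk3⟩ : ∃ k, u.testBit k = false ∧ v.testBit k = true ∧
      ∀ j, k < j → u.testBit j = v.testBit j := by
    by_contra hcon
    push Not at hcon
    obtain ⟨k, hk, hmax⟩ := Nat.exists_most_significant_bit (n := u ^^^ v) (by
      intro h; rw [Nat.xor_eq_zero_iff] at h; omega)
    have hj : ∀ j, k < j → u.testBit j = v.testBit j := by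
      intro j hj
      have := hmax j hj
      rw [Nat.testBit_xor] at this
      simpa using this
    rw [Nat.testBit_xor] at hk
    cases hu : u.testBit k <;> cases hw : v.testBit k
    · simp [hu, hw] at hk
    · obtain ⟨j, h1, h2⟩ := hcon k hu hw
      exact h2 (hj j h1)
    · exact absurd (Nat.lt_of_testBit k hw hu fun j h => (hj j h).symm) (by omega)
    · simp [hu, hw] at hk
  have hkd : k < d := by
    by_contra hle
    push Not at hle
    rw [Nat.testBit_eq_false_of_lt (hv.trans_le (Nat.pow_le_pow_right (by norm_num) hle))] at hk2
    simp at hk2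
  refine ⟨Q.level, by simp [Cube.child], fun l => ?_, ⟨k, hkd⟩, ?_, fun l hl => ?_⟩
  · rw [Cube.mem_region.1 ((Q.child_sub v).subset hq) l, Cube.mem_region.1 (Q.child_sub u).2 l]
  · rw [Cube.gridIndex_child, Cube.child_index_of_mem hq]
    simp [hk1, hk2]
  · rw [Cube.gridIndex_child, Cube.child_index_of_mem hq, hk3 l hl]

theorem Cube.not_after_child {Q : Cube d} {u v : ℕ} (huv : u < v) (hv : v < 2 ^ d)
    {q : EuclideanSpace ℝ (Fin d)} (hq : q ∈ (Q.child u).region) : ¬ (Q.child v).After q := by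
  rintro ⟨L, hL, hLq, k, hk, hk'⟩
  have hqQ := (Q.child_sub u).subset hq
  simp only [Cube.child] at hL
  have hLQ : L = Q.level := by
    by_contra hne
    have h1 := Cube.mem_region.1 hqQ k
    have h2 := Cube.mem_region.1 (Q.child_sub v).2 k
    have := gridIndex_eq_of_le (l := L + 1) (m := Q.level) (by omega) (h1.trans h2.symm)
    omega
  subst hLQ
  rw [Cube.gridIndex_child, Cube.child_index_of_mem hq] at hk
  have : v < u := by
    apply Nat.lt_of_testBit k
    · cases hu : u.testBit k <;> cases hw : v.testBit k <;> simp [hu, hw] at hk ⊢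
    · cases hu : u.testBit k <;> cases hw : v.testBit k <;> simp [hu, hw] at hk ⊢
    · intro j hj
      rcases lt_or_ge j d with hjd | hjd
      · have := hk' ⟨j, hjd⟩ hj
        rw [Cube.gridIndex_child, Cube.child_index_of_mem hq] at this
        simp only at this
        by_contra hne
        cases hu : u.testBit j <;> cases hw : v.testBit j <;> simp [hu, hw] at this hne
      · have hpow := Nat.pow_le_pow_right (n := 2) (by norm_num) hjd
        rw [Nat.testBit_eq_false_of_lt (by omega), Nat.testBit_eq_false_of_lt (by omega)]
  omega

/-! ### The traversal -/

/-- An entry of the search structure or of the stack. With `resume = false` it refers to the cube,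
otherwise to what follows the cube; `id` is the number of a cell. -/
structure Rec (d : ℕ) where
  resume : Bool
  id : ℕ
  cube : Cube d

def Rec.shift (m : ℕ) (e : Rec d) : Rec d := { e with id := m + e.id }

/-- The point `q` is at or after the entry `e`. -/
def Rec.Passes (e : Rec d) (q : EuclideanSpace ℝ (Fin d)) : Prop :=
  (e.resume = false ∧ q ∈ e.cube.region) ∨ e.cube.After q

structure Conf (d n : ℕ) where
  stack : List (Rec d)
  cells : List (Cell d × Fin n)
  events : List (Rec d)

def childList (Q : Cube d) (a m : ℕ) : List (Rec d) :=
  (List.range' a m).map fun v => ⟨false, 0, Q.child v⟩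

/-- In a jump the removed cube is put on top of an entry with `resume = true`, which carries the
number of the surrounding cell. When that entry is reached later, it marks the points of `Q` that
come after `P`. -/
def treat {n : ℕ} (Q : Cube d) (st : List (Rec d)) (c : List (Cell d × Fin n)) (e : List (Rec d)) :
    Outcome d n → Conf d n
  | .leaf b => ⟨st, c ++ [(⟨some Q, none⟩, b)], e ++ [⟨false, c.length, Q⟩]⟩
  | .jump b P => ⟨⟨false, 0, P⟩ :: ⟨true, c.length, P⟩ :: st, c ++ [(⟨some Q, some P⟩, b)],
      e ++ [⟨false, c.length, Q⟩]⟩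
  | .split => ⟨childList Q 0 (2 ^ d) ++ st, c, e⟩

/-- One step of the traversal. -/
def Conf.next {n : ℕ} (out : Cube d → Outcome d n) : Conf d n → Conf d n
  | ⟨[], c, e⟩ => ⟨[], c, e⟩
  | ⟨r :: st, c, e⟩ => if r.resume then ⟨st, c, e ++ [r]⟩ else treat r.cube st c e (out r.cube)

namespace Net

variable {n : ℕ} {I : Net d n}

/-- The cells `cs` subdivide `S` and the entries `es` locate the points of `S`. All entries come
after the points with `bef` and before those with `aft`. -/
structure Seg (I : Net d n) (S : Set (EuclideanSpace ℝ (Fin d)))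
    (bef aft : EuclideanSpace ℝ (Fin d) → Prop) (cs : List (Cell d × Fin n))
    (es : List (Rec d)) : Prop where
  sub : ∀ c ∈ cs, c.1.region ⊆ S
  nonempty : ∀ c ∈ cs, c.1.region.Nonempty
  good : ∀ c ∈ cs, ∀ p ∈ c.1.region, ∀ j, I.wd c.2 p ≤ (1 + I.eps) * I.wd j p
  disj : cs.Pairwise fun c c' => Disjoint c.1.region c'.1.region
  before : ∀ q, bef q → ∀ e ∈ es, ¬ e.Passes q
  after : ∀ q, aft q → ∀ e ∈ es, e.Passes q
  find : ∀ q ∈ S, ∃ l₁ e l₂ c, es = l₁ ++ e :: l₂ ∧ (∀ x ∈ l₁, x.Passes q) ∧ e.Passes q ∧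
    (∀ x ∈ l₂, ¬ x.Passes q) ∧ cs[e.id]? = some c ∧ q ∈ c.1.region

theorem passes_shift {m : ℕ} {e : Rec d} {q : EuclideanSpace ℝ (Fin d)} :
    (e.shift m).Passes q ↔ e.Passes q := Iff.rfl

/-- Two subdivisions can be joined when the points of the first precede all entries of the second
and the points of the second follow all entries of the first; cell numbers of the second are
shifted. -/
theorem Seg.append {S₁ S₂ : Set (EuclideanSpace ℝ (Fin d))}
    {b₁ b₂ b a₁ a₂ a : EuclideanSpace ℝ (Fin d) → Prop} {c₁ c₂ : List (Cell d × Fin n)}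
    {e₁ e₂ : List (Rec d)} (h₁ : I.Seg S₁ b₁ a₁ c₁ e₁) (h₂ : I.Seg S₂ b₂ a₂ c₂ e₂)
    (hd : Disjoint S₁ S₂) (h12 : ∀ q ∈ S₁, b₂ q) (h21 : ∀ q ∈ S₂, a₁ q)
    (hb : ∀ q, b q → b₁ q ∧ b₂ q) (ha : ∀ q, a q → a₁ q ∧ a₂ q) :
    I.Seg (S₁ ∪ S₂) b a (c₁ ++ c₂) (e₁ ++ e₂.map (Rec.shift c₁.length)) where
  sub c hc := by
    rcases List.mem_append.1 hc with h | h
    · exact (h₁.sub c h).trans Set.subset_union_left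
    · exact (h₂.sub c h).trans Set.subset_union_right
  nonempty c hc := by
    rcases List.mem_append.1 hc with h | h
    · exact h₁.nonempty c h
    · exact h₂.nonempty c h
  good c hc := by
    rcases List.mem_append.1 hc with h | h
    · exact h₁.good c h
    · exact h₂.good c h
  disj := by
    rw [List.pairwise_append]
    exact ⟨h₁.disj, h₂.disj, fun c hc c' hc' => hd.mono (h₁.sub c hc) (h₂.sub c' hc')⟩
  before q hq e he := by
    rcases List.mem_append.1 he with h | h
    · exact h₁.before q (hb q hq).1 e h
    · obtain ⟨e', he', rfl⟩ := List.mem_map.1 h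
      exact fun h' => h₂.before q (hb q hq).2 e' he' h'
  after q hq e he := by
    rcases List.mem_append.1 he with h | h
    · exact h₁.after q (ha q hq).1 e h
    · obtain ⟨e', he', rfl⟩ := List.mem_map.1 h
      exact h₂.after q (ha q hq).2 e' he'
  find q hq := by
    rcases hq with h | h
    · obtain ⟨l₁, e, l₂, c, rfl, hl, he, hl', hc, hqc⟩ := h₁.find q h
      refine ⟨l₁, e, l₂ ++ e₂.map (Rec.shift c₁.length), c, by simp, hl, he, ?_, ?_, hqc⟩
      · intro x hx
        rcases List.mem_append.1 hx with hx | hx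
        · exact hl' x hx
        · obtain ⟨e', he', rfl⟩ := List.mem_map.1 hx
          exact fun h' => h₂.before q (h12 q h) e' he' h'
      · rw [List.getElem?_append_left]
        · exact hc
        · by_contra hle
          rw [List.getElem?_eq_none (by omega)] at hc
          simp at hc
    · obtain ⟨l₁, e, l₂, c, rfl, hl, he, hl', hc, hqc⟩ := h₂.find q h
      refine ⟨e₁ ++ l₁.map (Rec.shift c₁.length), e.shift c₁.length,
        l₂.map (Rec.shift c₁.length), c, by simp, ?_, he, ?_, ?_, hqc⟩
      · intro x hx
        rcases List.mem_append.1 hx with hx | hx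
        · exact h₁.after q (h21 q h) x hx
        · obtain ⟨e', he', rfl⟩ := List.mem_map.1 hx
          exact hl e' he'
      · intro x hx
        obtain ⟨e', he', rfl⟩ := List.mem_map.1 hx
        exact fun h' => hl' e' he' h'
      · rw [List.getElem?_append_right (by simp [Rec.shift])]
        simpa [Rec.shift] using hc

/-- The subdivision of the cube `Q`. -/
abbrev SegCube (I : Net d n) (Q : Cube d) (cs : List (Cell d × Fin n)) (es : List (Rec d)) : Prop :=
  I.Seg Q.region (fun q => q ∉ Q.region ∧ ¬ Q.After q) Q.After cs es

theorem segCube_leaf {Q : Cube d} {b : Fin n}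
    (h : ∀ p ∈ Q.region, ∀ j, I.wd b p ≤ (1 + I.eps) * I.wd j p) :
    I.SegCube Q [(⟨some Q, none⟩, b)] [⟨false, 0, Q⟩] := by
  have hr : (⟨some Q, none⟩ : Cell d).region = Q.region := by simp [Cell.region]
  constructor
  · simp [hr]
  · simpa [hr] using ⟨_, Q.corner_mem⟩
  · simpa [hr] using h
  · simp
  · rintro q ⟨h1, h2⟩ e he
    simp only [List.mem_singleton] at he
    subst he
    rintro (⟨-, h⟩ | h)
    · exact h1 h
    · exact h2 h
  · intro q hq e he
    simp only [List.mem_singleton] at he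
    subst he
    exact Or.inr hq
  · intro q hq
    exact ⟨[], ⟨false, 0, Q⟩, [], _, rfl, by simp, Or.inl ⟨rfl, hq⟩, by simp, rfl, by rwa [hr]⟩

/-- A smaller cube lies in a single child, and for `d ≥ 1` there is another one. -/
theorem _root_.AMWVD.Cube.diff_nonempty (hd : 1 ≤ d) {P Q : Cube d} (h : P.Sub Q) (hne : P ≠ Q) :
    (Q.region \ P.region).Nonempty := by
  obtain ⟨v, hv, hPv⟩ := h.exists_child hne
  obtain ⟨u, hu, huv⟩ : ∃ u < 2 ^ d, u ≠ v := by
    have : 1 < 2 ^ d := Nat.one_lt_two_pow (by omega)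
    by_cases h0 : v = 0
    · exact ⟨1, this, by omega⟩
    · exact ⟨0, by omega, fun h => h0 h.symm⟩
  refine ⟨(Q.child u).corner, (Q.child_sub u).2, fun hm => huv ?_⟩
  exact Cube.child_disjoint hu hv (Cube.Sub.refl _)
    ⟨le_rfl, hPv.subset hm⟩

/-- The ring `Q \ P` is interrupted by `P` in the traversal order. Its points before `P` are found
by the opening entry of `Q`, those after `P` by the resuming entry, and both entries name cell `0`.
-/
theorem segCube_jump {Q P : Cube d} {b : Fin n} (hP : P.Sub Q) (hne : P ≠ Q)
    (hbad : I.badSet Q b ⊆ P.region) {cs : List (Cell d × Fin n)} {es : List (Rec d)}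
    (h : I.SegCube P cs es) :
    I.SegCube Q ((⟨some Q, some P⟩, b) :: cs)
      (⟨false, 0, Q⟩ :: (es.map (Rec.shift 1) ++ [⟨true, 0, P⟩])) := by
  have hr : (⟨some Q, some P⟩ : Cell d).region = Q.region \ P.region := by simp [Cell.region]
  constructor
  · intro c hc
    rcases List.mem_cons.1 hc with rfl | hc
    · rw [hr]; exact Set.sdiff_subset
    · exact (h.sub c hc).trans hP.subset
  · intro c hc
    rcases List.mem_cons.1 hc with rfl | hc
    · rw [hr]; exact Cube.diff_nonempty I.hd hP hne
    · exact h.nonempty c hc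
  · intro c hc
    rcases List.mem_cons.1 hc with rfl | hc
    · rw [hr]
      intro p hp j
      by_contra hlt
      push Not at hlt
      exact hp.2 (hbad ⟨hp.1, j, hlt⟩)
    · exact h.good c hc
  · rw [List.pairwise_cons]
    refine ⟨fun c hc => ?_, h.disj⟩
    rw [hr]
    exact disjoint_sdiff_self_left.mono_right (h.sub c hc)
  · rintro q ⟨h1, h2⟩ e he
    have hPa : ¬ P.After q := by rwa [hP.after_iff h1]
    simp only [List.mem_cons, List.mem_append, List.mem_map, List.not_mem_nil, or_false] at he
    rcases he with rfl | ⟨e, he, rfl⟩ | rfl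
    · rintro (⟨-, h⟩ | h)
      · exact h1 h
      · exact h2 h
    · exact fun h' => h.before q ⟨fun h => h1 (hP.subset h), hPa⟩ e he h'
    · rintro (⟨h, -⟩ | h)
      · simp at h
      · exact hPa h
  · intro q hq e he
    have hPa : P.After q := by rwa [hP.after_iff hq.not_mem]
    simp only [List.mem_cons, List.mem_append, List.mem_map, List.not_mem_nil, or_false] at he
    rcases he with rfl | ⟨e, he, rfl⟩ | rfl
    · exact Or.inr hq
    · exact h.after q hPa e he
    · exact Or.inr hPa
  · intro q hq
    by_cases hqP : q ∈ P.region
    · obtain ⟨l₁, e, l₂, c, rfl, hl, he, hl', hc, hqc⟩ := h.find q hqP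
      refine ⟨⟨false, 0, Q⟩ :: l₁.map (Rec.shift 1), e.shift 1,
        l₂.map (Rec.shift 1) ++ [⟨true, 0, P⟩], c, by simp, ?_, he, ?_, ?_, hqc⟩
      · intro x hx
        rcases List.mem_cons.1 hx with rfl | hx
        · exact Or.inl ⟨rfl, hq⟩
        · obtain ⟨y, hy, rfl⟩ := List.mem_map.1 hx
          exact hl y hy
      · intro x hx
        rcases List.mem_append.1 hx with hx | hx
        · obtain ⟨y, hy, rfl⟩ := List.mem_map.1 hx
          exact fun h' => hl' y hy h'
        · rw [List.mem_singleton] at hx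
          subst hx
          rintro (⟨h, -⟩ | h)
          · simp at h
          · exact h.not_mem hqP
      · simpa [Rec.shift, add_comm 1] using hc
    · by_cases haf : P.After q
      · refine ⟨⟨false, 0, Q⟩ :: es.map (Rec.shift 1), ⟨true, 0, P⟩, [], _, by simp, ?_,
          Or.inr haf, by simp, rfl, by rw [hr]; exact ⟨hq, hqP⟩⟩
        intro x hx
        rcases List.mem_cons.1 hx with rfl | hx
        · exact Or.inl ⟨rfl, hq⟩
        · obtain ⟨y, hy, rfl⟩ := List.mem_map.1 hx
          exact h.after q haf y hy
      · refine ⟨[], ⟨false, 0, Q⟩, _, _, rfl, by simp, Or.inl ⟨rfl, hq⟩, ?_, rfl,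
          by rw [hr]; exact ⟨hq, hqP⟩⟩
        intro x hx
        rcases List.mem_append.1 hx with hx | hx
        · obtain ⟨y, hy, rfl⟩ := List.mem_map.1 hx
          exact fun h' => h.before q ⟨hqP, haf⟩ y hy h'
        · rw [List.mem_singleton] at hx
          subst hx
          rintro (⟨h, -⟩ | h)
          · simp at h
          · exact haf h

/-- Joining the subdivisions of the children `a, …, a + m - 1`. -/
theorem exists_seg_children {Q : Cube d} {out : Cube d → Outcome d n} {N : ℕ → ℕ} (m : ℕ) :
    ∀ a, a + m = 2 ^ d → (∀ v < 2 ^ d, ∃ cs es, I.SegCube (Q.child v) cs es ∧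
      N v + 1 ≤ 3 * cs.length ∧ cs.length ≤ N v ∧ es.length ≤ N v ∧
      ∀ st c e, (Conf.next out)^[N v] ⟨⟨false, 0, Q.child v⟩ :: st, c, e⟩
        = ⟨st, c ++ cs, e ++ es.map (Rec.shift c.length)⟩) →
    ∃ cs es, I.Seg {q | ∃ v < 2 ^ d, a ≤ v ∧ q ∈ (Q.child v).region}
      (fun q => (q ∉ Q.region ∧ ¬ Q.After q) ∨ ∃ v < a, q ∈ (Q.child v).region) Q.After cs es ∧
      (∑ v ∈ Finset.range m, N (a + v)) + m ≤ 3 * cs.length ∧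
      cs.length ≤ ∑ v ∈ Finset.range m, N (a + v) ∧ es.length ≤ ∑ v ∈ Finset.range m, N (a + v) ∧
      ∀ st c e, (Conf.next out)^[∑ v ∈ Finset.range m, N (a + v)] ⟨childList Q a m ++ st, c, e⟩
        = ⟨st, c ++ cs, e ++ es.map (Rec.shift c.length)⟩ := by
  induction m with
  | zero =>
    intro a ha _
    refine ⟨[], [], ?_, by simp, by simp, by simp, by simp [childList]⟩
    have : {q | ∃ v < 2 ^ d, a ≤ v ∧ q ∈ (Q.child v).region} = ∅ := by
      ext q; simp; intro v h1 h2; omega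
    rw [this]
    constructor <;> simp
  | succ m ih =>
    intro a ha hN
    obtain ⟨cs₂, es₂, hs₂, hl₂, hc₂, he₂, hr₂⟩ := ih (a + 1) (by omega) hN
    obtain ⟨cs₁, es₁, hs₁, hl₁, hc₁, he₁, hr₁⟩ := hN a (by omega)
    have hsum : ∑ v ∈ Finset.range (m + 1), N (a + v)
        = N a + ∑ v ∈ Finset.range m, N (a + 1 + v) := by
      rw [Finset.sum_range_succ', add_comm]
      simp only [add_zero]
      congr 1
      apply Finset.sum_congr rfl
      intro v _
      congr 1
      ring
    have hS : {q | ∃ v < 2 ^ d, a ≤ v ∧ q ∈ (Q.child v).region} = (Q.child a).region ∪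
        {q | ∃ v < 2 ^ d, a + 1 ≤ v ∧ q ∈ (Q.child v).region} := by
      ext q
      constructor
      · rintro ⟨v, hv, hav, hq⟩
        rcases hav.eq_or_lt with rfl | h
        · exact Or.inl hq
        · exact Or.inr ⟨v, hv, h, hq⟩
      · rintro (h | ⟨v, hv, hav, hq⟩)
        · exact ⟨a, by omega, le_rfl, h⟩
        · exact ⟨v, hv, by omega, hq⟩
    refine ⟨cs₁ ++ cs₂, es₁ ++ es₂.map (Rec.shift cs₁.length), ?_, ?_, ?_, ?_, ?_⟩
    · rw [hS]
      refine hs₁.append hs₂ ?_ ?_ ?_ ?_ ?_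
      · rw [Set.disjoint_left]
        rintro q h ⟨v, hv, hav, hq⟩
        exact (Cube.after_child (by omega) hv hq).not_mem h
      · intro q hq
        exact Or.inr ⟨a, by omega, hq⟩
      · rintro q ⟨v, hv, hav, hq⟩
        exact Cube.after_child (by omega) hv hq
      · rintro q (⟨h1, h2⟩ | ⟨v, hv, hq⟩)
        · refine ⟨⟨fun h => h1 ((Q.child_sub a).subset h), ?_⟩, Or.inl ⟨h1, h2⟩⟩
          rwa [(Q.child_sub a).after_iff h1]
        · refine ⟨⟨fun h => ?_, Cube.not_after_child hv (by omega) hq⟩,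
            Or.inr ⟨v, by omega, hq⟩⟩
          exact (Cube.after_child hv (by omega) h).not_mem hq
      · intro q hq
        exact ⟨((Q.child_sub a).after_iff hq.not_mem).2 hq, hq⟩
    · rw [hsum, List.length_append]; omega
    · rw [hsum, List.length_append]; omega
    · rw [hsum, List.length_append, List.length_map]; omega
    · intro st c e
      have hcl : childList Q a (m + 1) = ⟨false, 0, Q.child a⟩ :: childList Q (a + 1) m := by
        simp [childList, List.range'_succ]
      rw [hsum, add_comm, Function.iterate_add_apply, hcl, List.cons_append, hr₁, hr₂]
      simp only [List.append_assoc, List.map_append, List.map_map, List.length_append]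
      congr 4
      funext x
      simp [Rec.shift, add_assoc]

/-- Besides the subdivision, this compares steps with cells: a leaf takes one step and a jump two,
each for one new cell, and a split takes one step that the slack of its at least two children
covers. Hence the running time can be measured by the size of the diagram. -/
theorem Explored.exists_seg {out : Cube d → Outcome d n} (hout : ∀ Q, I.OutcomeSpec Q (out Q))
    {Q : Cube d} {N : ℕ} (h : Explored out Q N) :
    ∃ cs es, I.SegCube Q cs es ∧ N + 1 ≤ 3 * cs.length ∧ cs.length ≤ N ∧ es.length ≤ N ∧
      ∀ st c e, (Conf.next out)^[N] ⟨⟨false, 0, Q⟩ :: st, c, e⟩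
        = ⟨st, c ++ cs, e ++ es.map (Rec.shift c.length)⟩ := by
  induction h with
  | @leaf Q b ho =>
    have hspec := hout Q
    rw [ho] at hspec
    refine ⟨_, _, segCube_leaf hspec, by simp, by simp, by simp, fun st c e => ?_⟩
    simp [Conf.next, ho, treat, Rec.shift]
  | @jump Q P b N ho _ ih =>
    have hspec := hout Q
    rw [ho] at hspec
    obtain ⟨-, hPQ, hne, -, hsub, -⟩ := hspec
    obtain ⟨cs, es, hs, hl, hc, he, hr⟩ := ih
    refine ⟨_, _, segCube_jump hPQ hne hsub hs, by simp; omega, by simp; omega, by simp; omega,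
      fun st c e => ?_⟩
    rw [add_comm N 2, show 2 + N = 1 + N + 1 by ring, Function.iterate_succ_apply,
      Function.iterate_add_apply]
    have h1 : Conf.next out ⟨⟨false, 0, Q⟩ :: st, c, e⟩ = treat Q st c e (out Q) := rfl
    rw [h1, ho]
    simp only [treat]
    rw [hr]
    simp only [Function.iterate_one, Conf.next, if_true]
    simp only [List.append_assoc, List.length_append, List.length_singleton,
      List.map_cons, List.map_append, List.map_map, List.map_nil, List.cons_append]
    simp [Rec.shift, add_assoc, Function.comp_def]
  | @split Q N ho _ ih =>
    obtain ⟨cs, es, hs, hl, hc, he, hr⟩ := exists_seg_children (2 ^ d) 0 (by simp) ih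
    simp only [zero_add] at hl hc he hr
    have h2 : 2 ≤ 2 ^ d := by
      calc 2 = 2 ^ 1 := rfl
        _ ≤ 2 ^ d := Nat.pow_le_pow_right (by norm_num) I.hd
    refine ⟨cs, es, ?_, by omega, by omega, by omega, fun st c e => ?_⟩
    · have hS : {q | ∃ v < 2 ^ d, 0 ≤ v ∧ q ∈ (Q.child v).region} = Q.region := by
        ext q
        constructor
        · rintro ⟨v, -, -, hq⟩; exact (Q.child_sub v).subset hq
        · intro hq
          obtain ⟨v, hv, h⟩ := Cube.exists_child hq
          exact ⟨v, hv, Nat.zero_le v, h⟩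
      rw [hS] at hs
      exact ⟨hs.sub, hs.nonempty, hs.good, hs.disj, fun q hq => hs.before q (Or.inl hq), hs.after,
        hs.find⟩
    · rw [add_comm, Function.iterate_succ_apply]
      have h1 : Conf.next out ⟨⟨false, 0, Q⟩ :: st, c, e⟩ = treat Q st c e (out Q) := rfl
      rw [h1, ho]
      exact hr st c e

end Net

/-! ### The computation at a cube -/

namespace Net

variable {d n : ℕ} {I : Net d n}

/-- Square of the factor between the distances from `b` and from `j` on the boundary of the region
where `j` is too good for the label `b`. -/
def nu (I : Net d n) (b j : Fin n) : ℝ := ((1 + I.eps) * I.w b / I.w j) ^ 2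

def top (Q : Cube d) (k : Fin d) : ℝ := Q.corner k + Q.side

/-- The defect of `b` against `j` along one axis. -/
def defect (I : Net d n) (b j : Fin n) (k : Fin d) (x : ℝ) : ℝ :=
  (x - I.s b k) ^ 2 - I.nu b j * (x - I.s j k) ^ 2

/-- The total defect is a sum over the axes, so its maximum over all `2 ^ d` vertices is found axis
by axis. -/
def vertexMax (I : Net d n) (Q : Cube d) (b j : Fin n) : ℝ :=
  ∑ k, max (I.defect b j k (Q.corner k)) (I.defect b j k (top Q k))

/-- For `nu > 1` the points that are bad against `j` form an Apollonius ball; this and `ballSq` are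
its centre and squared radius. -/
def ballCenter (I : Net d n) (b j : Fin n) (k : Fin d) : ℝ :=
  I.s j k + (I.s j k - I.s b k) / (I.nu b j - 1)

def ballSq (I : Net d n) (b j : Fin n) : ℝ :=
  I.nu b j * (∑ k, (I.s b k - I.s j k) ^ 2) / (I.nu b j - 1) ^ 2

/-- Distance of the centre from the cube along one axis; the squares add up to the squared distance
from the closed cube. -/
def gap (I : Net d n) (Q : Cube d) (b j : Fin n) (k : Fin d) : ℝ :=
  max 0 (max (Q.corner k - I.ballCenter b j k) (I.ballCenter b j k - top Q k))

def gapSq (I : Net d n) (Q : Cube d) (b j : Fin n) : ℝ := ∑ k, I.gap Q b j k ^ 2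

/-- Half the length of what the ball leaves along the axis `k` when all other coordinates are as
close to the centre as the cube allows. -/
def reach (I : Net d n) (Q : Cube d) (b j : Fin n) (k : Fin d) : ℝ :=
  √(I.ballSq b j - I.gapSq Q b j + I.gap Q b j k ^ 2)

def boxLo (I : Net d n) (Q : Cube d) (b j : Fin n) (k : Fin d) : ℝ :=
  max (Q.corner k) (I.ballCenter b j k - I.reach Q b j k)

def boxHi (I : Net d n) (Q : Cube d) (b j : Fin n) (k : Fin d) : ℝ :=
  min (top Q k) (I.ballCenter b j k + I.reach Q b j k)

/-- The points of `Q` where `j` is too good for the label `b`. -/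
def badOf (I : Net d n) (Q : Cube d) (b j : Fin n) : Set (EuclideanSpace ℝ (Fin d)) :=
  {p | p ∈ Q.region ∧ (1 + I.eps) * I.wd j p < I.wd b p}

theorem bad_iff {b j : Fin n} {p : EuclideanSpace ℝ (Fin d)} :
    (1 + I.eps) * I.wd j p < I.wd b p ↔ 0 < ∑ k, I.defect b j k (p k) := by
  have hb := I.wpos b
  have hj := I.wpos j
  have he := I.eps_pos
  have h1 : ∑ k, I.defect b j k (p k) = ‖p - I.s b‖ ^ 2 - I.nu b j * ‖p - I.s j‖ ^ 2 := by
    simp only [defect, Finset.sum_sub_distrib, ← Finset.mul_sum, EuclideanSpace.norm_sq_eq,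
      PiLp.sub_apply, Real.norm_eq_abs, sq_abs]
  rw [h1, sub_pos]
  unfold nu wd
  rw [← mul_pow, pow_lt_pow_iff_left₀ (by positivity) (by positivity) two_ne_zero,
    ← mul_div_assoc, div_lt_div_iff₀ hj hb, div_mul_eq_mul_div, div_lt_iff₀ hj]
  constructor <;> intro h <;> linarith

theorem mem_region_iff_top {Q : Cube d} {p : EuclideanSpace ℝ (Fin d)} :
    p ∈ Q.region ↔ ∀ k, Q.corner k ≤ p k ∧ p k < top Q k := Iff.rfl

/-- For `nu ≤ 1` the defect along each axis is convex, so on an interval it is bounded by its values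
at the ends. -/
theorem badOf_eq_empty_of_vertexMax {Q : Cube d} {b j : Fin n} (hnu : I.nu b j ≤ 1)
    (h : I.vertexMax Q b j ≤ 0) : I.badOf Q b j = ∅ := by
  rw [Set.eq_empty_iff_forall_notMem]
  rintro p ⟨hp, hbad⟩
  rw [bad_iff] at hbad
  refine absurd hbad (not_lt.2 (le_trans (Finset.sum_le_sum fun k _ => ?_) h))
  obtain ⟨h1, h2⟩ := mem_region_iff_top.1 hp k
  have hd0 : 0 < top Q k - Q.corner k := by linarith
  have hmul := mul_nonneg (mul_nonneg (sub_nonneg.2 h1) (sub_nonneg.2 h2.le)) (sub_nonneg.2 hnu)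
  have hconv : (top Q k - Q.corner k) * I.defect b j k (p k)
      ≤ (top Q k - p k) * I.defect b j k (Q.corner k)
        + (p k - Q.corner k) * I.defect b j k (top Q k) := by
    unfold defect
    nlinarith
  have m1 := mul_le_mul_of_nonneg_left
    (le_max_left (I.defect b j k (Q.corner k)) (I.defect b j k (top Q k))) (sub_nonneg.2 h2.le)
  have m2 := mul_le_mul_of_nonneg_left
    (le_max_right (I.defect b j k (Q.corner k)) (I.defect b j k (top Q k))) (sub_nonneg.2 h1)
  refine le_of_mul_le_mul_left ?_ hd0
  linarith

/-- The best vertex is a bad point of the closed cube, but perhaps not of the half-open one. This is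
why the certificate in `Stuck` only asks for a point within `d * side` of the corner. -/
theorem exists_bad_of_vertexMax {Q : Cube d} {b j : Fin n} (h : 0 < I.vertexMax Q b j) :
    ∃ p : EuclideanSpace ℝ (Fin d), ‖p - Q.corner‖ ≤ d * Q.side ∧
      (1 + I.eps) * I.wd j p < I.wd b p := by
  classical
  refine ⟨WithLp.toLp 2 fun k => if I.defect b j k (Q.corner k) ≤ I.defect b j k (top Q k)
    then top Q k else Q.corner k, ?_, ?_⟩
  · apply Cube.norm_sub_corner_le I.hd
    intro k
    have := Q.side_pos
    simp only
    split_ifs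
    · unfold top; rw [add_sub_cancel_left, abs_of_pos this]
    · simp; exact this.le
  · rw [bad_iff]
    refine lt_of_lt_of_le h (Finset.sum_le_sum fun k _ => ?_)
    simp only
    split_ifs with h
    · rw [max_eq_right h]
    · rw [max_eq_left (by linarith)]

theorem heavy_of_nu_le {b j : Fin n} (h : I.nu b j ≤ 1) : (1 + I.eps) * I.w b ≤ I.w j := by
  have hb := I.wpos b
  have hj := I.wpos j
  have he := I.eps_pos
  unfold nu at h
  rw [sq_le_one_iff₀ (by positivity), div_le_one hj] at h
  exact h

/-- Completing the square axis by axis turns the total defect into `nu - 1` times the difference of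
the squared radius and the squared distance from the centre. -/
theorem bad_iff_ball {b j : Fin n} (hnu : 1 < I.nu b j) {p : EuclideanSpace ℝ (Fin d)} :
    (1 + I.eps) * I.wd j p < I.wd b p ↔
      ∑ k, (p k - I.ballCenter b j k) ^ 2 < I.ballSq b j := by
  have h0 : 0 < I.nu b j - 1 := by linarith
  have key : ∑ k, I.defect b j k (p k)
      = (I.nu b j - 1) * (I.ballSq b j - ∑ k, (p k - I.ballCenter b j k) ^ 2) := by
    unfold ballSq
    rw [Finset.mul_sum, Finset.sum_div, ← Finset.sum_sub_distrib, Finset.mul_sum]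
    apply Finset.sum_congr rfl
    intro k _
    unfold defect ballCenter
    field_simp
    ring
  rw [bad_iff, key, mul_pos_iff_of_pos_left h0, sub_pos]

theorem gap_nonneg {Q : Cube d} {b j : Fin n} {k : Fin d} : 0 ≤ I.gap Q b j k := le_max_left _ _

theorem gap_sq_le {Q : Cube d} {b j : Fin n} {k : Fin d} {x : ℝ} (h1 : Q.corner k ≤ x)
    (h2 : x < top Q k) : I.gap Q b j k ^ 2 ≤ (x - I.ballCenter b j k) ^ 2 := by
  rw [← sq_abs (x - I.ballCenter b j k)]
  apply pow_le_pow_left₀ gap_nonneg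
  unfold gap
  refine max_le (abs_nonneg _) (max_le ?_ ?_)
  · exact le_trans (by linarith) (le_abs_self _)
  · exact le_trans (by linarith) (neg_le_abs _)

/-- On a half-open interval the closest point to the centre need not be attained, only approached.
-/
theorem exists_near_gap (Q : Cube d) (b j : Fin n) (k : Fin d) {η : ℝ} (hη : 0 < η) :
    ∃ x, Q.corner k ≤ x ∧ x < top Q k ∧
      (x - I.ballCenter b j k) ^ 2 < I.gap Q b j k ^ 2 + η := by
  have hs := Q.side_pos
  set z := I.ballCenter b j k with hz
  have ht : top Q k = Q.corner k + Q.side := rfl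
  rcases le_total z (Q.corner k) with h | h
  · refine ⟨Q.corner k, le_rfl, by linarith, ?_⟩
    have : I.gap Q b j k = Q.corner k - z := by
      unfold gap
      rw [← hz, max_eq_left (by linarith : z - top Q k ≤ Q.corner k - z), max_eq_right (by linarith)]
    rw [this]; linarith
  · rcases lt_or_ge z (top Q k) with h' | h'
    · exact ⟨z, h, h', by simp; positivity⟩
    · have hg : I.gap Q b j k = z - top Q k := by
        unfold gap
        rw [← hz, max_eq_right (by linarith : Q.corner k - z ≤ z - top Q k),
          max_eq_right (by linarith)]
      have hcont : Continuous fun t : ℝ => (top Q k - t - z) ^ 2 := by fun_prop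
      have hev : ∀ᶠ t in nhds (0 : ℝ), (top Q k - t - z) ^ 2 < I.gap Q b j k ^ 2 + η := by
        apply hcont.continuousAt.eventually_lt continuousAt_const
        rw [hg]
        nlinarith
      rw [Metric.eventually_nhds_iff] at hev
      obtain ⟨δ, hδ, hδ'⟩ := hev
      refine ⟨top Q k - min (δ / 2) Q.side, ?_, ?_, hδ' ?_⟩
      · have := min_le_right (δ / 2) Q.side; linarith
      · have : 0 < min (δ / 2) Q.side := lt_min (by linarith) hs
        linarith
      · rw [Real.dist_eq, sub_zero, abs_of_pos (lt_min (by linarith) hs)]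
        exact (min_le_left _ _).trans_lt (by linarith)

/-- `lo` and `hi` bound the smallest box that contains the nonempty set `B`, a part of `Q`. -/
structure IsBox (Q : Cube d) (B : Set (EuclideanSpace ℝ (Fin d))) (lo hi : Fin d → ℝ) : Prop where
  corner_le : ∀ k, Q.corner k ≤ lo k
  le_top : ∀ k, hi k ≤ top Q k
  lo_lt_hi : ∀ k, lo k < hi k
  mem : ∀ p ∈ B, ∀ k, lo k ≤ p k ∧ p k < hi k
  lo_approx : ∀ k, ∀ η > 0, ∃ p ∈ B, p k < lo k + η
  hi_approx : ∀ k, ∀ η > 0, ∃ p ∈ B, hi k - η < p k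

theorem IsBox.union {Q : Cube d} {B B' : Set (EuclideanSpace ℝ (Fin d))} {lo hi lo' hi' : Fin d → ℝ}
    (h : IsBox Q B lo hi) (h' : IsBox Q B' lo' hi') :
    IsBox Q (B ∪ B') (fun k => min (lo k) (lo' k)) (fun k => max (hi k) (hi' k)) where
  corner_le k := le_min (h.corner_le k) (h'.corner_le k)
  le_top k := max_le (h.le_top k) (h'.le_top k)
  lo_lt_hi k := (min_le_left _ _).trans_lt ((h.lo_lt_hi k).trans_le (le_max_left _ _))
  mem p hp k := by
    rcases hp with hp | hp
    · exact ⟨(min_le_left _ _).trans (h.mem p hp k).1, (h.mem p hp k).2.trans_le (le_max_left _ _)⟩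
    · exact ⟨(min_le_right _ _).trans (h'.mem p hp k).1,
        (h'.mem p hp k).2.trans_le (le_max_right _ _)⟩
  lo_approx k η hη := by
    rcases min_choice (lo k) (lo' k) with e | e <;> simp only [e]
    · obtain ⟨p, hp, hpk⟩ := h.lo_approx k η hη; exact ⟨p, Or.inl hp, hpk⟩
    · obtain ⟨p, hp, hpk⟩ := h'.lo_approx k η hη; exact ⟨p, Or.inr hp, hpk⟩
  hi_approx k η hη := by
    rcases max_choice (hi k) (hi' k) with e | e <;> simp only [e]
    · obtain ⟨p, hp, hpk⟩ := h.hi_approx k η hη; exact ⟨p, Or.inl hp, hpk⟩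
    · obtain ⟨p, hp, hpk⟩ := h'.hi_approx k η hη; exact ⟨p, Or.inr hp, hpk⟩

theorem badOf_eq_empty_of_gapSq {Q : Cube d} {b j : Fin n} (hnu : 1 < I.nu b j)
    (h : I.ballSq b j ≤ I.gapSq Q b j) : I.badOf Q b j = ∅ := by
  rw [Set.eq_empty_iff_forall_notMem]
  rintro p ⟨hp, hbad⟩
  rw [bad_iff_ball hnu] at hbad
  refine absurd hbad (not_lt.2 (h.trans (Finset.sum_le_sum fun k _ => ?_)))
  exact gap_sq_le (hp k).1 (hp k).2

/-- The constraints separate: a value `x` inside the cube occurs as `k`-th coordinate of a bad point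
iff `(x - ballCenter) ^ 2` plus the squared gaps of the other axes is less than `ballSq`. Hence the
projection to the axis is an interval cut off at `ballCenter ± reach`. -/
theorem isBox_badOf {Q : Cube d} {b j : Fin n} (hnu : 1 < I.nu b j)
    (h : I.gapSq Q b j < I.ballSq b j) :
    IsBox Q (I.badOf Q b j) (I.boxLo Q b j) (I.boxHi Q b j) := by
  classical
  have hs := Q.side_pos
  have hρ : ∀ k, I.gap Q b j k < I.reach Q b j k := by
    intro k
    unfold reach
    rw [Real.lt_sqrt gap_nonneg]
    linarith
  have hρ2 : ∀ k, I.reach Q b j k ^ 2 = I.ballSq b j - I.gapSq Q b j + I.gap Q b j k ^ 2 := by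
    intro k
    unfold reach
    rw [Real.sq_sqrt]
    have := sq_nonneg (I.gap Q b j k)
    linarith
  have hlt : ∀ k, I.boxLo Q b j k < I.boxHi Q b j k := by
    intro k
    have h1 := hρ k
    have h0 := gap_nonneg (I := I) (Q := Q) (b := b) (j := j) (k := k)
    have h2 : Q.corner k - I.ballCenter b j k ≤ I.gap Q b j k :=
      (le_max_left _ _).trans (le_max_right _ _)
    have h3 : I.ballCenter b j k - top Q k ≤ I.gap Q b j k :=
      (le_max_right _ _).trans (le_max_right _ _)
    unfold boxLo boxHi
    rw [max_lt_iff, lt_min_iff, lt_min_iff]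
    refine ⟨⟨?_, ?_⟩, ?_, ?_⟩ <;> first | linarith | (unfold top; linarith)
  -- every value between the bounds is attained
  have hval : ∀ k x, I.boxLo Q b j k < x → x < I.boxHi Q b j k → ∃ p ∈ I.badOf Q b j, p k = x := by
    intro k x hx1 hx2
    unfold boxLo at hx1
    unfold boxHi at hx2
    rw [max_lt_iff] at hx1
    rw [lt_min_iff] at hx2
    have hx : (x - I.ballCenter b j k) ^ 2 < I.reach Q b j k ^ 2 := by
      apply sq_lt_sq'
      · linarith
      · linarith
    set δ := I.reach Q b j k ^ 2 - (x - I.ballCenter b j k) ^ 2 with hδ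
    have hδ0 : 0 < δ := by linarith
    have hd0 : (0 : ℝ) < d := by exact_mod_cast I.hd
    -- The slack `δ` is shared: each of the other `d - 1` axes spends at most `δ / d`, in total less
    -- than `δ`.
    choose y hy1 hy2 hy3 using fun l => exists_near_gap (I := I) Q b j l (div_pos hδ0 hd0)
    refine ⟨WithLp.toLp 2 fun l => if l = k then x else y l, ⟨?_, ?_⟩, by simp⟩
    · rw [mem_region_iff_top]
      intro l
      simp only
      split_ifs with hl
      · subst hl; exact ⟨hx1.1.le, hx2.1⟩
      · exact ⟨hy1 l, hy2 l⟩
    · rw [bad_iff_ball hnu]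
      have hsum : ∑ l, ((if l = k then x else y l) - I.ballCenter b j l) ^ 2
          = (x - I.ballCenter b j k) ^ 2 +
            ∑ l ∈ Finset.univ.erase k, (y l - I.ballCenter b j l) ^ 2 := by
        rw [← Finset.add_sum_erase _ _ (Finset.mem_univ k)]
        simp only [if_true]
        congr 1
        apply Finset.sum_congr rfl
        intro l hl
        rw [if_neg (Finset.ne_of_mem_erase hl)]
      have hgs : I.gapSq Q b j = I.gap Q b j k ^ 2 +
          ∑ l ∈ Finset.univ.erase k, I.gap Q b j l ^ 2 := by
        unfold gapSq
        rw [← Finset.add_sum_erase _ _ (Finset.mem_univ k)]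
      have hle : ∑ l ∈ Finset.univ.erase k, (y l - I.ballCenter b j l) ^ 2
          ≤ ∑ l ∈ Finset.univ.erase k, (I.gap Q b j l ^ 2 + δ / d) :=
        Finset.sum_le_sum fun l _ => (hy3 l).le
      rw [Finset.sum_add_distrib, Finset.sum_const, Finset.card_erase_of_mem (Finset.mem_univ k),
        Finset.card_univ, Fintype.card_fin, nsmul_eq_mul] at hle
      have hcard : ((d - 1 : ℕ) : ℝ) * (δ / d) < δ := by
        rw [← mul_div_assoc, div_lt_iff₀ hd0, mul_comm]
        apply mul_lt_mul_of_pos_left _ hδ0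
        have := I.hd
        exact_mod_cast (by omega : d - 1 < d)
      have := hρ2 k
      simp only [hsum]
      linarith
  refine ⟨fun k => le_max_left _ _, fun k => min_le_left _ _, hlt, ?_, ?_, ?_⟩
  · rintro p ⟨hp, hbad⟩ k
    rw [bad_iff_ball hnu] at hbad
    obtain ⟨h1, h2⟩ := mem_region_iff_top.1 hp k
    have hsq : (p k - I.ballCenter b j k) ^ 2 < I.reach Q b j k ^ 2 := by
      have hle : ∑ l ∈ Finset.univ.erase k, I.gap Q b j l ^ 2
          ≤ ∑ l ∈ Finset.univ.erase k, (p l - I.ballCenter b j l) ^ 2 :=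
        Finset.sum_le_sum fun l _ => gap_sq_le (hp l).1 (hp l).2
      have hgs : I.gapSq Q b j = I.gap Q b j k ^ 2 +
          ∑ l ∈ Finset.univ.erase k, I.gap Q b j l ^ 2 := by
        unfold gapSq
        rw [← Finset.add_sum_erase _ _ (Finset.mem_univ k)]
      rw [← Finset.add_sum_erase _ _ (Finset.mem_univ k)] at hbad
      rw [hρ2 k]
      linarith
    have := abs_lt_of_sq_lt_sq' hsq (Real.sqrt_nonneg _)
    unfold boxLo boxHi
    exact ⟨max_le h1 (by linarith), lt_min h2 (by linarith)⟩
  · intro k η hη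
    have h1 := hlt k
    obtain ⟨p, hp, hpk⟩ := hval k (I.boxLo Q b j k + min (η / 2) ((I.boxHi Q b j k - I.boxLo Q b j k) / 2))
      (by have : 0 < min (η / 2) ((I.boxHi Q b j k - I.boxLo Q b j k) / 2) :=
            lt_min (by linarith) (by linarith)
          linarith)
      (by have := min_le_right (η / 2) ((I.boxHi Q b j k - I.boxLo Q b j k) / 2)
          linarith)
    refine ⟨p, hp, ?_⟩
    have := min_le_left (η / 2) ((I.boxHi Q b j k - I.boxLo Q b j k) / 2)
    linarith
  · intro k η hη
    have h1 := hlt k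
    obtain ⟨p, hp, hpk⟩ := hval k (I.boxHi Q b j k - min (η / 2) ((I.boxHi Q b j k - I.boxLo Q b j k) / 2))
      (by have := min_le_right (η / 2) ((I.boxHi Q b j k - I.boxLo Q b j k) / 2)
          linarith)
      (by have : 0 < min (η / 2) ((I.boxHi Q b j k - I.boxLo Q b j k) / 2) :=
            lt_min (by linarith) (by linarith)
          linarith)
    refine ⟨p, hp, ?_⟩
    have := min_le_left (η / 2) ((I.boxHi Q b j k - I.boxLo Q b j k) / 2)
    linarith

/-- State of the scan over the sites: `0`/`1` flags for a bad site and for a heavy bad site, and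
the bounding box of the bad set. -/
structure Scan (d : ℕ) where
  bad : ℤ
  heavy : ℤ
  lo : Fin d → ℝ
  hi : Fin d → ℝ

/-- The inverted box is neutral: the minimum and maximum with any box inside `Q` give that box. -/
def Scan.start (Q : Cube d) : Scan d := ⟨0, 0, top Q, Q.corner⟩

open Classical in
def Scan.step (I : Net d n) (Q : Cube d) (b j : Fin n) (x : Scan d) : Scan d :=
  if I.nu b j ≤ 1 then (if 0 < I.vertexMax Q b j then { x with heavy := 1 } else x)
  else if I.gapSq Q b j < I.ballSq b j then
    ⟨1, x.heavy, fun k => min (x.lo k) (I.boxLo Q b j k), fun k => max (x.hi k) (I.boxHi Q b j k)⟩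
  else x

/-- The scan is correct for the sites with numbers less than `m`. -/
def Scan.Valid (I : Net d n) (Q : Cube d) (b : Fin n) (m : ℕ) (x : Scan d) : Prop :=
  (x.heavy = 1 ∧ ∃ j p, (1 + I.eps) * I.w b ≤ I.w j ∧ ‖p - Q.corner‖ ≤ d * Q.side ∧
    (1 + I.eps) * I.wd j p < I.wd b p) ∨
  (x.heavy = 0 ∧ ((x.bad = 0 ∧ (∀ j : Fin n, j < m → I.badOf Q b j = ∅) ∧ x.lo = top Q ∧
      x.hi = Q.corner) ∨
    (x.bad = 1 ∧ IsBox Q {p | ∃ j : Fin n, j < m ∧ p ∈ I.badOf Q b j} x.lo x.hi)))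

theorem scan_start (Q : Cube d) (b : Fin n) : (Scan.start Q).Valid I Q b 0 :=
  Or.inr ⟨rfl, Or.inl ⟨rfl, by simp, rfl, rfl⟩⟩

theorem Scan.Valid.step {Q : Cube d} {b j : Fin n} {x : Scan d} (h : x.Valid I Q b j) :
    (x.step I Q b j).Valid I Q b (j + 1) := by
  have hB : {p | ∃ i : Fin n, (i : ℕ) < j + 1 ∧ p ∈ I.badOf Q b i}
      = {p | ∃ i : Fin n, (i : ℕ) < j ∧ p ∈ I.badOf Q b i} ∪ I.badOf Q b j := by
    ext p
    constructor
    · rintro ⟨i, hi, hp⟩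
      rcases Nat.lt_succ_iff_lt_or_eq.1 hi with h | h
      · exact Or.inl ⟨i, h, hp⟩
      · rw [Fin.ext h] at hp; exact Or.inr hp
    · rintro (⟨i, hi, hp⟩ | hp)
      · exact ⟨i, by omega, hp⟩
      · exact ⟨j, by omega, hp⟩
  have hall : ∀ (_ : I.badOf Q b j = ∅), (∀ i : Fin n, (i : ℕ) < j → I.badOf Q b i = ∅) →
      ∀ i : Fin n, (i : ℕ) < j + 1 → I.badOf Q b i = ∅ := by
    intro hj h i hi
    rcases Nat.lt_succ_iff_lt_or_eq.1 hi with h' | h'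
    · exact h i h'
    · rw [Fin.ext h']; exact hj
  unfold Scan.step
  split_ifs with h1 h2 h2
  · obtain ⟨p, hp, hbad⟩ := exists_bad_of_vertexMax h2
    exact Or.inl ⟨rfl, j, p, heavy_of_nu_le h1, hp, hbad⟩
  · have he := badOf_eq_empty_of_vertexMax h1 (not_lt.1 h2)
    rcases h with h | ⟨h0, ⟨h3, h4, h5⟩ | ⟨h3, h4⟩⟩
    · exact Or.inl h
    · exact Or.inr ⟨h0, Or.inl ⟨h3, hall he h4, h5⟩⟩
    · refine Or.inr ⟨h0, Or.inr ⟨h3, ?_⟩⟩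
      rw [hB, he, Set.union_empty]; exact h4
  · have hbox := isBox_badOf (not_le.1 h1) h2
    rcases h with h | ⟨h0, ⟨h3, h4, h5, h6⟩ | ⟨h3, h4⟩⟩
    · exact Or.inl h
    · refine Or.inr ⟨h0, Or.inr ⟨rfl, ?_⟩⟩
      rw [hB, show {p | ∃ i : Fin n, (i : ℕ) < j ∧ p ∈ I.badOf Q b i} = ∅ by
        ext p; simp; intro i hi; rw [h4 i hi]; simp, Set.empty_union]
      have e1 : (fun k => min (x.lo k) (I.boxLo Q b j k)) = I.boxLo Q b j := by
        funext k
        rw [h5]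
        exact min_eq_right ((hbox.lo_lt_hi k).le.trans (hbox.le_top k))
      have e2 : (fun k => max (x.hi k) (I.boxHi Q b j k)) = I.boxHi Q b j := by
        funext k
        rw [h6]
        exact max_eq_right ((hbox.corner_le k).trans (hbox.lo_lt_hi k).le)
      rw [e1, e2]
      exact hbox
    · refine Or.inr ⟨h0, Or.inr ⟨rfl, ?_⟩⟩
      rw [hB]
      exact h4.union hbox
  · have he := badOf_eq_empty_of_gapSq (not_le.1 h1) (not_lt.1 h2)
    rcases h with h | ⟨h0, ⟨h3, h4, h5⟩ | ⟨h3, h4⟩⟩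
    · exact Or.inl h
    · exact Or.inr ⟨h0, Or.inl ⟨h3, hall he h4, h5⟩⟩
    · refine Or.inr ⟨h0, Or.inr ⟨h3, ?_⟩⟩
      rw [hB, he, Set.union_empty]; exact h4

/-- The outcome of the scan, where `L` is the level of the smallest cube around the bad set. -/
def Scan.outcome (Q : Cube d) (b : Fin n) (x : Scan d) (L : ℤ) : Outcome d n :=
  if x.heavy = 1 then .split else if x.bad = 0 then .leaf b
  else if L ≤ Q.level then .split else .jump b (cubeAt L (WithLp.toLp 2 x.lo))

/-- Bad points approach every face of the box, so a cube contains the bad set iff it contains the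
half-open box on each axis. The smallest such cube has the least of the hull levels of the axes and
contains the lower corner of the box. -/
theorem Scan.Valid.outcomeSpec {Q : Cube d} {b : Fin n} {x : Scan d} {L : ℤ}
    (hb : I.Best Q b Q.corner) (h : x.Valid I Q b n) (hL : ∀ k, L ≤ hullLevel (x.lo k) (x.hi k))
    (hL' : ∃ k, L = hullLevel (x.lo k) (x.hi k)) : I.OutcomeSpec Q (x.outcome Q b L) := by
  unfold Scan.outcome
  rcases h with ⟨h, hw⟩ | ⟨h0, ⟨h1, h2, -⟩ | ⟨h1, h2⟩⟩
  · rw [if_pos h]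
    exact ⟨b, hb, Or.inl hw⟩
  · rw [if_neg (by omega), if_pos h1]
    intro p hp j
    by_contra hlt
    push Not at hlt
    have : p ∈ I.badOf Q b j := ⟨hp, hlt⟩
    rw [h2 j j.2] at this
    exact this
  · have hB : {p | ∃ j : Fin n, (j : ℕ) < n ∧ p ∈ I.badOf Q b j} = I.badSet Q b := by
      ext p
      constructor
      · rintro ⟨j, -, hp⟩; exact ⟨hp.1, j, hp.2⟩
      · rintro ⟨hp, j, hj⟩; exact ⟨j, j.2, hp, hj⟩
    rw [hB] at h2
    have hne : (I.badSet Q b).Nonempty := by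
      obtain ⟨p, hp, -⟩ := h2.lo_approx ⟨0, I.hd⟩ 1 one_pos
      exact ⟨p, hp⟩
    have hmin : ∀ H : Cube d, I.badSet Q b ⊆ H.region → H.level ≤ L := by
      intro H hH
      obtain ⟨k, rfl⟩ := hL'
      rw [le_hullLevel_iff (h2.lo_lt_hi k)]
      have hlo : H.corner k ≤ x.lo k := by
        by_contra hlt
        push Not at hlt
        obtain ⟨p, hp, hpk⟩ := h2.lo_approx k (H.corner k - x.lo k) (by linarith)
        have := (mem_region_iff_top.1 (hH hp) k).1
        linarith
      have hhi : x.hi k ≤ top H k := by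
        by_contra hlt
        push Not at hlt
        obtain ⟨p, hp, hpk⟩ := h2.hi_approx k (x.hi k - top H k) (by linarith)
        have := (mem_region_iff_top.1 (hH hp) k).2
        linarith
      have hidx : gridIndex H.level (x.lo k) = H.index k :=
        gridIndex_eq_iff.2 ⟨hlo, (h2.lo_lt_hi k).trans_le hhi⟩
      unfold gridEnd
      rw [hidx]
      exact hhi
    rw [if_neg (by omega), if_neg (by omega)]
    split_ifs with hlev
    · exact ⟨b, hb, Or.inr ⟨hne, fun H hH => (hmin H hH).trans hlev⟩⟩
    · push Not at hlev
      have hloQ : WithLp.toLp 2 x.lo ∈ Q.region := by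
        rw [mem_region_iff_top]
        exact fun k => ⟨h2.corner_le k, (h2.lo_lt_hi k).trans_le (h2.le_top k)⟩
      refine ⟨hb, cubeAt_sub hlev.le hloQ, fun h => ?_, hne, fun p hp => ?_, hmin⟩
      · have := congrArg Cube.level h
        simp only [cubeAt] at this
        omega
      · rw [Cube.mem_region]
        intro k
        obtain ⟨h3, h4⟩ := h2.mem p hp k
        have h5 := (le_hullLevel_iff (h2.lo_lt_hi k) L).1 (hL k)
        exact gridIndex_eq_iff.2 ⟨(gridPoint_le L _).trans h3, h4.trans_le h5⟩

end Net

/-! ### Reasoning about programs -/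

@[simp] theorem setIreg_ireg (σ : State) (r r' : ℕ) (v : ℤ) :
    (σ.setIreg r v).ireg r' = if r' = r then v else σ.ireg r' := by
  simp [State.setIreg, Function.update_apply]

@[simp] theorem setIreg_rreg (σ : State) (r : ℕ) (v : ℤ) : (σ.setIreg r v).rreg = σ.rreg := rfl

@[simp] theorem setIreg_iarr (σ : State) (r : ℕ) (v : ℤ) : (σ.setIreg r v).iarr = σ.iarr := rfl

@[simp] theorem setIreg_rarr (σ : State) (r : ℕ) (v : ℤ) : (σ.setIreg r v).rarr = σ.rarr := rfl

@[simp] theorem setRreg_rreg (σ : State) (r r' : ℕ) (v : ℝ) :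
    (σ.setRreg r v).rreg r' = if r' = r then v else σ.rreg r' := by
  simp [State.setRreg, Function.update_apply]

@[simp] theorem setRreg_ireg (σ : State) (r : ℕ) (v : ℝ) : (σ.setRreg r v).ireg = σ.ireg := rfl

@[simp] theorem setRreg_iarr (σ : State) (r : ℕ) (v : ℝ) : (σ.setRreg r v).iarr = σ.iarr := rfl

@[simp] theorem setRreg_rarr (σ : State) (r : ℕ) (v : ℝ) : (σ.setRreg r v).rarr = σ.rarr := rfl

@[simp] theorem setIarr_iarr (σ : State) (a a' : ℕ) (z z' v : ℤ) :
    (σ.setIarr a z v).iarr a' z' = if a' = a ∧ z' = z then v else σ.iarr a' z' := by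
  simp only [State.setIarr, Function.update_apply]
  by_cases h : a' = a <;> by_cases h' : z' = z <;> simp [h, h']

@[simp] theorem setIarr_ireg (σ : State) (a : ℕ) (z v : ℤ) : (σ.setIarr a z v).ireg = σ.ireg := rfl

@[simp] theorem setIarr_rreg (σ : State) (a : ℕ) (z v : ℤ) : (σ.setIarr a z v).rreg = σ.rreg := rfl

@[simp] theorem setIarr_rarr (σ : State) (a : ℕ) (z v : ℤ) : (σ.setIarr a z v).rarr = σ.rarr := rfl

@[simp] theorem setRarr_rarr (σ : State) (a a' : ℕ) (z z' : ℤ) (v : ℝ) :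
    (σ.setRarr a z v).rarr a' z' = if a' = a ∧ z' = z then v else σ.rarr a' z' := by
  simp only [State.setRarr, Function.update_apply]
  by_cases h : a' = a <;> by_cases h' : z' = z <;> simp [h, h']

@[simp] theorem setRarr_ireg (σ : State) (a : ℕ) (z : ℤ) (v : ℝ) :
    (σ.setRarr a z v).ireg = σ.ireg := rfl

@[simp] theorem setRarr_rreg (σ : State) (a : ℕ) (z : ℤ) (v : ℝ) :
    (σ.setRarr a z v).rreg = σ.rreg := rfl

@[simp] theorem setRarr_iarr (σ : State) (a : ℕ) (z : ℤ) (v : ℝ) :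
    (σ.setRarr a z v).iarr = σ.iarr := rfl

open Classical in
/-- The effect of a program without loops. -/
@[simp] def Cmd.run : Cmd → State → State
  | .skip, σ => σ
  | .iset r e, σ => σ.setIreg r (e.eval σ)
  | .rset r e, σ => σ.setRreg r (e.eval σ)
  | .istore a i e, σ => σ.setIarr a (i.eval σ) (e.eval σ)
  | .rstore a i e, σ => σ.setRarr a (i.eval σ) (e.eval σ)
  | .level r x y, σ => σ.setIreg r (commonLevel (x.eval σ) (y.eval σ))
  | .seq c₁ c₂, σ => c₂.run (c₁.run σ)
  | .cond b c₁ c₂, σ => if b.Holds σ then c₁.run σ else c₂.run σ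
  | .loop _ _, σ => σ

theorem Cmd.run_cond_pos {b : Test} {c₁ c₂ : Cmd} {σ : State} (h : b.Holds σ) :
    (Cmd.cond b c₁ c₂).run σ = c₁.run σ := if_pos h

theorem Cmd.run_cond_neg {b : Test} {c₁ c₂ : Cmd} {σ : State} (h : ¬ b.Holds σ) :
    (Cmd.cond b c₁ c₂).run σ = c₂.run σ := if_neg h

@[simp] def Cmd.Straight : Cmd → Prop
  | .seq c₁ c₂ => c₁.Straight ∧ c₂.Straight
  | .cond _ c₁ c₂ => c₁.Straight ∧ c₂.Straight
  | .loop _ _ => False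
  | _ => True

/-- Bound for the running time, up to the repetitions of loops. -/
def Cmd.size : Cmd → ℕ
  | .skip => 1
  | .iset _ e => e.cost + 1
  | .rset _ e => e.cost + 1
  | .istore _ i e => i.cost + e.cost + 1
  | .rstore _ i e => i.cost + e.cost + 1
  | .level _ x y => x.cost + y.cost + 1
  | .seq c₁ c₂ => c₁.size + c₂.size
  | .cond b c₁ c₂ => b.cost + c₁.size + c₂.size
  | .loop b c => b.cost + c.size

/-- Started in `σ`, the program `c` halts within `T` steps in a state that satisfies `Φ`. -/
def Runs (c : Cmd) (σ : State) (T : ℕ) (Φ : State → Prop) : Prop :=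
  ∃ (t : ℕ) (σ' : State), Exec c σ t σ' ∧ t ≤ T ∧ Φ σ'

theorem Cmd.Straight.exec {c : Cmd} (h : c.Straight) (σ : State) :
    ∃ t, Exec c σ t (c.run σ) ∧ t ≤ c.size := by
  induction c generalizing σ with
  | skip => exact ⟨_, .skip σ, le_rfl⟩
  | iset r e => exact ⟨_, .iset σ r e, le_rfl⟩
  | rset r e => exact ⟨_, .rset σ r e, le_rfl⟩
  | istore a i e => exact ⟨_, .istore σ a i e, le_rfl⟩
  | rstore a i e => exact ⟨_, .rstore σ a i e, le_rfl⟩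
  | level r x y => exact ⟨_, .level σ r x y, le_rfl⟩
  | seq c₁ c₂ h₁ h₂ =>
    obtain ⟨t₁, e₁, l₁⟩ := h₁ h.1 σ
    obtain ⟨t₂, e₂, l₂⟩ := h₂ h.2 (c₁.run σ)
    exact ⟨_, .seq e₁ e₂, add_le_add l₁ l₂⟩
  | cond b c₁ c₂ h₁ h₂ =>
    obtain ⟨t₁, e₁, l₁⟩ := h₁ h.1 σ
    obtain ⟨t₂, e₂, l₂⟩ := h₂ h.2 σ
    by_cases hb : b.Holds σ
    · refine ⟨b.cost + t₁, ?_, ?_⟩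
      · simp only [Cmd.run, hb, if_true]
        exact .condTrue hb e₁
      · simp only [Cmd.size]; omega
    · refine ⟨b.cost + t₂, ?_, ?_⟩
      · simp only [Cmd.run, hb, if_false]
        exact .condFalse hb e₂
      · simp only [Cmd.size]; omega
  | loop b c => exact h.elim

theorem Cmd.Straight.runs {c : Cmd} (h : c.Straight) {σ : State} {Φ : State → Prop}
    (hΦ : Φ (c.run σ)) : Runs c σ c.size Φ := by
  obtain ⟨t, e, l⟩ := h.exec σ
  exact ⟨t, _, e, l, hΦ⟩

theorem Runs.mono {c : Cmd} {σ : State} {T T' : ℕ} {Φ Ψ : State → Prop} (h : Runs c σ T Φ)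
    (hT : T ≤ T') (hΦ : ∀ σ', Φ σ' → Ψ σ') : Runs c σ T' Ψ := by
  obtain ⟨t, σ', e, l, p⟩ := h
  exact ⟨t, σ', e, l.trans hT, hΦ _ p⟩

theorem Runs.seq {c₁ c₂ : Cmd} {σ : State} {T₁ T₂ : ℕ} {Φ Ψ : State → Prop}
    (h₁ : Runs c₁ σ T₁ Φ) (h₂ : ∀ σ', Φ σ' → Runs c₂ σ' T₂ Ψ) :
    Runs (.seq c₁ c₂) σ (T₁ + T₂) Ψ := by
  obtain ⟨t₁, σ₁, e₁, l₁, p₁⟩ := h₁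
  obtain ⟨t₂, σ₂, e₂, l₂, p₂⟩ := h₂ _ p₁
  exact ⟨_, _, .seq e₁ e₂, add_le_add l₁ l₂, p₂⟩

theorem Runs.cond {b : Test} {c₁ c₂ : Cmd} {σ : State} {T : ℕ} {Φ : State → Prop}
    (h₁ : b.Holds σ → Runs c₁ σ T Φ) (h₂ : ¬ b.Holds σ → Runs c₂ σ T Φ) :
    Runs (.cond b c₁ c₂) σ (b.cost + T) Φ := by
  by_cases hb : b.Holds σ
  · obtain ⟨t, σ', e, l, p⟩ := h₁ hb
    exact ⟨_, _, .condTrue hb e, by omega, p⟩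
  · obtain ⟨t, σ', e, l, p⟩ := h₂ hb
    exact ⟨_, _, .condFalse hb e, by omega, p⟩

/-- A loop whose invariant `J` counts the repetitions and ends after at most `N` of them. -/
theorem Runs.loop {b : Test} {c : Cmd} {T N : ℕ} (J : ℕ → State → Prop)
    (step : ∀ i σ, i < N → J i σ → b.Holds σ → Runs c σ T (J (i + 1)))
    (hdone : ∀ σ, J N σ → ¬ b.Holds σ) {σ : State} (h : J 0 σ) :
    Runs (.loop b c) σ (N * (b.cost + T) + b.cost) fun σ' => ∃ i ≤ N, J i σ' ∧ ¬ b.Holds σ' := by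
  suffices H : ∀ m i σ, i + m = N → J i σ →
      Runs (.loop b c) σ (m * (b.cost + T) + b.cost) fun σ' => ∃ i ≤ N, J i σ' ∧ ¬ b.Holds σ' from
    H N 0 σ (zero_add N) h
  intro m
  induction m with
  | zero =>
    intro i σ hi hJ
    obtain rfl : i = N := by omega
    exact ⟨_, _, .loopDone (hdone σ hJ), by simp, i, le_rfl, hJ, hdone σ hJ⟩
  | succ m ih =>
    intro i σ hi hJ
    by_cases hb : b.Holds σ
    · obtain ⟨t₁, σ₁, e₁, l₁, p₁⟩ := step i σ (by omega) hJ hb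
      obtain ⟨t₂, σ₂, e₂, l₂, p₂⟩ := ih (i + 1) σ₁ (by omega) p₁
      refine ⟨_, _, .loopStep hb e₁ e₂, ?_, p₂⟩
      rw [add_mul]; omega
    · exact ⟨_, _, .loopDone hb, by omega, i, by omega, hJ, hb⟩

def Cmd.block : List Cmd → Cmd
  | [] => .skip
  | c :: l => .seq c (Cmd.block l)

@[simp] theorem Cmd.run_block_nil (σ : State) : (Cmd.block []).run σ = σ := rfl

@[simp] theorem Cmd.run_block_cons (c : Cmd) (l : List Cmd) (σ : State) :
    (Cmd.block (c :: l)).run σ = (Cmd.block l).run (c.run σ) := rfl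

@[simp] theorem Cmd.straight_block_nil : (Cmd.block []).Straight := trivial

@[simp] theorem Cmd.straight_block_cons (c : Cmd) (l : List Cmd) :
    (Cmd.block (c :: l)).Straight ↔ c.Straight ∧ (Cmd.block l).Straight := Iff.rfl

/-- The programs `f 0, …, f (m - 1)` one after the other. -/
def Cmd.unroll (f : ℕ → Cmd) : ℕ → Cmd
  | 0 => .skip
  | m + 1 => .seq (Cmd.unroll f m) (f m)

theorem Cmd.straight_unroll {f : ℕ → Cmd} {m : ℕ} (h : ∀ k, (f k).Straight) :
    (Cmd.unroll f m).Straight := by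
  induction m with
  | zero => trivial
  | succ m ih => exact ⟨ih, h m⟩

theorem Cmd.run_unroll {f : ℕ → Cmd} {m : ℕ} (P : ℕ → State → Prop)
    (step : ∀ k σ, k < m → P k σ → P (k + 1) ((f k).run σ)) {σ : State} (h : P 0 σ) :
    P m ((Cmd.unroll f m).run σ) := by
  induction m with
  | zero => exact h
  | succ m ih => exact step m _ m.lt_succ_self (ih fun k σ hk => step k σ (by omega))

/-! ### Derived expressions -/

instance : Add IExp := ⟨.add⟩
instance : Sub IExp := ⟨.sub⟩
instance : Add RExp := ⟨.add⟩
instance : Sub RExp := ⟨.sub⟩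
instance : Mul RExp := ⟨.mul⟩
instance : Div RExp := ⟨.div⟩

section
variable (σ : State)

@[simp] theorem IExp.eval_const (z : ℤ) : (IExp.const z).eval σ = z := rfl
@[simp] theorem IExp.eval_reg (r : ℕ) : (IExp.reg r).eval σ = σ.ireg r := rfl
@[simp] theorem IExp.eval_arr (a : ℕ) (i : IExp) :
    (IExp.arr a i).eval σ = σ.iarr a (i.eval σ) := rfl
@[simp] theorem IExp.eval_add (x y : IExp) : (x + y).eval σ = x.eval σ + y.eval σ := rfl
@[simp] theorem IExp.eval_sub (x y : IExp) : (x - y).eval σ = x.eval σ - y.eval σ := rfl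
@[simp] theorem RExp.eval_const (q : ℚ) : (RExp.const q).eval σ = q := rfl
@[simp] theorem RExp.eval_reg (r : ℕ) : (RExp.reg r).eval σ = σ.rreg r := rfl
@[simp] theorem RExp.eval_arr (a : ℕ) (i : IExp) :
    (RExp.arr a i).eval σ = σ.rarr a (i.eval σ) := rfl
@[simp] theorem RExp.eval_add (x y : RExp) : (x + y).eval σ = x.eval σ + y.eval σ := rfl
@[simp] theorem RExp.eval_sub (x y : RExp) : (x - y).eval σ = x.eval σ - y.eval σ := rfl
@[simp] theorem RExp.eval_mul (x y : RExp) : (x * y).eval σ = x.eval σ * y.eval σ := rfl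
@[simp] theorem RExp.eval_div (x y : RExp) : (x / y).eval σ = x.eval σ / y.eval σ := rfl
@[simp] theorem RExp.eval_sqrt (x : RExp) : (RExp.sqrt x).eval σ = √(x.eval σ) := rfl
@[simp] theorem RExp.eval_side (l : IExp) : (RExp.side l).eval σ = gridSide (l.eval σ) := rfl
@[simp] theorem RExp.eval_corner (l : IExp) (x : RExp) : (RExp.corner l x).eval σ =
    gridPoint (l.eval σ) (gridIndex (l.eval σ) (x.eval σ)) := rfl
@[simp] theorem Test.holds_ile (x y : IExp) :
    (Test.ile x y).Holds σ ↔ x.eval σ ≤ y.eval σ := Iff.rfl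
@[simp] theorem Test.holds_rle (x y : RExp) :
    (Test.rle x y).Holds σ ↔ x.eval σ ≤ y.eval σ := Iff.rfl
@[simp] theorem Test.holds_neg (b : Test) : (Test.neg b).Holds σ ↔ ¬ b.Holds σ := Iff.rfl
@[simp] theorem Test.holds_both (b c : Test) :
    (Test.both b c).Holds σ ↔ b.Holds σ ∧ c.Holds σ := Iff.rfl

end

def RExp.sum (f : ℕ → RExp) : ℕ → RExp
  | 0 => .const 0
  | m + 1 => RExp.sum f m + f m

@[simp] theorem RExp.eval_sum (σ : State) (f : ℕ → RExp) (m : ℕ) :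
    (RExp.sum f m).eval σ = ∑ k : Fin m, (f k).eval σ := by
  induction m with
  | zero => simp [RExp.sum]
  | succ m ih => simp [RExp.sum, ih, Fin.sum_univ_castSucc]

def RExp.sq (x : RExp) : RExp := x * x

@[simp] theorem RExp.eval_sq (σ : State) (x : RExp) : x.sq.eval σ = x.eval σ ^ 2 := by
  simp [RExp.sq, _root_.sq]

/-- Expressions cannot branch; the absolute value is obtained as the square root of a square. -/
def RExp.max (x y : RExp) : RExp := (x + y + .sqrt (x - y).sq) / .const 2

@[simp] theorem RExp.eval_max (σ : State) (x y : RExp) :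
    (x.max y).eval σ = Max.max (x.eval σ) (y.eval σ) := by
  simp [RExp.max, Real.sqrt_sq_eq_abs]
  rcases le_total (x.eval σ) (y.eval σ) with h | h
  · rw [abs_of_nonpos (by linarith), max_eq_right h]; ring
  · rw [abs_of_nonneg (by linarith), max_eq_left h]; ring

def RExp.min (x y : RExp) : RExp := (x + y - .sqrt (x - y).sq) / .const 2

@[simp] theorem RExp.eval_min (σ : State) (x y : RExp) :
    (x.min y).eval σ = Min.min (x.eval σ) (y.eval σ) := by
  simp [RExp.min, Real.sqrt_sq_eq_abs]
  rcases le_total (x.eval σ) (y.eval σ) with h | h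
  · rw [abs_of_nonpos (by linarith), min_eq_left h]; ring
  · rw [abs_of_nonneg (by linarith), min_eq_right h]; ring

/-! ### Frames -/

@[simp] def Cmd.SetsI (r : ℕ) : Cmd → Prop
  | .iset r' _ => r = r'
  | .level r' _ _ => r = r'
  | .seq c₁ c₂ => c₁.SetsI r ∨ c₂.SetsI r
  | .cond _ c₁ c₂ => c₁.SetsI r ∨ c₂.SetsI r
  | .loop _ c => c.SetsI r
  | _ => False

@[simp] def Cmd.SetsR (r : ℕ) : Cmd → Prop
  | .rset r' _ => r = r'
  | .seq c₁ c₂ => c₁.SetsR r ∨ c₂.SetsR r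
  | .cond _ c₁ c₂ => c₁.SetsR r ∨ c₂.SetsR r
  | .loop _ c => c.SetsR r
  | _ => False

@[simp] def Cmd.StoresI (a : ℕ) : Cmd → Prop
  | .istore a' _ _ => a = a'
  | .seq c₁ c₂ => c₁.StoresI a ∨ c₂.StoresI a
  | .cond _ c₁ c₂ => c₁.StoresI a ∨ c₂.StoresI a
  | .loop _ c => c.StoresI a
  | _ => False

@[simp] def Cmd.StoresR (a : ℕ) : Cmd → Prop
  | .rstore a' _ _ => a = a'
  | .seq c₁ c₂ => c₁.StoresR a ∨ c₂.StoresR a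
  | .cond _ c₁ c₂ => c₁.StoresR a ∨ c₂.StoresR a
  | .loop _ c => c.StoresR a
  | _ => False

/-- `σ'` agrees with `σ` on everything that `c` does not write to. -/
structure Cmd.Frame (c : Cmd) (σ σ' : State) : Prop where
  ireg : ∀ r, ¬ c.SetsI r → σ'.ireg r = σ.ireg r
  rreg : ∀ r, ¬ c.SetsR r → σ'.rreg r = σ.rreg r
  iarr : ∀ a, ¬ c.StoresI a → σ'.iarr a = σ.iarr a
  rarr : ∀ a, ¬ c.StoresR a → σ'.rarr a = σ.rarr a

/-- Syntactic independence: what a program never writes to is preserved, so that invariants need to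
mention only the memory in use. -/
theorem Exec.frame {c : Cmd} {σ σ' : State} {t : ℕ} (h : Exec c σ t σ') : c.Frame σ σ' := by
  induction h with
  | skip => exact ⟨fun _ _ => rfl, fun _ _ => rfl, fun _ _ => rfl, fun _ _ => rfl⟩
  | iset =>
    refine ⟨fun r h => ?_, fun _ _ => rfl, fun _ _ => rfl, fun _ _ => rfl⟩
    simp at h; simp [h]
  | rset =>
    refine ⟨fun _ _ => rfl, fun r h => ?_, fun _ _ => rfl, fun _ _ => rfl⟩
    simp at h; simp [h]
  | istore =>
    refine ⟨fun _ _ => rfl, fun _ _ => rfl, fun a h => funext fun z => ?_, fun _ _ => rfl⟩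
    simp at h; simp [h]
  | rstore =>
    refine ⟨fun _ _ => rfl, fun _ _ => rfl, fun _ _ => rfl, fun a h => funext fun z => ?_⟩
    simp at h; simp [h]
  | level =>
    refine ⟨fun r h => ?_, fun _ _ => rfl, fun _ _ => rfl, fun _ _ => rfl⟩
    simp at h; simp [h]
  | seq _ _ h₁ h₂ =>
    exact ⟨fun r h => (h₂.1 r fun h' => h (.inr h')).trans (h₁.1 r fun h' => h (.inl h')),
      fun r h => (h₂.2 r fun h' => h (.inr h')).trans (h₁.2 r fun h' => h (.inl h')),
      fun r h => (h₂.3 r fun h' => h (.inr h')).trans (h₁.3 r fun h' => h (.inl h')),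
      fun r h => (h₂.4 r fun h' => h (.inr h')).trans (h₁.4 r fun h' => h (.inl h'))⟩
  | condTrue _ _ h₁ =>
    exact ⟨fun r h => h₁.1 r fun h' => h (.inl h'), fun r h => h₁.2 r fun h' => h (.inl h'),
      fun r h => h₁.3 r fun h' => h (.inl h'), fun r h => h₁.4 r fun h' => h (.inl h')⟩
  | condFalse _ _ h₁ =>
    exact ⟨fun r h => h₁.1 r fun h' => h (.inr h'), fun r h => h₁.2 r fun h' => h (.inr h'),
      fun r h => h₁.3 r fun h' => h (.inr h'), fun r h => h₁.4 r fun h' => h (.inr h')⟩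
  | loopDone => exact ⟨fun _ _ => rfl, fun _ _ => rfl, fun _ _ => rfl, fun _ _ => rfl⟩
  | loopStep _ _ _ h₁ h₂ =>
    exact ⟨fun r h => (h₂.1 r h).trans (h₁.1 r h), fun r h => (h₂.2 r h).trans (h₁.2 r h),
      fun r h => (h₂.3 r h).trans (h₁.3 r h), fun r h => (h₂.4 r h).trans (h₁.4 r h)⟩

theorem Runs.frame {c : Cmd} {σ : State} {T : ℕ} {Φ : State → Prop} (h : Runs c σ T Φ) :
    Runs c σ T fun σ' => Φ σ' ∧ c.Frame σ σ' := by
  obtain ⟨t, σ', e, l, p⟩ := h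
  exact ⟨t, σ', e, l, p, e.frame⟩

theorem Cmd.Straight.frame {c : Cmd} (h : c.Straight) (σ : State) : c.Frame σ (c.run σ) := by
  obtain ⟨t, e, -⟩ := h.exec σ
  exact e.frame

@[simp] theorem Cmd.setsI_block_nil (r : ℕ) : ¬ (Cmd.block []).SetsI r := id
@[simp] theorem Cmd.setsR_block_nil (r : ℕ) : ¬ (Cmd.block []).SetsR r := id
@[simp] theorem Cmd.storesI_block_nil (r : ℕ) : ¬ (Cmd.block []).StoresI r := id
@[simp] theorem Cmd.storesR_block_nil (r : ℕ) : ¬ (Cmd.block []).StoresR r := id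

@[simp] theorem Cmd.setsI_block_cons (r : ℕ) (c : Cmd) (l : List Cmd) :
    (Cmd.block (c :: l)).SetsI r ↔ c.SetsI r ∨ (Cmd.block l).SetsI r := Iff.rfl
@[simp] theorem Cmd.setsR_block_cons (r : ℕ) (c : Cmd) (l : List Cmd) :
    (Cmd.block (c :: l)).SetsR r ↔ c.SetsR r ∨ (Cmd.block l).SetsR r := Iff.rfl
@[simp] theorem Cmd.storesI_block_cons (r : ℕ) (c : Cmd) (l : List Cmd) :
    (Cmd.block (c :: l)).StoresI r ↔ c.StoresI r ∨ (Cmd.block l).StoresI r := Iff.rfl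
@[simp] theorem Cmd.storesR_block_cons (r : ℕ) (c : Cmd) (l : List Cmd) :
    (Cmd.block (c :: l)).StoresR r ↔ c.StoresR r ∨ (Cmd.block l).StoresR r := Iff.rfl

@[simp] theorem Cmd.setsI_unroll (r : ℕ) (f : ℕ → Cmd) (m : ℕ) :
    (Cmd.unroll f m).SetsI r ↔ ∃ k < m, (f k).SetsI r := by
  induction m with
  | zero => simp [Cmd.unroll]
  | succ m ih => rw [Nat.exists_lt_succ_right, ← ih]; rfl

@[simp] theorem Cmd.setsR_unroll (r : ℕ) (f : ℕ → Cmd) (m : ℕ) :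
    (Cmd.unroll f m).SetsR r ↔ ∃ k < m, (f k).SetsR r := by
  induction m with
  | zero => simp [Cmd.unroll]
  | succ m ih => rw [Nat.exists_lt_succ_right, ← ih]; rfl

@[simp] theorem Cmd.storesI_unroll (r : ℕ) (f : ℕ → Cmd) (m : ℕ) :
    (Cmd.unroll f m).StoresI r ↔ ∃ k < m, (f k).StoresI r := by
  induction m with
  | zero => simp [Cmd.unroll]
  | succ m ih => rw [Nat.exists_lt_succ_right, ← ih]; rfl

@[simp] theorem Cmd.storesR_unroll (r : ℕ) (f : ℕ → Cmd) (m : ℕ) :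
    (Cmd.unroll f m).StoresR r ↔ ∃ k < m, (f k).StoresR r := by
  induction m with
  | zero => simp [Cmd.unroll]
  | succ m ih => rw [Nat.exists_lt_succ_right, ← ih]; rfl


/-! ### The program for one cube

Integer registers: `0` number of sites, `1` stack height, `2` number of cells, `3` number of events,
`4` running site, `5` label, `6` and `7` result of the scan, `8` level of the cube, `9` level of the
inner cube, `10` auxiliary, `11` and `12` popped entry, `13` second running site. Real registers:
`0` approximation parameter, `1` extent of the root, `2` and `3` auxiliary; the corner of the cube
from `4` on, followed by the lower and upper corner of the box around the bad set. -/

namespace Net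

variable {d n : ℕ} {I : Net d n}

/-- The memory holds the input and the net. -/
structure Base (I : Net d n) (σ : State) : Prop where
  num : σ.ireg 0 = n
  eps : σ.rreg 0 = I.eps
  site : ∀ (k : Fin d) (i : Fin n), σ.rarr k (i : ℕ) = I.s i k
  weight : ∀ i : Fin n, σ.rarr d (i : ℕ) = I.w i
  kap : ∀ i : Fin n, σ.rarr (5 * d + 1) (i : ℕ) = I.kap i

/-- The registers hold the cube `Q`. -/
structure _root_.AMWVD.Cube.Loaded (Q : Cube d) (σ : State) : Prop where
  level : σ.ireg 8 = Q.level
  corner : ∀ k : Fin d, σ.rreg (4 + k) = Q.corner k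

theorem Base.setIreg {σ : State} (h : I.Base σ) {r : ℕ} {v : ℤ} (hr : r ≠ 0) :
    I.Base (σ.setIreg r v) :=
  ⟨by simp [hr.symm, h.num], h.eps, h.site, h.weight, h.kap⟩

theorem Base.setRreg {σ : State} (h : I.Base σ) {r : ℕ} {v : ℝ} (hr : r ≠ 0) :
    I.Base (σ.setRreg r v) :=
  ⟨h.num, by simp [hr.symm, h.eps], h.site, h.weight, h.kap⟩

theorem _root_.AMWVD.Cube.Loaded.setIreg {Q : Cube d} {σ : State} (h : Q.Loaded σ) {r : ℕ} {v : ℤ}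
    (hr : r ≠ 8) : Q.Loaded (σ.setIreg r v) :=
  ⟨by simp [hr.symm, h.level], h.corner⟩

theorem _root_.AMWVD.Cube.Loaded.setRreg {Q : Cube d} {σ : State} (h : Q.Loaded σ) {r : ℕ} {v : ℝ}
    (hr : 4 + d ≤ r) : Q.Loaded (σ.setRreg r v) := by
  refine ⟨h.level, fun k => ?_⟩
  rw [setRreg_rreg, if_neg (by omega), h.corner]

end Net

namespace Prog

variable (d : ℕ)

def site (r k : ℕ) : RExp := .arr k (.reg r)
def weight (r : ℕ) : RExp := .arr d (.reg r)
def kap (r : ℕ) : RExp := .arr (5 * d + 1) (.reg r)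
def one : RExp := .const 1
def two : RExp := .const 2
def cor (k : ℕ) : RExp := .reg (4 + k)
def lo (k : ℕ) : RExp := .reg (4 + d + k)
def hi (k : ℕ) : RExp := .reg (4 + 2 * d + k)
def top (k : ℕ) : RExp := cor k + .side (.reg 8)
def inc (r : ℕ) : Cmd := .iset r (.reg r + .const 1)
def more (r : ℕ) : Test := .ile (.reg r + .const 1) (.reg 0)

def distSq (r : ℕ) : RExp := .sum (fun k => (cor k - site r k).sq) d / (weight d r).sq
def nu : RExp := ((one + .reg 0) * weight d 5 / weight d 4).sq
def defect (k : ℕ) (x : RExp) : RExp := (x - site 5 k).sq - nu d * (x - site 4 k).sq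
def vertexMax : RExp := .sum (fun k => (defect d k (cor k)).max (defect d k (top k))) d
def center (k : ℕ) : RExp := site 4 k + (site 4 k - site 5 k) / (nu d - one)
def ballSq : RExp := nu d * .sum (fun k => (site 5 k - site 4 k).sq) d / (nu d - one).sq
def gap (k : ℕ) : RExp := (RExp.const 0).max ((cor k - center d k).max (center d k - top k))
def gapSq : RExp := .sum (fun k => (gap d k).sq) d
def reach (k : ℕ) : RExp := .sqrt (ballSq d - gapSq d + (gap d k).sq)
def boxLo (k : ℕ) : RExp := (cor k).max (center d k - reach d k)
def boxHi (k : ℕ) : RExp := (top k).min (center d k + reach d k)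

variable {d} {n : ℕ} {I : Net d n} {Q : Cube d} {b j : Fin n} {σ : State}


@[simp] theorem eval_one : one.eval σ = 1 := by simp [one]
@[simp] theorem eval_two : two.eval σ = 2 := by simp [two]

theorem eval_site (hB : I.Base σ) {r : ℕ} {i : Fin n} (h : σ.ireg r = (i : ℕ)) (k : Fin d) :
    (site r k).eval σ = I.s i k := by
  simp [site, h, hB.site]

theorem eval_weight (hB : I.Base σ) {r : ℕ} {i : Fin n} (h : σ.ireg r = (i : ℕ)) :
    (weight d r).eval σ = I.w i := by
  simp [weight, h, hB.weight]

theorem eval_kap (hB : I.Base σ) {r : ℕ} {i : Fin n} (h : σ.ireg r = (i : ℕ)) :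
    (kap d r).eval σ = I.kap i := by
  simp [kap, h, hB.kap]

theorem eval_cor (hQ : Q.Loaded σ) (k : Fin d) : (cor k).eval σ = Q.corner k := hQ.corner k

theorem eval_top (hQ : Q.Loaded σ) (k : Fin d) : (top k).eval σ = Net.top Q k := by
  simp [top, eval_cor hQ, Net.top, hQ.level, Cube.side]

theorem eval_distSq (hB : I.Base σ) (hQ : Q.Loaded σ) {r : ℕ} {i : Fin n}
    (h : σ.ireg r = (i : ℕ)) : (distSq d r).eval σ = I.wd i Q.corner ^ 2 := by
  simp [distSq, eval_site hB h, eval_weight hB h, eval_cor hQ, Net.wd, div_pow,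
    EuclideanSpace.norm_sq_eq]

theorem eval_nu (hB : I.Base σ) (hb : σ.ireg 5 = (b : ℕ)) (hj : σ.ireg 4 = (j : ℕ)) :
    (nu d).eval σ = I.nu b j := by
  simp [nu, eval_weight hB hb, eval_weight hB hj, hB.eps, Net.nu]

theorem eval_defect (hB : I.Base σ) (hb : σ.ireg 5 = (b : ℕ)) (hj : σ.ireg 4 = (j : ℕ))
    (k : Fin d) (x : RExp) : (defect d k x).eval σ = I.defect b j k (x.eval σ) := by
  simp [defect, eval_site hB hb, eval_site hB hj, eval_nu hB hb hj, Net.defect]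

theorem eval_vertexMax (hB : I.Base σ) (hQ : Q.Loaded σ) (hb : σ.ireg 5 = (b : ℕ))
    (hj : σ.ireg 4 = (j : ℕ)) : (vertexMax d).eval σ = I.vertexMax Q b j := by
  simp [vertexMax, eval_defect hB hb hj, eval_cor hQ, eval_top hQ, Net.vertexMax]

theorem eval_center (hB : I.Base σ) (hb : σ.ireg 5 = (b : ℕ)) (hj : σ.ireg 4 = (j : ℕ))
    (k : Fin d) : (center d k).eval σ = I.ballCenter b j k := by
  simp [center, eval_site hB hb, eval_site hB hj, eval_nu hB hb hj, Net.ballCenter]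

theorem eval_ballSq (hB : I.Base σ) (hb : σ.ireg 5 = (b : ℕ)) (hj : σ.ireg 4 = (j : ℕ)) :
    (ballSq d).eval σ = I.ballSq b j := by
  simp [ballSq, eval_site hB hb, eval_site hB hj, eval_nu hB hb hj, Net.ballSq]

theorem eval_gap (hB : I.Base σ) (hQ : Q.Loaded σ) (hb : σ.ireg 5 = (b : ℕ))
    (hj : σ.ireg 4 = (j : ℕ)) (k : Fin d) : (gap d k).eval σ = I.gap Q b j k := by
  simp [gap, eval_center hB hb hj, eval_cor hQ, eval_top hQ, Net.gap]

theorem eval_gapSq (hB : I.Base σ) (hQ : Q.Loaded σ) (hb : σ.ireg 5 = (b : ℕ))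
    (hj : σ.ireg 4 = (j : ℕ)) : (gapSq d).eval σ = I.gapSq Q b j := by
  simp [gapSq, eval_gap hB hQ hb hj, Net.gapSq]

theorem eval_reach (hB : I.Base σ) (hQ : Q.Loaded σ) (hb : σ.ireg 5 = (b : ℕ))
    (hj : σ.ireg 4 = (j : ℕ)) (k : Fin d) : (reach d k).eval σ = I.reach Q b j k := by
  simp [reach, eval_ballSq hB hb hj, eval_gapSq hB hQ hb hj, eval_gap hB hQ hb hj, Net.reach]

theorem eval_boxLo (hB : I.Base σ) (hQ : Q.Loaded σ) (hb : σ.ireg 5 = (b : ℕ))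
    (hj : σ.ireg 4 = (j : ℕ)) (k : Fin d) : (boxLo d k).eval σ = I.boxLo Q b j k := by
  simp [boxLo, eval_center hB hb hj, eval_reach hB hQ hb hj, eval_cor hQ, Net.boxLo]

theorem eval_boxHi (hB : I.Base σ) (hQ : Q.Loaded σ) (hb : σ.ireg 5 = (b : ℕ))
    (hj : σ.ireg 4 = (j : ℕ)) (k : Fin d) : (boxHi d k).eval σ = I.boxHi Q b j k := by
  simp [boxHi, eval_center hB hb hj, eval_reach hB hQ hb hj, eval_top hQ, Net.boxHi]

end Prog

/-! ### The outcome at a cube as a function of the cube -/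

namespace Net

variable {d n : ℕ} (I : Net d n) (Q : Cube d)

open Classical in
/-- The best label at the corner of `Q` among the sites of the net with numbers less than `m` and
the heaviest site. -/
def pick : ℕ → Fin n
  | 0 => ⟨n - 1, by have := I.hn; omega⟩
  | m + 1 => if h : m < n then
      if I.Alive (I.scale Q) ⟨m, h⟩ ∧ I.wd ⟨m, h⟩ Q.corner ≤ I.wd (pick m) Q.corner then ⟨m, h⟩
      else pick m
    else pick m

theorem pick_spec (m : ℕ) : I.Alive (I.scale Q) (I.pick Q m) ∧ ∀ c : Fin n, c < m →
    I.Alive (I.scale Q) c → I.wd (I.pick Q m) Q.corner ≤ I.wd c Q.corner := by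
  induction m with
  | zero =>
    refine ⟨?_, by simp⟩
    unfold Alive
    -- The starting value is the heaviest site. No heavier site could have removed it, so it is in
    -- every net.
    rcases I.of_kap (I.pick Q 0) with h | ⟨c, hc, -⟩
    · rw [h]; simp
    · simp only [pick, Fin.lt_def] at hc
      have := c.2
      omega
  | succ m ih =>
    simp only [pick]
    split_ifs with h h'
    · refine ⟨h'.1, fun c hc hal => ?_⟩
      rcases Nat.lt_succ_iff_lt_or_eq.1 hc with hc | hc
      · exact h'.2.trans (ih.2 c hc hal)
      · rw [show c = ⟨m, h⟩ from Fin.ext hc]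
    · refine ⟨ih.1, fun c hc hal => ?_⟩
      rcases Nat.lt_succ_iff_lt_or_eq.1 hc with hc | hc
      · exact ih.2 c hc hal
      · obtain rfl : c = ⟨m, h⟩ := Fin.ext hc
        by_contra hlt
        exact h' ⟨hal, (not_le.1 hlt).le⟩
    · exact ⟨ih.1, fun c _ hal => ih.2 c (by omega) hal⟩

theorem best_pick : I.Best Q (I.pick Q n) Q.corner :=
  ⟨(I.pick_spec Q n).1, fun c => (I.pick_spec Q n).2 c c.2⟩

def scan (b : Fin n) : ℕ → Scan d
  | 0 => Scan.start Q
  | m + 1 => if h : m < n then (scan b m).step I Q b ⟨m, h⟩ else scan b m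

theorem valid_scan (b : Fin n) (m : ℕ) (hm : m ≤ n) : (I.scan Q b m).Valid I Q b m := by
  induction m with
  | zero => exact scan_start Q b
  | succ m ih =>
    rw [scan, dif_pos (show m < n from hm)]
    exact Scan.Valid.step (j := ⟨m, hm⟩) (ih (by omega))

def Scan.hull (x : Scan d) : ℤ := ⨅ k, hullLevel (x.lo k) (x.hi k)

/-- The mathematical function that the program evaluates; everything about the traversal depends on
it only through `outcomeSpec_out`. -/
def out : Outcome d n :=
  (I.scan Q (I.pick Q n) n).outcome Q (I.pick Q n) (I.scan Q (I.pick Q n) n).hull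

theorem outcomeSpec_out : I.OutcomeSpec Q (I.out Q) := by
  have : Nonempty (Fin d) := ⟨⟨0, I.hd⟩⟩
  refine (I.valid_scan Q _ n le_rfl).outcomeSpec (I.best_pick Q)
    (fun k => ciInf_le (Set.finite_range _).bddBelow k) ?_
  obtain ⟨k, hk⟩ := exists_eq_ciInf_of_finite
    (f := fun k => hullLevel ((I.scan Q (I.pick Q n) n).lo k) ((I.scan Q (I.pick Q n) n).hi k))
  exact ⟨k, hk.symm⟩

end Net

/-! ### Programs for the label, the scan and the hull level -/

namespace Prog

variable (d : ℕ)

def pick : Cmd :=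
  .block [.iset 5 (.reg 0 - .const 1), .iset 4 (.const 0), .loop (more 4) (.block [
    .cond (.both (.neg (.rle one (kap d 4 * (.reg 0 * .side (.reg 8) / .const 1000))))
      (.rle (distSq d 4) (distSq d 5))) (.iset 5 (.reg 4)) .skip, inc 4])]

def scan : Cmd :=
  .block [.iset 6 (.const 0), .iset 7 (.const 0),
    .unroll (fun k => .block [.rset (4 + d + k) (top k), .rset (4 + 2 * d + k) (cor k)]) d,
    .iset 4 (.const 0), .loop (more 4) (.block [
      .cond (.rle (nu d) one) (.cond (.rle (vertexMax d) (.const 0)) .skip (.iset 7 (.const 1)))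
        (.cond (.rle (ballSq d) (gapSq d)) .skip (.block [.iset 6 (.const 1),
          .unroll (fun k => .block [.rset (4 + d + k) ((lo d k).min (boxLo d k)),
            .rset (4 + 2 * d + k) ((hi d k).max (boxHi d k))]) d])), inc 4])]

def hull : Cmd :=
  .unroll (fun k => .block [.level 10 (lo d k) (hi d k),
    .cond (.rle (hi d k) (.corner (.reg 10) (lo d k) + .side (.reg 10) / two))
      (.level 10 (lo d k) ((lo d k + hi d k) / two)) .skip,
    if k = 0 then .iset 9 (.reg 10) else .cond (.ile (.reg 10) (.reg 9)) (.iset 9 (.reg 10)) .skip]) d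

variable {d} {n : ℕ} {I : Net d n} {Q : Cube d} {b j : Fin n} {σ : State}


/-- Times are kept in the form `size * m`, where `m` bounds the repetitions. As `size` is additive,
the constants of composed programs never have to be computed. -/
theorem Runs.block_cons {c : Cmd} {l : List Cmd} {σ : State} {m : ℕ} {Φ Ψ : State → Prop}
    (h₁ : Runs c σ (c.size * m) Φ)
    (h₂ : ∀ σ', Φ σ' → Runs (.block l) σ' ((Cmd.block l).size * m) Ψ) :
    Runs (.block (c :: l)) σ ((Cmd.block (c :: l)).size * m) Ψ :=
  (h₁.seq h₂).mono (add_mul _ _ _).ge fun _ h => h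

theorem Runs.block_nil {σ : State} {m : ℕ} {Φ : State → Prop} (hm : 1 ≤ m) (h : Φ σ) :
    Runs (.block []) σ ((Cmd.block []).size * m) Φ :=
  ⟨1, σ, .skip σ, by simpa [Cmd.block, Cmd.size] using hm, h⟩

theorem Runs.of_straight {c : Cmd} (h : c.Straight) {σ : State} {m : ℕ} {Φ : State → Prop}
    (hm : 1 ≤ m) (hΦ : Φ (c.run σ)) : Runs c σ (c.size * m) Φ :=
  (h.runs hΦ).mono (Nat.le_mul_of_pos_right _ hm) fun _ h => h

/-- A loop over the sites from `a` on. -/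
theorem Runs.for {c : Cmd} {r a n m : ℕ} (P : ℕ → State → Prop)
    (hP : ∀ i σ, P i σ → σ.ireg 0 = n ∧ σ.ireg r = i)
    (step : ∀ i σ, a ≤ i → i < n → P i σ → Runs c σ (c.size * m) (P (i + 1)))
    {σ : State} (han : a ≤ n) (hm : 1 ≤ m) (h : P a σ) :
    Runs (.loop (more r) c) σ ((Cmd.loop (more r) c).size * (m * (n + 1))) (P n) := by
  have hmore : ∀ i σ, P i σ → ((more r).Holds σ ↔ i + 1 ≤ n) := by
    intro i σ h
    obtain ⟨h1, h2⟩ := hP i σ h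
    simp [more, h1, h2]
  refine (Runs.loop (T := c.size * m) (N := n - a) (fun i σ => P (a + i) σ) ?_ ?_ h).mono ?_ ?_
  · intro i σ hi hJ _
    exact step (a + i) σ (by omega) (by omega) hJ
  · intro σ hJ
    rw [hmore _ _ hJ]; omega
  · have h1 : (n - a) * ((more r).cost + c.size * m) ≤ n * ((more r).cost + c.size * m) :=
      Nat.mul_le_mul_right _ (by omega)
    have h2 : (more r).cost * 1 ≤ (more r).cost * m := Nat.mul_le_mul_left _ hm
    calc _ ≤ n * ((more r).cost * m + c.size * m) + ((more r).cost * m + c.size * m) := by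
          have : n * ((more r).cost + c.size * m) ≤ n * ((more r).cost * m + c.size * m) :=
            Nat.mul_le_mul_left _ (by omega)
          omega
      _ = _ := by simp only [Cmd.size]; ring
  · rintro σ' ⟨i, hi, hJ, hb⟩
    rw [hmore _ _ hJ] at hb
    rwa [show a + i = n by omega] at hJ

theorem runs_pick (hB : I.Base σ) (hQ : Q.Loaded σ) :
    Runs (pick d) σ ((pick d).size * (n + 1)) fun σ' => I.Base σ' ∧ Q.Loaded σ' ∧
      σ'.ireg 5 = (I.pick Q n : ℕ) := by
  have hn := I.hn
  refine Runs.block_cons (Runs.of_straight (by trivial) (by omega) rfl) ?_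
  rintro _ rfl
  refine Runs.block_cons (Runs.of_straight (by trivial) (by omega) rfl) ?_
  rintro _ rfl
  refine Runs.block_cons (Φ := fun σ' => I.Base σ' ∧ Q.Loaded σ' ∧
      σ'.ireg 5 = (I.pick Q n : ℕ)) ?_ fun _ h => Runs.block_nil (by omega) h
  have := Runs.for (r := 4) (a := 0) (n := n) (m := 1) (c := .block [
    .cond (.both (.neg (.rle one (kap d 4 * (.reg 0 * .side (.reg 8) / .const 1000))))
      (.rle (distSq d 4) (distSq d 5))) (.iset 5 (.reg 4)) .skip, inc 4])
    (fun i σ => I.Base σ ∧ Q.Loaded σ ∧ σ.ireg 5 = (I.pick Q i : ℕ) ∧ σ.ireg 4 = i)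
    (fun i σ h => ⟨h.1.num, h.2.2.2⟩) (σ := (Cmd.iset 4 (.const 0)).run
      ((Cmd.iset 5 (.reg 0 - .const 1)).run σ)) ?_ (by omega) le_rfl ?_
  · rw [one_mul] at this
    exact this.mono le_rfl fun σ' h => ⟨h.1, h.2.1, h.2.2.1⟩
  · rintro i σ - hi ⟨hB, hQ, h5, h4⟩
    refine Runs.of_straight (by simp [inc]) le_rfl ?_
    have e4 : σ.ireg 4 = ((⟨i, hi⟩ : Fin n) : ℕ) := h4
    have hcond : (Test.both (.neg (.rle one (kap d 4 * (.reg 0 * .side (.reg 8) / .const 1000))))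
      (.rle (distSq d 4) (distSq d 5))).Holds σ ↔ I.Alive (I.scale Q) ⟨i, hi⟩ ∧
        I.wd ⟨i, hi⟩ Q.corner ≤ I.wd (I.pick Q i) Q.corner := by
      simp [eval_kap hB e4, eval_distSq hB hQ e4, eval_distSq hB hQ h5, hB.eps, hQ.level,
        Net.Alive, Net.scale, Cube.side,
        pow_le_pow_iff_left₀ (Net.wd_nonneg _ _) (Net.wd_nonneg _ _) two_ne_zero]
    simp only [Cmd.run_block_cons, Cmd.run_block_nil, Net.pick, dif_pos hi]
    by_cases h : I.Alive (I.scale Q) ⟨i, hi⟩ ∧ I.wd ⟨i, hi⟩ Q.corner ≤ I.wd (I.pick Q i) Q.corner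
    · rw [if_pos h, Cmd.run_cond_pos (hcond.2 h)]
      refine ⟨(hB.setIreg (by omega)).setIreg (by omega),
        (hQ.setIreg (by omega)).setIreg (by omega), ?_, ?_⟩ <;> simp [h4, inc]
    · rw [if_neg h, Cmd.run_cond_neg (mt hcond.1 h)]
      refine ⟨hB.setIreg (by omega), hQ.setIreg (by omega), ?_, ?_⟩ <;> simp [h4, h5, inc]
  · refine ⟨(hB.setIreg (by omega)).setIreg (by omega), (hQ.setIreg (by omega)).setIreg (by omega),
        ?_, ?_⟩ <;> simp [hB.num, Net.pick]
    omega

/-- The registers hold the result of a scan. -/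
structure Scanned (x : Net.Scan d) (σ : State) : Prop where
  bad : σ.ireg 6 = x.bad
  heavy : σ.ireg 7 = x.heavy
  lo : ∀ k : Fin d, σ.rreg (4 + d + k) = x.lo k
  hi : ∀ k : Fin d, σ.rreg (4 + 2 * d + k) = x.hi k

theorem Scanned.setIreg {x : Net.Scan d} (h : Scanned x σ) {r : ℕ} {v : ℤ} (hr : r ≠ 6 ∧ r ≠ 7) :
    Scanned x (σ.setIreg r v) :=
  ⟨by simp [hr.1.symm, h.bad], by simp [hr.2.symm, h.heavy], h.lo, h.hi⟩


/-- The new bounds of an axis depend only on the old bounds of the same axis, so the box can be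
updated in place, one axis after the other. `P` collects what the registers of the box do not
affect. -/
theorem run_box {f g : ℕ → RExp} {u v : Fin d → ℝ} {P : State → Prop}
    (hP : ∀ σ r x, P σ → 4 + d ≤ r → P (σ.setRreg r x)) {σ₀ : State}
    (hf : ∀ σ, P σ → ∀ k : Fin d, σ.rreg (4 + d + k) = σ₀.rreg (4 + d + k) → (f k).eval σ = u k)
    (hg : ∀ σ, P σ → ∀ k : Fin d, σ.rreg (4 + 2 * d + k) = σ₀.rreg (4 + 2 * d + k) →
      (g k).eval σ = v k) (h : P σ₀) :
    let σ := (Cmd.unroll (fun k => .block [.rset (4 + d + k) (f k), .rset (4 + 2 * d + k) (g k)])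
      d).run σ₀
    P σ ∧ ∀ k : Fin d, σ.rreg (4 + d + k) = u k ∧ σ.rreg (4 + 2 * d + k) = v k := by
  have := Cmd.run_unroll (m := d) (f := fun k => .block [.rset (4 + d + k) (f k),
    .rset (4 + 2 * d + k) (g k)]) (fun m σ => P σ ∧ ∀ k : Fin d,
      (k < m → σ.rreg (4 + d + k) = u k ∧ σ.rreg (4 + 2 * d + k) = v k) ∧
      (m ≤ k → σ.rreg (4 + d + k) = σ₀.rreg (4 + d + k) ∧
        σ.rreg (4 + 2 * d + k) = σ₀.rreg (4 + 2 * d + k))) ?_ (σ := σ₀) ⟨h, by simp⟩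
  · exact ⟨this.1, fun k => (this.2 k).1 k.2⟩
  · rintro m σ hm ⟨h1, h2⟩
    simp only [Cmd.run_block_cons, Cmd.run_block_nil, Cmd.run]
    have e1 := hf σ h1 ⟨m, hm⟩ ((h2 ⟨m, hm⟩).2 le_rfl).1
    set σ' := σ.setRreg (4 + d + m) ((f m).eval σ) with hσ'
    have h1' : P σ' := hP _ _ _ h1 (by omega)
    have e2 := hg σ' h1' ⟨m, hm⟩ (by
      rw [hσ', setRreg_rreg, if_neg (by simp; omega)]; exact ((h2 ⟨m, hm⟩).2 le_rfl).2)
    refine ⟨hP _ _ _ h1' (by omega), fun k => ?_⟩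
    by_cases hk : (k : ℕ) = m
    · refine ⟨fun _ => ⟨?_, ?_⟩, fun h => by omega⟩
      · rw [setRreg_rreg, if_neg (by omega), hσ', setRreg_rreg, if_pos (by omega)]
        rw [show k = ⟨m, hm⟩ from Fin.ext hk]
        exact e1
      · rw [setRreg_rreg, if_pos (by omega)]
        rw [show k = ⟨m, hm⟩ from Fin.ext hk]
        exact e2
    · rw [setRreg_rreg, if_neg (by omega), hσ', setRreg_rreg, if_neg (by omega), setRreg_rreg,
        if_neg (by omega), setRreg_rreg, if_neg (by omega)]
      exact ⟨fun h => (h2 k).1 (by omega), fun h => (h2 k).2 (by omega)⟩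

theorem runs_scan (hB : I.Base σ) (hQ : Q.Loaded σ) (hb : σ.ireg 5 = (b : ℕ)) :
    Runs (scan d) σ ((scan d).size * (n + 1)) fun σ' => I.Base σ' ∧ Q.Loaded σ' ∧
      σ'.ireg 5 = (b : ℕ) ∧ Scanned (I.scan Q b n) σ' := by
  have hn := I.hn
  refine Runs.block_cons (Runs.of_straight (by trivial) (by omega) rfl) ?_
  rintro _ rfl
  refine Runs.block_cons (Runs.of_straight (by trivial) (by omega) rfl) ?_
  rintro _ rfl
  have hP : ∀ u v z : ℤ, ∀ (σ : State) (r : ℕ) (x : ℝ), (I.Base σ ∧ Q.Loaded σ ∧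
      σ.ireg 5 = (b : ℕ) ∧ σ.ireg 6 = u ∧ σ.ireg 7 = v ∧ σ.ireg 4 = z) → 4 + d ≤ r →
      (I.Base (σ.setRreg r x) ∧ Q.Loaded (σ.setRreg r x) ∧ (σ.setRreg r x).ireg 5 = (b : ℕ) ∧
        (σ.setRreg r x).ireg 6 = u ∧ (σ.setRreg r x).ireg 7 = v ∧ (σ.setRreg r x).ireg 4 = z) :=
    fun u v z σ r x h hr => ⟨h.1.setRreg (by omega), h.2.1.setRreg hr, h.2.2⟩
  refine Runs.block_cons (Φ := fun σ' => I.Base σ' ∧ Q.Loaded σ' ∧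
      σ'.ireg 5 = (b : ℕ) ∧ Scanned (I.scan Q b 0) σ') (Runs.of_straight ?_ (by omega) ?_) ?_
  · exact Cmd.straight_unroll fun k => ⟨trivial, trivial, trivial⟩
  · have := run_box (f := top) (g := cor) (u := Net.top Q) (v := Q.corner) (hP 0 0 (σ.ireg 4))
      (σ₀ := (Cmd.iset 7 (.const 0)).run ((Cmd.iset 6 (.const 0)).run σ))
      (fun σ h k _ => eval_top h.2.1 k) (fun σ h k _ => eval_cor h.2.1 k)
      ⟨(hB.setIreg (by omega)).setIreg (by omega), (hQ.setIreg (by omega)).setIreg (by omega),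
        by simp [hb]⟩
    exact ⟨this.1.1, this.1.2.1, this.1.2.2.1, this.1.2.2.2.1, this.1.2.2.2.2.1,
      fun k => (this.2 k).1, fun k => (this.2 k).2⟩
  clear hB hQ hb
  rintro σ ⟨hB, hQ, hb, hS⟩
  refine Runs.block_cons (Runs.of_straight (by trivial) (by omega) rfl) ?_
  rintro _ rfl
  refine Runs.block_cons (Φ := fun σ' => I.Base σ' ∧ Q.Loaded σ' ∧
      σ'.ireg 5 = (b : ℕ) ∧ Scanned (I.scan Q b n) σ') ?_ fun _ h => Runs.block_nil (by omega) h
  have := Runs.for (r := 4) (a := 0) (n := n) (m := 1) (c := .block [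
      .cond (.rle (nu d) one) (.cond (.rle (vertexMax d) (.const 0)) .skip (.iset 7 (.const 1)))
        (.cond (.rle (ballSq d) (gapSq d)) .skip (.block [.iset 6 (.const 1),
          .unroll (fun k => .block [.rset (4 + d + k) ((lo d k).min (boxLo d k)),
            .rset (4 + 2 * d + k) ((hi d k).max (boxHi d k))]) d])), inc 4])
    (fun i σ => I.Base σ ∧ Q.Loaded σ ∧ σ.ireg 5 = (b : ℕ) ∧ Scanned (I.scan Q b i) σ ∧
      σ.ireg 4 = i)
    (fun i σ h => ⟨h.1.num, h.2.2.2.2⟩) (σ := (Cmd.iset 4 (.const 0)).run σ) ?_ (by omega) le_rfl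
      ⟨hB.setIreg (by omega), hQ.setIreg (by omega), by simp [hb], hS.setIreg (by omega), by simp⟩
  · rw [one_mul] at this
    exact this.mono le_rfl fun σ' h => ⟨h.1, h.2.1, h.2.2.1, h.2.2.2.1⟩
  · clear hB hQ hb hS
    rintro i σ - hin ⟨hB, hQ, hb, hS, h4⟩
    have hu : (Cmd.unroll (fun k => .block [.rset (4 + d + k) ((lo d k).min (boxLo d k)),
        .rset (4 + 2 * d + k) ((hi d k).max (boxHi d k))]) d).Straight :=
      Cmd.straight_unroll fun k => ⟨trivial, trivial, trivial⟩
    refine Runs.of_straight (by simp [inc, hu]) le_rfl ?_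
    have hj : σ.ireg 4 = ((⟨i, hin⟩ : Fin n) : ℕ) := h4
    simp only [Cmd.run_block_cons, Cmd.run_block_nil, Net.scan, dif_pos hin]
    suffices H : ∀ σ' : State, (I.Base σ' ∧ Q.Loaded σ' ∧ σ'.ireg 5 = (b : ℕ) ∧
        Scanned (Net.Scan.step I Q b ⟨i, hin⟩ (I.scan Q b i)) σ' ∧ σ'.ireg 4 = i) →
        (I.Base ((inc 4).run σ') ∧ Q.Loaded ((inc 4).run σ') ∧ ((inc 4).run σ').ireg 5 = (b : ℕ) ∧
        Scanned (Net.Scan.step I Q b ⟨i, hin⟩ (I.scan Q b i)) ((inc 4).run σ') ∧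
        ((inc 4).run σ').ireg 4 = (i + 1 : ℕ)) by
      apply H
      unfold Net.Scan.step
      by_cases h1 : I.nu b ⟨i, hin⟩ ≤ 1
      · rw [if_pos h1, Cmd.run_cond_pos (by simpa [eval_nu hB hb hj] using h1)]
        by_cases h2 : 0 < I.vertexMax Q b ⟨i, hin⟩
        · rw [if_pos h2, Cmd.run_cond_neg (by simpa [eval_vertexMax hB hQ hb hj] using h2)]
          exact ⟨hB.setIreg (by omega), hQ.setIreg (by omega), by simp [hb],
            ⟨by simp [hS.bad], by simp, hS.lo, hS.hi⟩, by simp [h4]⟩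
        · rw [if_neg h2, Cmd.run_cond_pos (by simpa [eval_vertexMax hB hQ hb hj] using h2)]
          exact ⟨hB, hQ, hb, hS, h4⟩
      · rw [if_neg h1, Cmd.run_cond_neg (by simpa [eval_nu hB hb hj] using h1)]
        by_cases h2 : I.gapSq Q b ⟨i, hin⟩ < I.ballSq b ⟨i, hin⟩
        · rw [if_pos h2, Cmd.run_cond_neg
            (by simpa [eval_gapSq hB hQ hb hj, eval_ballSq hB hb hj] using h2)]
          have := run_box (f := fun k => (lo d k).min (boxLo d k))
            (g := fun k => (hi d k).max (boxHi d k))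
            (u := fun k => min ((I.scan Q b i).lo k) (I.boxLo Q b ⟨i, hin⟩ k))
            (v := fun k => max ((I.scan Q b i).hi k) (I.boxHi Q b ⟨i, hin⟩ k))
            (hP 1 (I.scan Q b i).heavy i)
            (σ₀ := (Cmd.iset 6 (.const 1)).run σ) (fun σ' h k hk => ?_) (fun σ' h k hk => ?_)
            ⟨hB.setIreg (by omega), hQ.setIreg (by omega), by simp [hb, h4, hS.heavy]⟩
          · exact ⟨this.1.1, this.1.2.1, this.1.2.2.1, ⟨this.1.2.2.2.1, this.1.2.2.2.2.1,
              fun k => (this.2 k).1, fun k => (this.2 k).2⟩, this.1.2.2.2.2.2⟩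
          · rw [RExp.eval_min, eval_boxLo (j := ⟨i, hin⟩) h.1 h.2.1 h.2.2.1 h.2.2.2.2.2, lo, RExp.eval_reg, hk]
            simp [hS.lo]
          · rw [RExp.eval_max, eval_boxHi (j := ⟨i, hin⟩) h.1 h.2.1 h.2.2.1 h.2.2.2.2.2, hi, RExp.eval_reg, hk]
            simp [hS.hi]
        · rw [if_neg h2, Cmd.run_cond_pos
            (by simpa [eval_gapSq hB hQ hb hj, eval_ballSq hB hb hj] using h2)]
          exact ⟨hB, hQ, hb, hS, h4⟩
    rintro σ' ⟨hB, hQ, hb, hS, h4⟩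
    exact ⟨hB.setIreg (by omega), hQ.setIreg (by omega), by simp [hb, inc], hS.setIreg (by omega),
      by simp [h4, inc]⟩

/-- Two calls of `level` and a comparison with the middle of the interval evaluate `hullLevel`.
Register `9` keeps the running minimum and is initialised at axis `0`. -/
theorem runs_hull {x : Net.Scan d} (hd : 1 ≤ d) (hS : Scanned x σ) :
    ((hull d).run σ).ireg 9 = x.hull := by
  have := Cmd.run_unroll (m := d) (f := fun k => .block [.level 10 (lo d k) (hi d k),
    .cond (.rle (hi d k) (.corner (.reg 10) (lo d k) + .side (.reg 10) / two))
      (.level 10 (lo d k) ((lo d k + hi d k) / two)) .skip,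
    if k = 0 then .iset 9 (.reg 10)
    else .cond (.ile (.reg 10) (.reg 9)) (.iset 9 (.reg 10)) .skip])
    (fun m σ => Scanned x σ ∧ (0 < m → (∃ k : Fin d, σ.ireg 9 = hullLevel (x.lo k) (x.hi k)) ∧
      ∀ k : Fin d, k < m → σ.ireg 9 ≤ hullLevel (x.lo k) (x.hi k))) ?_ (σ := σ) ⟨hS, by simp⟩
  · obtain ⟨⟨k, hk⟩, h⟩ := this.2 hd
    have : Nonempty (Fin d) := ⟨k⟩
    refine le_antisymm (le_ciInf fun k => h k k.2) ?_
    exact (ciInf_le (Set.finite_range _).bddBelow k).trans hk.ge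
  · clear hS
    rintro m σ hm ⟨hS, h⟩
    simp only [Cmd.run_block_cons, Cmd.run_block_nil]
    obtain ⟨σ₁, hσ₁⟩ : ∃ σ₁, σ₁ = (Cmd.cond (.rle (hi d m) (.corner (.reg 10) (lo d m)
      + .side (.reg 10) / two)) (.level 10 (lo d m) ((lo d m + hi d m) / two)) .skip).run
        ((Cmd.level 10 (lo d m) (hi d m)).run σ) := ⟨_, rfl⟩
    have e1 : ∀ z, (lo d m).eval (σ.setIreg 10 z) = x.lo ⟨m, hm⟩ := fun _ => hS.lo ⟨m, hm⟩
    have e2 : ∀ z, (hi d m).eval (σ.setIreg 10 z) = x.hi ⟨m, hm⟩ := fun _ => hS.hi ⟨m, hm⟩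
    have e3 : (lo d m).eval σ = x.lo ⟨m, hm⟩ := hS.lo ⟨m, hm⟩
    have e4 : (hi d m).eval σ = x.hi ⟨m, hm⟩ := hS.hi ⟨m, hm⟩
    have key : Scanned x σ₁ ∧ σ₁.ireg 9 = σ.ireg 9 ∧
        σ₁.ireg 10 = hullLevel (x.lo ⟨m, hm⟩) (x.hi ⟨m, hm⟩) := by
      rw [hσ₁]
      simp only [Cmd.run, Test.holds_rle, RExp.eval_add, RExp.eval_corner, RExp.eval_side,
        RExp.eval_div, eval_two, e1, e2, e3, e4, IExp.eval_reg, setIreg_ireg, if_true]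
      unfold hullLevel
      split_ifs
      · exact ⟨(hS.setIreg (by omega)).setIreg (by omega), by simp, by simp⟩
      · exact ⟨hS.setIreg (by omega), by simp, by simp⟩
    rw [← hσ₁]
    obtain ⟨h1, h9, h10⟩ := key
    by_cases h0 : m = 0
    · subst h0
      rw [if_pos rfl]
      refine ⟨h1.setIreg (by omega), fun _ => ⟨⟨⟨0, hm⟩, by simp [h10]⟩, fun k hk => ?_⟩⟩
      obtain rfl : k = ⟨0, hm⟩ := Fin.ext (by simpa using hk)
      simp [h10]
    · rw [if_neg h0]
      obtain ⟨h2, h3⟩ := h (by omega)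
      by_cases hle : σ₁.ireg 10 ≤ σ₁.ireg 9
      · rw [Cmd.run_cond_pos (by simpa using hle)]
        refine ⟨h1.setIreg (by omega), fun _ => ⟨⟨⟨m, hm⟩, by simp [h10]⟩, fun k hk => ?_⟩⟩
        rcases Nat.lt_succ_iff_lt_or_eq.1 hk with hk | hk
        · refine le_trans ?_ (h3 k hk)
          simp only [Cmd.run, setIreg_ireg, if_true, IExp.eval_reg]
          omega
        · obtain rfl : k = ⟨m, hm⟩ := Fin.ext hk
          simp [h10]
      · rw [Cmd.run_cond_neg (by simpa using hle)]
        refine ⟨h1, fun _ => ⟨h9 ▸ h2, fun k hk => ?_⟩⟩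
        rcases Nat.lt_succ_iff_lt_or_eq.1 hk with hk | hk
        · exact h9 ▸ h3 k hk
        · obtain rfl : k = ⟨m, hm⟩ := Fin.ext hk
          simp only [Cmd.run]
          omega

end Prog

namespace Prog

/-! ### Lists in memory -/

variable {d n : ℕ} {I : Net d n} {Q : Cube d} {σ σ' : State}

/-- Write a cube with a flag. -/
def putCube (d a b : ℕ) (z f l : IExp) (x : ℕ → RExp) : Cmd :=
  .block [.istore a z f, .istore (a + 1) z l, .unroll (fun k => .rstore (b + k) z (x k)) d]

/-- Append an entry to a list whose length is in register `r`. -/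
def push (d a b r : ℕ) (v f l : IExp) (x : ℕ → RExp) : Cmd :=
  .block [.istore a (.reg r) v, putCube d (a + 1) b (.reg r) f l x, inc r]

theorem straight_putCube {a b : ℕ} {z f l : IExp} {x : ℕ → RExp} :
    (putCube d a b z f l x).Straight :=
  ⟨trivial, trivial, Cmd.straight_unroll fun _ => trivial, trivial⟩

theorem straight_push {a b r : ℕ} {v f l : IExp} {x : ℕ → RExp} :
    (push d a b r v f l x).Straight :=
  ⟨trivial, straight_putCube, trivial, trivial⟩

theorem run_unroll_rstore {b : ℕ} {z : IExp} {x : ℕ → RExp} {c : Fin d → ℝ} {y : ℤ}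
    (hz : ∀ τ : State, τ.ireg = σ.ireg → z.eval τ = y)
    (hx : ∀ τ : State, τ.ireg = σ.ireg → τ.rreg = σ.rreg → ∀ k : Fin d, (x k).eval τ = c k) :
    let σ' := (Cmd.unroll (fun k => .rstore (b + k) z (x k)) d).run σ
    σ'.ireg = σ.ireg ∧ σ'.rreg = σ.rreg ∧ σ'.iarr = σ.iarr ∧
      (∀ k : Fin d, σ'.rarr (b + k) y = c k) ∧
      ∀ a' z', ¬ (z' = y ∧ b ≤ a' ∧ a' < b + d) → σ'.rarr a' z' = σ.rarr a' z' := by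
  have := Cmd.run_unroll (m := d) (f := fun k => .rstore (b + k) z (x k))
    (fun m τ => τ.ireg = σ.ireg ∧ τ.rreg = σ.rreg ∧ τ.iarr = σ.iarr ∧
      (∀ k : Fin d, k < m → τ.rarr (b + k) y = c k) ∧
      ∀ a' z', ¬ (z' = y ∧ b ≤ a' ∧ a' < b + d) → τ.rarr a' z' = σ.rarr a' z') ?_ (σ := σ)
    ⟨rfl, rfl, rfl, by simp, fun _ _ _ => rfl⟩
  · exact ⟨this.1, this.2.1, this.2.2.1, fun k => this.2.2.2.1 k k.2, this.2.2.2.2⟩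
  · rintro m τ hm ⟨h1, h2, h3, h4, h5⟩
    have e1 := hz τ h1
    have e2 := hx τ h1 h2 ⟨m, hm⟩
    simp only at e2
    simp only [Cmd.run, e1, e2]
    refine ⟨h1, h2, h3, fun k hk => ?_, fun a' z' h => ?_⟩
    · rw [setRarr_rarr]
      split_ifs with h
      · rw [show k = ⟨m, hm⟩ from Fin.ext (by simp only; omega)]
      · exact h4 k (by omega)
    · rw [setRarr_rarr, if_neg (by omega), h5 _ _ h]

theorem run_putCube {a b : ℕ} {z f l : IExp} {x : ℕ → RExp} {c : Fin d → ℝ} {y u v : ℤ}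
    (hz : ∀ τ : State, τ.ireg = σ.ireg → z.eval τ = y)
    (hf : ∀ τ : State, τ.ireg = σ.ireg → f.eval τ = u)
    (hl : ∀ τ : State, τ.ireg = σ.ireg → l.eval τ = v)
    (hx : ∀ τ : State, τ.ireg = σ.ireg → τ.rreg = σ.rreg → ∀ k : Fin d, (x k).eval τ = c k) :
    let σ' := (putCube d a b z f l x).run σ
    σ'.ireg = σ.ireg ∧ σ'.rreg = σ.rreg ∧ σ'.iarr a y = u ∧ σ'.iarr (a + 1) y = v ∧
      (∀ k : Fin d, σ'.rarr (b + k) y = c k) ∧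
      (∀ a' z', ¬ (z' = y ∧ a ≤ a' ∧ a' ≤ a + 1) → σ'.iarr a' z' = σ.iarr a' z') ∧
      ∀ a' z', ¬ (z' = y ∧ b ≤ a' ∧ a' < b + d) → σ'.rarr a' z' = σ.rarr a' z' := by
  simp only [putCube, Cmd.run_block_cons, Cmd.run_block_nil]
  obtain ⟨σ₁, h₁⟩ : ∃ σ₁, σ₁ = (Cmd.istore (a + 1) z l).run ((Cmd.istore a z f).run σ) := ⟨_, rfl⟩
  rw [← h₁]
  have e : σ₁ = (σ.setIarr a y u).setIarr (a + 1) y v := by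
    rw [h₁, Cmd.run, Cmd.run, hz σ rfl, hf σ rfl, hz (σ.setIarr a y u) rfl,
      hl (σ.setIarr a y u) rfl]
  clear h₁
  have hi : σ₁.ireg = σ.ireg := by rw [e]; rfl
  have hr : σ₁.rreg = σ.rreg := by rw [e]; rfl
  have := run_unroll_rstore (σ := σ₁) (b := b) (z := z) (x := x) (c := c) (y := y)
    (fun τ h => hz τ (h.trans hi)) (fun τ h h' => hx τ (h.trans hi) (h'.trans hr))
  obtain ⟨h1, h2, h3, h4, h5⟩ := this
  refine ⟨h1.trans hi, h2.trans hr, ?_, ?_, h4, fun a' z' h => ?_, fun a' z' h => ?_⟩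
  · rw [h3, e]; simp
  · rw [h3, e]; simp
  · rw [h3, e, setIarr_iarr, if_neg (by omega), setIarr_iarr, if_neg (by omega)]
  · rw [h5 _ _ h, e]; rfl

/-- Entry `z` of the list in the integer arrays from `a` on and the real arrays from `b` on. -/
structure HasRec (σ : State) (a b : ℕ) (z : ℤ) (e : Rec d) : Prop where
  id : σ.iarr a z = e.id
  flag : σ.iarr (a + 1) z = if e.resume then 1 else 0
  level : σ.iarr (a + 2) z = e.cube.level
  corner : ∀ k : Fin d, σ.rarr (b + k) z = e.cube.corner k

def HasRecs (σ : State) (a b : ℕ) (l : List (Rec d)) : Prop :=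
  ∀ (i : ℕ) e, l[i]? = some e → HasRec σ a b i e

structure HasCell (σ : State) (z : ℤ) (c : Cell d × Fin n) : Prop where
  label : σ.iarr 0 z = (c.2 : ℕ)
  outer : StoresCube σ 1 (d + 1) z c.1.outer
  inner : StoresCube σ 3 (2 * d + 1) z c.1.inner

def HasCells (σ : State) (l : List (Cell d × Fin n)) : Prop :=
  ∀ (i : ℕ) c, l[i]? = some c → HasCell σ i c

theorem HasRec.congr' {a b : ℕ} {z : ℤ} {e : Rec d} (h : HasRec σ a b z e) (hi : σ'.iarr = σ.iarr)
    (hr : σ'.rarr = σ.rarr) : HasRec σ' a b z e :=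
  ⟨by rw [hi, h.id], by rw [hi, h.flag], by rw [hi, h.level], fun k => by rw [hr, h.corner]⟩

theorem HasRecs.congr {a b : ℕ} {l : List (Rec d)} (h : HasRecs σ a b l)
    (hi : ∀ (a' : ℕ) (z : ℤ), a ≤ a' → a' ≤ a + 2 → 0 ≤ z → z < l.length →
      σ'.iarr a' z = σ.iarr a' z)
    (hr : ∀ (a' : ℕ) (z : ℤ), b ≤ a' → a' < b + d → 0 ≤ z → z < l.length →
      σ'.rarr a' z = σ.rarr a' z) : HasRecs σ' a b l := by
  intro i e he
  obtain ⟨h1, h2, h3, h4⟩ := h i e he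
  have hlt : i < l.length := (List.getElem?_eq_some_iff.1 he).1
  refine ⟨?_, ?_, ?_, fun k => ?_⟩
  · rw [hi _ _ (by omega) (by omega) (by omega) (by omega), h1]
  · rw [hi _ _ (by omega) (by omega) (by omega) (by omega), h2]
  · rw [hi _ _ (by omega) (by omega) (by omega) (by omega), h3]
  · rw [hr _ _ (by omega) (by omega) (by omega) (by omega), h4]

theorem HasRecs.append {a b : ℕ} {l : List (Rec d)} {e : Rec d} (h : HasRecs σ a b l)
    (he : HasRec σ a b l.length e) : HasRecs σ a b (l ++ [e]) := by
  intro i e' he'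
  rw [List.getElem?_append] at he'
  split_ifs at he' with hi
  · exact h i e' he'
  · rw [List.getElem?_singleton] at he'
    split_ifs at he' with h0
    cases he'
    rwa [show i = l.length by omega]

theorem StoresCube.congr {a b : ℕ} {z : ℤ} {o : Option (Cube d)} (h : StoresCube σ a b z o)
    (hi : ∀ a' : ℕ, a ≤ a' → a' ≤ a + 1 → σ'.iarr a' z = σ.iarr a' z)
    (hr : ∀ a' : ℕ, b ≤ a' → a' < b + d → σ'.rarr a' z = σ.rarr a' z) : StoresCube σ' a b z o := by
  cases o with
  | none => exact (hi a le_rfl (by omega)).trans h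
  | some Q =>
    obtain ⟨h1, h2, h3⟩ := h
    exact ⟨(hi a le_rfl (by omega)).trans h1, (hi _ (by omega) le_rfl).trans h2,
      fun k => (hr _ (by omega) (by omega)).trans (h3 k)⟩

theorem HasCells.congr {l : List (Cell d × Fin n)} (h : HasCells σ l)
    (hi : ∀ (a' : ℕ) (z : ℤ), a' ≤ 4 → 0 ≤ z → z < l.length → σ'.iarr a' z = σ.iarr a' z)
    (hr : ∀ (a' : ℕ) (z : ℤ), d + 1 ≤ a' → a' < 3 * d + 1 → 0 ≤ z → z < l.length →
      σ'.rarr a' z = σ.rarr a' z) : HasCells σ' l := by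
  intro i e he
  obtain ⟨h1, h2, h3⟩ := h i e he
  have hlt : i < l.length := (List.getElem?_eq_some_iff.1 he).1
  refine ⟨?_, StoresCube.congr h2 (fun a' _ _ => hi _ _ (by omega) (by omega) (by omega))
    (fun a' _ _ => hr _ _ (by omega) (by omega) (by omega) (by omega)),
    StoresCube.congr h3 (fun a' _ _ => hi _ _ (by omega) (by omega) (by omega))
    (fun a' _ _ => hr _ _ (by omega) (by omega) (by omega) (by omega))⟩
  rw [hi _ _ (by omega) (by omega) (by omega), h1]

theorem HasCells.append {l : List (Cell d × Fin n)} {e : Cell d × Fin n} (h : HasCells σ l)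
    (he : HasCell σ l.length e) : HasCells σ (l ++ [e]) := by
  intro i e' he'
  rw [List.getElem?_append] at he'
  split_ifs at he' with hi
  · exact h i e' he'
  · rw [List.getElem?_singleton] at he'
    split_ifs at he' with h0
    cases he'
    rwa [show i = l.length by omega]

/-- All array entries at addresses outside `[0, B)` are zero. -/
def Bounded (B : ℤ) (σ : State) : Prop :=
  ∀ (a : ℕ) (z : ℤ), z < 0 ∨ B ≤ z → σ.iarr a z = 0 ∧ σ.rarr a z = 0

/-- The entry `e` has been appended to a list whose length is in register `r`. -/
structure Pushed (a b r : ℕ) (e : Rec d) (σ σ' : State) : Prop where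
  ireg : ∀ r', σ'.ireg r' = if r' = r then σ.ireg r + 1 else σ.ireg r'
  rreg : σ'.rreg = σ.rreg
  hasRec : HasRec σ' a b (σ.ireg r) e
  iarr : ∀ (a' : ℕ) (z : ℤ), ¬ (z = σ.ireg r ∧ a ≤ a' ∧ a' ≤ a + 2) → σ'.iarr a' z = σ.iarr a' z
  rarr : ∀ (a' : ℕ) (z : ℤ), ¬ (z = σ.ireg r ∧ b ≤ a' ∧ a' < b + d) → σ'.rarr a' z = σ.rarr a' z

theorem pushed_push {a b r : ℕ} {v f l : IExp} {x : ℕ → RExp} {e : Rec d} (hv : v.eval σ = e.id)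
    (hf : ∀ τ : State, τ.ireg = σ.ireg → f.eval τ = if e.resume then 1 else 0)
    (hl : ∀ τ : State, τ.ireg = σ.ireg → l.eval τ = e.cube.level)
    (hx : ∀ τ : State, τ.ireg = σ.ireg → τ.rreg = σ.rreg → ∀ k : Fin d,
      (x k).eval τ = e.cube.corner k) : Pushed a b r e σ ((push d a b r v f l x).run σ) := by
  obtain ⟨h1, h2, h3, h4, h5, h6, h7⟩ := run_putCube (σ := σ.setIarr a (σ.ireg r) e.id)
    (a := a + 1) (b := b) (z := .reg r) (f := f) (l := l) (x := x) (c := e.cube.corner)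
    (y := σ.ireg r) (fun τ h => by simp [h]) hf hl hx
  have e0 : (push d a b r v f l x).run σ = (inc r).run ((putCube d (a + 1) b (.reg r) f l x).run
      (σ.setIarr a (σ.ireg r) e.id)) := by
    rw [push, Cmd.run_block_cons, Cmd.run, hv]; rfl
  rw [e0]
  set τ := (putCube d (a + 1) b (.reg r) f l x).run (σ.setIarr a (σ.ireg r) e.id)
  refine ⟨fun r' => ?_, h2, ⟨?_, h3, h4, h5⟩, fun a' z h => ?_, fun a' z h => h7 a' z h⟩
  · simp [inc, h1]
  · change τ.iarr a _ = _
    rw [h6 _ _ (by omega)]; simp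
  · change τ.iarr a' z = _
    rw [h6 _ _ (by omega), setIarr_iarr, if_neg (by omega)]

/-- The memory holds the configuration `x`. -/
structure Rep (I : Net d n) (B : ℤ) (x : Conf d n) (σ : State) : Prop where
  base : I.Base σ
  sp : σ.ireg 1 = x.stack.length
  nc : σ.ireg 2 = x.cells.length
  ne : σ.ireg 3 = x.events.length
  stack : HasRecs σ 9 (4 * d + 1) x.stack.reverse
  cells : HasCells σ x.cells
  events : HasRecs σ 6 (3 * d + 1) x.events
  bounded : Bounded B σ

theorem Bounded.congr {B z₀ : ℤ} (h : Bounded B σ) (h0 : 0 ≤ z₀) (hB : z₀ < B)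
    (hi : ∀ (a' : ℕ) (z : ℤ), z ≠ z₀ → σ'.iarr a' z = σ.iarr a' z)
    (hr : ∀ (a' : ℕ) (z : ℤ), z ≠ z₀ → σ'.rarr a' z = σ.rarr a' z) : Bounded B σ' := by
  intro a z hz
  rw [hi a z (by omega), hr a z (by omega)]
  exact h a z hz

theorem _root_.AMWVD.Net.Base.congr (h : I.Base σ) (h0 : σ'.ireg 0 = σ.ireg 0)
    (h1 : σ'.rreg 0 = σ.rreg 0)
    (hr : ∀ (a : ℕ) (z : ℤ), a ≤ d ∨ a = 5 * d + 1 → σ'.rarr a z = σ.rarr a z) : I.Base σ' :=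
  ⟨h0.trans h.num, h1.trans h.eps, fun k i => (hr _ _ (by omega)).trans (h.site k i),
    fun i => (hr _ _ (by omega)).trans (h.weight i), fun i => (hr _ _ (by omega)).trans (h.kap i)⟩

/-- The stack is stored with its top last, hence the reversal. The lists occupy disjoint arrays, so
a push changes none of the others. -/
theorem Rep.pushStack {B : ℤ} {x : Conf d n} {e : Rec d} (h : Rep I B x σ)
    (hp : Pushed 9 (4 * d + 1) 1 e σ σ') (hB : x.stack.length < B) :
    Rep I B { x with stack := e :: x.stack } σ' := by
  obtain ⟨h1, h2, h3, h4, h5⟩ := hp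
  rw [h.sp] at h3 h4 h5
  refine ⟨h.base.congr (by simp [h1]) (by simp [h2]) fun a z ha => h5 a z (by omega),
    by simp [h1, h.sp], by simp [h1, h.nc], by simp [h1, h.ne], ?_,
    h.cells.congr (fun a z ha _ _ => h4 a z (by omega)) (fun a z ha _ _ _ => h5 a z (by omega)),
    h.events.congr (fun a z ha _ _ _ => h4 a z (by omega)) (fun a z ha _ _ _ => h5 a z (by omega)),
    h.bounded.congr (z₀ := x.stack.length) (by omega) hB (fun a z _ => h4 a z (by omega))
      fun a z _ => h5 a z (by omega)⟩
  simp only [List.reverse_cons]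
  refine HasRecs.append (h.stack.congr ?_ ?_) (by rwa [List.length_reverse])
  · intro a z _ _ _ hz
    rw [List.length_reverse] at hz
    exact h4 a z (by omega)
  · intro a z _ _ _ hz
    rw [List.length_reverse] at hz
    exact h5 a z (by omega)

theorem Rep.pushEvent {B : ℤ} {x : Conf d n} {e : Rec d} (h : Rep I B x σ)
    (hp : Pushed 6 (3 * d + 1) 3 e σ σ') (hB : x.events.length < B) :
    Rep I B { x with events := x.events ++ [e] } σ' := by
  obtain ⟨h1, h2, h3, h4, h5⟩ := hp
  rw [h.ne] at h3 h4 h5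
  exact ⟨h.base.congr (by simp [h1]) (by simp [h2]) fun a z ha => h5 a z (by omega),
    by simp [h1, h.sp], by simp [h1, h.nc], by simp [h1, h.ne],
    h.stack.congr (fun a z ha _ _ _ => h4 a z (by omega)) (fun a z ha _ _ _ => h5 a z (by omega)),
    h.cells.congr (fun a z ha _ _ => h4 a z (by omega)) (fun a z ha _ _ _ => h5 a z (by omega)),
    (h.events.congr (fun a z ha _ _ _ => h4 a z (by omega))
      (fun a z ha _ _ _ => h5 a z (by omega))).append h3,
    h.bounded.congr (z₀ := x.events.length) (by omega) hB (fun a z _ => h4 a z (by omega))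
      fun a z _ => h5 a z (by omega)⟩

/-- A cell is written as an entry whose `id` is the label and whose flag tells whether there is an
outer cube, since the two layouts agree. The description of the inner cube must already be in place.
-/
theorem Rep.pushCell {B : ℤ} {x : Conf d n} {Q : Cube d} {o : Option (Cube d)} {b : Fin n}
    {t : Bool} (h : Rep I B x σ) (hp : Pushed 0 (d + 1) 2 ⟨t, b, Q⟩ σ σ') (hB : x.cells.length < B)
    (ho : StoresCube σ 3 (2 * d + 1) (σ.ireg 2) o) :
    Rep I B { x with cells := x.cells ++ [(⟨if t then some Q else none, o⟩, b)] } σ' := by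
  obtain ⟨h1, h2, h3, h4, h5⟩ := hp
  rw [h.nc] at h3 h4 h5 ho
  refine ⟨h.base.congr (by simp [h1]) (by simp [h2]) fun a z ha => h5 a z (by omega),
    by simp [h1, h.sp], by simp [h1, h.nc], by simp [h1, h.ne],
    h.stack.congr (fun a z ha _ _ _ => h4 a z (by omega)) (fun a z ha _ _ _ => h5 a z (by omega)),
    (h.cells.congr (fun a z ha _ _ => h4 a z (by omega))
      (fun a z ha _ _ _ => h5 a z (by omega))).append ?_,
    h.events.congr (fun a z ha _ _ _ => h4 a z (by omega)) (fun a z ha _ _ _ => h5 a z (by omega)),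
    h.bounded.congr (z₀ := x.cells.length) (by omega) hB (fun a z _ => h4 a z (by omega))
      fun a z _ => h5 a z (by omega)⟩
  refine ⟨h3.id, ?_,
    StoresCube.congr ho (fun a _ _ => h4 _ _ (by omega)) (fun a _ _ => h5 _ _ (by omega))⟩
  cases t
  · exact h3.flag
  · exact ⟨h3.flag, h3.level, h3.corner⟩

theorem Rep.putInner {B : ℤ} {x : Conf d n} (h : Rep I B x σ) (hB : x.cells.length < B)
    (hi : σ'.ireg = σ.ireg) (hr : σ'.rreg = σ.rreg)
    (h4 : ∀ (a : ℕ) (z : ℤ), ¬ (z = σ.ireg 2 ∧ 3 ≤ a ∧ a ≤ 4) → σ'.iarr a z = σ.iarr a z)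
    (h5 : ∀ (a : ℕ) (z : ℤ), ¬ (z = σ.ireg 2 ∧ 2 * d + 1 ≤ a ∧ a < 2 * d + 1 + d) →
      σ'.rarr a z = σ.rarr a z) : Rep I B x σ' := by
  rw [h.nc] at h4 h5
  exact ⟨h.base.congr (by simp [hi]) (by simp [hr]) fun a z ha => h5 a z (by omega),
    by simp [hi, h.sp], by simp [hi, h.nc], by simp [hi, h.ne],
    h.stack.congr (fun a z ha _ _ _ => h4 a z (by omega)) (fun a z ha _ _ _ => h5 a z (by omega)),
    h.cells.congr (fun a z ha _ _ => h4 a z (by omega)) (fun a z ha _ _ _ => h5 a z (by omega)),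
    h.events.congr (fun a z ha _ _ _ => h4 a z (by omega)) (fun a z ha _ _ _ => h5 a z (by omega)),
    h.bounded.congr (z₀ := x.cells.length) (by omega) hB (fun a z _ => h4 a z (by omega))
      fun a z _ => h5 a z (by omega)⟩

end Prog

namespace Prog

variable {d n : ℕ} {I : Net d n} {Q : Cube d} {σ σ' : State}

/-! ### One step of the traversal -/

def test (r : ℕ) (z : ℤ) : Test := .both (.ile (.reg r) (.const z)) (.ile (.const z) (.reg r))

@[simp] theorem holds_test {r : ℕ} {z : ℤ} : (test r z).Holds σ ↔ σ.ireg r = z := by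
  simp [test, le_antisymm_iff]

variable (d)

/-- The popped entry is not erased; only the height decreases. -/
def pop : Cmd :=
  .block [.iset 1 (.reg 1 - .const 1), .iset 11 (.arr 10 (.reg 1)), .iset 12 (.arr 9 (.reg 1)),
    .iset 8 (.arr 11 (.reg 1)), .unroll (fun k => .rset (4 + k) (.arr (4 * d + 1 + k) (.reg 1))) d]

def pushStack (v f l : IExp) (x : ℕ → RExp) : Cmd := push d 9 (4 * d + 1) 1 v f l x

def pushEvent (v f : IExp) : Cmd := push d 6 (3 * d + 1) 3 v f (.reg 8) cor

def pushCell : Cmd := push d 0 (d + 1) 2 (.reg 5) (.const 1) (.reg 8) cor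

def leaf : Cmd :=
  .block [pushEvent d (.reg 2) (.const 0), .istore 3 (.reg 2) (.const 0), pushCell d]

def innerCor (k : ℕ) : RExp := .corner (.reg 9) (lo d k)

/-- The cell is appended last, because the stack entry, the event and the inner cube all use the old
number of cells as the number of the new one. -/
def jump : Cmd :=
  .block [pushStack d (.reg 2) (.const 1) (.reg 9) (innerCor d),
    pushStack d (.const 0) (.const 0) (.reg 9) (innerCor d), pushEvent d (.reg 2) (.const 0),
    putCube d 3 (2 * d + 1) (.reg 2) (.const 1) (.reg 9) (innerCor d), pushCell d]

def childCor (v k : ℕ) : RExp :=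
  if v.testBit k then cor k + .side (.reg 8 + .const 1) else cor k

/-- The children are pushed in decreasing order, so that child `0` ends on top. -/
def split : Cmd :=
  .unroll (fun m => pushStack d (.const 0) (.const 0) (.reg 8 + .const 1)
    (childCor (2 ^ d - 1 - m))) (2 ^ d)

def choose : Cmd :=
  .cond (test 7 1) (split d) (.cond (test 6 0) (leaf d)
    (.cond (.ile (.reg 9) (.reg 8)) (split d) (jump d)))

def body : Cmd :=
  .block [pop d, .cond (test 11 1) (pushEvent d (.reg 12) (.const 1))
    (.block [pick d, scan d, hull d, choose d])]

variable {d}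

theorem straight_split : (split d).Straight := Cmd.straight_unroll fun _ => straight_push

theorem straight_choose : (choose d).Straight :=
  ⟨straight_split, ⟨straight_push, trivial, straight_push, trivial⟩, straight_split,
    straight_push, straight_push, straight_push, straight_putCube, straight_push, trivial⟩

theorem straight_hull : (hull d).Straight := by
  refine Cmd.straight_unroll fun k => ⟨trivial, ⟨trivial, trivial⟩, ?_, trivial⟩
  split_ifs
  · trivial
  · exact ⟨trivial, trivial⟩

theorem straight_pop : (pop d).Straight :=
  ⟨trivial, trivial, trivial, trivial, Cmd.straight_unroll fun _ => trivial, trivial⟩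

theorem HasRecs.of_append {a b : ℕ} {l l' : List (Rec d)} (h : HasRecs σ a b (l ++ l')) :
    HasRecs σ a b l := by
  intro i e he
  refine h i e ?_
  rw [List.getElem?_append_left (List.getElem?_eq_some_iff.1 he).1, he]

theorem Rep.congr {B : ℤ} {x : Conf d n} (h : Rep I B x σ) (hi : ∀ r < 4, σ'.ireg r = σ.ireg r)
    (hr : σ'.rreg 0 = σ.rreg 0) (hia : σ'.iarr = σ.iarr) (hra : σ'.rarr = σ.rarr) :
    Rep I B x σ' :=
  ⟨h.base.congr (hi 0 (by omega)) hr (by simp [hra]), (hi 1 (by omega)).trans h.sp,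
    (hi 2 (by omega)).trans h.nc, (hi 3 (by omega)).trans h.ne,
    h.stack.congr (by simp [hia]) (by simp [hra]), h.cells.congr (by simp [hia]) (by simp [hra]),
    h.events.congr (by simp [hia]) (by simp [hra]), by
      intro a z hz; rw [hia, hra]; exact h.bounded a z hz⟩

theorem run_pop {B : ℤ} {r : Rec d} {st : List (Rec d)} {c : List (Cell d × Fin n)}
    {e : List (Rec d)} (h : Rep I B ⟨r :: st, c, e⟩ σ) :
    let σ' := (pop d).run σ
    Rep I B ⟨st, c, e⟩ σ' ∧ σ'.ireg 11 = (if r.resume then 1 else 0) ∧ σ'.ireg 12 = r.id ∧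
      r.cube.Loaded σ' := by
  have hs := h.sp
  simp only [List.length_cons, Nat.cast_add, Nat.cast_one] at hs
  obtain ⟨h1, h2, h3, h4⟩ := h.stack st.length r (by simp)
  simp only [Nat.reduceAdd] at h1 h2 h3 h4
  obtain ⟨σ₁, hσ₁⟩ : ∃ σ₁, σ₁ = (((σ.setIreg 1 st.length).setIreg 11
    (if r.resume then 1 else 0)).setIreg 12 r.id).setIreg 8 r.cube.level := ⟨_, rfl⟩
  have e0 : (pop d).run σ = (Cmd.unroll (fun k => .rset (4 + k) (.arr (4 * d + 1 + k) (.reg 1)))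
      d).run σ₁ := by
    simp only [pop, Cmd.run_block_cons, Cmd.run_block_nil, Cmd.run, IExp.eval_sub, IExp.eval_reg,
      IExp.eval_arr, IExp.eval_const, hs, add_sub_cancel_right, setIreg_ireg, setIreg_iarr,
      if_true, if_neg (show (1 : ℕ) ≠ 11 by omega), if_neg (show (1 : ℕ) ≠ 12 by omega), h1, h2,
      h3, hσ₁]
  have := Cmd.run_unroll (m := d)
    (f := fun k => .rset (4 + k) (.arr (4 * d + 1 + k) (.reg 1)))
    (fun m τ => τ.ireg = σ₁.ireg ∧ τ.iarr = σ.iarr ∧ τ.rarr = σ.rarr ∧ τ.rreg 0 = σ.rreg 0 ∧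
      ∀ k : Fin d, k < m → τ.rreg (4 + k) = r.cube.corner k) ?_ (σ := σ₁)
    ⟨rfl, by rw [hσ₁]; rfl, by rw [hσ₁]; rfl, by rw [hσ₁]; rfl, by simp⟩
  · simp only [e0]
    obtain ⟨t1, t2, t3, t4, t5⟩ := this
    have hst : HasRecs σ 9 (4 * d + 1) st.reverse :=
      HasRecs.of_append (l' := [r]) (by simpa using h.stack)
    refine ⟨⟨h.base.congr ?_ t4 (by simp [t3]), ?_, ?_, ?_,
      hst.congr (by simp [t2]) (by simp [t3]), h.cells.congr (by simp [t2]) (by simp [t3]),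
      h.events.congr (by simp [t2]) (by simp [t3]), ?_⟩, ?_, ?_, ?_, fun k => t5 k k.2⟩
    · rw [t1, hσ₁]; simp
    · rw [t1, hσ₁]; simp
    · rw [t1, hσ₁]; simp [h.nc]
    · rw [t1, hσ₁]; simp [h.ne]
    · intro a z hz
      rw [t2, t3]
      exact h.bounded a z hz
    · rw [t1, hσ₁]; simp
    · rw [t1, hσ₁]; simp
    · rw [t1, hσ₁]; simp
  · rintro m τ hm ⟨t1, t2, t3, t4, t5⟩
    refine ⟨t1, t2, t3, by simp [t4]; omega, fun k hk => ?_⟩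
    simp only [Cmd.run, setRreg_rreg]
    split_ifs with hkm
    · have : k = ⟨m, hm⟩ := Fin.ext (by simp only; omega)
      subst this
      simp only [RExp.eval_arr, IExp.eval_reg, t1, t3, ← h4]
      simp [hσ₁]
    · exact t5 k (by omega)

/-- The registers that describe the node. -/
structure Node (Q : Cube d) (b : Fin n) (x : Net.Scan d) (σ : State) : Prop where
  loaded : Q.Loaded σ
  label : σ.ireg 5 = (b : ℕ)
  scanned : Scanned x σ
  hull : σ.ireg 9 = x.hull

theorem Node.congr {b : Fin n} {x : Net.Scan d} (h : Node Q b x σ)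
    (hi : ∀ r, 4 ≤ r → σ'.ireg r = σ.ireg r) (hr : σ'.rreg = σ.rreg) : Node Q b x σ' :=
  ⟨⟨(hi _ (by omega)).trans h.loaded.level, fun k => by rw [hr, h.loaded.corner]⟩,
    (hi _ (by omega)).trans h.label,
    ⟨(hi _ (by omega)).trans h.scanned.bad, (hi _ (by omega)).trans h.scanned.heavy,
      fun k => by rw [hr, h.scanned.lo], fun k => by rw [hr, h.scanned.hi]⟩,
    (hi _ (by omega)).trans h.hull⟩

theorem Node.pushed {b : Fin n} {x : Net.Scan d} {a a' r : ℕ} {e : Rec d} (h : Node Q b x σ)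
    (hp : Pushed a a' r e σ σ') (hr : r < 4) : Node Q b x σ' :=
  h.congr (fun r' hr' => by rw [hp.ireg, if_neg (by omega)]) hp.rreg

theorem pushed_pushEvent {v f : IExp} {i : ℕ} {t : Bool} (hQ : Q.Loaded σ) (hv : v.eval σ = i)
    (hf : ∀ τ : State, f.eval τ = if t then 1 else 0) :
    Pushed 6 (3 * d + 1) 3 ⟨t, i, Q⟩ σ ((pushEvent d v f).run σ) :=
  pushed_push hv (fun τ _ => hf τ) (fun τ h => by simp [h, hQ.level])
    (fun τ _ h k => by simp [cor, h, hQ.corner])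

theorem pushed_pushCell {b : Fin n} (hQ : Q.Loaded σ) (hb : σ.ireg 5 = (b : ℕ)) :
    Pushed 0 (d + 1) 2 ⟨true, b, Q⟩ σ ((pushCell d).run σ) :=
  pushed_push hb (fun τ _ => by simp) (fun τ h => by simp [h, hQ.level])
    (fun τ _ h k => by simp [cor, h, hQ.corner])

theorem run_leaf {B : ℤ} {st : List (Rec d)} {c : List (Cell d × Fin n)} {e : List (Rec d)}
    {b : Fin n} {x : Net.Scan d} (h : Rep I B ⟨st, c, e⟩ σ) (hN : Node Q b x σ)
    (hc : c.length < B) (he : e.length < B) :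
    Rep I B (treat Q st c e (.leaf b)) ((leaf d).run σ) := by
  simp only [leaf, Cmd.run_block_cons, Cmd.run_block_nil]
  have p1 := pushed_pushEvent (v := .reg 2) (f := .const 0) (i := c.length) (t := false)
    hN.loaded h.nc (by simp)
  generalize (pushEvent d (.reg 2) (.const 0)).run σ = σ₁ at p1 ⊢
  have h1 := h.pushEvent p1 he
  have n1 := hN.pushed p1 (by omega)
  have h2 : Rep I B _ ((Cmd.istore 3 (.reg 2) (.const 0)).run σ₁) :=
    h1.putInner hc rfl rfl (fun a z hz => by simp; intro h h'; omega) (fun a z _ => rfl)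
  have n2 : Node Q b x ((Cmd.istore 3 (.reg 2) (.const 0)).run σ₁) := n1.congr (fun _ _ => rfl) rfl
  have p3 := pushed_pushCell n2.loaded n2.label
  exact h2.pushCell (o := none) p3 hc (by simp [StoresCube])

theorem eval_innerCor {b : Fin n} {x : Net.Scan d} (hN : Node Q b x σ) (k : Fin d) :
    (innerCor d k).eval σ = (cubeAt x.hull (WithLp.toLp 2 x.lo)).corner k := by
  simp [innerCor, hN.hull, lo, hN.scanned.lo, cubeAt]

theorem run_jump {B : ℤ} {st : List (Rec d)} {c : List (Cell d × Fin n)} {e : List (Rec d)}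
    {b : Fin n} {x : Net.Scan d} (h : Rep I B ⟨st, c, e⟩ σ) (hN : Node Q b x σ)
    (hs : st.length + 1 < B) (hc : c.length < B) (he : e.length < B) :
    Rep I B (treat Q st c e (.jump b (cubeAt x.hull (WithLp.toLp 2 x.lo)))) ((jump d).run σ) := by
  simp only [jump, Cmd.run_block_cons, Cmd.run_block_nil]
  have hin : ∀ {σ : State}, Node Q b x σ → ∀ {v f : IExp} {i : ℕ} {t : Bool}, v.eval σ = i →
      (∀ τ : State, f.eval τ = if t then 1 else 0) →
      Pushed 9 (4 * d + 1) 1 ⟨t, i, cubeAt x.hull (WithLp.toLp 2 x.lo)⟩ σ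
        ((pushStack d v f (.reg 9) (innerCor d)).run σ) := fun hN _ _ _ _ hv hf =>
    pushed_push hv (fun τ _ => hf τ) (fun τ h => by simp [h, hN.hull, cubeAt])
      (fun τ h h' => eval_innerCor (hN.congr (by simp [h]) h'))
  have p1 := hin hN (v := .reg 2) (f := .const 1) (i := c.length) (t := true) h.nc (by simp)
  generalize (pushStack d (.reg 2) (.const 1) (.reg 9) (innerCor d)).run σ = σ₁ at p1 ⊢
  have h1 := h.pushStack p1 (show (st.length : ℤ) < B by omega)
  have n1 := hN.pushed p1 (by omega)
  have p2 := hin n1 (v := .const 0) (f := .const 0) (i := 0) (t := false) (by simp) (by simp)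
  generalize (pushStack d (.const 0) (.const 0) (.reg 9) (innerCor d)).run σ₁ = σ₂ at p2 ⊢
  have h2 := h1.pushStack p2 (by simpa using hs)
  have n2 := n1.pushed p2 (by omega)
  have p3 := pushed_pushEvent (v := .reg 2) (f := .const 0) (i := c.length) (t := false)
    n2.loaded h2.nc (by simp)
  generalize (pushEvent d (.reg 2) (.const 0)).run σ₂ = σ₃ at p3 ⊢
  have h3 := h2.pushEvent p3 he
  have n3 := n2.pushed p3 (by omega)
  obtain ⟨q1, q2, q3, q4, q5, q6, q7⟩ := run_putCube (σ := σ₃) (a := 3) (b := 2 * d + 1)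
    (z := .reg 2) (f := .const 1) (l := .reg 9) (x := innerCor d) (y := σ₃.ireg 2) (u := 1)
    (v := x.hull) (c := (cubeAt x.hull (WithLp.toLp 2 x.lo)).corner)
    (fun τ h => by simp [h]) (fun τ h => by simp) (fun τ h => by simp [h, n3.hull])
    (fun τ h h' => eval_innerCor (n3.congr (by simp [h]) h'))
  generalize (putCube d 3 (2 * d + 1) (.reg 2) (.const 1) (.reg 9) (innerCor d)).run σ₃ = σ₄ at *
  have h4 := h3.putInner (σ' := σ₄) hc q1 q2 q6 q7
  have n4 : Node Q b x σ₄ := n3.congr (by simp [q1]) q2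
  exact h4.pushCell (o := some _) (pushed_pushCell n4.loaded n4.label) hc (by rw [q1]; exact ⟨q3, q4, q5⟩)

theorem run_split {B : ℤ} {st : List (Rec d)} {c : List (Cell d × Fin n)} {e : List (Rec d)}
    {b : Fin n} {x : Net.Scan d} (h : Rep I B ⟨st, c, e⟩ σ) (hN : Node Q b x σ)
    (hs : st.length + 2 ^ d ≤ B) :
    Rep I B (treat Q st c e .split) ((split d).run σ) := by
  have := Cmd.run_unroll (m := 2 ^ d) (f := fun m => pushStack d (.const 0) (.const 0)
    (.reg 8 + .const 1) (childCor (2 ^ d - 1 - m)))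
    (fun m σ => Rep I B ⟨childList Q (2 ^ d - m) m ++ st, c, e⟩ σ ∧ Node Q b x σ) ?_
    ⟨by simpa [childList] using h, hN⟩
  · simpa [treat, split] using this.1
  · rintro m τ hm ⟨hR, hN⟩
    have p1 : Pushed 9 (4 * d + 1) 1 ⟨false, 0, Q.child (2 ^ d - 1 - m)⟩ τ
        ((pushStack d (.const 0) (.const 0) (.reg 8 + .const 1)
          (childCor (2 ^ d - 1 - m))).run τ) := by
      refine pushed_push (by simp) (fun τ _ => by simp)
        (fun τ' h => by simp [h, hN.loaded.level, Cube.child]) fun τ' h h' k => ?_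
      simp only [Cube.child_corner, childCor]
      split_ifs <;> simp [cor, h, h', hN.loaded.corner, hN.loaded.level]
    refine ⟨?_, hN.pushed p1 (by omega)⟩
    have := hR.pushStack p1 (by
      simp [childList]
      have : (m : ℤ) < 2 ^ d := by exact_mod_cast hm
      omega)
    have e1 : 2 ^ d - (m + 1) = 2 ^ d - 1 - m := by omega
    have e2 : 2 ^ d - m = 2 ^ d - 1 - m + 1 := by omega
    rw [e2] at this
    rw [e1]
    simpa [childList, List.range'_succ] using this

theorem run_choose {B : ℤ} {st : List (Rec d)} {c : List (Cell d × Fin n)} {e : List (Rec d)}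
    {b : Fin n} {x : Net.Scan d} (h : Rep I B ⟨st, c, e⟩ σ) (hN : Node Q b x σ)
    (hs : st.length + 2 ^ d ≤ B) (hs' : st.length + 1 < B) (hc : c.length < B)
    (he : e.length < B) :
    Rep I B (treat Q st c e (x.outcome Q b x.hull)) ((choose d).run σ) := by
  unfold Net.Scan.outcome choose
  split_ifs with h1 h2 h3
  · rw [Cmd.run_cond_pos (by simp [hN.scanned.heavy, h1])]
    exact run_split h hN hs
  all_goals rw [Cmd.run_cond_neg (by simp [hN.scanned.heavy, h1])]
  · rw [Cmd.run_cond_pos (by simp [hN.scanned.bad, h2])]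
    exact run_leaf h hN hc he
  all_goals rw [Cmd.run_cond_neg (by simp [hN.scanned.bad, h2])]
  · rw [Cmd.run_cond_pos (by simpa [hN.hull, hN.loaded.level] using h3)]
    exact run_split h hN hs
  · rw [Cmd.run_cond_neg (by simpa [hN.hull, hN.loaded.level] using h3)]
    exact run_jump h hN hs' hc he

/-- One step of the traversal costs a constant times `n + 1`: only the choice of the label and the
scan run through the sites. -/
theorem runs_body {B : ℤ} {x : Conf d n} (h : Rep I B x σ) (hne : x.stack ≠ [])
    (hs : x.stack.length + 2 ^ d ≤ B) (hc : x.cells.length < B)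
    (he : x.events.length < B) :
    Runs (body d) σ ((body d).size * (n + 1)) (Rep I B (Conf.next I.out x)) := by
  obtain ⟨_ | ⟨r, st⟩, c, e⟩ := x
  · exact absurd rfl hne
  simp only [List.length_cons, Nat.cast_add, Nat.cast_one] at hs hc he
  have h2 : (2 : ℤ) ≤ 2 ^ d := by
    calc (2 : ℤ) = 2 ^ 1 := (pow_one 2).symm
      _ ≤ 2 ^ d := pow_le_pow_right₀ (by norm_num) I.hd
  obtain ⟨hR, h11, h12, hQ⟩ := run_pop h
  refine Runs.block_cons (Runs.of_straight straight_pop (by omega) rfl) ?_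
  rintro _ rfl
  generalize (pop d).run σ = σ at *
  refine Runs.block_cons (Φ := Rep I B (Conf.next I.out ⟨r :: st, c, e⟩)) ?_
    fun _ h => Runs.block_nil (by omega) h
  have hle : ∀ t a b : ℕ, t + a * (n + 1) ≤ (t + a + b) * (n + 1) ∧
      t + b * (n + 1) ≤ (t + a + b) * (n + 1) := by
    intro t a b
    have := Nat.zero_le (t * n)
    have := Nat.zero_le (a * n)
    have := Nat.zero_le (b * n)
    constructor <;> ring_nf <;> omega
  by_cases hr : r.resume = true
  · refine (Runs.cond (T := (pushEvent d (.reg 12) (.const 1)).size * (n + 1))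
      (Φ := Rep I B (Conf.next I.out ⟨r :: st, c, e⟩)) (fun _ => ?_) fun hb => ?_).mono
      (hle _ _ _).1 fun _ h => h
    · refine Runs.of_straight straight_push (by omega) ?_
      have p := pushed_pushEvent (v := .reg 12) (f := .const 1) (i := r.id) (t := true) hQ h12
        (by simp)
      have := hR.pushEvent p he
      simp only [Conf.next, hr, if_true]
      obtain ⟨rr, ri, rc⟩ := r
      simp only at hr
      subst hr
      exact this
    · exact absurd (by simp [h11, hr]) hb
  · refine (Runs.cond (T := (Cmd.block [pick d, scan d, hull d, choose d]).size * (n + 1))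
      (Φ := Rep I B (Conf.next I.out ⟨r :: st, c, e⟩)) (fun hb => ?_) fun _ => ?_).mono
      (hle _ _ _).2 fun _ h => h
    · exact absurd hb (by simp [h11, hr])
    · have hcg : ∀ {c' : Cmd} {σ σ' : State} {x : Conf d n}, Rep I B x σ → c'.Frame σ σ' →
          (∀ r < 4, ¬ c'.SetsI r) → ¬ c'.SetsR 0 → (∀ a, ¬ c'.StoresI a) → (∀ a, ¬ c'.StoresR a) →
          Rep I B x σ' := fun h hf h1 h2 h3 h4 =>
        h.congr (fun r hr => hf.ireg r (h1 r hr)) (hf.rreg 0 h2) (funext fun a => hf.iarr a (h3 a))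
          (funext fun a => hf.rarr a (h4 a))
      refine Runs.block_cons (runs_pick hR.base hQ).frame ?_
      rintro σ₁ ⟨⟨b1, l1, e1⟩, f1⟩
      have R1 := hcg hR f1 (by intro r hr; simp [pick, inc]; omega) (by simp [pick, inc])
        (by simp [pick, inc]) (by simp [pick, inc])
      refine Runs.block_cons (runs_scan b1 l1 e1).frame ?_
      rintro σ₂ ⟨⟨b2, l2, e2, s2⟩, f2⟩
      have R2 := hcg R1 f2 (by intro r hr; simp [scan, inc]; omega)
        (by simp [scan, inc]; omega) (by simp [scan, inc]) (by simp [scan, inc])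
      refine Runs.block_cons (Runs.of_straight straight_hull (by omega) rfl) ?_
      rintro _ rfl
      have f3 : (hull d).Frame σ₂ _ := straight_hull.frame σ₂
      have hset : ∀ r, r < 9 → ¬ (hull d).SetsI r := by
        intro r hr
        simp only [hull, Cmd.setsI_unroll, not_exists, not_and]
        intro k _
        split_ifs <;> simp <;> omega
      have hs0 : ∀ r, ¬ (hull d).SetsR r := by
        intro r
        simp only [hull, Cmd.setsR_unroll, not_exists, not_and]
        intro k _
        split_ifs <;> simp
      have ha0 : ∀ r, ¬ (hull d).StoresI r := by
        intro r
        simp only [hull, Cmd.storesI_unroll, not_exists, not_and]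
        intro k _
        split_ifs <;> simp
      have ha1 : ∀ r, ¬ (hull d).StoresR r := by
        intro r
        simp only [hull, Cmd.storesR_unroll, not_exists, not_and]
        intro k _
        split_ifs <;> simp
      have R3 := hcg R2 f3 (fun r hr => hset r (by omega)) (hs0 0) ha0 ha1
      have N3 : Node r.cube (I.pick r.cube n) (I.scan r.cube (I.pick r.cube n) n)
          ((hull d).run σ₂) :=
        ⟨⟨(f3.ireg 8 (hset 8 (by omega))).trans l2.level,
          fun k => (f3.rreg _ (hs0 _)).trans (l2.corner k)⟩,
          (f3.ireg 5 (hset 5 (by omega))).trans e2,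
          ⟨(f3.ireg 6 (hset 6 (by omega))).trans s2.bad,
            (f3.ireg 7 (hset 7 (by omega))).trans s2.heavy,
            fun k => (f3.rreg _ (hs0 _)).trans (s2.lo k),
            fun k => (f3.rreg _ (hs0 _)).trans (s2.hi k)⟩, runs_hull I.hd s2⟩
      refine Runs.block_cons (Φ := Rep I B (Conf.next I.out ⟨r :: st, c, e⟩))
        (Runs.of_straight straight_choose (by omega) ?_) fun _ h => Runs.block_nil (by omega) h
      have := run_choose R3 N3 (by omega) (by omega) hc he
      simpa [Conf.next, hr, Net.out] using this

end Prog

namespace Prog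

variable {d n : ℕ} {σ σ' : State}

/-! ### The net -/

/-- The memory holds the input. -/
structure Input (s : Fin n → EuclideanSpace ℝ (Fin d)) (w : Fin n → ℝ) (ε : ℝ) (σ : State) :
    Prop where
  num : σ.ireg 0 = n
  eps : σ.rreg 0 = ε
  site : ∀ (k : Fin d) (i : Fin n), σ.rarr k (i : ℕ) = s i k
  weight : ∀ i : Fin n, σ.rarr d (i : ℕ) = w i

theorem Input.congr {s : Fin n → EuclideanSpace ℝ (Fin d)} {w : Fin n → ℝ} {ε : ℝ}
    (h : Input s w ε σ) (h0 : σ'.ireg 0 = σ.ireg 0) (h1 : σ'.rreg 0 = σ.rreg 0)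
    (hr : ∀ (a : ℕ) (z : ℤ), a ≤ d → σ'.rarr a z = σ.rarr a z) : Input s w ε σ' :=
  ⟨h0.trans h.num, h1.trans h.eps, fun k i => (hr _ _ (by omega)).trans (h.site k i),
    fun i => (hr _ _ le_rfl).trans (h.weight i)⟩

/-- The value `v` is right for the site `a`, considering only heavier sites with numbers less
than `m`. -/
def RowOK (s : Fin n → EuclideanSpace ℝ (Fin d)) (w κ : Fin n → ℝ) (a : Fin n) (m : ℕ) (v : ℝ) :
    Prop :=
  0 ≤ v ∧ (∀ c : Fin n, a < c → (c : ℕ) < m → 2 * κ c * (w a * ‖s a - s c‖ / w c) ≤ 1 →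
    1 ≤ v * (w a * ‖s a - s c‖ / w c)) ∧
  (v = 0 ∨ ∃ c, a < c ∧ 2 * κ c * (w a * ‖s a - s c‖ / w c) ≤ 1 ∧
    v * (w a * ‖s a - s c‖ / w c) = 1)

theorem RowOK.congr {s : Fin n → EuclideanSpace ℝ (Fin d)} {w κ κ' : Fin n → ℝ} {a : Fin n} {m : ℕ}
    {v : ℝ} (h : RowOK s w κ a m v) (hκ : ∀ c, a < c → κ' c = κ c) : RowOK s w κ' a m v := by
  refine ⟨h.1, fun c hc hm h' => h.2.1 c hc hm (hκ c hc ▸ h'), h.2.2.imp id ?_⟩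
  rintro ⟨c, hc, h'⟩
  exact ⟨c, hc, by rw [hκ c hc]; exact h'⟩

variable (d)

def phi : RExp :=
  weight d 4 * .sqrt (.sum (fun k => (site 4 k - site 13 k).sq) d) / weight d 13

def row : Cmd :=
  .loop (more 13) (.block [.rset 3 (phi d),
    .cond (.both (.rle (two * kap d 13 * .reg 3) one) (.rle (.reg 2 * .reg 3) one))
      (.rset 2 (one / .reg 3)) .skip, inc 13])

/-- The sites are treated from the heaviest down, because the value for a site depends only on the
final values for heavier ones. -/
def net : Cmd :=
  .block [.iset 4 (.reg 0 - .const 1), .loop (.ile (.const 0) (.reg 4)) (.block [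
    .rset 2 (.const 0), .iset 13 (.reg 4 + .const 1), row d, .rstore (5 * d + 1) (.reg 4) (.reg 2),
    .iset 4 (.reg 4 - .const 1)])]

variable {d} {s : Fin n → EuclideanSpace ℝ (Fin d)} {w : Fin n → ℝ} {ε : ℝ}

theorem eval_phi (h : Input s w ε σ) {a c : Fin n} (ha : σ.ireg 4 = (a : ℕ))
    (hc : σ.ireg 13 = (c : ℕ)) : (phi d).eval σ = w a * ‖s a - s c‖ / w c := by
  simp [phi, weight, site, ha, hc, h.weight, h.site, EuclideanSpace.norm_eq]

/-- The value in register `2` is replaced by `1 / phi` only when this does not decrease it, so the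
requirements for earlier sites persist, and the last replacement is the witness. -/
theorem runs_row (hs : Function.Injective s) (hw : ∀ i, 0 < w i) {a : Fin n}
    (h : Input s w ε σ) (ha : σ.ireg 4 = (a : ℕ)) (h13 : σ.ireg 13 = (a + 1 : ℕ))
    (h2 : σ.rreg 2 = 0) :
    Runs (row d) σ ((row d).size * (n + 1)) fun σ' =>
      RowOK s w (fun i => σ.rarr (5 * d + 1) (i : ℕ)) a n (σ'.rreg 2) := by
  have := Runs.for (r := 13) (a := a + 1) (n := n) (m := 1) (c := .block [.rset 3 (phi d),
    .cond (.both (.rle (two * kap d 13 * .reg 3) one) (.rle (.reg 2 * .reg 3) one))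
      (.rset 2 (one / .reg 3)) .skip, inc 13])
    (fun i τ => Input s w ε τ ∧ τ.ireg 13 = i ∧ τ.ireg 4 = (a : ℕ) ∧ τ.rarr = σ.rarr ∧
      RowOK s w (fun i => σ.rarr (5 * d + 1) (i : ℕ)) a i (τ.rreg 2))
    (fun i σ h => ⟨h.1.num, h.2.1⟩) (σ := σ) ?_ (by omega) le_rfl ?_
  · rw [one_mul] at this
    exact this.mono le_rfl fun σ' h => h.2.2.2.2
  · rintro i τ hai hi ⟨t1, t2, t3, t4, t5, t6, t7⟩
    refine Runs.of_straight (by simp [inc]) le_rfl ?_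
    have hac : a < (⟨i, hi⟩ : Fin n) := hai
    have e1 : (phi d).eval τ = w a * ‖s a - s ⟨i, hi⟩‖ / w ⟨i, hi⟩ :=
      eval_phi (c := ⟨i, hi⟩) t1 t3 t2
    have hφ : 0 < w a * ‖s a - s ⟨i, hi⟩‖ / w ⟨i, hi⟩ := by
      have := hw a
      have := hw ⟨i, hi⟩
      have : 0 < ‖s a - s ⟨i, hi⟩‖ := norm_pos_iff.2 (sub_ne_zero.2 fun h => hac.ne (hs h))
      positivity
    set φ := w a * ‖s a - s ⟨i, hi⟩‖ / w ⟨i, hi⟩ with hφd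
    simp only [Cmd.run_block_cons, Cmd.run_block_nil]
    have hb : (Test.both (.rle (two * kap d 13 * .reg 3) one) (.rle (.reg 2 * .reg 3) one)).Holds
        ((Cmd.rset 3 (phi d)).run τ) ↔
        2 * σ.rarr (5 * d + 1) (i : ℕ) * φ ≤ 1 ∧ τ.rreg 2 * φ ≤ 1 := by
      simp [kap, e1, t2, t4]
    have mono : ∀ v, τ.rreg 2 ≤ v → (2 * σ.rarr (5 * d + 1) (i : ℕ) * φ ≤ 1 → 1 ≤ v * φ) →
        ∀ c : Fin n, a < c → (c : ℕ) < i + 1 →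
          2 * σ.rarr (5 * d + 1) (c : ℕ) * (w a * ‖s a - s c‖ / w c) ≤ 1 →
          1 ≤ v * (w a * ‖s a - s c‖ / w c) := by
      intro v hv h c hc hci hk
      rcases Nat.lt_succ_iff_lt_or_eq.1 hci with hci | hci
      · refine (t6 c hc hci hk).trans (mul_le_mul_of_nonneg_right hv ?_)
        have := hw a
        have := hw c
        positivity
      · obtain rfl : c = ⟨i, hi⟩ := Fin.ext hci
        exact h hk
    by_cases hcase : 2 * σ.rarr (5 * d + 1) (i : ℕ) * φ ≤ 1 ∧ τ.rreg 2 * φ ≤ 1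
    · rw [Cmd.run_cond_pos (hb.2 hcase)]
      refine ⟨t1.congr (by simp [inc]) (by simp [inc]) (by simp [inc]), by simp [inc, t2],
        by simp [inc, t3], by simp [inc, t4], ?_⟩
      have e2 : ((inc 13).run ((Cmd.rset 2 (one / .reg 3)).run ((Cmd.rset 3 (phi d)).run τ))).rreg 2
          = 1 / φ := by simp [inc, e1]
      rw [e2]
      refine ⟨by positivity, mono _ ((le_div_iff₀ hφ).2 hcase.2) fun _ => ?_,
        Or.inr ⟨⟨i, hi⟩, hac, hcase.1, ?_⟩⟩
      · rw [one_div_mul_cancel hφ.ne']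
      · exact one_div_mul_cancel hφ.ne'
    · rw [Cmd.run_cond_neg (mt hb.1 hcase)]
      refine ⟨t1.congr (by simp [inc]) (by simp [inc]) (by simp [inc]), by simp [inc, t2],
        by simp [inc, t3], by simp [inc, t4], ?_⟩
      have e2 : ((inc 13).run (Cmd.skip.run ((Cmd.rset 3 (phi d)).run τ))).rreg 2 = τ.rreg 2 := by
        simp [inc]
      rw [e2]
      refine ⟨t5, mono _ le_rfl fun h => ?_, t7⟩
      by_contra hlt
      exact hcase ⟨h, (not_le.1 hlt).le⟩
  · refine ⟨h, h13, ha, rfl, ?_⟩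
    rw [h2]
    exact ⟨le_rfl, fun c hc hm => by simp only [Fin.lt_def] at hc; omega, Or.inl rfl⟩

theorem runs_net (hd : 1 ≤ d) (hn : 1 ≤ n) (hs : Function.Injective s) (hw : ∀ i, 0 < w i)
    (hmono : Monotone w) (hε : 0 < ε) (hε' : ε ≤ 1 / 4) (h : Input s w ε σ)
    (h0 : ∀ z : ℤ, z < 0 ∨ (n : ℤ) ≤ z → σ.rarr (5 * d + 1) z = 0) :
    Runs (net d) σ ((net d).size * ((n + 1) * (n + 1))) fun σ' => ∃ I : Net d n,
      I.s = s ∧ I.w = w ∧ I.eps = ε ∧ I.Base σ' ∧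
      ∀ z : ℤ, z < 0 ∨ (n : ℤ) ≤ z → σ'.rarr (5 * d + 1) z = 0 := by
  have hpos : 1 ≤ (n + 1) * (n + 1) := Nat.mul_pos n.succ_pos n.succ_pos
  refine Runs.block_cons (Runs.of_straight (by trivial) hpos rfl) ?_
  rintro _ rfl
  refine Runs.block_cons (Φ := fun σ' => ∃ I : Net d n, I.s = s ∧ I.w = w ∧ I.eps = ε ∧
    I.Base σ' ∧ ∀ z : ℤ, z < 0 ∨ (n : ℤ) ≤ z → σ'.rarr (5 * d + 1) z = 0) ?_
    fun _ h => Runs.block_nil hpos h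
  obtain ⟨c, hc⟩ : ∃ c, c = Cmd.block [.rset 2 (.const 0), .iset 13 (.reg 4 + .const 1), row d,
    .rstore (5 * d + 1) (.reg 4) (.reg 2), .iset 4 (.reg 4 - .const 1)] := ⟨_, rfl⟩
  rw [← hc]
  refine (Runs.loop (T := c.size * (n + 1)) (N := n) (fun i τ => Input s w ε τ ∧
    τ.ireg 4 = (n : ℤ) - 1 - i ∧ (∀ z : ℤ, z < 0 ∨ (n : ℤ) ≤ z → τ.rarr (5 * d + 1) z = 0) ∧
    ∀ a : Fin n, n ≤ a + i → RowOK s w (fun j => τ.rarr (5 * d + 1) (j : ℕ)) a n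
      (τ.rarr (5 * d + 1) (a : ℕ))) ?_ ?_ ?_).mono ?_ ?_
  · rintro i τ hi ⟨t1, t2, t3, t4⟩ -
    rw [hc]
    refine Runs.block_cons (Runs.of_straight (by trivial) (by omega) rfl) ?_
    rintro _ rfl
    refine Runs.block_cons (Runs.of_straight (by trivial) (by omega) rfl) ?_
    rintro _ rfl
    have ha : n - 1 - i < n := by omega
    have e4 : τ.ireg 4 = ((⟨n - 1 - i, ha⟩ : Fin n) : ℕ) := by rw [t2]; simp only; omega
    refine Runs.block_cons (runs_row (s := s) (w := w) (ε := ε) (a := ⟨n - 1 - i, ha⟩) hs hw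
      (t1.congr (by simp) (by simp) (by simp)) (by simp [e4]) (by simp [e4]) (by simp)).frame ?_
    rintro τ' ⟨hrow, hf⟩
    refine Runs.block_cons (Runs.of_straight (by trivial) (by omega) rfl) ?_
    rintro _ rfl
    refine Runs.block_cons (Runs.of_straight (by trivial) (by omega) rfl) ?_
    rintro _ rfl
    refine Runs.block_nil (by omega) ?_
    have f1 : τ'.ireg 4 = (n - 1 - i : ℕ) := by
      rw [hf.ireg 4 (by simp [row, inc])]; simp [e4]
    have f2 : τ'.ireg 0 = n := by
      rw [hf.ireg 0 (by simp [row, inc])]; simp [t1.num]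
    have f3 : τ'.rreg 0 = ε := by
      rw [hf.rreg 0 (by simp [row, inc])]; simp [t1.eps]
    have f4 : τ'.rarr = τ.rarr := by
      funext a
      rw [hf.rarr a (by simp [row, inc])]; simp
    simp only [Cmd.run, setRreg_rarr, setIreg_rarr] at hrow ⊢
    refine ⟨?_, ?_, ?_, ?_⟩
    · refine ⟨by simp [f2], by simp [f3], fun k i => ?_, fun i => ?_⟩
      · simp only [setIreg_rarr, setRarr_rarr]
        rw [if_neg (by omega), f4, t1.site]
      · simp only [setIreg_rarr, setRarr_rarr]
        rw [if_neg (by omega), f4, t1.weight]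
    · simp [f1]; omega
    · intro z hz
      simp only [setRarr_rarr, IExp.eval_reg, f1]
      rw [if_neg (by omega), f4, t3 z hz]
    · intro a han
      simp only [setRarr_rarr, IExp.eval_reg, f1, f4, RExp.eval_reg, true_and]
      by_cases hai : (a : ℕ) = n - 1 - i
      · obtain rfl : a = ⟨n - 1 - i, ha⟩ := Fin.ext hai
        rw [if_pos rfl]
        refine hrow.congr fun c hc => ?_
        rw [if_neg]
        rw [Fin.lt_def] at hc
        simp only at hc
        omega
      · rw [if_neg (by omega)]
        refine (t4 a (by omega)).congr fun c hc => ?_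
        rw [if_neg]
        rw [Fin.lt_def] at hc
        omega
  · rintro τ ⟨-, t2, -⟩
    simp [t2]
  · refine ⟨h.congr (by simp) (by simp) (by simp), by simp [h.num], by simpa using h0, ?_⟩
    intro a ha
    have := a.2
    omega
  · simp only [Cmd.size, Test.cost, IExp.cost]
    have := Nat.zero_le (n * n)
    have := Nat.zero_le n
    have := Nat.zero_le (c.size * n)
    ring_nf
    omega
  · rintro τ ⟨i, hi, ⟨t1, t2, t3, t4⟩, hb⟩
    simp only [Test.holds_ile, IExp.eval_const, IExp.eval_reg, t2] at hb
    obtain rfl : i = n := by omega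
    refine ⟨⟨s, w, ε, fun j => τ.rarr (5 * d + 1) (j : ℕ), hd, hn, hs, hw, hmono, hε, hε', ?_, ?_,
      ?_⟩, rfl, rfl, rfl, ⟨t1.num, t1.eps, t1.site, t1.weight, fun _ => rfl⟩, t3⟩
    · exact fun a => (t4 a (by omega)).1
    · exact fun a c hac => (t4 a (by omega)).2.1 c hac c.2
    · exact fun a => (t4 a (by omega)).2.2

end Prog

/-! ### Growth of the configuration and its initial value -/

theorem Conf.next_length {d n : ℕ} (hd : 1 ≤ d) (out : Cube d → Outcome d n) (x : Conf d n) (i : ℕ) :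
    ((Conf.next out)^[i] x).stack.length ≤ x.stack.length + i * 2 ^ d ∧
    ((Conf.next out)^[i] x).cells.length ≤ x.cells.length + i ∧
    ((Conf.next out)^[i] x).events.length ≤ x.events.length + i := by
  induction i with
  | zero => simp
  | succ i ih =>
    rw [Function.iterate_succ_apply']
    obtain ⟨h1, h2, h3⟩ := ih
    have h4 : (1 : ℕ) ≤ 2 ^ d := Nat.one_le_two_pow
    generalize (Conf.next out)^[i] x = y at *
    rw [add_mul]
    obtain ⟨_ | ⟨r, st⟩, c, e⟩ := y
    · simp only [Conf.next, List.length_nil] at *; omega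
    · simp only [Conf.next, List.length_cons] at *
      split_ifs
      · simp only [List.length_append, List.length_singleton]; omega
      · cases ho : out r.cube with
        | leaf b =>
          simp only [treat, List.length_append, List.length_singleton]
          omega
        | jump b P =>
          have h5 : (2 : ℕ) ≤ 2 ^ d := by
            calc 2 = 2 ^ 1 := rfl
              _ ≤ 2 ^ d := Nat.pow_le_pow_right (by norm_num) hd
          simp only [treat, List.length_append, List.length_cons, List.length_nil]
          omega
        | split =>
          simp only [treat, childList, List.length_append, List.length_map, List.length_range']
          omega

namespace Net

variable {d n : ℕ} (I : Net d n)

/-- The sum of `1 + x ^ 2` bounds the sum of the `|x|` without absolute values; the factor `4 / eps`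
suffices for the heaviest site to be a good label outside the box of this extent. -/
def extent : ℝ := 1 + 4 / I.eps * ∑ j, ∑ k, (1 + I.s j k ^ 2)

def root : Cube d := cubeAt (commonLevel (-I.extent) I.extent) (WithLp.toLp 2 fun _ => -I.extent)

def heaviest : Fin n := ⟨n - 1, by have := I.hn; omega⟩

/-- The state right after a jump from the whole space to the root: cell `0` is the complement of the
root, and the entry below the root on the stack resumes it. -/
def start : Conf d n :=
  ⟨[⟨false, 0, I.root⟩, ⟨true, 0, I.root⟩], [(⟨none, some I.root⟩, I.heaviest)],
    [⟨false, 0, I.root⟩]⟩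

end Net

namespace Prog

variable (d : ℕ)

/-! ### The construction program -/

def extent : Cmd :=
  .block [.rset 1 (.const 0), .iset 4 (.const 0), .loop (more 4) (.block [
    .rset 1 (.reg 1 + .sum (fun k => one + (site 4 k).sq) d), inc 4]),
    .rset 1 (one + .const 4 / .reg 0 * .reg 1), .level 8 (.const 0 - .reg 1) (.reg 1),
    .unroll (fun k => .rset (4 + k) (.corner (.reg 8) (.const 0 - .reg 1))) d]

def init : Cmd :=
  .block [.iset 1 (.const 0), .iset 2 (.const 0), .iset 3 (.const 0),
    .iset 5 (.reg 0 - .const 1), putCube d 3 (2 * d + 1) (.reg 2) (.const 1) (.reg 8) cor,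
    push d 0 (d + 1) 2 (.reg 5) (.const 0) (.reg 8) cor, pushEvent d (.const 0) (.const 0),
    pushStack d (.const 0) (.const 1) (.reg 8) cor, pushStack d (.const 0) (.const 0) (.reg 8) cor]

def traverse : Cmd := .loop (.ile (.const 1) (.reg 1)) (body d)

/-- Integers can neither be multiplied nor halved, so the step lengths for the bisection are
tabulated by doubling. -/
def powers : Cmd :=
  .block [.iset 4 (.const 1), .iset 9 (.const 0), .loop (.ile (.reg 4) (.reg 3)) (.block [
    .istore 12 (.reg 9) (.reg 4), .iset 4 (.reg 4 + .reg 4), inc 9]),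
    .istore 5 (.const 0) (.reg 2), .istore 5 (.const 1) (.reg 3), .istore 5 (.const 2) (.reg 9)]

def build : Cmd := .block [net d, extent d, init d, traverse d, powers]

variable {d} {n : ℕ} {I : Net d n} {σ σ' : State}

theorem runs_extent (hB : I.Base σ) :
    Runs (extent d) σ ((extent d).size * (n + 1)) fun σ' => I.Base σ' ∧ I.root.Loaded σ' ∧
      σ'.iarr = σ.iarr ∧ σ'.rarr = σ.rarr := by
  have h1n : 1 ≤ n + 1 := by omega
  have hf : ∀ {c : Cmd} {T : ℕ} {Φ : State → Prop}, Runs c σ T Φ →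
      (∀ a, ¬ c.StoresI a) → (∀ a, ¬ c.StoresR a) → Runs c σ T fun σ' => Φ σ' ∧
      σ'.iarr = σ.iarr ∧ σ'.rarr = σ.rarr := fun h h1 h2 =>
    h.frame.mono le_rfl fun σ' h => ⟨h.1, funext fun a => h.2.iarr a (h1 a),
      funext fun a => h.2.rarr a (h2 a)⟩
  refine (hf (Φ := fun σ' => I.Base σ' ∧ I.root.Loaded σ') ?_ (by simp [extent, inc])
    (by simp [extent, inc])).mono le_rfl fun σ' h => ⟨h.1.1, h.1.2, h.2⟩
  refine Runs.block_cons (Runs.of_straight (by trivial) h1n rfl) ?_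
  rintro _ rfl
  refine Runs.block_cons (Runs.of_straight (by trivial) h1n rfl) ?_
  rintro _ rfl
  refine Runs.block_cons (Φ := fun τ => I.Base τ ∧ τ.rreg 1 = ∑ j, ∑ k, (1 + I.s j k ^ 2)) ?_ ?_
  · have := Runs.for (r := 4) (a := 0) (n := n) (m := 1) (c := .block [
      .rset 1 (.reg 1 + .sum (fun k => one + (site 4 k).sq) d), inc 4])
      (fun i τ => I.Base τ ∧ τ.ireg 4 = i ∧ τ.rreg 1 = ∑ j ∈ Finset.range i,
        if h : j < n then ∑ k, (1 + I.s ⟨j, h⟩ k ^ 2) else 0) (fun i σ h => ⟨h.1.num, h.2.1⟩)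
      (σ := (Cmd.iset 4 (.const 0)).run ((Cmd.rset 1 (.const 0)).run σ)) ?_ (by omega) le_rfl
      ⟨(hB.setRreg (by omega)).setIreg (by omega), by simp, by simp⟩
    · rw [one_mul] at this
      refine this.mono le_rfl fun τ h => ⟨h.1, h.2.2.trans ?_⟩
      rw [Finset.sum_range]
      exact Finset.sum_congr rfl fun j _ => dif_pos j.2
    · rintro i τ - hi ⟨t1, t2, t3⟩
      refine Runs.of_straight (by simp [inc]) le_rfl ?_
      refine ⟨(t1.setRreg (by omega)).setIreg (by omega), by simp [inc, t2], ?_⟩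
      rw [Finset.sum_range_succ, dif_pos hi]
      have : ∀ k : Fin d, (site 4 k).eval τ = I.s ⟨i, hi⟩ k := fun k => eval_site t1 t2 k
      simp [inc, this, t3]
  · rintro τ ⟨t1, t2⟩
    refine Runs.of_straight ?_ h1n ?_
    · exact ⟨trivial, trivial, Cmd.straight_unroll fun _ => trivial, trivial⟩
    simp only [Cmd.run_block_cons, Cmd.run_block_nil]
    have e1 : (Cmd.rset 1 (one + .const 4 / .reg 0 * .reg 1)).run τ = τ.setRreg 1 I.extent := by
      simp [t1.eps, t2, Net.extent]
    rw [e1]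
    have e2 : (Cmd.level 8 (.const 0 - .reg 1) (.reg 1)).run (τ.setRreg 1 I.extent)
        = (τ.setRreg 1 I.extent).setIreg 8 I.root.level := by
      simp [Net.root, cubeAt]
    rw [e2]
    obtain ⟨τ₀, hτ₀⟩ : ∃ τ₀, τ₀ = (τ.setRreg 1 I.extent).setIreg 8 I.root.level := ⟨_, rfl⟩
    rw [← hτ₀]
    have b0 : I.Base τ₀ := by
      rw [hτ₀]; exact (t1.setRreg (by omega)).setIreg (by omega)
    have := Cmd.run_unroll (m := d)
      (f := fun k => .rset (4 + k) (.corner (.reg 8) (.const 0 - .reg 1)))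
      (fun m σ => I.Base σ ∧ σ.ireg 8 = I.root.level ∧ σ.rreg 1 = I.extent ∧
        ∀ k : Fin d, k < m → σ.rreg (4 + k) = I.root.corner k) ?_ (σ := τ₀)
      ⟨b0, by rw [hτ₀]; simp, by rw [hτ₀]; simp, by simp⟩
    · exact ⟨this.1, this.2.1, fun k => this.2.2.2 k k.2⟩
    · rintro m σ hm ⟨h1, h2, h3, h4⟩
      refine ⟨h1.setRreg (by omega), h2, by simp [h3]; omega, fun k hk => ?_⟩
      simp only [Cmd.run, setRreg_rreg]
      split_ifs with hkm
      · simp [h2, h3, Net.root, cubeAt]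
      · exact h4 k (by omega)

theorem run_init {B : ℤ} (hB : I.Base σ) (hQ : I.root.Loaded σ) (hb : Bounded B σ) (h2 : 2 ≤ B) :
    Rep I B I.start ((init d).run σ) := by
  simp only [init, Cmd.run_block_cons, Cmd.run_block_nil]
  obtain ⟨σ₀, h₀⟩ : ∃ σ₀, σ₀ = (Cmd.iset 5 (.reg 0 - .const 1)).run ((Cmd.iset 3 (.const 0)).run
    ((Cmd.iset 2 (.const 0)).run ((Cmd.iset 1 (.const 0)).run σ))) := ⟨_, rfl⟩
  rw [← h₀]
  have r0 : Rep I B ⟨[], [], []⟩ σ₀ := by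
    rw [h₀]
    exact ⟨hB.congr (by simp) (by simp) (by simp), by simp, by simp, by simp,
      by intro i e h; simp at h, by intro i e h; simp at h, by intro i e h; simp at h, hb⟩
  have l0 : I.root.Loaded σ₀ := by
    rw [h₀]; exact ⟨by simp [hQ.level], hQ.corner⟩
  have e0 : σ₀.ireg 5 = (I.heaviest : ℕ) := by
    have := I.hn
    rw [h₀]; simp [hB.num, Net.heaviest]; omega
  clear h₀
  have hL : ∀ {a b r : ℕ} {e : Rec d} {σ σ' : State}, I.root.Loaded σ → Pushed a b r e σ σ' →
      r ≠ 8 → I.root.Loaded σ' := fun h p hr =>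
    ⟨by rw [p.ireg, if_neg hr.symm, h.level], fun k => by rw [p.rreg, h.corner]⟩
  obtain ⟨q1, q2, q3, q4, q5, q6, q7⟩ := run_putCube (σ := σ₀) (a := 3) (b := 2 * d + 1)
    (z := .reg 2) (f := .const 1) (l := .reg 8) (x := cor) (y := σ₀.ireg 2) (u := 1)
    (v := I.root.level) (c := I.root.corner) (fun τ h => by simp [h]) (fun τ h => by simp)
    (fun τ h => by simp [h, l0.level]) (fun τ _ h k => by simp [cor, h, l0.corner])
  generalize (putCube d 3 (2 * d + 1) (.reg 2) (.const 1) (.reg 8) cor).run σ₀ = σ₁ at *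
  have r1 := r0.putInner (σ' := σ₁) (by simp; omega) q1 q2 q6 q7
  have l1 : I.root.Loaded σ₁ := ⟨by rw [q1, l0.level], fun k => by rw [q2, l0.corner]⟩
  have p2 : Pushed 0 (d + 1) 2 ⟨false, I.heaviest, I.root⟩ σ₁
      ((push d 0 (d + 1) 2 (.reg 5) (.const 0) (.reg 8) cor).run σ₁) :=
    pushed_push (by simp [q1, e0]) (fun τ _ => by simp) (fun τ h => by simp [h, l1.level])
      (fun τ _ h k => by simp [cor, h, l1.corner])
  have r2 := r1.pushCell (o := some I.root) p2 (by simp; omega) (by rw [q1]; exact ⟨q3, q4, q5⟩)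
  have l2 := hL l1 p2 (by omega)
  generalize (push d 0 (d + 1) 2 (.reg 5) (.const 0) (.reg 8) cor).run σ₁ = σ₂ at *
  have p3 := pushed_pushEvent (v := .const 0) (f := .const 0) (i := 0) (t := false) l2 (by simp)
    (by simp)
  have r3 := r2.pushEvent p3 (by simp; omega)
  have l3 := hL l2 p3 (by omega)
  generalize (pushEvent d (.const 0) (.const 0)).run σ₂ = σ₃ at *
  have p4 : ∀ {σ : State} {t : Bool} {f : IExp}, I.root.Loaded σ →
      (∀ τ : State, f.eval τ = if t then 1 else 0) → Pushed 9 (4 * d + 1) 1 ⟨t, 0, I.root⟩ σ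
      ((pushStack d (.const 0) f (.reg 8) cor).run σ) := fun l hf =>
    pushed_push (by simp) (fun τ _ => hf τ) (fun τ h => by simp [h, l.level])
      (fun τ _ h k => by simp [cor, h, l.corner])
  have p5 := p4 (f := .const 1) (t := true) l3 (by simp)
  have r4 := r3.pushStack p5 (by simp; omega)
  have l4 := hL l3 p5 (by omega)
  generalize (pushStack d (.const 0) (.const 1) (.reg 8) cor).run σ₃ = σ₄ at *
  have p6 := p4 (f := .const 0) (t := false) l4 (by simp)
  exact r4.pushStack p6 (by simp; omega)

theorem straight_init : (init d).Straight :=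
  ⟨trivial, trivial, trivial, trivial, straight_putCube, straight_push, straight_push,
    straight_push, straight_push, trivial⟩

theorem runs_traverse {B : ℤ} {x : Conf d n} {N : ℕ} (h : Rep I B x σ)
    (hN : ((Conf.next I.out)^[N] x).stack = []) (h1 : x.stack.length + N * 2 ^ d ≤ B)
    (h2 : x.cells.length + N ≤ B) (h3 : x.events.length + N ≤ B) :
    Runs (traverse d) σ ((traverse d).size * ((N + 1) * (n + 1)))
      (Rep I B ((Conf.next I.out)^[N] x)) := by
  refine (Runs.loop (T := (body d).size * (n + 1)) (N := N)
    (fun i σ => Rep I B ((Conf.next I.out)^[i] x) σ) ?_ ?_ h).mono ?_ ?_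
  · intro i τ hi hR hb
    obtain ⟨l1, l2, l3⟩ := Conf.next_length I.hd I.out x i
    have hne : ((Conf.next I.out)^[i] x).stack ≠ [] := by
      intro h0
      have := hR.sp
      rw [h0] at this
      simp [this] at hb
    have hmul : ((i + 1 : ℕ) : ℤ) * 2 ^ d ≤ N * 2 ^ d :=
      mul_le_mul_of_nonneg_right (by exact_mod_cast hi) (by positivity)
    push_cast at hmul
    rw [add_mul, one_mul] at hmul
    have l1' : ((((Conf.next I.out)^[i] x).stack.length : ℕ) : ℤ) ≤
      x.stack.length + i * 2 ^ d := by exact_mod_cast l1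
    rw [Function.iterate_succ_apply']
    exact runs_body hR hne (by omega) (by omega) (by omega)
  · intro τ hR
    have := hR.sp
    rw [hN] at this
    simp [this]
  · simp only [traverse, Cmd.size, Test.cost, IExp.cost]
    have := Nat.zero_le (n * N)
    have := Nat.zero_le n
    have := Nat.zero_le ((body d).size * n)
    ring_nf
    omega
  · rintro τ ⟨i, hi, hR, hb⟩
    have hem : ((Conf.next I.out)^[i] x).stack = [] := by
      have := hR.sp
      rw [← List.length_eq_zero_iff]
      simp [this] at hb
      exact List.length_eq_zero_iff.2 hb
    -- With an empty stack a step changes nothing, so a loop that ends early has already reached the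
    -- configuration after `N` steps.
    have hfix : Conf.next I.out ((Conf.next I.out)^[i] x) = (Conf.next I.out)^[i] x := by
      generalize (Conf.next I.out)^[i] x = y at *
      obtain ⟨st, c, e⟩ := y
      simp only at hem
      subst hem
      rfl
    rwa [show N = (N - i) + i by omega, Function.iterate_add_apply, Function.iterate_fixed hfix]

/-- The memory holds the complete structure `x`. -/
structure Stored (x : Conf d n) (B : ℤ) (K : ℕ) (σ : State) : Prop where
  cells : HasCells σ x.cells
  events : HasRecs σ 6 (3 * d + 1) x.events
  size : σ.iarr 5 0 = x.cells.length
  count : σ.iarr 5 1 = x.events.length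
  logs : σ.iarr 5 2 = K
  pow : ∀ k : ℕ, k < K → σ.iarr 12 k = 2 ^ k
  lt : x.events.length < 2 ^ K
  le : K = 0 ∨ 2 ^ (K - 1) ≤ x.events.length
  bounded : Bounded B σ

theorem runs_powers {B : ℤ} {x : Conf d n} (h : Rep I B x σ) (h3 : 3 ≤ B)
    (he : x.events.length ≤ B) :
    Runs powers σ (powers.size * (x.events.length + 1)) fun σ' => ∃ K, Stored x B K σ' := by
  have h1e : 1 ≤ x.events.length + 1 := by omega
  refine Runs.block_cons (Runs.of_straight (by trivial) h1e rfl) ?_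
  rintro _ rfl
  refine Runs.block_cons (Runs.of_straight (by trivial) h1e rfl) ?_
  rintro _ rfl
  refine Runs.block_cons (Φ := fun τ => ∃ K : ℕ, Rep I B x τ ∧ τ.ireg 9 = K ∧
    (∀ k : ℕ, k < K → τ.iarr 12 k = 2 ^ k) ∧ x.events.length < 2 ^ K ∧
    (K = 0 ∨ 2 ^ (K - 1) ≤ x.events.length)) ?_ ?_
  -- Since `m < 2 ^ m`, the number of entries bounds the rounds. This crude bound suffices, as the
  -- traversal takes at least as long.
  · refine (Runs.loop (T := 12) (N := x.events.length) (fun i τ => Rep I B x τ ∧ τ.ireg 9 = i ∧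
      τ.ireg 4 = 2 ^ i ∧ (∀ k : ℕ, k < i → τ.iarr 12 k = 2 ^ k) ∧
      (i = 0 ∨ 2 ^ (i - 1) ≤ x.events.length)) ?_ ?_ ?_).mono ?_ ?_
    · rintro i τ hi ⟨t1, t2, t3, t4, t5⟩ hb
      have hb' : 2 ^ i ≤ x.events.length := by
        simp only [Test.holds_ile, IExp.eval_reg, t3, t1.ne] at hb
        exact_mod_cast hb
      refine (Cmd.Straight.runs (by simp [inc]) ?_).mono (T' := 12) (by decide) fun _ h => h
      refine ⟨?_, by simp [inc, t2], by simp [inc, t3, pow_succ]; ring, fun k hk => ?_, ?_⟩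
      · refine ⟨t1.base.congr (by simp [inc]) (by simp [inc]) (by simp [inc]),
          by simp [inc, t1.sp], by simp [inc, t1.nc], by simp [inc, t1.ne],
          t1.stack.congr ?_ (by simp [inc]), t1.cells.congr ?_ (by simp [inc]),
          t1.events.congr ?_ (by simp [inc]), t1.bounded.congr (z₀ := i) (by omega) (by omega)
            (fun a z hz => by simp [inc, t2, hz]) (by simp [inc])⟩
        all_goals intro a z; intros; simp [inc]; omega
      · simp only [Cmd.run_block_cons, Cmd.run_block_nil, Cmd.run, inc, setIreg_iarr, setIarr_iarr,
          IExp.eval_reg, t2, t3, true_and, Nat.cast_inj]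
        split_ifs with hki
        · rw [hki]
        · exact t4 k (by omega)
      · exact Or.inr hb'
    · rintro τ ⟨t1, t2, t3, -⟩
      simp only [Test.holds_ile, IExp.eval_reg, t3, t1.ne, not_le]
      exact_mod_cast Nat.lt_two_pow_self
    · exact ⟨h.congr (by intro r hr; simp; omega) rfl rfl rfl, by simp, by simp, by simp,
        Or.inl rfl⟩
    · simp only [Cmd.block, Cmd.size, Test.cost, IExp.cost, inc]
      omega
    · rintro τ ⟨i, hi, ⟨t1, t2, t3, t4, t5⟩, hb⟩
      refine ⟨i, t1, t2, t4, ?_, t5⟩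
      simp only [Test.holds_ile, IExp.eval_reg, t3, t1.ne, not_le] at hb
      exact_mod_cast hb
  · rintro τ ⟨K, t1, t2, t3, t4, t5⟩
    refine Runs.of_straight (by simp) h1e ⟨K, ?_⟩
    refine ⟨t1.cells.congr ?_ (by simp), t1.events.congr ?_ (by simp), by simp [t1.nc],
      by simp [t1.ne], by simp [t2], by simpa using t3, t4, t5, ?_⟩
    · intro a z; intros; simp; split_ifs <;> omega
    · intro a z; intros; simp; split_ifs <;> omega
    · intro a z hz
      simp only [Cmd.run_block_cons, Cmd.run_block_nil, Cmd.run, setIarr_iarr, IExp.eval_const]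
      rw [if_neg (by omega), if_neg (by omega), if_neg (by omega)]
      exact t1.bounded a z hz

end Prog

/-! ### Point location -/

variable {d n : ℕ}

/-- State of the comparison of the cube `Q` with `q` after `m` axes: the least level `L` at which
the cube of level `L + 1` around `q` differs from that around `Q`, and whether `q` is later. -/
def Cube.Compared (Q : Cube d) (q : EuclideanSpace ℝ (Fin d)) (t : ℤ) (m : ℕ) (L v : ℤ) : Prop :=
  ((∀ k : Fin d, k < m → Q.corner k ≤ q k ∧ q k < Q.corner k + Q.side) ∧ L = Q.level ∧ v = t) ∨
  ∃ k : Fin d, k < m ∧ ¬ (Q.corner k ≤ q k ∧ q k < Q.corner k + Q.side) ∧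
    L = commonLevel (Q.corner k) (q k) ∧ (v = if q k ≤ Q.corner k then 0 else 1) ∧
    ∀ j : Fin d, j < m → ¬ (Q.corner j ≤ q j ∧ q j < Q.corner j + Q.side) →
      L ≤ commonLevel (Q.corner j) (q j) ∧ (k < j → L < commonLevel (Q.corner j) (q j))

theorem Cube.inside_iff {Q : Cube d} {q : EuclideanSpace ℝ (Fin d)} {k : Fin d} :
    (Q.corner k ≤ q k ∧ q k < Q.corner k + Q.side) ↔
      gridIndex Q.level (Q.corner k) = gridIndex Q.level (q k) := by
  rw [Cube.corner_apply, gridIndex_gridPoint, eq_comm, gridIndex_eq_iff]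
  rfl

theorem Cube.outside_level {Q : Cube d} {q : EuclideanSpace ℝ (Fin d)} {k : Fin d}
    (h : ¬ (Q.corner k ≤ q k ∧ q k < Q.corner k + Q.side)) :
    Q.corner k ≠ q k ∧ commonLevel (Q.corner k) (q k) < Q.level := by
  rw [Cube.inside_iff] at h
  have hne : Q.corner k ≠ q k := fun h' => h (by rw [h'])
  refine ⟨hne, ?_⟩
  by_contra hlt
  exact h ((le_commonLevel_iff hne _).1 (not_lt.1 hlt))

/-- The smallest common level over the axes on which `q` is outside is the level of the smallest
cube around both. Among the axes attaining it the last one decides, and by monotonicity of the index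
the coordinates themselves can be compared there. -/
theorem Cube.Compared.iff {Q : Cube d} {q : EuclideanSpace ℝ (Fin d)} {t L v : ℤ}
    (h : Q.Compared q t d L v) : v = 1 ↔ (t = 1 ∧ q ∈ Q.region) ∨ Q.After q := by
  rcases h with ⟨h, -, rfl⟩ | ⟨k, -, ho, hL, hv, hmin⟩
  · have hq : q ∈ Q.region := by
      rw [Cube.mem_region]
      intro k
      have := (Cube.inside_iff.1 (h k k.2)).symm
      rwa [Cube.corner_apply, gridIndex_gridPoint] at this
    constructor
    · exact fun h => Or.inl ⟨h, hq⟩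
    · rintro (⟨h, -⟩ | h)
      · exact h
      · exact absurd hq h.not_mem
  · obtain ⟨hne, hlt⟩ := Cube.outside_level ho
    have hnq : q ∉ Q.region := by
      intro hq
      rw [Cube.mem_region] at hq
      apply ho
      rw [Cube.inside_iff, Cube.corner_apply, gridIndex_gridPoint, hq k]
    have agree : ∀ j (l : ℤ), l ≤ Q.level → (¬ (Q.corner j ≤ q j ∧ q j < Q.corner j + Q.side) →
        l ≤ commonLevel (Q.corner j) (q j)) →
        gridIndex l (Q.corner j) = gridIndex l (q j) := by
      intro j l hl h
      by_cases hj : Q.corner j ≤ q j ∧ q j < Q.corner j + Q.side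
      · exact gridIndex_eq_of_le hl (Cube.inside_iff.1 hj)
      · exact (le_commonLevel_iff (Cube.outside_level hj).1 _).1 (h hj)
    have hk : gridIndex (L + 1) (Q.corner k) ≠ gridIndex (L + 1) (q k) := by
      intro h
      have := (le_commonLevel_iff hne _).2 h
      omega
    have hafter : Q.After q ↔ Q.corner k < q k := by
      constructor
      · rintro ⟨L', hL', hall, k', hk', hgt⟩
        have h1 : L' ≤ L := by rw [hL]; exact (le_commonLevel_iff hne _).2 (hall k).symm
        have h2 : L ≤ L' := by
          by_contra hcon
          exact hk'.ne (agree k' (L' + 1) (by omega) fun hj => by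
            have := (hmin k' k'.2 hj).1
            omega)
        obtain rfl : L' = L := le_antisymm h1 h2
        have h3 : k' = k := by
          rcases lt_trichotomy k' k with h | h | h
          · exact absurd (hgt k h) hk
          · exact h
          · exact absurd (agree k' (L' + 1) (by omega) fun hj => (hmin k' k'.2 hj).2 h) hk'.ne
        subst h3
        by_contra hcon
        exact absurd hk' (not_lt.2 (gridIndex_mono _ (not_lt.1 hcon)))
      · intro hlt'
        exact ⟨L, by omega, fun j => (agree j L (by omega) fun hj => (hmin j j.2 hj).1).symm, k,
          lt_of_le_of_ne (gridIndex_mono _ hlt'.le) hk, fun j hj =>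
            agree j (L + 1) (by omega) fun hj' => (hmin j j.2 hj').2 hj⟩
    rw [hafter, hv]
    split_ifs with hle
    · simp [hnq, -Cube.corner_apply, hle]
    · simp [hnq, -Cube.corner_apply, not_le.1 hle]

namespace Prog

variable {σ τ : State}

variable (d)

def evCor (k : ℕ) : RExp := .arr (3 * d + 1 + k) (.reg 4)

/-- The test admits equality, so that a later axis with the same level replaces an earlier one. -/
def compareAxis (k : ℕ) : Cmd :=
  .cond (.both (.rle (evCor d k) (.reg k))
    (.neg (.rle (evCor d k + .side (.arr 8 (.reg 4))) (.reg k)))) .skip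
    (.block [.level 7 (evCor d k) (.reg k), .cond (.ile (.reg 7) (.reg 5)) (.block [
      .iset 5 (.reg 7), .cond (.rle (.reg k) (evCor d k)) (.iset 6 (.const 0))
        (.iset 6 (.const 1))]) .skip])

/-- The initial verdict holds if no axis separates: a point inside the cube has passed an opening
entry but not a resuming one. -/
def compare : Cmd :=
  .block [.iset 5 (.arr 8 (.reg 4)), .iset 6 (.const 1 - .arr 7 (.reg 4)),
    .unroll (compareAxis d) d]

def bisect : Cmd :=
  .block [.iset 2 (.reg 2 - .const 1), .iset 4 (.reg 3 + .arr 12 (.reg 2)),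
    .cond (.ile (.reg 4 + .const 1) (.reg 1)) (.block [compare d,
      .cond (test 6 1) (.iset 3 (.reg 4)) .skip]) .skip]

def query : Cmd :=
  .block [.iset 1 (.arr 5 (.const 1)), .iset 2 (.arr 5 (.const 2)), .iset 3 (.const 0),
    .loop (.ile (.const 1) (.reg 2)) (bisect d), .iset 0 (.arr 6 (.reg 3))]

variable {d}

theorem straight_compareAxis (k : ℕ) : (compareAxis d k).Straight := by
  simp [compareAxis]

theorem straight_compare : (compare d).Straight :=
  ⟨trivial, trivial, Cmd.straight_unroll straight_compareAxis, trivial⟩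

theorem straight_bisect : (bisect d).Straight :=
  ⟨trivial, trivial, ⟨⟨straight_compare, ⟨trivial, trivial⟩, trivial⟩, trivial⟩, trivial⟩

theorem run_compare {e : Rec d} {q : EuclideanSpace ℝ (Fin d)} {i : ℕ}
    (h : HasRec τ 6 (3 * d + 1) i e) (h4 : τ.ireg 4 = i) (hq : ∀ k : Fin d, τ.rreg k = q k) :
    ((compare d).run τ).ireg 6 = 1 ↔ e.Passes q := by
  have hcor : ∀ {τ' : State}, τ'.ireg 4 = i → τ'.rarr = τ.rarr → ∀ k : Fin d,
      (evCor d k).eval τ' = e.cube.corner k := fun h1 h2 k => by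
    simp [evCor, h1, h2, h.corner]
  have key := Cmd.run_unroll (m := d) (f := compareAxis d)
    (fun m τ' => τ'.ireg 4 = i ∧ τ'.rarr = τ.rarr ∧ τ'.iarr = τ.iarr ∧ τ'.rreg = τ.rreg ∧
      e.cube.Compared q (if e.resume then 0 else 1) m (τ'.ireg 5) (τ'.ireg 6)) ?_
    (σ := (Cmd.iset 6 (.const 1 - .arr 7 (.reg 4))).run ((Cmd.iset 5 (.arr 8 (.reg 4))).run τ))
    ⟨by simp [h4], rfl, rfl, rfl, Or.inl ⟨by simp, by simp [h4]; exact h.level, ?_⟩⟩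
  · have := key.2.2.2.2.iff
    rw [show (compare d).run τ = (Cmd.unroll (compareAxis d) d).run
      ((Cmd.iset 6 (.const 1 - .arr 7 (.reg 4))).run ((Cmd.iset 5 (.arr 8 (.reg 4))).run τ))
      from rfl, this]
    unfold Rec.Passes
    cases e.resume <;> simp
  · rintro m τ' hm ⟨t1, t2, t3, t4, t5⟩
    have e1 := hcor t1 t2 ⟨m, hm⟩
    have e2 : τ'.rreg m = q ⟨m, hm⟩ := by rw [t4]; exact hq ⟨m, hm⟩
    simp only at e1
    have e3 : τ'.iarr 8 i = e.cube.level := by rw [t3]; exact h.level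
    have hlast : ∀ j : Fin d, (j : ℕ) < m + 1 → (j : ℕ) < m ∨ j = ⟨m, hm⟩ := fun j hj =>
      (Nat.lt_succ_iff_lt_or_eq.1 hj).imp id Fin.ext
    unfold compareAxis
    by_cases hin : e.cube.corner ⟨m, hm⟩ ≤ q ⟨m, hm⟩ ∧
        q ⟨m, hm⟩ < e.cube.corner ⟨m, hm⟩ + e.cube.side
    · rw [Cmd.run_cond_pos (by
        simp only [Test.holds_both, Test.holds_rle, Test.holds_neg, RExp.eval_add, RExp.eval_side,
          RExp.eval_reg, IExp.eval_arr, IExp.eval_reg, e1, e2, t1, e3, not_le]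
        exact hin)]
      refine ⟨t1, t2, t3, t4, ?_⟩
      rcases t5 with ⟨h1, h2, h3⟩ | ⟨k, h1, h2, h3, h4, h5⟩
      · refine Or.inl ⟨fun j hj => ?_, h2, h3⟩
        rcases hlast j hj with hj | rfl
        · exact h1 j hj
        · exact hin
      · refine Or.inr ⟨k, by omega, h2, h3, h4, fun j hj ho => ?_⟩
        rcases hlast j hj with hj | rfl
        · exact h5 j hj ho
        · exact absurd hin ho
    · rw [Cmd.run_cond_neg (by
        simp only [Test.holds_both, Test.holds_rle, Test.holds_neg, RExp.eval_add, RExp.eval_side,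
          RExp.eval_reg, IExp.eval_arr, IExp.eval_reg, e1, e2, t1, e3, not_le]
        exact hin)]
      simp only [Cmd.run_block_cons, Cmd.run_block_nil]
      have e4 : (Cmd.level 7 (evCor d m) (.reg m)).run τ' = τ'.setIreg 7
          (commonLevel (e.cube.corner ⟨m, hm⟩) (q ⟨m, hm⟩)) := by simp [e1, e2]
      rw [e4]
      by_cases hle : commonLevel (e.cube.corner ⟨m, hm⟩) (q ⟨m, hm⟩) ≤ τ'.ireg 5
      · rw [Cmd.run_cond_pos (by simpa using hle)]
        simp only [Cmd.run_block_cons, Cmd.run_block_nil]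
        have e5 : ∀ u : State, u.ireg 4 = i → u.rarr = τ.rarr → u.rreg = τ.rreg →
            (Cmd.cond (.rle (.reg m) (evCor d m)) (.iset 6 (.const 0)) (.iset 6 (.const 1))).run u
            = u.setIreg 6 (if q ⟨m, hm⟩ ≤ e.cube.corner ⟨m, hm⟩ then 0 else 1) := by
          intro u h1 h2 h3
          have e1 := hcor h1 h2 ⟨m, hm⟩
          have e2 : u.rreg m = q ⟨m, hm⟩ := by rw [h3]; exact hq ⟨m, hm⟩
          simp only at e1
          split_ifs with hc
          · rw [Cmd.run_cond_pos (by simpa [e1, e2] using hc)]; simp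
          · rw [Cmd.run_cond_neg (by simpa [e1, e2] using hc)]; simp
        rw [e5 _ (by simp [t1]) (by simp [t2]) (by simp [t4])]
        refine ⟨by simp [t1], t2, t3, t4, Or.inr ⟨⟨m, hm⟩, by simp, hin, by simp, by simp, ?_⟩⟩
        intro j hj ho
        simp only [Cmd.run, setIreg_ireg, IExp.eval_reg]
        simp only [if_true, if_neg (show (5 : ℕ) ≠ 6 by omega)]
        rcases hlast j hj with hj | rfl
        · refine ⟨?_, fun hlt => absurd hlt (by rw [Fin.lt_def]; simp only; omega)⟩
          rcases t5 with ⟨h1, h2, h3⟩ | ⟨k, h1, h2, h3, h4, h5⟩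
          · exact absurd (h1 j hj) ho
          · exact hle.trans (h5 j hj ho).1
        · exact ⟨le_rfl, fun h => absurd h (lt_irrefl _)⟩
      · rw [Cmd.run_cond_neg (by simpa using hle)]
        refine ⟨by simp [t1], t2, t3, t4, ?_⟩
        simp only [Cmd.run, setIreg_ireg, if_neg (show (5 : ℕ) ≠ 7 by omega),
          if_neg (show (6 : ℕ) ≠ 7 by omega)]
        push Not at hle
        rcases t5 with ⟨h1, h2, h3⟩ | ⟨k, h1, h2, h3, h4, h5⟩
        · have := (Cube.outside_level hin).2
          omega
        · refine Or.inr ⟨k, by omega, h2, h3, h4, fun j hj ho => ?_⟩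
          rcases hlast j hj with hj | rfl
          · exact h5 j hj ho
          · exact ⟨hle.le, fun _ => hle⟩
  · simp only [Cmd.run, setIreg_ireg, IExp.eval_sub, IExp.eval_const, IExp.eval_arr, IExp.eval_reg,
      setIreg_iarr, if_neg (show (4 : ℕ) ≠ 5 by omega), if_true, h4, h.flag]
    split_ifs <;> rfl

/-- Bisection with the invariant `l ≤ M < l + 2 ^ (K - i)`. Entry `0` is the default answer and is
never compared, so it is exempt from `hpass`; trial positions beyond the last entry count as not
passed. -/
theorem runs_query {x : Conf d n} {B : ℤ} {K M : ℕ} {q : EuclideanSpace ℝ (Fin d)}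
    (hS : Stored x B K σ) (hia : τ.iarr = σ.iarr) (hra : τ.rarr = σ.rarr)
    (hq : ∀ k : Fin d, τ.rreg k = q k) (hM : M < x.events.length)
    (hpass : ∀ (i : ℕ) e, x.events[i]? = some e → 1 ≤ i → (e.Passes q ↔ i ≤ M)) :
    Runs (query d) τ ((query d).size * (K + 1)) fun τ' => τ'.iarr = σ.iarr ∧ τ'.rarr = σ.rarr ∧
      τ'.ireg 0 = σ.iarr 6 M := by
  have h1K : 1 ≤ K + 1 := by omega
  refine Runs.block_cons (Runs.of_straight (by trivial) h1K rfl) ?_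
  rintro _ rfl
  refine Runs.block_cons (Runs.of_straight (by trivial) h1K rfl) ?_
  rintro _ rfl
  refine Runs.block_cons (Runs.of_straight (by trivial) h1K rfl) ?_
  rintro _ rfl
  refine Runs.block_cons (Φ := fun τ' => τ'.iarr = σ.iarr ∧ τ'.rarr = σ.rarr ∧ τ'.ireg 3 = M) ?_ ?_
  · refine (Runs.loop (T := (bisect d).size) (N := K) (fun i τ' => τ'.iarr = σ.iarr ∧
      τ'.rarr = σ.rarr ∧ (∀ k : Fin d, τ'.rreg k = q k) ∧ τ'.ireg 1 = x.events.length ∧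
      τ'.ireg 2 = (K - i : ℕ) ∧ ∃ l : ℕ, τ'.ireg 3 = l ∧ l ≤ M ∧ M < l + 2 ^ (K - i))
      ?_ ?_ ?_).mono ?_ ?_
    · rintro i τ' hi ⟨t1, t2, t3, t4, t5, l, t6, t7, t8⟩ -
      refine straight_bisect.runs ?_
      obtain ⟨j, hj⟩ : ∃ j, K - i = j + 1 := ⟨K - i - 1, by omega⟩
      have hj' : K - (i + 1) = j := by omega
      rw [hj] at t5 t8
      rw [hj']
      simp only [bisect, Cmd.run_block_cons, Cmd.run_block_nil]
      have e1 : (Cmd.iset 2 (.reg 2 - .const 1)).run τ' = τ'.setIreg 2 j := by simp [t5]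
      have e2 : (Cmd.iset 4 (.reg 3 + .arr 12 (.reg 2))).run (τ'.setIreg 2 j)
          = (τ'.setIreg 2 j).setIreg 4 (l + 2 ^ j : ℕ) := by
        simp [t6, t1, hS.pow j (by omega)]
      rw [e1, e2]
      obtain ⟨u, hu⟩ : ∃ u, u = (τ'.setIreg 2 j).setIreg 4 (l + 2 ^ j : ℕ) := ⟨_, rfl⟩
      rw [← hu]
      have u1 : u.iarr = σ.iarr := by rw [hu]; exact t1
      have u2 : u.rarr = σ.rarr := by rw [hu]; exact t2
      have u3 : ∀ k : Fin d, u.rreg k = q k := by rw [hu]; exact t3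
      have u4 : u.ireg 1 = x.events.length := by rw [hu]; simpa using t4
      have u5 : u.ireg 2 = j := by rw [hu]; simp
      have u6 : u.ireg 3 = l := by rw [hu]; simpa using t6
      have u7 : u.ireg 4 = (l + 2 ^ j : ℕ) := by rw [hu]; simp
      clear hu
      have hpow : 2 ^ (j + 1) = 2 ^ j + 2 ^ j := by ring
      have hpos : 0 < 2 ^ j := Nat.two_pow_pos j
      by_cases hlt : l + 2 ^ j < x.events.length
      · rw [Cmd.run_cond_pos (by
          simp only [Test.holds_ile, IExp.eval_add, IExp.eval_reg, IExp.eval_const, u4, u7]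
          omega)]
        simp only [Cmd.run_block_cons, Cmd.run_block_nil]
        have hget : x.events[l + 2 ^ j]? = some x.events[l + 2 ^ j] := by simp [hlt]
        have hcmp := run_compare ((hS.events _ _ hget).congr' u1 u2) u7 u3
        rw [hpass _ _ hget (by omega)] at hcmp
        have hf := (straight_compare (d := d)).frame u
        generalize (compare d).run u = v at *
        have hset : ∀ r, r < 5 → ¬ (compare d).SetsI r := by
          intro r hr
          simp only [compare, compareAxis, Cmd.setsI_block_cons, Cmd.setsI_unroll, Cmd.SetsI,
            Cmd.setsI_block_nil, not_or, not_exists, not_and]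
          refine ⟨by omega, by omega, fun _ _ => ?_, id⟩
          simp only [not_false_eq_true, true_and, and_true]
          omega
        have v1 : v.iarr = σ.iarr := by
          funext a; rw [hf.iarr a (by simp [compare, compareAxis]), u1]
        have v2 : v.rarr = σ.rarr := by
          funext a; rw [hf.rarr a (by simp [compare, compareAxis]), u2]
        have v3 : ∀ k : Fin d, v.rreg k = q k := by
          intro a; rw [hf.rreg a (by simp [compare, compareAxis]), u3]
        have v4 := (hf.ireg 1 (hset 1 (by omega))).trans u4
        have v5 := (hf.ireg 2 (hset 2 (by omega))).trans u5
        have v6 := (hf.ireg 3 (hset 3 (by omega))).trans u6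
        have v7 := (hf.ireg 4 (hset 4 (by omega))).trans u7
        by_cases hp : v.ireg 6 = 1
        · rw [Cmd.run_cond_pos (by simpa using hp)]
          exact ⟨v1, v2, v3, by simpa using v4, by simpa using v5, l + 2 ^ j, by simpa using v7,
            hcmp.1 hp, by omega⟩
        · rw [Cmd.run_cond_neg (by simpa using hp)]
          have := mt hcmp.2 hp
          exact ⟨v1, v2, v3, v4, v5, l, v6, t7, by omega⟩
      · rw [Cmd.run_cond_neg (by
          simp only [Test.holds_ile, IExp.eval_add, IExp.eval_reg, IExp.eval_const, u4, u7]
          omega)]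
        exact ⟨u1, u2, u3, u4, u5, l, u6, t7, by omega⟩
    · rintro τ' ⟨-, -, -, -, t5, -⟩
      simp [t5]
    · refine ⟨hia, hra, hq, ?_, ?_, 0, by simp, by omega, ?_⟩
      · simp [hia, hS.count]
      · simp [hia, hS.logs]
      · have := hS.lt
        simp
        omega
    · simp only [Cmd.size, Test.cost, IExp.cost]
      ring_nf
      omega
    · rintro τ' ⟨i, hi, ⟨t1, t2, -, -, t5, l, t6, t7, t8⟩, hb⟩
      have : K - i = 0 := by
        simp [t5] at hb
        omega
      rw [this] at t8
      exact ⟨t1, t2, by rw [t6]; congr 1; omega⟩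
  · rintro τ' ⟨t1, t2, t3⟩
    refine Runs.of_straight (by simp) h1K ⟨t1, t2, ?_⟩
    simp [t1, t3]

end Prog

namespace Net

variable {d n : ℕ} (I : Net d n)

/-! ### The root -/

theorem le_heaviest (j : Fin n) : I.w j ≤ I.w I.heaviest :=
  I.mono (by rw [Fin.le_def]; simp only [heaviest]; omega)

/-- If `j` beats the heaviest site by more than `1 + eps` at `p`, then `eps * ‖p - s j‖` is less
than the distance of the two sites. Hence `p` is within the extent on every axis, and the root
contains that box. -/
theorem heaviest_good {p : EuclideanSpace ℝ (Fin d)} (hp : p ∉ I.root.region) (j : Fin n) :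
    I.wd I.heaviest p ≤ (1 + I.eps) * I.wd j p := by
  by_contra hlt
  push Not at hlt
  have he := I.eps_pos
  have he' := I.eps_le
  have hwj := I.wpos j
  have hwl := I.wpos I.heaviest
  set l := I.heaviest
  set S := ∑ j, ∑ k, (1 + I.s j k ^ 2) with hS
  have hX : I.extent = 1 + 4 / I.eps * S := rfl
  have habs : ∀ i : Fin n, ∑ k, |I.s i k| ≤ S := by
    intro i
    refine le_trans (Finset.sum_le_sum fun k _ => ?_)
      (Finset.single_le_sum (f := fun i => ∑ k, (1 + I.s i k ^ 2)) (fun i _ =>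
        Finset.sum_nonneg fun k _ => by positivity) (Finset.mem_univ i))
    nlinarith [sq_nonneg (|I.s i k| - 1), sq_abs (I.s i k)]
  have hS0 : 0 ≤ S := (Finset.sum_nonneg fun k _ => abs_nonneg _).trans (habs j)
  have h1 : (1 + I.eps) * ‖p - I.s j‖ < ‖p - I.s l‖ := by
    unfold wd at hlt
    rw [← mul_div_assoc, div_lt_div_iff₀ hwj hwl] at hlt
    have h2 := mul_le_mul_of_nonneg_left (I.le_heaviest j) (norm_nonneg (p - I.s l))
    exact lt_of_mul_lt_mul_right (hlt.trans_le h2) hwl.le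
  have h2 := norm_sub_le_norm_sub_add_norm_sub p (I.s j) (I.s l)
  have h3 : ‖I.s j - I.s l‖ ≤ 2 * S := by
    have : ‖I.s j - I.s l‖ ≤ ∑ k, |(I.s j - I.s l) k| := by
      rw [EuclideanSpace.norm_eq]
      refine Real.sqrt_le_iff.2 ⟨Finset.sum_nonneg fun k _ => abs_nonneg _, ?_⟩
      simp only [Real.norm_eq_abs]
      exact Finset.sum_sq_le_sq_sum_of_nonneg fun k _ => abs_nonneg _
    refine this.trans ?_
    calc _ ≤ ∑ k, (|I.s j k| + |I.s l k|) := Finset.sum_le_sum fun k _ => abs_sub _ _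
      _ ≤ _ := by rw [Finset.sum_add_distrib]; linarith [habs j, habs l]
  have h4 : I.eps * ‖p - I.s j‖ ≤ 2 * S := by linarith
  apply hp
  have hXpos : 0 < I.extent := by rw [hX]; positivity
  rw [Cube.mem_region]
  intro k
  have hk : |p k| < I.extent := by
    have h5 : |p k - I.s j k| ≤ ‖p - I.s j‖ := by
      simpa using PiLp.norm_apply_le (p - I.s j) k
    have h6 : |I.s j k| ≤ S :=
      (Finset.single_le_sum (f := fun k => |I.s j k|) (fun k _ => abs_nonneg _)
        (Finset.mem_univ k)).trans (habs j)
    have h7 : |p k| ≤ |p k - I.s j k| + |I.s j k| := by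
      simpa using abs_add_le (p k - I.s j k) (I.s j k)
    have h8 : ‖p - I.s j‖ ≤ 2 * S / I.eps := by rw [le_div_iff₀ he]; linarith
    have h9 : S ≤ S / I.eps := by rw [le_div_iff₀ he]; nlinarith
    rw [hX]
    have : 4 / I.eps * S = 2 * S / I.eps + 2 * (S / I.eps) := by ring
    have h10 : 0 ≤ S / I.eps := by positivity
    linarith
  obtain ⟨h5, h6⟩ := abs_lt.1 hk
  have hc : gridIndex I.root.level (-I.extent) = gridIndex I.root.level I.extent :=
    (le_commonLevel_iff (by linarith) _).1 le_rfl
  have hi : I.root.index k = gridIndex I.root.level (-I.extent) := rfl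
  rw [hi]
  exact le_antisymm (hc ▸ gridIndex_mono _ h6.le) (gridIndex_mono _ h5.le)

/-! ### The complete structure -/

theorem passes_iff {q : EuclideanSpace ℝ (Fin d)} {e₀ : Rec d} {l₁ l₂ : List (Rec d)}
    (h₁ : ∀ x ∈ l₁, x.Passes q) (h₂ : ∀ x ∈ l₂, ¬ x.Passes q) (i : ℕ) (e : Rec d)
    (he : (e₀ :: (l₁ ++ l₂))[i]? = some e) (hi : 1 ≤ i) : e.Passes q ↔ i ≤ l₁.length := by
  obtain ⟨j, rfl⟩ : ∃ j, i = j + 1 := ⟨i - 1, by omega⟩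
  rw [List.getElem?_cons_succ, List.getElem?_append] at he
  split_ifs at he with h
  · exact iff_of_true (h₁ e (List.mem_of_getElem? he)) (by omega)
  · exact iff_of_false (h₂ e (List.mem_of_getElem? he)) (by omega)

/-- The cells of `x` form an approximate diagram, and its events locate all points. -/
structure Complete (I : Net d n) (x : Conf d n) : Prop where
  nonempty : ∀ c ∈ x.cells, c.1.region.Nonempty
  good : ∀ c ∈ x.cells, ∀ p ∈ c.1.region, ∀ j, I.wd c.2 p ≤ (1 + I.eps) * I.wd j p
  disj : x.cells.Pairwise fun c c' => Disjoint c.1.region c'.1.region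
  find : ∀ q, ∃ M e c, x.events[M]? = some e ∧
    (∀ (i : ℕ) e', x.events[i]? = some e' → 1 ≤ i → (e'.Passes q ↔ i ≤ M)) ∧
    x.cells[e.id]? = some c ∧ q ∈ c.1.region

theorem exists_not_mem (hd : 1 ≤ d) (Q : Cube d) : ∃ p, p ∉ Q.region := by
  refine ⟨WithLp.toLp 2 fun k => gridPoint Q.level (Q.index k) + gridSide Q.level, fun h => ?_⟩
  exact absurd (h ⟨0, hd⟩).2 (lt_irrefl _)

/-- The subdivision of the root, surrounded by cell `0`, in the same way as in a jump; the outer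
cell is found through the opening or the resuming entry of the root. -/
theorem exists_complete : ∃ N : ℕ, ((Conf.next I.out)^[N] I.start).stack = [] ∧
    I.Complete ((Conf.next I.out)^[N] I.start) ∧
    N ≤ (2 * 2 ^ d + 6) * I.essCount I.root + 3 ∧
    N ≤ 3 * ((Conf.next I.out)^[N] I.start).cells.length ∧
    ((Conf.next I.out)^[N] I.start).cells.length ≤ N + 1 := by
  obtain ⟨N, hN, h0, h1, -⟩ := exists_explored I.outcomeSpec_out _ I.root rfl
  obtain ⟨cs, es, hseg, hl, hc, hes, hrun⟩ := hN.exists_seg I.outcomeSpec_out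
  have hfin : (Conf.next I.out)^[N + 1] I.start = ⟨[], (⟨none, some I.root⟩, I.heaviest) :: cs,
      ⟨false, 0, I.root⟩ :: (es.map (Rec.shift 1) ++ [⟨true, 0, I.root⟩])⟩ := by
    rw [Function.iterate_succ_apply']
    unfold start
    rw [hrun]
    simp [Conf.next]
  have hr0 : ∀ q, q ∈ (⟨none, some I.root⟩ : Cell d).region ↔ q ∉ I.root.region := by
    intro q; simp [Cell.region]
  have hpe : ∀ q, (⟨true, 0, I.root⟩ : Rec d).Passes q ↔ I.root.After q := by
    intro q; simp [Rec.Passes]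
  refine ⟨N + 1, by rw [hfin], ?_, ?_, ?_, ?_⟩
  · rw [hfin]
    refine ⟨?_, ?_, ?_, fun q => ?_⟩
    · simp only [List.mem_cons]
      rintro c (rfl | hc)
      · obtain ⟨p, hp⟩ := exists_not_mem I.hd I.root
        exact ⟨p, (hr0 p).2 hp⟩
      · exact hseg.nonempty c hc
    · simp only [List.mem_cons]
      rintro c (rfl | hc) p hp j
      · exact I.heaviest_good ((hr0 p).1 hp) j
      · exact hseg.good c hc p hp j
    · simp only [List.pairwise_cons]
      refine ⟨fun c hc => ?_, hseg.disj⟩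
      rw [Set.disjoint_left]
      intro p hp hp'
      exact (hr0 p).1 hp (hseg.sub c hc hp')
    · by_cases hq : q ∈ I.root.region
      · obtain ⟨l₁, e, l₂, c, hes', h2, h3, h4, h5, h6⟩ := hseg.find q hq
        refine ⟨(l₁.map (Rec.shift 1) ++ [e.shift 1]).length, e.shift 1, c, ?_, ?_, ?_, h6⟩
        · rw [hes']; simp
        · have e1 : es.map (Rec.shift 1) ++ [⟨true, 0, I.root⟩] =
              (l₁.map (Rec.shift 1) ++ [e.shift 1]) ++
                (l₂.map (Rec.shift 1) ++ [⟨true, 0, I.root⟩]) := by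
            rw [hes']; simp
          rw [e1]
          refine passes_iff ?_ ?_
          · intro x hx
            simp only [List.mem_append, List.mem_map, List.mem_singleton] at hx
            rcases hx with ⟨y, hy, rfl⟩ | rfl
            · exact passes_shift.2 (h2 y hy)
            · exact passes_shift.2 h3
          · intro x hx
            simp only [List.mem_append, List.mem_map, List.mem_singleton] at hx
            rcases hx with ⟨y, hy, rfl⟩ | rfl
            · exact mt passes_shift.1 (h4 y hy)
            · rw [hpe]; exact fun h => h.not_mem hq
        · rw [show (e.shift 1).id = e.id + 1 from add_comm _ _, List.getElem?_cons_succ, h5]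
      · by_cases ha : I.root.After q
        · refine ⟨(es.map (Rec.shift 1) ++ [(⟨true, 0, I.root⟩ : Rec d)]).length, ⟨true, 0, I.root⟩, _, ?_, ?_,
            rfl, (hr0 q).2 hq⟩
          · simp
          · have := passes_iff (q := q) (e₀ := ⟨false, 0, I.root⟩)
              (l₁ := es.map (Rec.shift 1) ++ [⟨true, 0, I.root⟩]) (l₂ := []) ?_ (by simp)
            · rwa [List.append_nil] at this
            · intro x hx
              simp only [List.mem_append, List.mem_map, List.mem_singleton] at hx
              rcases hx with ⟨y, hy, rfl⟩ | rfl
              · exact passes_shift.2 (hseg.after q ha y hy)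
              · exact (hpe q).2 ha
        · refine ⟨0, ⟨false, 0, I.root⟩, _, rfl, ?_, rfl, (hr0 q).2 hq⟩
          refine passes_iff (l₁ := []) (by simp) fun x hx => ?_
          change x ∈ es.map (Rec.shift 1) ++ [(⟨true, 0, I.root⟩ : Rec d)] at hx
          simp only [List.mem_append, List.mem_map, List.mem_singleton] at hx
          rcases hx with ⟨y, hy, rfl⟩ | rfl
          · exact mt passes_shift.1 (hseg.before q ⟨hq, ha⟩ y hy)
          · exact mt (hpe q).1 ha
  · have := Nat.two_pow_pos d
    rcases Nat.eq_zero_or_pos (I.essCount I.root) with h | h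
    · have := h0 h; omega
    · have := h1 h; omega
  · rw [hfin]; simp; omega
  · rw [hfin]; simp; omega

/-- The diagram of a list of cells. -/
def _root_.AMWVD.Conf.diagram (x : Conf d n) : Diagram d n :=
  ⟨x.cells.length, fun j => (x.cells.get j).1, fun j => (x.cells.get j).2⟩

variable {I}

theorem Complete.cover {x : Conf d n} (h : I.Complete x) (q : EuclideanSpace ℝ (Fin d)) :
    ∃ j, q ∈ (x.diagram.cell j).region := by
  obtain ⟨M, e, c, -, -, h3, h4⟩ := h.find q
  obtain ⟨hlt, rfl⟩ := List.getElem?_eq_some_iff.1 h3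
  exact ⟨⟨e.id, hlt⟩, h4⟩

theorem Complete.isAMWVD {x : Conf d n} (h : I.Complete x) :
    x.diagram.IsAMWVD I.eps I.s I.w := by
  refine ⟨⟨fun j => h.nonempty _ (List.get_mem _ _), fun j j' hne => ?_, ?_⟩,
    fun j p hp i => h.good _ (List.get_mem _ _) p hp i⟩
  · have := List.pairwise_iff_get.1 h.disj
    rcases lt_or_gt_of_ne hne with h' | h'
    · exact this j j' h'
    · exact (this j' j h').symm
  · rw [Set.eq_univ_iff_forall]
    intro q
    exact Set.mem_iUnion.2 (h.cover q)

/-- At a site the minimum is `0`, so the cell containing it must have that site as label; every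
label occurs. This lets `n` be absorbed into the size in the time bound. -/
theorem Complete.le_size {x : Conf d n} (h : I.Complete x) : n ≤ x.diagram.size := by
  have : Function.Surjective x.diagram.label := by
    intro i
    obtain ⟨j, hj⟩ := h.cover (I.s i)
    refine ⟨j, I.inj ?_⟩
    have h1 := h.isAMWVD.approx j _ hj i
    rw [sub_self, norm_zero, zero_div, mul_zero] at h1
    exact (wd_eq_zero (le_antisymm h1 (wd_nonneg _ _))).symm
  simpa using Fintype.card_le_of_surjective _ this

theorem essCount_le (Q : Cube d) : I.essCount Q ≤ {P : Cube d | I.Ess P}.ncard := by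
  classical
  unfold essCount
  rw [Set.ncard_eq_toFinset_card _ (ncard_ess_le I).1]
  exact Finset.card_filter_le _ _

end Net

theorem Prog.Stored.storesDiagram {d n : ℕ} {x : Conf d n} {B : ℤ} {K : ℕ} {σ : State}
    (h : Prog.Stored x B K σ) : StoresDiagram σ x.diagram := by
  refine ⟨h.size, fun j => ?_⟩
  obtain ⟨h1, h2, h3⟩ := h.cells j.1 _ (List.getElem?_eq_getElem j.2)
  exact ⟨h1, h2, h3⟩


/-! ### Running the whole construction -/

namespace Prog

variable {d n : ℕ}

theorem exists_exec_build (hd : 1 ≤ d) (hn : 1 ≤ n) {s : Fin n → EuclideanSpace ℝ (Fin d)}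
    {w : Fin n → ℝ} {ε : ℝ} (hs : Function.Injective s) (hw : ∀ i, 0 < w i) (hmono : Monotone w)
    (hε : 0 < ε) (hε' : ε ≤ 1 / 4) : ∃ I : Net d n, I.s = s ∧ I.w = w ∧ I.eps = ε ∧
    ∃ (N : ℕ) (x : Conf d n) (t K : ℕ) (σ : State), I.Complete x ∧
      N ≤ (2 * 2 ^ d + 6) * I.essCount I.root + 3 ∧ N ≤ 3 * x.cells.length ∧
      x.cells.length ≤ N + 1 ∧ x.events.length ≤ N + 1 ∧
      Exec (build d) (inputState s w ε) t σ ∧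
      t ≤ (build d).size * ((n + 1) * (n + 1) + (N + 2) * (n + 1)) ∧
      Stored x (n + 3 + N * 2 ^ d : ℕ) K σ := by
  have hin : Input s w ε (inputState s w ε) := by
    refine ⟨by simp [inputState], by simp [inputState], fun k i => ?_, fun i => ?_⟩
    · simp [inputState]
    · simp [inputState]
  have hz : ∀ (a : ℕ) (z : ℤ), z < 0 ∨ n ≤ z → (inputState s w ε).rarr a z = 0 := by
    intro a z hz
    simp only [inputState]
    rw [dif_neg]
    omega
  obtain ⟨t₁, σ₁, e₁, l₁, ⟨I, rfl, rfl, rfl, hB, hk⟩, hf⟩ :=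
    (runs_net hd hn hs hw hmono hε hε' hin (hz _)).frame
  obtain ⟨N, hst, hcomp, hN1, hN2, hN3⟩ := I.exists_complete
  have hlen := Conf.next_length hd I.out I.start N
  have hstart : I.start.stack.length = 2 ∧ I.start.cells.length = 1 ∧ I.start.events.length = 1 :=
    ⟨rfl, rfl, rfl⟩
  set x := (Conf.next I.out)^[N] I.start with hx
  have hxe : x.events.length ≤ N + 1 := by
    have := hlen.2.2
    rw [hstart.2.2] at this
    omega
  refine ⟨I, rfl, rfl, rfl, N, x, ?_⟩
  set B : ℕ := n + 3 + N * 2 ^ d with hBdef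
  have hNB : N ≤ N * 2 ^ d := Nat.le_mul_of_pos_right _ (Nat.two_pow_pos d)
  have hB1 : Bounded B σ₁ := by
    intro a z hz'
    rw [hf.iarr a (by simp [net, row, inc])]
    refine ⟨rfl, ?_⟩
    by_cases ha : a = 5 * d + 1
    · subst ha; exact hk z (by omega)
    · rw [hf.rarr a (by simp [net, row, inc, ha])]
      exact hz a z (by omega)
  set m := (n + 1) * (n + 1) + (N + 2) * (n + 1) with hm
  have hm1 : n + 1 ≤ m := by
    have := Nat.le_mul_of_pos_left (n + 1) (show 0 < N + 2 by omega)
    omega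
  have hm2 : (N + 1) * (n + 1) ≤ m := by
    have : (N + 1) * (n + 1) ≤ (N + 2) * (n + 1) := Nat.mul_le_mul_right _ (by omega)
    omega
  have hm3 : N + 2 ≤ m := by
    have := Nat.le_mul_of_pos_right (N + 2) (show 0 < n + 1 by omega)
    omega
  have hrest : Runs (.block [extent d, init d, traverse d, powers]) σ₁
      ((Cmd.block [extent d, init d, traverse d, powers]).size * m)
      fun σ' => ∃ K, Stored x B K σ' := by
    refine Runs.block_cons ((runs_extent hB).mono (Nat.mul_le_mul_left _ hm1) fun _ h => h) ?_
    rintro σ₂ ⟨b2, q2, i2, r2⟩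
    have hB2 : Bounded B σ₂ := by
      intro a z h; rw [i2, r2]; exact hB1 a z h
    refine Runs.block_cons (Runs.of_straight straight_init (by omega)
      (run_init b2 q2 hB2 (by omega))) ?_
    intro σ₃ h3
    refine Runs.block_cons ((runs_traverse h3 hst ?_ ?_ ?_).mono (Nat.mul_le_mul_left _ hm2)
      fun _ h => h) ?_
    · rw [hstart.1]
      have : ((N * 2 ^ d : ℕ) : ℤ) = N * 2 ^ d := by push_cast; rfl
      omega
    · rw [hstart.2.1]; omega
    · rw [hstart.2.2]; omega
    intro σ₄ h4
    refine Runs.block_cons ((runs_powers h4 (by omega) ?_).mono (Nat.mul_le_mul_left _ ?_)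
      fun _ h => h) fun _ h => Runs.block_nil (by omega) h
    · change (x.events.length : ℤ) ≤ _
      omega
    · change x.events.length + 1 ≤ _
      omega
  obtain ⟨t₂, σ₂, e₂, l₂, K, hK⟩ := hrest
  refine ⟨t₁ + t₂, K, σ₂, hcomp, hN1, hN2, hN3, by omega, .seq e₁ e₂, ?_, hK⟩
  have : (build d).size = (net d).size +
    (Cmd.block [extent d, init d, traverse d, powers]).size := rfl
  rw [this, add_mul]
  have : (net d).size * ((n + 1) * (n + 1)) ≤ (net d).size * m :=
    Nat.mul_le_mul_left _ (by omega)
  omega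

end Prog

/-! ### Bounds -/

section bounds

variable {d n : ℕ} {ε : ℝ}

theorem one_le_log (hn : 1 ≤ n) (hε : 0 < ε) (hε' : ε ≤ 1 / 4) : 1 ≤ Real.log (1 / ε) ∧
    Real.log (1 / ε) ≤ Real.log (n / ε) := by
  have hn' : (1 : ℝ) ≤ n := by exact_mod_cast hn
  constructor
  · rw [Real.le_log_iff_exp_le (by positivity)]
    have h1 := Real.exp_one_lt_d9
    have : 4 ≤ 1 / ε := by rw [le_div_iff₀ hε]; linarith
    linarith
  · apply Real.log_le_log (by positivity)
    gcongr

theorem le_volume (hn : 1 ≤ n) (hε : 0 < ε) (hε' : ε ≤ 1 / 4) :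
    (n : ℝ) ≤ n * Real.log (1 / ε) / ε ^ (d - 1) := by
  have hp : ε ^ (d - 1) ≤ 1 := pow_le_one₀ hε.le (by linarith)
  have hp0 : 0 < ε ^ (d - 1) := by positivity
  rw [le_div_iff₀ hp0]
  have := (one_le_log hn hε hε').1
  have hn' : (0 : ℝ) ≤ n := by positivity
  calc (n : ℝ) * ε ^ (d - 1) ≤ n * 1 := by gcongr
    _ ≤ _ := by gcongr

theorem log_volume_le (hd : 1 ≤ d) (hn : 1 ≤ n) (hε : 0 < ε) (hε' : ε ≤ 1 / 4) :
    Real.log (n * Real.log (1 / ε) / ε ^ (d - 1)) ≤ d * Real.log (n / ε) := by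
  have hn' : (1 : ℝ) ≤ n := by exact_mod_cast hn
  have h1 := (one_le_log hn hε hε').1
  rw [show (d : ℝ) * Real.log (n / ε) = Real.log ((n / ε) ^ d) from (Real.log_pow _ d).symm]
  apply Real.log_le_log (by positivity)
  have h2 : Real.log (1 / ε) ≤ 1 / ε := (Real.log_le_sub_one_of_pos (by positivity)).trans (by simp)
  obtain ⟨k, rfl⟩ : ∃ k, d = k + 1 := ⟨d - 1, by omega⟩
  rw [Nat.add_sub_cancel]
  calc n * Real.log (1 / ε) / ε ^ k ≤ n * (1 / ε) / ε ^ k := by gcongr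
    _ = (n : ℝ) ^ 1 / ε ^ (k + 1) := by field_simp; ring
    _ ≤ (n : ℝ) ^ (k + 1) / ε ^ (k + 1) := by gcongr
    _ = _ := by rw [div_pow]

theorem card_balls (i : Fin n) : (balls i).card = n - 1 - i := by
  have : balls i = (Finset.Ioi i).map ⟨fun j => (i, j), fun a b h => (Prod.mk.inj h).2⟩ := by
    ext ⟨a, b⟩
    simp only [balls, Finset.mem_filter, Finset.mem_univ, true_and, Finset.mem_map,
      Finset.mem_Ioi]
    constructor
    · rintro ⟨rfl, h⟩; exact ⟨b, h, rfl⟩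
    · rintro ⟨j, h, e⟩; cases e; exact ⟨rfl, h⟩
  rw [this, Finset.card_map, Fin.card_Ioi]

/-- The cardinalities are `0, …, n - 1`, with sum `n * (n - 1) / 2`, and `x ≤ x ^ d` for natural
numbers. So the mean pays for the linear work per step. -/
theorem le_sum_card_balls (hd : 1 ≤ d) (hn : 1 ≤ n) :
    (n : ℝ) - 1 ≤ 2 * (1 / n * ∑ i : Fin n, ((balls i).card : ℝ) ^ d) := by
  have hn' : (0 : ℝ) < n := by exact_mod_cast hn
  have h1 : ((n * (n - 1) : ℕ) : ℝ) ≤ 2 * ∑ i : Fin n, ((balls i).card : ℝ) ^ d := by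
    have h2 : ∑ i : Fin n, (balls i).card = ∑ i ∈ Finset.range n, i := by
      rw [← Finset.sum_range_reflect, Finset.sum_range]
      exact Finset.sum_congr rfl fun i _ => card_balls i
    have h3 : n * (n - 1) ≤ 2 * ∑ i : Fin n, (balls i).card ^ d := by
      rw [← Finset.sum_range_id_mul_two, mul_comm, ← h2]
      exact Nat.mul_le_mul_left _ (Finset.sum_le_sum fun i _ => Nat.le_self_pow (by omega) _)
    exact_mod_cast h3
  rw [Nat.cast_mul, Nat.cast_sub hn, Nat.cast_one] at h1
  have : 2 * (1 / n * ∑ i : Fin n, ((balls i).card : ℝ) ^ d)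
      = (2 * ∑ i : Fin n, ((balls i).card : ℝ) ^ d) / n := by ring
  rw [this, le_div_iff₀ hn']
  linarith

/-- The left side is `(n + 1) * (n + N + 3)`. The first factor is at most `2 * (G + L)`, the second
at most `Z + 3 * Z + 3 * Z`, as `1 ≤ n ≤ Z`. -/
theorem steps_le (hd : 1 ≤ d) (hn : 1 ≤ n) {N Z L : ℝ} (hL : 1 ≤ L) (hN : 0 ≤ N)
    (hNZ : N ≤ 3 * Z) (hnZ : n ≤ Z) : ((n : ℝ) + 1) * (n + 1) + (N + 2) * (n + 1) ≤
      14 * ((1 / n * ∑ i : Fin n, ((balls i).card : ℝ) ^ d + L) * Z) := by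
  have hn1 : (1 : ℝ) ≤ n := by exact_mod_cast hn
  have h8 := le_sum_card_balls (n := n) hd hn
  set G := 1 / (n : ℝ) * ∑ i : Fin n, ((balls i).card : ℝ) ^ d
  have h9 : (n : ℝ) + 1 ≤ 2 * (G + L) := by linarith
  calc ((n : ℝ) + 1) * (n + 1) + (N + 2) * (n + 1) = (n + 1) * (n + N + 3) := by ring
    _ ≤ (2 * (G + L)) * (7 * Z) :=
        mul_le_mul h9 (by linarith) (by positivity) (by linarith)
    _ = _ := by ring

/-- The exponent exceeds the binary logarithm of the number of entries by at most one, and the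
logarithm of the size bound is at most `log A + d * log (n / ε)`. -/
theorem log_steps_le (hd : 1 ≤ d) (hn : 1 ≤ n) (hε : 0 < ε) (hε' : ε ≤ 1 / 4) {A : ℝ} (hA : 1 ≤ A)
    {K E : ℕ} (hK : K = 0 ∨ 2 ^ (K - 1) ≤ E)
    (hE : (E : ℝ) ≤ A * (n * Real.log (1 / ε) / ε ^ (d - 1))) :
    (K : ℝ) + 1 ≤ (2 + (Real.log A + d) / Real.log 2) * Real.log (n / ε) := by
  have hlog2 : 0 < Real.log 2 := Real.log_pos one_lt_two
  obtain ⟨hl1, hl2⟩ := one_le_log hn hε hε'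
  have hn1 : (1 : ℝ) ≤ n := by exact_mod_cast hn
  have hV1 := hn1.trans (le_volume (d := d) hn hε hε')
  have h14 := log_volume_le hd hn hε hε'
  set L := Real.log (n / ε)
  set V := n * Real.log (1 / ε) / ε ^ (d - 1)
  have hL1 : 1 ≤ L := hl1.trans hl2
  have hd0 : (0 : ℝ) ≤ d := by positivity
  have hlA : 0 ≤ Real.log A := Real.log_nonneg hA
  have h7 : Real.log A + d * L ≤ (Real.log A + d) * L := by
    rw [add_mul]
    exact add_le_add_left (le_mul_of_one_le_right hlA hL1) _
  have h8 : ((K : ℝ) - 1) * Real.log 2 ≤ (Real.log A + d) * L := by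
    rcases hK with hK | hK
    · have : 0 ≤ (Real.log A + d) * L := by positivity
      rw [hK]
      push_cast
      linarith
    · have h9 : ((2 : ℝ) ^ (K - 1)) ≤ A * V := le_trans (by exact_mod_cast hK) hE
      have h11 := Real.log_le_log (by positivity) h9
      rw [Real.log_pow, Real.log_mul (by positivity) (by positivity)] at h11
      have h12 : (K : ℝ) - 1 ≤ ((K - 1 : ℕ) : ℝ) := by
        rw [sub_le_iff_le_add]
        exact_mod_cast (by omega : K ≤ K - 1 + 1)
      have h13 := mul_le_mul_of_nonneg_right h12 hlog2.le
      linarith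
  have h9 : (K : ℝ) - 1 ≤ (Real.log A + d) / Real.log 2 * L := by
    rw [div_mul_eq_mul_div, le_div_iff₀ hlog2]
    exact h8
  rw [add_mul]
  linarith

end bounds


theorem StorageAtMost.mono {σ : State} {M M' : ℝ} (h : StorageAtMost σ M) (hM : M ≤ M') :
    StorageAtMost σ M' :=
  fun a z hz => h a z (hz.imp id hM.trans)

theorem Locates.mono {d n : ℕ} {query : Cmd} {σ : State} {D : Diagram d n}
    {q : EuclideanSpace ℝ (Fin d)} {T T' : ℝ} (h : Locates query σ D q T) (hT : T ≤ T') :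
    Locates query σ D q T' := by
  intro τ h1 h2 h3
  obtain ⟨t, τ', h4, h5, h6⟩ := h τ h1 h2 h3
  exact ⟨t, τ', h4, h5.trans hT, h6⟩

/-! ### The programs meet their bounds -/

namespace Prog

variable {d n : ℕ} {I : Net d n}

theorem Stored.locates {x : Conf d n} {B : ℤ} {K : ℕ} {σ : State} (hst : Stored x B K σ)
    (hcomp : I.Complete x) (q : EuclideanSpace ℝ (Fin d)) :
    Locates (query d) σ x.diagram q ((query d).size * (K + 1)) := by
  intro τ hia hra hq
  obtain ⟨M, e, c, g1, g2, g3, g4⟩ := hcomp.find q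
  obtain ⟨t, τ', e', l', r1, r2, r3⟩ :=
    runs_query hst hia hra hq (List.getElem?_eq_some_iff.1 g1).1 g2
  obtain ⟨hid, hc⟩ := List.getElem?_eq_some_iff.1 g3
  refine ⟨t, τ', e', by exact_mod_cast l', r1, r2, ⟨e.id, hid⟩,
    r3.trans (hst.events M e g1).id, ?_⟩
  rw [show x.diagram.cell ⟨e.id, hid⟩ = c.1 from congrArg Prod.fst hc]
  exact g4

/-- The construction program and the query program meet their bounds, with the size bound entering
through the single constant `A`. -/
theorem exists_size_factor (hd : 1 ≤ d) : ∃ A : ℝ, 1 ≤ A ∧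
    ∀ (n : ℕ) (_ : 1 ≤ n) (s : Fin n → EuclideanSpace ℝ (Fin d)) (w : Fin n → ℝ)
      (_ : Function.Injective s) (_ : ∀ i, 0 < w i) (_ : Monotone w)
      (ε : ℝ) (_ : 0 < ε) (_ : ε ≤ 1 / 4),
      ∃ (t : ℕ) (σ : State) (D : Diagram d n),
        Exec (build d) (inputState s w ε) t σ ∧ StoresDiagram σ D ∧ D.IsAMWVD ε s w ∧
        (D.size : ℝ) ≤ A * (n * Real.log (1 / ε) / ε ^ (d - 1)) ∧
        StorageAtMost σ ((4 + 2 ^ d * A) * (n * Real.log (1 / ε) / ε ^ (d - 1))) ∧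
        (t : ℝ) ≤ 14 * (build d).size * (1 / n * ∑ i : Fin n, ((balls i).card : ℝ) ^ d
          + Real.log (n / ε)) * D.size ∧
        ∀ q, Locates (query d) σ D q ((query d).size *
          ((2 + (Real.log A + d) / Real.log 2) * Real.log (n / ε))) := by
  obtain ⟨C₀, hC₀, hess⟩ := Net.exists_ess_bound d
  have hA0 : 0 ≤ (2 * 2 ^ d + 6 : ℝ) * C₀ := by positivity
  -- The steps number at most `2 * 2 ^ d + 6` per essential cube plus `3`, and cells and entries
  -- exceed the steps by at most one; the `4` is absorbed because the volume term is at least `1`.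
  refine ⟨(2 * 2 ^ d + 6) * C₀ + 4, by linarith, ?_⟩
  intro n hn s w hs hw hmono ε hε hε'
  obtain ⟨I, rfl, rfl, rfl, N, x, t, K, σ, hcomp, h1, h2, h3, h4, hex, ht, hst⟩ :=
    exists_exec_build hd hn hs hw hmono hε hε'
  have hnV : (n : ℝ) ≤ n * Real.log (1 / I.eps) / I.eps ^ (d - 1) := le_volume hn hε hε'
  have h5 : (I.essCount I.root : ℝ) ≤ C₀ * (n * Real.log (1 / I.eps) / I.eps ^ (d - 1)) :=
    le_trans (by exact_mod_cast Net.essCount_le I.root) (hess n I)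
  generalize hV : n * Real.log (1 / I.eps) / I.eps ^ (d - 1) = V at hnV h5 ⊢
  have hn1 : (1 : ℝ) ≤ n := by exact_mod_cast hn
  have hN1 : ((N + 1 : ℕ) : ℝ) ≤ ((2 * 2 ^ d + 6) * C₀ + 4) * V := by
    have h6 : (N : ℝ) ≤ (2 * 2 ^ d + 6) * (I.essCount I.root) + 3 := by exact_mod_cast h1
    have h7 : (2 * 2 ^ d + 6 : ℝ) * (I.essCount I.root) ≤ (2 * 2 ^ d + 6) * (C₀ * V) :=
      mul_le_mul_of_nonneg_left h5 (by positivity)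
    push_cast
    linarith
  have hA : 1 ≤ (2 * 2 ^ d + 6) * C₀ + 4 := by linarith
  generalize (2 * 2 ^ d + 6) * C₀ + 4 = A at hN1 hA ⊢
  obtain ⟨hl1, hl2⟩ := one_le_log hn hε hε'
  refine ⟨t, σ, x.diagram, hex, hst.storesDiagram, hcomp.isAMWVD,
    le_trans (by exact_mod_cast h3) hN1, ?_, ?_, fun q => ?_⟩
  · intro a z hz
    refine hst.bounded a z (hz.imp id fun h => ?_)
    -- Here `n + 3` is at most `4 * V`, and the stack never grows by more than `2 ^ d` per step.
    have h5 : ((n + 3 + N * 2 ^ d : ℕ) : ℝ) ≤ z := by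
      refine le_trans ?_ h
      push_cast at hN1 ⊢
      have : 2 ^ d * (N : ℝ) ≤ 2 ^ d * (A * V) :=
        mul_le_mul_of_nonneg_left (by linarith) (by positivity)
      linarith
    exact_mod_cast h5
  · have h5 : (t : ℝ) ≤ (build d).size * ((n + 1) * (n + 1) + (N + 2) * (n + 1)) := by
      exact_mod_cast ht
    have h6 : (N : ℝ) ≤ 3 * (x.diagram.size : ℝ) := by exact_mod_cast h2
    have h7 : (n : ℝ) ≤ (x.diagram.size : ℝ) := by exact_mod_cast hcomp.le_size
    have h10 := steps_le hd hn (hl1.trans hl2) N.cast_nonneg h6 h7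
    have h11 := mul_le_mul_of_nonneg_left h10 (Nat.cast_nonneg (α := ℝ) (build d).size)
    linarith
  · refine (hst.locates hcomp q).mono (mul_le_mul_of_nonneg_left ?_ (Nat.cast_nonneg _))
    exact log_steps_le hd hn hε hε' hA hst.le (hV ▸ (Nat.cast_le.2 h4).trans hN1)

end Prog
end
end AMWVD

theorem mainTheorem3 (d : ℕ) (hd : 1 ≤ d) :
    ∃ (build query : AMWVD.Cmd) (C : ℝ), 0 < C ∧
      ∀ (n : ℕ) (_ : 1 ≤ n) (s : Fin n → EuclideanSpace ℝ (Fin d)) (w : Fin n → ℝ)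
        (_ : Function.Injective s) (_ : ∀ i, 0 < w i) (_ : Monotone w)
        (ε : ℝ) (_ : 0 < ε) (_ : ε ≤ 1 / 4),
        ∃ (t : ℕ) (σ : AMWVD.State) (D : AMWVD.Diagram d n),
          AMWVD.Exec build (AMWVD.inputState s w ε) t σ ∧
          AMWVD.StoresDiagram σ D ∧
          D.IsAMWVD ε s w ∧
          (D.size : ℝ) ≤ C * (n * Real.log (1 / ε) / ε ^ (d - 1)) ∧
          AMWVD.StorageAtMost σ (C * (n * Real.log (1 / ε) / ε ^ (d - 1))) ∧
          (t : ℝ) ≤ C * (1 / n * ∑ i : Fin n, ((AMWVD.balls i).card : ℝ) ^ d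
            + Real.log (n / ε)) * D.size ∧
          ∀ q : EuclideanSpace ℝ (Fin d),
            AMWVD.Locates query σ D q (C * Real.log (n / ε)) := by
  obtain ⟨A, hA, h⟩ := AMWVD.Prog.exists_size_factor hd
  have hS : (0 : ℝ) ≤ (AMWVD.Prog.build d).size := Nat.cast_nonneg _
  have hR : 0 ≤ ((AMWVD.Prog.query d).size : ℝ) * (2 + (Real.log A + d) / Real.log 2) := by
    have := Real.log_nonneg hA
    have := Real.log_pos one_lt_two
    positivity
  have hP : 0 ≤ 2 ^ d * A := by positivity
  -- All four bounds have nonnegative constants, so their sum serves for each of them.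
  refine ⟨AMWVD.Prog.build d, AMWVD.Prog.query d, A + (4 + 2 ^ d * A) +
    14 * (AMWVD.Prog.build d).size +
    (AMWVD.Prog.query d).size * (2 + (Real.log A + d) / Real.log 2), by linarith, ?_⟩
  intro n hn s w hs hw hmono ε hε hε'
  obtain ⟨t, σ, D, h1, h2, h3, h4, h5, h6, h7⟩ := h n hn s w hs hw hmono ε hε hε'
  obtain ⟨hl1, hl2⟩ := AMWVD.one_le_log hn hε hε'
  have hV : 0 ≤ n * Real.log (1 / ε) / ε ^ (d - 1) :=
    n.cast_nonneg.trans (AMWVD.le_volume hn hε hε')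
  refine ⟨t, σ, D, h1, h2, h3, h4.trans ?_, h5.mono ?_, h6.trans ?_, fun q => (h7 q).mono ?_⟩
  · exact mul_le_mul_of_nonneg_right (by linarith) hV
  · exact mul_le_mul_of_nonneg_right (by linarith) hV
  · refine mul_le_mul_of_nonneg_right ?_ D.size.cast_nonneg
    refine mul_le_mul_of_nonneg_right (by linarith) (add_nonneg ?_ (by linarith))
    positivity
  · rw [← mul_assoc]
    exact mul_le_mul_of_nonneg_right (by linarith) (by linarith)
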